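/- Let $d\ge 1$, $\gamma>0$, $1<p<\infty$, and let $K$ be a real separable Hilbert space. All values below lie in a complex Hilbert space $H$ that contains $K$ isometrically as a real subspace (for instance the complexification of $K$, or $H=K$ if $K$ is itself a complex Hilbert space). Let $\varphi:\mathbb R^d\to[0,\infty)$ satisfy, with constants $\kappa_\varphi,\mu_\varphi>0$ and $N_\varphi\in\mathbb N$: $\varphi(\xi)\ge\kappa_\varphi|\xi|^\gamma$ for $\xi\ne0$, $\varphi$ is $C^{N_\varphi}$ on $\mathbb R^d\setminus\{0\}$, and $|\partial^\alpha\varphi(\xi)|\le\mu_\varphi|\xi|^{\gamma-|\alpha|}$ for $\xi\neq 0$ and $|\alpha|\le N_\varphi$. Let $\psi:\mathbb R\times\mathbb R^d\to\mathbb C$ be measurable and satisfy, with constants $\kappa_\psi,\mu_\psi>0$ and $N_\psi\in\mathbb N$: $\operatorname{Re}\psi(t,\xi)\le-\kappa_\psi|\xi|^\gamma$ for almost all $t,\xi$; and for almost all $t$, $\psi(t,\cdot)$ is $C^{N_\psi}$ on $\mathbb R^d\setminus\{0\}$ with $|\partial_\xi^\alpha\psi(t,\xi)|\le\mu_\psi|\xi|^{\gamma-|\alpha|}$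 for $|\alpha|\le N_\psi$ and all $\xi$ with no vanishing coordinate. Assume $N_\varphi,N_\psi>d+2+2\lfloor\gamma\rfloor$. With $\mathcal F f(\xi)=(2\pi)^{-d/2}\int e^{-ix\cdot\xi}f(x)\,dx$ and $\mathcal F^{-1}f(x)=(2\pi)^{-d/2}\int e^{ix\cdot\xi}f(\xi)\,d\xi$, put for $s<t$ $$p_\psi(t,s,\cdot)=(2\pi)^{-d/2}\mathcal F^{-1}\Big(e^{\int_s^t\psi(r,\cdot)\,dr}\Big),\qquad L_\varphi p_\psi(t,s,\cdot)=\mathcal F^{-1}\big(\varphi\,\mathcal F p_\psi(t,s,\cdot)\big),$$ $$L_\varphi\mathcal T_\psi(t,s)g(x)=\int_{\mathbb R^d}L_\varphi p_\psi(t,s,x-y)\,g(y)\,dy,\qquad \mathcal Gf(t,x)=\int_{-\infty}^t L_\varphi\mathcal T_\psi(t,s)f(s,\cdot)(x)\,ds .$$ Then the integrals defining $\mathcal Gf(t,x)$ converge absolutely for every $f\in C_c^\infty(\mathbb R\times\mathbb R^d;K)$ and all $(t,x)$, and $\mathcal G$ extends to a bounded (real-)linear operator $\mathcal G:L^p(\mathbb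 R^{d+1};K)\to L^p(\mathbb R^{d+1};H)$ such that, for every $f\in L^p(\mathbb R^{d+1};K)$, the function $\mathcal Gf$ is given by the integral above at almost every point $(t,x)$ where that integral converges absolutely. Moreover there is a constant $C>0$ depending only on $d,p,\gamma,\mu_\varphi,\mu_\psi,\kappa_\psi$ such that for every $f\in L^p(\mathbb R^{d+1};K)$ $$\int_{-\infty}^\infty\int_{\mathbb R^d}\|\mathcal Gf(t,x)\|_H^p\,dx\,dt\le C\int_{-\infty}^\infty\int_{\mathbb R^d}\|f(s,x)\|_K^p\,dx\,ds .$$ -/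

import Mathlib

open MeasureTheory Set Filter Topology
open scoped ContDiff ENNReal RealInnerProductSpace

universe u v

noncomputable section

namespace PseudoDiff

/-- The Euclidean space `ℝ^d`. -/
abbrev E (d : ℕ) : Type := EuclideanSpace ℝ (Fin d)

/-- Every partial derivative `∂_{i_1} ⋯ ∂_{i_n} m` of order `n ≤ N` is bounded on `S` by
`μ |ξ|^(γ - n)`. For a function that is `C^N` near the points of `S` these are exactly the
derivatives `∂^α m` with `|α| ≤ N`. -/
def PartialsBounded {d : ℕ} {F : Type*} [NormedAddCommGroup F] [NormedSpace ℝ F]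
    (N : ℕ) (γ μ : ℝ) (S : Set (E d)) (m : E d → F) : Prop :=
  ∀ n : ℕ, n ≤ N → ∀ i : Fin n → Fin d, ∀ ξ ∈ S,
    ‖iteratedFDeriv ℝ n m ξ (fun j => EuclideanSpace.single (i j) (1 : ℝ))‖
      ≤ μ * ‖ξ‖ ^ (γ - (n : ℝ))

/-- The points of `ℝ^d` on no coordinate hyperplane. -/
def offHyperplanes (d : ℕ) : Set (E d) := {ξ | ∀ i, ξ i ≠ 0}

/-- Condition (S1): `Re ψ(t, ξ) ≤ -κ |ξ|^γ` for almost all `t` and `ξ`. -/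
def CondS1 {d : ℕ} (γ κ : ℝ) (ψ : ℝ → E d → ℂ) : Prop :=
  ∀ᵐ t : ℝ, ∀ᵐ ξ : E d, (ψ t ξ).re ≤ -(κ * ‖ξ‖ ^ γ)

/-- Condition (S2): for almost all `t` the function `ψ(t, ·)` is `C^N` away from the origin, and
`|∂^α ψ(t, ξ)| ≤ μ |ξ|^(γ - |α|)` for `|α| ≤ N` and `ξ` on no coordinate hyperplane. -/
def CondS2 {d : ℕ} (N : ℕ) (γ μ : ℝ) (ψ : ℝ → E d → ℂ) : Prop :=
  ∀ᵐ t : ℝ, ContDiffOn ℝ N (ψ t) {0}ᶜ ∧ PartialsBounded N γ μ (offHyperplanes d) (ψ t)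

/-- The class of time dependent symbols of order `γ`, with its constants displayed; time runs
through the whole real line. -/
structure SymbolS {d : ℕ} (N : ℕ) (γ κ μ : ℝ) (ψ : ℝ → E d → ℂ) : Prop where
  measurable : Measurable (Function.uncurry ψ)
  order : d / 2 + 1 ≤ N
  s1 : CondS1 γ κ ψ
  s2 : CondS2 N γ μ ψ

/-- The class of time independent symbols `φ ≥ 0` of order `γ`, with its constants displayed. -/
structure SymbolM {d : ℕ} (γ κ μ : ℝ) (φ : E d → ℝ) : Prop where
  nonneg : ∀ ξ, 0 ≤ φ ξ
  lower : ∀ ξ, ξ ≠ 0 → κ * ‖ξ‖ ^ γ ≤ φ ξ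
  smooth : ContDiffOn ℝ (d / 2 + 1 : ℕ) φ {0}ᶜ
  upper : PartialsBounded (d / 2 + 1) γ μ {0}ᶜ φ

/-- `(𝓕 f)(ξ) = (2π)^(-d/2) ∫ e^(-i x·ξ) f(x) dx`. -/
def fourierT {d : ℕ} (f : E d → ℂ) (ξ : E d) : ℂ :=
  (((2 * Real.pi) ^ (-(d : ℝ) / 2) : ℝ) : ℂ) *
    ∫ x : E d, Complex.exp (-(Complex.I * ((⟪x, ξ⟫ : ℝ) : ℂ))) * f x

/-- `(𝓕⁻¹ f)(x) = (2π)^(-d/2) ∫ e^(i x·ξ) f(ξ) dξ`. -/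
def fourierTInv {d : ℕ} (f : E d → ℂ) (x : E d) : ℂ :=
  (((2 * Real.pi) ^ (-(d : ℝ) / 2) : ℝ) : ℂ) *
    ∫ ξ : E d, Complex.exp (Complex.I * ((⟪x, ξ⟫ : ℝ) : ℂ)) * f ξ

/-- The pseudo-differential operator `L_φ f = 𝓕⁻¹ (φ 𝓕 f)`. -/
def pseudoOp {d : ℕ} (φ : E d → ℝ) (f : E d → ℂ) : E d → ℂ :=
  fourierTInv (fun ξ => (φ ξ : ℂ) * fourierT f ξ)

/-- The fundamental solution `p_ψ(t, s, ·)`. The factor `(2π)^(-d/2)` in front of `𝓕⁻¹` is the one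
for which convolution with `p_ψ(t, s, ·)` is the Fourier multiplier `exp (∫_s^t ψ(r, ·) dr)`. -/
def fundSol {d : ℕ} (ψ : ℝ → E d → ℂ) (t s : ℝ) (x : E d) : ℂ :=
  (((2 * Real.pi) ^ (-(d : ℝ) / 2) : ℝ) : ℂ) *
    fourierTInv (fun ξ => Complex.exp (∫ r in s..t, ψ r ξ)) x

/-- The kernel `L_φ p_ψ(t, s, ·)` of the operator `L_φ 𝒯_ψ(t, s)`. -/
def potKernel {d : ℕ} (φ : E d → ℝ) (ψ : ℝ → E d → ℂ) (t s : ℝ) : E d → ℂ :=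
  pseudoOp φ (fundSol ψ t s)

section potential

variable {d : ℕ} {K H : Type*} [NormedAddCommGroup K] [InnerProductSpace ℝ K]
  [NormedAddCommGroup H] [InnerProductSpace ℂ H]

/-- `L_φ 𝒯_ψ(t, s) g (x) = ∫ L_φ p_ψ(t, s, x - y) g(y) dy`. The kernel is complex valued and `g`
has values in the real space `K`, which is regarded as a subspace of the complex space `H`. -/
def evolOp (φ : E d → ℝ) (ψ : ℝ → E d → ℂ) (ι : K →ₗᵢ[ℝ] H) (t s : ℝ) (g : E d → K)
    (x : E d) : H :=
  ∫ y : E d, potKernel φ ψ t s (x - y) • ι (g y)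

/-- `∫_{-∞}^t L_φ 𝒯_ψ(t, s) f(s, ·)(x) ds` at the point `z = (t, x)`. -/
def potential (φ : E d → ℝ) (ψ : ℝ → E d → ℂ) (ι : K →ₗᵢ[ℝ] H) (f : ℝ × E d → K)
    (z : ℝ × E d) : H :=
  ∫ s in Iio z.1, evolOp φ ψ ι z.1 s (fun y => f (s, y)) z.2

/-- The integrals that define `potential φ ψ ι f` at `z` converge absolutely. -/
def PotentialConverges (φ : E d → ℝ) (ψ : ℝ → E d → ℂ) (ι : K →ₗᵢ[ℝ] H) (f : ℝ × E d → K)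
    (z : ℝ × E d) : Prop :=
  (∀ᵐ s ∂(volume.restrict (Iio z.1)),
      Integrable (fun y : E d => potKernel φ ψ z.1 s (z.2 - y) • ι (f (s, y)))) ∧
    IntegrableOn (fun s => evolOp φ ψ ι z.1 s (fun y => f (s, y)) z.2) (Iio z.1)

end potential

end PseudoDiff

end

/-! The operator is a singular integral on ℝ^{d+1} with kernel k(t,s,x-y) for s < t, where k(t,s,·)
has the Fourier multiplier φ·exp(∫_s^t ψ). The scaling is parabolic: time counts like the γ-th power
of space. The spatial L¹ norm of k(t,s,·) is only controlled by (t-s)⁻¹, which is not integrable in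
time, so boundedness has to come from cancellation. The proof is Calderón–Zygmund theory on
parabolic cubes.

L². After Plancherel in x the multiplier is bounded by M|ξ|^γ exp(-κ(t-s)|ξ|^γ). As a kernel in
(t,s) this has mass M/κ in each variable, whatever ξ ≠ 0 is, and Schur's test applied one frequency
at a time gives the bound (`KernelBounds.eLpNorm_two_kernelOp_le`).

Kernel estimates. On an annulus |ξ| ~ R the rescaled symbols have d+2 bounded derivatives, so each
Littlewood–Paley piece of k has integrable moments of order η ≤ 1. The dyadic sum converges at high
frequency by the exponential decay and at low frequency by the positive power R^{γ-η}
(`exists_multiplier_bound`, `exists_lintegral_fourierInv_le`). Moving s or t, or translating in x,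
adds a small term δ to the exponent, and exp δ - 1 supplies the gain (`exists_kernelBounds`). This
yields Hörmander's condition outside enlarged parabolic boxes: far away in time by the increments,
near in time but far in space by the η-moment (`KernelBounds.hormander`). Time reversal carries it
over to the adjoint.

L^p. The Calderón–Zygmund decomposition gives a weak type estimate whose right side sees only f cut
at heights comparable to lam. Integrating it in lam gives 1 < p < 2 with no interpolation theorem,
and duality (`SchurKernel.eLpNorm_le_of_adj`) gives p > 2.

Truncation and limit. To make every integral converge absolutely the kernel is first multiplied by a
cutoff of t-s. The cutoffs are Lipschitz relative to t-s with a fixed constant, so all bounds are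
independent of the truncation. On Lipschitz functions of compact support, the mean value zero of
k(t,s,·), which reflects that its multiplier vanishes at the origin, improves the rate to
(t-s)^{-1+η/γ}; the integral then converges absolutely and the truncations converge in L^p by
domination. Density and the uniform bound produce the operator, and an almost everywhere convergent
subsequence identifies it with the integral wherever that converges absolutely
(`KernelBounds.exists_limit_operator`). -/

noncomputable section

namespace PseudoDiff

/-! ### Integral operators bounded by Schur's test -/

/-- Schur's test for nonnegative kernels. -/
theorem lintegral_rpow_lintegral_mul_le {α β : Type*} [MeasurableSpace α] [MeasurableSpace β]
    {μ : Measure α} {ν : Measure β} [SFinite μ] [SFinite ν] {a : α → β → ℝ≥0∞}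
    (ha : Measurable (Function.uncurry a)) {A B : ℝ≥0∞}
    (hrow : ∀ᵐ x ∂μ, ∫⁻ y, a x y ∂ν ≤ A) (hcol : ∀ᵐ y ∂ν, ∫⁻ x, a x y ∂μ ≤ B)
    {p : ℝ} (hp : 1 < p) {u : β → ℝ≥0∞} (hu : AEMeasurable u ν) :
    ∫⁻ x, (∫⁻ y, a x y * u y ∂ν) ^ p ∂μ ≤ A ^ (p - 1) * B * ∫⁻ y, u y ^ p ∂ν := by
  have hp0 : 0 < p := by linarith
  have hpq : p.HolderConjugate (p.conjExponent) := Real.HolderConjugate.conjExponent hp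
  set q := p.conjExponent with hq
  have hq0 : 0 < q := hpq.symm.pos
  have key : ∀ᵐ x ∂μ, (∫⁻ y, a x y * u y ∂ν) ^ p ≤ A ^ (p - 1) * ∫⁻ y, a x y * u y ^ p ∂ν := by
    filter_upwards [hrow] with x hx
    have hax : Measurable (a x) := ha.of_uncurry_left
    -- Hölder for the splitting a = a^{1/q} a^{1/p}: the row integral then enters with the power p/q
    -- = p - 1.
    have h1 := ENNReal.lintegral_mul_le_Lp_mul_Lq ν hpq.symm
      (f := fun y => a x y ^ (1 / q)) (g := fun y => a x y ^ (1 / p) * u y)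
      (hax.pow_const _).aemeasurable ((hax.pow_const _).aemeasurable.mul hu)
    have h2 : ∀ y, a x y ^ (1 / q) * (a x y ^ (1 / p) * u y) = a x y * u y := by
      intro y
      rw [← mul_assoc, ← ENNReal.rpow_add_of_nonneg _ _ (by positivity) (by positivity)]
      rw [show 1 / q + 1 / p = 1 by
        simpa [one_div] using hpq.symm.inv_add_inv_eq_one]
      simp
    simp only [Pi.mul_apply, h2] at h1
    have h3 : ∀ y, (a x y ^ (1 / q)) ^ q = a x y := fun y => by
      rw [← ENNReal.rpow_mul, one_div, inv_mul_cancel₀ hq0.ne', ENNReal.rpow_one]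
    have h4 : ∀ y, (a x y ^ (1 / p) * u y) ^ p = a x y * u y ^ p := fun y => by
      rw [ENNReal.mul_rpow_of_nonneg _ _ hp0.le, ← ENNReal.rpow_mul, one_div,
        inv_mul_cancel₀ hp0.ne', ENNReal.rpow_one]
    simp only [h3, h4] at h1
    calc (∫⁻ y, a x y * u y ∂ν) ^ p
        ≤ ((∫⁻ y, a x y ∂ν) ^ (1 / q) * (∫⁻ y, a x y * u y ^ p ∂ν) ^ (1 / p)) ^ p := by gcongr
      _ = (∫⁻ y, a x y ∂ν) ^ (p - 1) * ∫⁻ y, a x y * u y ^ p ∂ν := by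
          rw [ENNReal.mul_rpow_of_nonneg _ _ hp0.le, ← ENNReal.rpow_mul, ← ENNReal.rpow_mul,
            one_div, one_div, inv_mul_cancel₀ hp0.ne', ENNReal.rpow_one]
          congr 2
          have := hpq.inv_add_inv_eq_one
          field_simp at this ⊢
          linarith
      _ ≤ _ := by
          gcongr
  calc ∫⁻ x, (∫⁻ y, a x y * u y ∂ν) ^ p ∂μ
      ≤ ∫⁻ x, A ^ (p - 1) * ∫⁻ y, a x y * u y ^ p ∂ν ∂μ := lintegral_mono_ae key
    _ = A ^ (p - 1) * ∫⁻ x, ∫⁻ y, a x y * u y ^ p ∂ν ∂μ := by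
        apply lintegral_const_mul''
        have : AEMeasurable (Function.uncurry fun x y => a x y * u y ^ p) (μ.prod ν) :=
          ha.aemeasurable.mul (hu.comp_snd.pow_const _)
        exact this.lintegral_prod_right'
    _ = A ^ (p - 1) * ∫⁻ y, ∫⁻ x, a x y * u y ^ p ∂μ ∂ν := by
        rw [lintegral_lintegral_swap]
        exact ha.aemeasurable.mul (hu.comp_snd.pow_const _)
    _ ≤ A ^ (p - 1) * ∫⁻ y, B * u y ^ p ∂ν := by
        gcongr 1
        apply lintegral_mono_ae
        filter_upwards [hcol] with y hy
        rw [lintegral_mul_const _ (ha.of_uncurry_right)]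
        gcongr
    _ = _ := by
        rw [lintegral_const_mul'' _ (hu.pow_const _), mul_assoc]

/-! ### Dyadic grids and stopping cubes -/

/-- A nested family of countable partitions, indexed by scales `k : ℤ`, with the doubling
property. The cubes of scale `k` are the fibres of `idx k`; `star k z` is an enlargement of the
cube of scale `k` that contains `z`. -/
structure DyadicGrid (Z : Type*) [TopologicalSpace Z] [MeasurableSpace Z] (μ : Measure Z) where
  ι : Type
  countable_ι : Countable ι
  idx : ℤ → Z → ι
  measurable_cube : ∀ k z, MeasurableSet {w | idx k w = idx k z}
  nested : ∀ k z w, idx k w = idx k z → idx (k + 1) w = idx (k + 1) z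
  D : NNReal
  one_le_D : 1 ≤ D
  doubling : ∀ k z, μ {w | idx (k + 1) w = idx (k + 1) z} ≤ D * μ {w | idx k w = idx k z}
  pos : ∀ k z, 0 < μ {w | idx k w = idx k z}
  -- Forces the averages of an integrable function below any given height at all large scales, so
  -- that a largest stopping scale exists.
  large : ∀ R : ℝ≥0∞, R ≠ ⊤ → ∃ k₀ : ℤ, ∀ k ≥ k₀, ∀ z, R < μ {w | idx k w = idx k z}
  finite : ∀ k z, μ {w | idx k w = idx k z} ≠ ⊤
  small : ∀ z, ∀ U ∈ 𝓝 z, ∃ k, {w | idx k w = idx k z} ⊆ U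
  star : ℤ → Z → Set Z
  measurable_star : ∀ k z, MeasurableSet (star k z)
  star_le : ∀ k z, μ (star k z) ≤ D * μ {w | idx k w = idx k z}

namespace DyadicGrid

variable {Z : Type*} [TopologicalSpace Z] [MeasurableSpace Z] {μ : Measure Z}
  (g : DyadicGrid Z μ)

/-- The cube of scale `k` that contains `z`. -/
def cube (k : ℤ) (z : Z) : Set Z := {w | g.idx k w = g.idx k z}

theorem mem_cube {k : ℤ} {z w : Z} : w ∈ g.cube k z ↔ g.idx k w = g.idx k z := Iff.rfl

theorem measurableSet_cube (k : ℤ) (z : Z) : MeasurableSet (g.cube k z) := g.measurable_cube k z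

theorem cube_eq {k : ℤ} {z w : Z} (h : w ∈ g.cube k z) : g.cube k w = g.cube k z := by
  ext x
  rw [mem_cube, mem_cube, g.mem_cube.1 h]

theorem mem_cube_of_le {k k' : ℤ} (hk : k ≤ k') {z w : Z} (h : w ∈ g.cube k z) :
    w ∈ g.cube k' z := by
  obtain ⟨n, rfl⟩ := Int.le.dest hk
  clear hk
  induction n with
  | zero => simpa using h
  | succ n ih =>
    have := g.nested _ _ _ ih
    rw [mem_cube]
    push_cast
    rw [← add_assoc]
    exact this

/-- Calderón–Zygmund stopping cubes for an integrable function at height `lam`. -/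
theorem exists_stopping {u : Z → ℝ≥0∞} (hu : ∫⁻ z, u z ∂μ ≠ ⊤) {lam : ℝ≥0∞} (hl : lam ≠ 0)
    (hl' : lam ≠ ⊤) :
    ∃ (S : Type) (_ : Countable S) (k : S → ℤ) (c : S → Z),
      Pairwise (Function.onFun Disjoint fun s => g.cube (k s) (c s)) ∧
      (∀ s, lam * μ (g.cube (k s) (c s)) < ∫⁻ z in g.cube (k s) (c s), u z ∂μ) ∧
      (∀ s, ∫⁻ z in g.cube (k s) (c s), u z ∂μ ≤ g.D * (lam * μ (g.cube (k s) (c s)))) ∧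
      ∀ z ∉ ⋃ s, g.cube (k s) (c s), ∀ k, ∫⁻ w in g.cube k z, u w ∂μ ≤ lam * μ (g.cube k z) := by
  have := g.countable_ι
  -- `P k z` says that k is the largest scale at which the average around z exceeds lam. Indexing by
  -- the pair of scale and cube index makes the family countable and lists each cube once.
  let P : ℤ → Z → Prop := fun k z => lam * μ (g.cube k z) < ∫⁻ w in g.cube k z, u w ∂μ ∧
    ∀ k' > k, ∫⁻ w in g.cube k' z, u w ∂μ ≤ lam * μ (g.cube k' z)
  let S := {s : ℤ × g.ι // ∃ z, g.idx s.1 z = s.2 ∧ P s.1 z}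
  have hc : ∀ s : S, ∃ z, g.idx s.1.1 z = s.1.2 ∧ P s.1.1 z := fun s => s.2
  choose c hc1 hc2 using hc
  refine ⟨S, inferInstance, fun s => s.1.1, c, ?_, fun s => (hc2 s).1, fun s => ?_, ?_⟩
  · have key : ∀ s s' : S, s.1.1 < s'.1.1 →
        Disjoint (g.cube s.1.1 (c s)) (g.cube s'.1.1 (c s')) := by
      intro s s' h
      rw [Set.disjoint_left]
      intro z hz hz'
      have h1 := (hc2 s).2 _ h
      rw [← g.cube_eq (g.mem_cube_of_le h.le hz), g.cube_eq hz'] at h1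
      exact absurd (hc2 s').1 (not_lt.2 h1)
    intro s s' hne
    rcases lt_trichotomy s.1.1 s'.1.1 with h | h | h
    · exact key s s' h
    · rw [Function.onFun, Set.disjoint_left]
      intro z hz hz'
      apply hne
      have h2 : s.1.2 = s'.1.2 := by
        have e1 : g.idx s.1.1 z = g.idx s.1.1 (c s) := hz
        have e2 : g.idx s'.1.1 z = g.idx s'.1.1 (c s') := hz'
        rw [← hc1 s, ← hc1 s', ← e1, ← e2, h]
      exact Subtype.ext (Prod.ext h h2)
    · exact (key s' s h).symm
  -- By maximality the parent cube has average at most lam, and doubling passes this on to the cube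
  -- itself.
  · calc ∫⁻ z in g.cube s.1.1 (c s), u z ∂μ ≤ ∫⁻ z in g.cube (s.1.1 + 1) (c s), u z ∂μ :=
          lintegral_mono_set fun z hz => g.mem_cube_of_le (by simp) hz
      _ ≤ lam * μ (g.cube (s.1.1 + 1) (c s)) := (hc2 s).2 _ (by simp)
      _ ≤ lam * (g.D * μ (g.cube s.1.1 (c s))) := by gcongr; exact g.doubling _ _
      _ = _ := by ring
  · intro z hz k
    by_contra! hk
    -- A cube of measure above (∫u)/lam cannot have average above lam, so the bad scales at z are
    -- bounded above and the greatest one is a stopping scale.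
    obtain ⟨k₀, hk₀⟩ := g.large ((∫⁻ z, u z ∂μ) / lam) (ENNReal.div_ne_top hu hl)
    have hbd : ∀ j : ℤ, lam * μ (g.cube j z) < ∫⁻ w in g.cube j z, u w ∂μ → j ≤ k₀ := by
      intro j hj
      by_contra! hj'
      have h1 := hk₀ j hj'.le z
      rw [ENNReal.div_lt_iff (Or.inl hl) (Or.inl hl'), mul_comm] at h1
      exact absurd (h1.trans hj) (not_lt.2 (setLIntegral_le_lintegral _ _))
    obtain ⟨j, hj1, hj2⟩ := Int.exists_greatest_of_bdd
      (P := fun j => lam * μ (g.cube j z) < ∫⁻ w in g.cube j z, u w ∂μ) ⟨k₀, hbd⟩ ⟨k, hk⟩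
    have hS : P j z := ⟨hj1, fun k' hk' => by
      by_contra! h
      exact absurd (hj2 k' h) (not_le.2 hk')⟩
    apply hz
    let s : S := ⟨(j, g.idx j z), z, rfl, hS⟩
    exact mem_iUnion.2 ⟨s, (hc1 s).symm⟩

/-- A continuous function is bounded at a point by its averages over small cubes. -/
theorem le_of_average_le [OpensMeasurableSpace Z] {u : Z → ℝ≥0∞} (hu : Continuous u) {z : Z}
    {lam : ℝ≥0∞} (h : ∀ k, ∫⁻ w in g.cube k z, u w ∂μ ≤ lam * μ (g.cube k z)) : u z ≤ lam := by
  by_contra! hlt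
  obtain ⟨r, hr1, hr2⟩ := exists_between hlt
  -- Continuity takes the place of Lebesgue differentiation: u exceeds r on a whole cube around z.
  obtain ⟨k, hk⟩ := g.small z {w | r < u w} ((isOpen_lt continuous_const hu).mem_nhds hr2)
  have h1 : r * μ (g.cube k z) ≤ ∫⁻ w in g.cube k z, u w ∂μ := by
    rw [← setLIntegral_const]
    exact setLIntegral_mono hu.measurable fun w hw => (hk hw).le
  have h2 := (ENNReal.mul_le_mul_iff_left (g.pos k z).ne' (g.finite k z)).1 (h1.trans (h k))
  exact absurd hr1 (not_lt.2 h2)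

end DyadicGrid

/-! ### The weak type estimate of Calderón and Zygmund -/

section CZ

set_option linter.unusedSectionVars false

variable {Z : Type*} [TopologicalSpace Z] [MeasurableSpace Z] {μ : Measure Z}
variable {H : Type*} [NormedAddCommGroup H] [NormedSpace ℂ H]

/-- The integral operator with kernel `k`. -/
def kernelOp (μ : Measure Z) (k : Z → Z → ℂ) (f : Z → H) (z : Z) : H := ∫ w, k z w • f w ∂μ

/-- Kernels that are integrable in each variable and satisfy Hörmander's condition, with constant
`A`, relative to a dyadic grid. -/
structure CZKernel (g : DyadicGrid Z μ) (A M : NNReal) (k : Z → Z → ℂ) : Prop where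
  meas : Measurable (Function.uncurry k)
  -- M only guarantees absolute convergence; the constants of the Calderón–Zygmund estimate do not
  -- contain it.
  row : ∀ z, ∫⁻ w, ‖k z w‖ₑ ∂μ ≤ M
  col : ∀ w, ∫⁻ z, ‖k z w‖ₑ ∂μ ≤ M
  hor : ∀ j w w', w ∈ g.cube j w' → ∫⁻ z in (g.star j w')ᶜ, ‖k z w - k z w'‖ₑ ∂μ ≤ A

theorem aestronglyMeasurable_kernelOp [SFinite μ] {k : Z → Z → ℂ}
    (hk : Measurable (Function.uncurry k)) {f : Z → H} (hf : AEStronglyMeasurable f μ) :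
    AEStronglyMeasurable (kernelOp μ k f) μ := by
  have : AEStronglyMeasurable (fun q : Z × Z => k q.1 q.2 • f q.2) (μ.prod μ) :=
    hk.aestronglyMeasurable.smul hf.comp_snd
  exact this.integral_prod_right'

theorem enorm_kernelOp_le (k : Z → Z → ℂ) (f : Z → H) (z : Z) :
    ‖kernelOp μ k f z‖ₑ ≤ ∫⁻ w, ‖k z w‖ₑ * ‖f w‖ₑ ∂μ := by
  refine (enorm_integral_le_lintegral_enorm _).trans (le_of_eq ?_)
  simp [enorm_smul]

theorem integrable_kernel_smul {k : Z → ℂ} (hk : Measurable k) {M : ℝ≥0∞} (hM : M ≠ ⊤)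
    (hkM : ∫⁻ w, ‖k w‖ₑ ∂μ ≤ M) {f : Z → H} (hf : AEStronglyMeasurable f μ) {R : ℝ≥0∞}
    (hR : R ≠ ⊤) (hfR : ∀ z, ‖f z‖ₑ ≤ R) : Integrable (fun w => k w • f w) μ := by
  refine ⟨hk.aestronglyMeasurable.smul hf, ?_⟩
  refine lt_of_le_of_lt (b := M * R) ?_ (ENNReal.mul_lt_top hM.lt_top hR.lt_top)
  calc ∫⁻ w, ‖k w • f w‖ₑ ∂μ ≤ ∫⁻ w, ‖k w‖ₑ * R ∂μ := by
        apply lintegral_mono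
        intro w
        simp only [enorm_smul]
        gcongr
        exact hfR w
    _ = (∫⁻ w, ‖k w‖ₑ ∂μ) * R := lintegral_mul_const _ hk.enorm
    _ ≤ _ := by gcongr

variable [CompleteSpace H] [BorelSpace Z] [SigmaFinite μ]

/-- The estimate of the operator on the bad part. -/
theorem lintegral_kernelOp_bad_le {g : DyadicGrid Z μ} {A M : NNReal} {k : Z → Z → ℂ}
    (hk : CZKernel g A M k) {S : Type} [Countable S] {j : S → ℤ} {c : S → Z}
    (hd : Pairwise (Function.onFun Disjoint fun s => g.cube (j s) (c s))) {b : Z → H}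
    (hb : Integrable b μ) {R : ℝ≥0∞} (hR : R ≠ ⊤) (hbR : ∀ z, ‖b z‖ₑ ≤ R)
    (hb0 : ∀ z ∉ ⋃ s, g.cube (j s) (c s), b z = 0)
    (hbs : ∀ s, ∫ z in g.cube (j s) (c s), b z ∂μ = 0) :
    ∫⁻ z in (⋃ s, g.star (j s) (c s))ᶜ, ‖kernelOp μ k b z‖ₑ ∂μ ≤ A * ∫⁻ z, ‖b z‖ₑ ∂μ := by
  set Q : S → Set Z := fun s => g.cube (j s) (c s) with hQ
  have hQm : ∀ s, MeasurableSet (Q s) := fun s => g.measurableSet_cube _ _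
  have hint : ∀ z, Integrable (fun w => k z w • b w) μ := fun z =>
    integrable_kernel_smul (hk.meas.of_uncurry_left) (by simp) (hk.row z)
      hb.aestronglyMeasurable hR hbR
  have hpt : ∀ z, ‖kernelOp μ k b z‖ₑ ≤
      ∑' s, ∫⁻ w in Q s, ‖k z w - k z (c s)‖ₑ * ‖b w‖ₑ ∂μ := by
    intro z
    have h1 : kernelOp μ k b z = ∫ w in ⋃ s, Q s, k z w • b w ∂μ := by
      rw [kernelOp, setIntegral_eq_integral_of_forall_compl_eq_zero]
      intro w hw
      rw [hb0 w hw, smul_zero]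
    have h2 := hasSum_integral_iUnion hQm hd ((hint z).integrableOn (s := ⋃ s, Q s))
    rw [h1, ← h2.tsum_eq]
    refine enorm_tsum_le_tsum_enorm.trans (ENNReal.tsum_le_tsum fun s => ?_)
    -- The mean of b over the cube is zero, so the value of the kernel at the centre can be
    -- subtracted; this is where Hörmander's condition becomes applicable.
    have h3 : ∫ w in Q s, k z w • b w ∂μ = ∫ w in Q s, (k z w - k z (c s)) • b w ∂μ := by
      simp only [sub_smul]
      have e : Integrable (fun w => k z (c s) • b w) (μ.restrict (Q s)) :=
        (hb.integrableOn (s := Q s)).smul (k z (c s))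
      rw [integral_sub (hint z).integrableOn e,
        integral_smul, hbs s, smul_zero, sub_zero]
    rw [h3]
    refine (enorm_integral_le_lintegral_enorm _).trans (le_of_eq ?_)
    simp [enorm_smul]
  have hmeas : ∀ s, AEMeasurable (fun q : Z × Z => ‖k q.1 q.2 - k q.1 (c s)‖ₑ * ‖b q.2‖ₑ)
      (μ.prod μ) := fun s =>
    ((hk.meas.sub (hk.meas.comp (measurable_fst.prodMk measurable_const))).enorm.aemeasurable).mul
      hb.aestronglyMeasurable.comp_snd.enorm
  calc ∫⁻ z in (⋃ s, g.star (j s) (c s))ᶜ, ‖kernelOp μ k b z‖ₑ ∂μ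
      ≤ ∫⁻ z in (⋃ s, g.star (j s) (c s))ᶜ,
          ∑' s, ∫⁻ w in Q s, ‖k z w - k z (c s)‖ₑ * ‖b w‖ₑ ∂μ ∂μ := lintegral_mono hpt
    _ = ∑' s, ∫⁻ z in (⋃ s, g.star (j s) (c s))ᶜ,
          ∫⁻ w in Q s, ‖k z w - k z (c s)‖ₑ * ‖b w‖ₑ ∂μ ∂μ := by
        apply lintegral_tsum
        intro s
        exact AEMeasurable.lintegral_prod_right' (ν := μ.restrict (Q s))
          ((hmeas s).mono_measure (Measure.prod_mono Measure.restrict_le_self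
            Measure.restrict_le_self))
    _ ≤ ∑' s, ∫⁻ z in (g.star (j s) (c s))ᶜ,
          ∫⁻ w in Q s, ‖k z w - k z (c s)‖ₑ * ‖b w‖ₑ ∂μ ∂μ := by
        refine ENNReal.tsum_le_tsum fun s => lintegral_mono_set ?_
        exact compl_subset_compl.2 (subset_iUnion (fun s => g.star (j s) (c s)) s)
    _ = ∑' s, ∫⁻ w in Q s, ∫⁻ z in (g.star (j s) (c s))ᶜ,
          ‖k z w - k z (c s)‖ₑ * ‖b w‖ₑ ∂μ ∂μ := by
        congr with s
        apply lintegral_lintegral_swap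
        exact (hmeas s).mono_measure (Measure.prod_mono Measure.restrict_le_self
            Measure.restrict_le_self)
    _ ≤ ∑' s, ∫⁻ w in Q s, A * ‖b w‖ₑ ∂μ := by
        refine ENNReal.tsum_le_tsum fun s => setLIntegral_mono' (hQm s) fun w hw => ?_
        rw [lintegral_mul_const']
        · gcongr
          exact hk.hor _ _ _ hw
        · simp
    _ = ∫⁻ w in ⋃ s, Q s, A * ‖b w‖ₑ ∂μ := by
        rw [lintegral_iUnion hQm hd]
    _ ≤ ∫⁻ w, A * ‖b w‖ₑ ∂μ := setLIntegral_le_lintegral _ _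
    _ = _ := lintegral_const_mul' _ _ (by simp)

/-- The total measure of the stopping cubes. -/
theorem measure_iUnion_stopping_le {g : DyadicGrid Z μ} {u : Z → ℝ≥0∞} (hu : Measurable u)
    (hu' : ∫⁻ z, u z ∂μ ≠ ⊤) {lam : ℝ≥0∞} (hl : lam ≠ 0) (hl' : lam ≠ ⊤)
    {S : Type} [Countable S] {j : S → ℤ} {c : S → Z}
    (hd : Pairwise (Function.onFun Disjoint fun s => g.cube (j s) (c s)))
    (hs : ∀ s, lam * μ (g.cube (j s) (c s)) < ∫⁻ z in g.cube (j s) (c s), u z ∂μ) :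
    μ (⋃ s, g.cube (j s) (c s)) ≤ 2 * (lam⁻¹ * ∫⁻ z in {z | lam / 2 < u z}, u z ∂μ) := by
  have hQm : ∀ s, MeasurableSet (g.cube (j s) (c s)) := fun s => g.measurableSet_cube _ _
  set Ω := ⋃ s, g.cube (j s) (c s) with hΩ
  have hΩm : MeasurableSet Ω := MeasurableSet.iUnion hQm
  have h1 : lam * μ Ω ≤ ∫⁻ z in Ω, u z ∂μ := by
    rw [hΩ, measure_iUnion hd hQm, lintegral_iUnion hQm hd, ← ENNReal.tsum_mul_left]
    exact ENNReal.tsum_le_tsum fun s => (hs s).le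
  have hT : MeasurableSet {z | lam / 2 < u z} := measurableSet_lt measurable_const hu
  -- The part of u below lam/2 contributes at most half of lam·μ(Ω) and is absorbed on the left,
  -- which needs μ(Ω) finite. Only the part of u above lam/2 remains, and this form can be
  -- integrated in lam.
  have h2 : ∫⁻ z in Ω, u z ∂μ ≤ ∫⁻ z in {z | lam / 2 < u z}, u z ∂μ + lam / 2 * μ Ω := by
    rw [← lintegral_inter_add_sdiff (μ := μ) u Ω hT]
    gcongr ?_ + ?_
    · exact lintegral_mono_set inter_subset_right
    · calc ∫⁻ z in Ω \ {z | lam / 2 < u z}, u z ∂μ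
          ≤ ∫⁻ z in Ω \ {z | lam / 2 < u z}, lam / 2 ∂μ :=
            setLIntegral_mono' (hΩm.diff hT) fun z hz => not_lt.1 hz.2
        _ ≤ lam / 2 * μ Ω := by
            rw [setLIntegral_const]
            gcongr
            exact sdiff_subset
  have hfin : lam * μ Ω ≠ ⊤ :=
    ne_top_of_le_ne_top hu' (h1.trans (setLIntegral_le_lintegral _ _))
  have h3 : lam / 2 * μ Ω + lam / 2 * μ Ω = lam * μ Ω := by
    rw [← add_mul, ENNReal.add_halves]
  have hfin2 : lam / 2 * μ Ω ≠ ⊤ := by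
    refine ne_top_of_le_ne_top hfin ?_
    rw [← h3]; exact le_self_add
  have h4 : lam / 2 * μ Ω ≤ ∫⁻ z in {z | lam / 2 < u z}, u z ∂μ := by
    have := h1.trans h2
    rw [← h3] at this
    exact (ENNReal.add_le_add_iff_right hfin2).1 this
  calc μ Ω = 2 * (lam⁻¹ * (lam / 2 * μ Ω)) := by
        rw [div_eq_mul_inv, ← mul_assoc, ← mul_assoc, ← mul_assoc, mul_assoc 2,
          ENNReal.inv_mul_cancel hl hl', mul_one, ENNReal.mul_inv_cancel (by simp) (by simp),
          one_mul]
    _ ≤ _ := by gcongr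

end CZ

section CZStrong

set_option linter.unusedSectionVars false

variable {Z : Type*} [TopologicalSpace Z] [MeasurableSpace Z] {μ : Measure Z}
variable {H : Type*} [NormedAddCommGroup H] [NormedSpace ℂ H]
variable [CompleteSpace H] [BorelSpace Z] [SigmaFinite μ]

/-- The weak type estimate, in a form that can be integrated in `lam`. -/
theorem measure_lt_kernelOp_le [IsFiniteMeasureOnCompacts μ]
    {g : DyadicGrid Z μ} {A M : NNReal} {k : Z → Z → ℂ}
    (hk : CZKernel g A M k)
    (hL2 : ∀ f : Z → H, MemLp f 2 μ →
      ∫⁻ z, ‖kernelOp μ k f z‖ₑ ^ 2 ∂μ ≤ A ^ 2 * ∫⁻ z, ‖f z‖ₑ ^ 2 ∂μ)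
    {f : Z → H} (hf : Continuous f) (hfc : HasCompactSupport f)
    {lam : ℝ≥0∞} (hl : lam ≠ 0) (hl' : lam ≠ ⊤) :
    μ {z | lam < ‖kernelOp μ k f z‖ₑ} ≤
      ((4 * A ^ 2 + 2 * (4 * A ^ 2 * g.D ^ 2 + g.D + 4 * A * g.D) : NNReal) : ℝ≥0∞) *
        (lam⁻¹ * ∫⁻ z in {z | lam / 2 < ‖f z‖ₑ}, ‖f z‖ₑ ∂μ +
          (lam ^ 2)⁻¹ * ∫⁻ z in {z | ‖f z‖ₑ ≤ lam}, ‖f z‖ₑ ^ 2 ∂μ) := by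
  classical
  have hfi : Integrable f μ := by
    rw [← memLp_one_iff_integrable]
    exact hf.memLp_of_hasCompactSupport hfc
  obtain ⟨S, hSc, j, c, hd, hs1, hs2, hs3⟩ := g.exists_stopping (u := fun z => ‖f z‖ₑ)
    hfi.2.ne hl hl'
  set Q : S → Set Z := fun s => g.cube (j s) (c s) with hQ
  have hQm : ∀ s, MeasurableSet (Q s) := fun s => g.measurableSet_cube _ _
  set Ω := ⋃ s, Q s with hΩ
  have hΩm : MeasurableSet Ω := MeasurableSet.iUnion hQm
  set Ωs := ⋃ s, g.star (j s) (c s) with hΩs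
  set I₁ := ∫⁻ z in {z | lam / 2 < ‖f z‖ₑ}, ‖f z‖ₑ ∂μ with hI₁
  set I₂ := ∫⁻ z in {z | ‖f z‖ₑ ≤ lam}, ‖f z‖ₑ ^ 2 ∂μ with hI₂
  have hΩle : μ Ω ≤ 2 * (lam⁻¹ * I₁) :=
    measure_iUnion_stopping_le hf.enorm.measurable hfi.2.ne hl hl' hd hs1
  have hΩsle : μ Ωs ≤ g.D * μ Ω := by
    calc μ Ωs ≤ ∑' s, μ (g.star (j s) (c s)) := measure_iUnion_le _
      _ ≤ ∑' s, g.D * μ (Q s) := ENNReal.tsum_le_tsum fun s => g.star_le _ _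
      _ = _ := by rw [ENNReal.tsum_mul_left, measure_iUnion hd hQm]
  have hout : ∀ z ∉ Ω, ‖f z‖ₑ ≤ lam := fun z hz => g.le_of_average_le hf.enorm (hs3 z hz)
  let avg : S → H := fun s => (μ (Q s)).toReal⁻¹ • ∫ w in Q s, f w ∂μ
  have hQtop : ∀ s, μ (Q s) ≠ ⊤ := fun s => g.finite _ _
  have hQpos : ∀ s, μ (Q s) ≠ 0 := fun s => (g.pos _ _).ne'
  have havg : ∀ s, ‖avg s‖ₑ ≤ g.D * lam := by
    intro s
    have h0 : 0 < (μ (Q s)).toReal := ENNReal.toReal_pos (hQpos s) (hQtop s)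
    calc ‖avg s‖ₑ = (μ (Q s))⁻¹ * ‖∫ w in Q s, f w ∂μ‖ₑ := by
          rw [enorm_smul, Real.enorm_eq_ofReal (by positivity), ENNReal.ofReal_inv_of_pos h0,
            ENNReal.ofReal_toReal (hQtop s)]
      _ ≤ (μ (Q s))⁻¹ * (g.D * (lam * μ (Q s))) := by
          gcongr
          exact (enorm_integral_le_lintegral_enorm _).trans (hs2 s)
      _ = g.D * lam * ((μ (Q s))⁻¹ * μ (Q s)) := by ring
      _ = _ := by rw [ENNReal.inv_mul_cancel (hQpos s) (hQtop s), mul_one]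
  -- The good part: averages on the stopping cubes, f elsewhere. It is bounded by D·lam everywhere.
  let gd : Z → H := fun z => if h : ∃ s, z ∈ Q s then avg h.choose else f z
  have hgdQ : ∀ s, ∀ z ∈ Q s, gd z = avg s := by
    intro s z hz
    have h : ∃ s, z ∈ Q s := ⟨s, hz⟩
    have h1 : h.choose = s := by
      by_contra hne
      exact Set.disjoint_left.1 (hd hne) h.choose_spec hz
    simp only [gd, dif_pos h]
    rw [h1]
  have hgdout : ∀ z ∉ Ω, gd z = f z := by
    intro z hz
    have h : ¬ ∃ s, z ∈ Q s := by simpa [hΩ] using hz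
    simp only [gd, dif_neg h]
  have hD1 : (1 : ℝ≥0∞) ≤ g.D := by exact_mod_cast g.one_le_D
  have hgdle : ∀ z, ‖gd z‖ₑ ≤ g.D * lam := by
    intro z
    by_cases hz : z ∈ Ω
    · obtain ⟨s, hs⟩ := mem_iUnion.1 hz
      rw [hgdQ s z hs]
      exact havg s
    · rw [hgdout z hz]
      refine (hout z hz).trans ?_
      calc lam = 1 * lam := (one_mul _).symm
        _ ≤ _ := by gcongr
  have hgdm : AEStronglyMeasurable gd μ := by
    have h1 : AEStronglyMeasurable gd (μ.restrict Ω) := by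
      rw [hΩ, aestronglyMeasurable_iUnion_iff]
      intro s
      refine (aestronglyMeasurable_const (b := avg s)).congr ?_
      exact (ae_restrict_of_forall_mem (hQm s) fun z hz => (hgdQ s z hz).symm)
    have h2 : AEStronglyMeasurable gd (μ.restrict Ωᶜ) := by
      refine hfi.aestronglyMeasurable.restrict.congr ?_
      exact ae_restrict_of_forall_mem hΩm.compl fun z hz => (hgdout z hz).symm
    have := (aestronglyMeasurable_union_iff (s := Ω) (t := Ωᶜ)).2 ⟨h1, h2⟩
    rwa [union_compl_self, Measure.restrict_univ] at this
  have hΩtop : μ Ω ≠ ⊤ := by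
    refine ne_top_of_le_ne_top ?_ hΩle
    refine ENNReal.mul_ne_top (by simp) (ENNReal.mul_ne_top (ENNReal.inv_ne_top.2 hl) ?_)
    exact ne_top_of_le_ne_top hfi.2.ne (setLIntegral_le_lintegral _ _)
  have hgd1 : ∫⁻ z in Ω, ‖gd z‖ₑ ∂μ ≤ g.D * (lam * μ Ω) := by
    calc ∫⁻ z in Ω, ‖gd z‖ₑ ∂μ ≤ ∫⁻ z in Ω, g.D * lam ∂μ := lintegral_mono fun z => hgdle z
      _ = _ := by rw [setLIntegral_const, mul_assoc]
  have hf1 : ∫⁻ z in Ω, ‖f z‖ₑ ∂μ ≤ g.D * (lam * μ Ω) := by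
    rw [hΩ, lintegral_iUnion hQm hd, measure_iUnion hd hQm, ← ENNReal.tsum_mul_left,
      ← ENNReal.tsum_mul_left]
    exact ENNReal.tsum_le_tsum hs2
  -- Off Ω the function f is at most lam. Keeping its L² mass there, instead of estimating it by lam
  -- times the L¹ norm, is what makes the later integral in lam converge.
  have hgdL2 : ∫⁻ z, ‖gd z‖ₑ ^ 2 ∂μ ≤ I₂ + g.D ^ 2 * (lam ^ 2 * μ Ω) := by
    rw [← lintegral_add_compl _ hΩm, add_comm]
    gcongr ?_ + ?_
    · calc ∫⁻ z in Ωᶜ, ‖gd z‖ₑ ^ 2 ∂μ = ∫⁻ z in Ωᶜ, ‖f z‖ₑ ^ 2 ∂μ :=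
            setLIntegral_congr_fun hΩm.compl fun z hz => by simp only [hgdout z hz]
        _ ≤ _ := lintegral_mono_set fun z hz => hout z hz
    · calc ∫⁻ z in Ω, ‖gd z‖ₑ ^ 2 ∂μ ≤ ∫⁻ z in Ω, (g.D * lam) ^ 2 ∂μ :=
            lintegral_mono fun z => by gcongr; exact hgdle z
        _ = _ := by rw [setLIntegral_const, mul_pow, mul_assoc]
  have hI₂top : I₂ ≠ ⊤ := by
    refine ne_top_of_le_ne_top (b := lam * ∫⁻ z, ‖f z‖ₑ ∂μ) (ENNReal.mul_ne_top hl' hfi.2.ne) ?_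
    rw [← lintegral_const_mul' _ _ hl']
    calc I₂ ≤ ∫⁻ z in {z | ‖f z‖ₑ ≤ lam}, lam * ‖f z‖ₑ ∂μ := by
          refine setLIntegral_mono' (measurableSet_le hf.enorm.measurable measurable_const)
            fun z hz => ?_
          rw [pow_two]
          gcongr
          exact hz
      _ ≤ _ := setLIntegral_le_lintegral _ _
  have hgdmem : MemLp gd 2 μ := by
    refine ⟨hgdm, ?_⟩
    rw [eLpNorm_lt_top_iff_lintegral_rpow_enorm_lt_top (by simp) (by simp)]
    have e : ∀ z, ‖gd z‖ₑ ^ ((2 : ℝ≥0∞).toReal) = ‖gd z‖ₑ ^ 2 := fun z => by simp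
    simp only [e]
    refine lt_of_le_of_lt hgdL2 (ENNReal.add_lt_top.2 ⟨hI₂top.lt_top, ?_⟩)
    exact ENNReal.mul_lt_top (by simp)
      (ENNReal.mul_lt_top (ENNReal.pow_lt_top hl'.lt_top) hΩtop.lt_top)
  obtain ⟨Rf, hRf⟩ := hf.bounded_above_of_compact_support hfc
  have hfR : ∀ z, ‖f z‖ₑ ≤ ENNReal.ofReal Rf := fun z => by
    rw [← ofReal_norm]
    exact ENNReal.ofReal_le_ofReal (hRf z)
  have hDl : (g.D : ℝ≥0∞) * lam ≠ ⊤ := ENNReal.mul_ne_top (by simp) hl'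
  set b : Z → H := fun z => f z - gd z with hb
  have hbout : ∀ z ∉ Ω, b z = 0 := fun z hz => by simp [hb, hgdout z hz]
  have hb1 : ∫⁻ z, ‖b z‖ₑ ∂μ ≤ 2 * (g.D * (lam * μ Ω)) := by
    calc ∫⁻ z, ‖b z‖ₑ ∂μ = ∫⁻ z in Ω, ‖b z‖ₑ ∂μ := by
          rw [setLIntegral_eq_of_support_subset]
          intro z hz
          by_contra h
          exact hz (by simp [hbout z h])
      _ ≤ ∫⁻ z in Ω, (‖f z‖ₑ + ‖gd z‖ₑ) ∂μ := lintegral_mono fun z => enorm_sub_le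
      _ = ∫⁻ z in Ω, ‖f z‖ₑ ∂μ + ∫⁻ z in Ω, ‖gd z‖ₑ ∂μ :=
          lintegral_add_left hf.enorm.measurable _
      _ ≤ g.D * (lam * μ Ω) + g.D * (lam * μ Ω) := add_le_add hf1 hgd1
      _ = _ := by ring
  have hbint : Integrable b μ := by
    refine ⟨hfi.aestronglyMeasurable.sub hgdm, hb1.trans_lt ?_⟩
    exact ENNReal.mul_lt_top (by simp)
      (ENNReal.mul_lt_top (by simp) (ENNReal.mul_lt_top hl'.lt_top hΩtop.lt_top))
  have hbR : ∀ z, ‖b z‖ₑ ≤ ENNReal.ofReal Rf + g.D * lam := fun z =>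
    enorm_sub_le.trans (add_le_add (hfR z) (hgdle z))
  have hbs : ∀ s, ∫ z in Q s, b z ∂μ = 0 := by
    intro s
    have e1 : ∫ z in Q s, gd z ∂μ = ∫ z in Q s, f z ∂μ := by
      rw [setIntegral_congr_fun (hQm s) (fun z hz => hgdQ s z hz), setIntegral_const]
      simp only [avg]
      rw [smul_smul, Measure.real, mul_inv_cancel₀, one_smul]
      exact (ENNReal.toReal_pos (hQpos s) (hQtop s)).ne'
    have e2 : IntegrableOn gd (Q s) μ := by
      have : IntegrableOn (fun z => f z - b z) (Q s) μ :=
        hfi.integrableOn.sub hbint.integrableOn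
      simpa [hb] using this
    rw [hb, integral_sub hfi.integrableOn e2, e1, sub_self]
  have hsplit : ∀ z, kernelOp μ k f z = kernelOp μ k gd z + kernelOp μ k b z := by
    intro z
    rw [kernelOp, kernelOp, kernelOp, ← integral_add]
    · simp [hb, smul_sub]
    · exact integrable_kernel_smul hk.meas.of_uncurry_left (by simp) (hk.row z) hgdm hDl hgdle
    · exact integrable_kernel_smul hk.meas.of_uncurry_left (by simp) (hk.row z)
        hbint.aestronglyMeasurable (by simp [hDl]) hbR
  have hbad := lintegral_kernelOp_bad_le hk hd hbint (R := ENNReal.ofReal Rf + g.D * lam)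
    (by simp [hDl]) hbR hbout hbs
  have hgood := hL2 gd hgdmem
  have hl2 : lam / 2 ≠ 0 := (ENNReal.half_pos hl).ne'
  have hl2' : lam / 2 ≠ ⊤ := (ENNReal.div_lt_top hl' (by simp)).ne
  -- Three sources: the good part, by Chebyshev in L²; the enlarged cubes, by their measure; the bad
  -- part away from them, by Chebyshev in L¹.
  have hsub : {z | lam < ‖kernelOp μ k f z‖ₑ} ⊆
      ({z | (lam / 2) ^ 2 ≤ ‖kernelOp μ k gd z‖ₑ ^ 2} ∪ Ωs) ∪
        {z | z ∈ Ωsᶜ ∧ lam / 2 ≤ ‖kernelOp μ k b z‖ₑ} := by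
    intro z hz
    by_contra hcon
    simp only [mem_union, mem_ofPred_eq, not_or, not_le, not_and, mem_compl_iff] at hcon
    obtain ⟨⟨h1, h2⟩, h3⟩ := hcon
    have h1' : ‖kernelOp μ k gd z‖ₑ < lam / 2 := lt_of_not_ge fun h => not_le.2 h1 (pow_le_pow_left' h 2)
    have h3' := h3 h2
    have : ‖kernelOp μ k f z‖ₑ < lam := by
      rw [hsplit]
      refine (enorm_add_le _ _).trans_lt ?_
      calc _ < lam / 2 + lam / 2 := ENNReal.add_lt_add h1' h3'
        _ = lam := ENNReal.add_halves _
    exact absurd hz (not_lt.2 this.le)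
  have hm1 : μ {z | (lam / 2) ^ 2 ≤ ‖kernelOp μ k gd z‖ₑ ^ 2} ≤
      ((lam / 2) ^ 2)⁻¹ * (A ^ 2 * (I₂ + g.D ^ 2 * (lam ^ 2 * μ Ω))) := by
    have h1 := (meas_ge_le_lintegral_div (μ := μ)
      ((aestronglyMeasurable_kernelOp hk.meas hgdm).enorm.pow_const 2)
      (pow_ne_zero 2 hl2) (ENNReal.pow_ne_top hl2')).trans_eq ENNReal.div_eq_inv_mul
    refine h1.trans ?_
    gcongr
    exact hgood.trans (by gcongr)
  have hm2 : μ {z | z ∈ Ωsᶜ ∧ lam / 2 ≤ ‖kernelOp μ k b z‖ₑ} ≤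
      (lam / 2)⁻¹ * (A * (2 * (g.D * (lam * μ Ω)))) := by
    have hΩsm : MeasurableSet Ωsᶜ :=
      (MeasurableSet.iUnion fun s => g.measurable_star _ _).compl
    have h1 := (meas_ge_le_lintegral_div (μ := μ.restrict Ωsᶜ)
      ((aestronglyMeasurable_kernelOp hk.meas hbint.aestronglyMeasurable).enorm.restrict) hl2 hl2').trans_eq
        ENNReal.div_eq_inv_mul
    rw [Measure.restrict_apply' hΩsm] at h1
    have h2 : {z | z ∈ Ωsᶜ ∧ lam / 2 ≤ ‖kernelOp μ k b z‖ₑ} =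
      {z | lam / 2 ≤ ‖kernelOp μ k b z‖ₑ} ∩ Ωsᶜ := by
      ext z; exact and_comm
    rw [h2]
    refine h1.trans ?_
    gcongr
    exact hbad.trans (by gcongr)
  have einv : (lam / 2)⁻¹ = 2 * lam⁻¹ := by
    rw [ENNReal.inv_div (by simp) (by simp), div_eq_mul_inv]
  have einv2 : ((lam / 2) ^ 2)⁻¹ = 4 * (lam ^ 2)⁻¹ := by
    rw [ENNReal.inv_pow, einv, ENNReal.inv_pow, mul_pow]
    norm_num
  have ecan : lam⁻¹ * lam = 1 := ENNReal.inv_mul_cancel hl hl'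
  have ecan2 : (lam ^ 2)⁻¹ * lam ^ 2 = 1 := ENNReal.inv_mul_cancel (by simp [hl]) (by simp [hl'])
  calc μ {z | lam < ‖kernelOp μ k f z‖ₑ}
      ≤ μ {z | (lam / 2) ^ 2 ≤ ‖kernelOp μ k gd z‖ₑ ^ 2} + μ Ωs +
          μ {z | z ∈ Ωsᶜ ∧ lam / 2 ≤ ‖kernelOp μ k b z‖ₑ} :=
        (measure_mono hsub).trans ((measure_union_le _ _).trans (by
          gcongr; exact measure_union_le _ _))
    _ ≤ ((lam / 2) ^ 2)⁻¹ * (A ^ 2 * (I₂ + g.D ^ 2 * (lam ^ 2 * μ Ω))) + g.D * μ Ω +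
          (lam / 2)⁻¹ * (A * (2 * (g.D * (lam * μ Ω)))) := by gcongr
    _ = 4 * A ^ 2 * ((lam ^ 2)⁻¹ * I₂) + (4 * A ^ 2 * g.D ^ 2 * ((lam ^ 2)⁻¹ * lam ^ 2) +
          g.D + 4 * A * g.D * (lam⁻¹ * lam)) * μ Ω := by
        rw [einv, einv2]; ring
    _ = 4 * A ^ 2 * ((lam ^ 2)⁻¹ * I₂) + (4 * A ^ 2 * g.D ^ 2 + g.D + 4 * A * g.D) * μ Ω := by
        rw [ecan, ecan2, mul_one, mul_one]
    _ ≤ 4 * A ^ 2 * ((lam ^ 2)⁻¹ * I₂) + (4 * A ^ 2 * g.D ^ 2 + g.D + 4 * A * g.D) *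
          (2 * (lam⁻¹ * I₁)) := by gcongr
    -- Nonnegative terms are added so that both integrals carry the same constant.
    _ ≤ 4 * A ^ 2 * ((lam ^ 2)⁻¹ * I₂) + (4 * A ^ 2 * g.D ^ 2 + g.D + 4 * A * g.D) *
          (2 * (lam⁻¹ * I₁)) + (4 * A ^ 2 * (lam⁻¹ * I₁) +
          2 * (4 * A ^ 2 * g.D ^ 2 + g.D + 4 * A * g.D) * ((lam ^ 2)⁻¹ * I₂)) := le_self_add
    _ = _ := by push_cast; ring

end CZStrong

/-! ### From the weak type estimate to `L^p` -/

theorem lintegral_Ioo_rpow {p : ℝ} (hp : 1 < p) {a : ℝ} (ha : 0 ≤ a) :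
    ∫⁻ t in Ioo 0 a, ENNReal.ofReal (t ^ (p - 2)) = ENNReal.ofReal (a ^ (p - 1) / (p - 1)) := by
  have h := integral_rpow (a := 0) (b := a) (r := p - 2) (Or.inl (by linarith))
  rw [Real.zero_rpow (by linarith), sub_zero, show p - 2 + 1 = p - 1 by ring,
    intervalIntegral.integral_of_le ha] at h
  rw [← h, ofReal_integral_eq_lintegral_ofReal, restrict_Ioo_eq_restrict_Ioc]
  · exact (intervalIntegrable_iff_integrableOn_Ioc_of_le ha).1
      (intervalIntegral.intervalIntegrable_rpow' (by linarith))
  · exact ae_restrict_of_forall_mem measurableSet_Ioc fun t ht => Real.rpow_nonneg ht.1.le _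

theorem lintegral_Ioi_rpow {p : ℝ} (hp : p < 2) {a : ℝ} (ha : 0 < a) :
    ∫⁻ t in Ioi a, ENNReal.ofReal (t ^ (p - 3)) = ENNReal.ofReal (a ^ (p - 2) / (2 - p)) := by
  have h := integral_Ioi_rpow_of_lt (a := p - 3) (by linarith) ha
  rw [show p - 3 + 1 = p - 2 by ring] at h
  rw [← ofReal_integral_eq_lintegral_ofReal (integrableOn_Ioi_rpow_of_lt (by linarith) ha)
    (ae_restrict_of_forall_mem measurableSet_Ioi fun t ht => Real.rpow_nonneg (ha.trans ht).le _),
    h]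
  congr 1
  rw [neg_div, ← div_neg]
  congr 1
  ring

/-- Integration in `t` of the right-hand side of the weak type estimate. -/
theorem lintegral_weak_type_le {Z : Type*} [MeasurableSpace Z] {μ : Measure Z} [SFinite μ]
    {u : Z → ℝ} (hu : Measurable u) (hu0 : ∀ z, 0 ≤ u z) {p : ℝ} (hp : 1 < p) (hp2 : p < 2) :
    ∫⁻ t in Ioi (0 : ℝ), ((ENNReal.ofReal t)⁻¹ *
        ∫⁻ z in {z | ENNReal.ofReal t / 2 < ENNReal.ofReal (u z)}, ENNReal.ofReal (u z) ∂μ +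
        (ENNReal.ofReal t ^ 2)⁻¹ * ∫⁻ z in {z | ENNReal.ofReal (u z) ≤ ENNReal.ofReal t},
          ENNReal.ofReal (u z) ^ 2 ∂μ) * ENNReal.ofReal (t ^ (p - 1)) ≤
      ENNReal.ofReal (2 ^ (p - 1) / (p - 1) + 1 / (2 - p)) *
        ∫⁻ z, ENNReal.ofReal (u z ^ p) ∂μ := by
  -- By Tonelli the integral in t is done first at fixed z: the first term gives t^{p-2} on (0, 2u),
  -- integrable since p > 1, the second t^{p-3} on [u, ∞), integrable since p < 2.
  set F : ℝ → Z → ℝ≥0∞ := fun t z => {q : ℝ × Z | q.1 < 2 * u q.2}.indicator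
    (fun q => ENNReal.ofReal (q.1 ^ (p - 2)) * ENNReal.ofReal (u q.2)) (t, z) +
    {q : ℝ × Z | u q.2 ≤ q.1}.indicator
    (fun q => ENNReal.ofReal (q.1 ^ (p - 3)) * ENNReal.ofReal (u q.2) ^ 2) (t, z) with hF
  have hu' : Measurable fun q : ℝ × Z => u q.2 := hu.comp measurable_snd
  have hFm : Measurable (Function.uncurry F) := by
    apply Measurable.add
    · exact (((measurable_fst.pow_const _).ennreal_ofReal).mul hu'.ennreal_ofReal).indicator
        (measurableSet_lt measurable_fst (hu'.const_mul 2))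
    · exact (((measurable_fst.pow_const _).ennreal_ofReal).mul
        (hu'.ennreal_ofReal.pow_const 2)).indicator (measurableSet_le hu' measurable_fst)
  have hstep : ∀ t ∈ Ioi (0 : ℝ), ((ENNReal.ofReal t)⁻¹ *
        ∫⁻ z in {z | ENNReal.ofReal t / 2 < ENNReal.ofReal (u z)}, ENNReal.ofReal (u z) ∂μ +
        (ENNReal.ofReal t ^ 2)⁻¹ * ∫⁻ z in {z | ENNReal.ofReal (u z) ≤ ENNReal.ofReal t},
          ENNReal.ofReal (u z) ^ 2 ∂μ) * ENNReal.ofReal (t ^ (p - 1)) = ∫⁻ z, F t z ∂μ := by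
    intro t ht
    have ht0 : 0 < t := ht
    have e1 : (ENNReal.ofReal t)⁻¹ * ENNReal.ofReal (t ^ (p - 1)) =
        ENNReal.ofReal (t ^ (p - 2)) := by
      rw [← ENNReal.ofReal_inv_of_pos ht0, ← ENNReal.ofReal_mul (by positivity),
        ← Real.rpow_neg_one, ← Real.rpow_add ht0]
      congr 2; ring
    have e2 : (ENNReal.ofReal t ^ 2)⁻¹ * ENNReal.ofReal (t ^ (p - 1)) =
        ENNReal.ofReal (t ^ (p - 3)) := by
      rw [← ENNReal.ofReal_pow ht0.le, ← ENNReal.ofReal_inv_of_pos (by positivity),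
        ← ENNReal.ofReal_mul (by positivity), ← Real.rpow_natCast, ← Real.rpow_neg ht0.le,
        ← Real.rpow_add ht0]
      congr 2; push_cast; ring
    have s1 : {z | ENNReal.ofReal t / 2 < ENNReal.ofReal (u z)} = {z | t < 2 * u z} := by
      ext z
      have : ENNReal.ofReal t / 2 = ENNReal.ofReal (t / 2) := by
        rw [ENNReal.ofReal_div_of_pos (by norm_num)]; simp
      simp only [mem_ofPred_eq, this]
      rw [ENNReal.ofReal_lt_ofReal_iff_of_nonneg (by positivity)]
      constructor <;> intro h <;> linarith
    have s2 : {z | ENNReal.ofReal (u z) ≤ ENNReal.ofReal t} = {z | u z ≤ t} := by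
      ext z
      simp only [mem_ofPred_eq, ENNReal.ofReal_le_ofReal_iff ht0.le]
    rw [add_mul, mul_right_comm, e1, mul_right_comm, e2, s1, s2]
    simp only [hF]
    rw [lintegral_add_left, ← lintegral_const_mul' _ _ (by simp),
      ← lintegral_const_mul' _ _ (by simp), ← lintegral_indicator, ← lintegral_indicator]
    · rfl
    · exact measurableSet_le hu measurable_const
    · exact measurableSet_lt measurable_const (hu.const_mul 2)
    · exact (((((measurable_fst.pow_const _).ennreal_ofReal).mul hu'.ennreal_ofReal).indicator
        (measurableSet_lt measurable_fst (hu'.const_mul 2)))).comp measurable_prodMk_left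
  rw [setLIntegral_congr_fun measurableSet_Ioi hstep,
    lintegral_lintegral_swap hFm.aemeasurable, ← lintegral_const_mul' _ _ (by simp)]
  apply lintegral_mono
  intro z
  rcases (hu0 z).eq_or_lt with h0 | h0
  · have : ∀ t ∈ Ioi (0 : ℝ), F t z = 0 := by
      intro t ht
      have h0' : u z ≤ 0 := h0.ge
      simp [hF, indicator, h0']
    simp only
    rw [setLIntegral_congr_fun measurableSet_Ioi this]
    simp
  · have hle : ∀ t ∈ Ioi (0 : ℝ), F t z ≤
        (Ioo 0 (2 * u z)).indicator (fun t => ENNReal.ofReal (t ^ (p - 2))) t *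
          ENNReal.ofReal (u z) +
        (Ici (u z)).indicator (fun t => ENNReal.ofReal (t ^ (p - 3))) t *
          ENNReal.ofReal (u z) ^ 2 := by
      intro t ht
      have ht0 : 0 < t := ht
      simp only [hF, indicator, mem_ofPred_eq, mem_Ioo, mem_Ici, ht0, true_and]
      apply le_of_eq
      congr 1 <;> split_ifs <;> simp
    calc ∫⁻ t in Ioi (0 : ℝ), F t z
        ≤ ∫⁻ t in Ioi (0 : ℝ), ((Ioo 0 (2 * u z)).indicator
          (fun t => ENNReal.ofReal (t ^ (p - 2))) t * ENNReal.ofReal (u z) +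
          (Ici (u z)).indicator (fun t => ENNReal.ofReal (t ^ (p - 3))) t *
          ENNReal.ofReal (u z) ^ 2) := setLIntegral_mono' measurableSet_Ioi hle
      _ ≤ ∫⁻ t, ((Ioo 0 (2 * u z)).indicator
          (fun t => ENNReal.ofReal (t ^ (p - 2))) t * ENNReal.ofReal (u z) +
          (Ici (u z)).indicator (fun t => ENNReal.ofReal (t ^ (p - 3))) t *
          ENNReal.ofReal (u z) ^ 2) := setLIntegral_le_lintegral _ _
      _ = ENNReal.ofReal ((2 * u z) ^ (p - 1) / (p - 1)) * ENNReal.ofReal (u z) +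
          ENNReal.ofReal (u z ^ (p - 2) / (2 - p)) * ENNReal.ofReal (u z) ^ 2 := by
        rw [lintegral_add_left, lintegral_mul_const', lintegral_mul_const',
          lintegral_indicator measurableSet_Ioo, lintegral_indicator measurableSet_Ici,
          lintegral_Ioo_rpow hp (by positivity), ← restrict_Ioi_eq_restrict_Ici,
          lintegral_Ioi_rpow hp2 h0]
        · exact ENNReal.pow_ne_top (by simp)
        · simp
        · exact (((measurable_id.pow_const _).ennreal_ofReal).indicator
            measurableSet_Ioo).mul_const _
      _ = _ := by
        have hp1 : 0 < p - 1 := by linarith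
        have hp2' : 0 < 2 - p := by linarith
        rw [← ENNReal.ofReal_pow h0.le, ← ENNReal.ofReal_mul (by positivity),
          ← ENNReal.ofReal_mul (by positivity), ← ENNReal.ofReal_add (by positivity)
          (by positivity)]
        simp only
        rw [← ENNReal.ofReal_mul (by positivity)]
        congr 1
        rw [Real.mul_rpow (by norm_num) h0.le, add_mul]
        have a1 : u z ^ (p - 1) * u z = u z ^ p := by
          rw [← Real.rpow_add_one h0.ne']; congr 1; ring
        have a2 : u z ^ (p - 2) * u z ^ 2 = u z ^ p := by
          rw [← Real.rpow_add_natCast h0.ne']; congr 1; push_cast; ring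
        linear_combination (2 ^ (p - 1) / (p - 1)) * a1 + (1 / (2 - p)) * a2

section CZStrong

set_option linter.unusedSectionVars false

variable {Z : Type*} [TopologicalSpace Z] [MeasurableSpace Z] {μ : Measure Z}
variable {H : Type*} [NormedAddCommGroup H] [NormedSpace ℂ H]
variable [CompleteSpace H] [BorelSpace Z] [SigmaFinite μ]

/-- The constant of the `L^p` estimate for `1 < p < 2`. -/
def czConst (A D : NNReal) (p : ℝ) : ℝ≥0∞ :=
  ENNReal.ofReal p * ((4 * A ^ 2 + 2 * (4 * A ^ 2 * D ^ 2 + D + 4 * A * D) : NNReal) : ℝ≥0∞) *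
    ENNReal.ofReal (2 ^ (p - 1) / (p - 1) + 1 / (2 - p))

theorem czConst_ne_top (A D : NNReal) (p : ℝ) : czConst A D p ≠ ⊤ :=
  ENNReal.mul_ne_top (ENNReal.mul_ne_top (by simp) ENNReal.coe_ne_top) (by simp)

/-- The layer cake formula with the weak type estimate inserted under the integral in t. Continuity
of f is what bounds it off the stopping cubes. -/
theorem lintegral_kernelOp_rpow_le_of_continuous [IsFiniteMeasureOnCompacts μ]
    {g : DyadicGrid Z μ} {A M : NNReal} {k : Z → Z → ℂ} (hk : CZKernel g A M k)
    (hL2 : ∀ f : Z → H, MemLp f 2 μ →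
      ∫⁻ z, ‖kernelOp μ k f z‖ₑ ^ 2 ∂μ ≤ A ^ 2 * ∫⁻ z, ‖f z‖ₑ ^ 2 ∂μ)
    {p : ℝ} (hp : 1 < p) (hp2 : p < 2)
    {f : Z → H} (hf : Continuous f) (hfc : HasCompactSupport f) :
    ∫⁻ z, ‖kernelOp μ k f z‖ₑ ^ p ∂μ ≤ czConst A g.D p * ∫⁻ z, ‖f z‖ₑ ^ p ∂μ := by
  have hfi : AEStronglyMeasurable f μ := by
    exact (hf.memLp_of_hasCompactSupport (μ := μ) (p := 1) hfc).1
  have hp0 : 0 < p := by linarith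
  have e : ∀ v : H, ‖v‖ₑ ^ p = ENNReal.ofReal (‖v‖ ^ p) := fun v => by
    rw [← ofReal_norm, ENNReal.ofReal_rpow_of_nonneg (norm_nonneg _) hp0.le]
  simp only [e]
  rw [lintegral_rpow_eq_lintegral_meas_lt_mul μ (Eventually.of_forall fun z => norm_nonneg _)
    (aestronglyMeasurable_kernelOp hk.meas hfi).norm.aemeasurable hp0, czConst, mul_assoc,
    mul_assoc]
  gcongr ENNReal.ofReal p * ?_
  refine le_trans ?_ (mul_le_mul_right (lintegral_weak_type_le (μ := μ) hf.norm.measurable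
    (fun z => norm_nonneg _) hp hp2) _)
  rw [← lintegral_const_mul' _ _ ENNReal.coe_ne_top]
  refine setLIntegral_mono' measurableSet_Ioi fun t ht => ?_
  have ht0 : 0 < t := ht
  have h := measure_lt_kernelOp_le hk hL2 hf hfc (lam := ENNReal.ofReal t) (by simpa using ht0)
    (by simp)
  rw [← mul_assoc]
  gcongr
  have hset : {z | t < ‖kernelOp μ k f z‖} = {z | ENNReal.ofReal t < ‖kernelOp μ k f z‖ₑ} := by
    ext z
    rw [mem_ofPred_eq, mem_ofPred_eq, ← ofReal_norm,
      ENNReal.ofReal_lt_ofReal_iff_of_nonneg ht0.le]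
  rw [hset]
  simp only [← ofReal_norm] at h ⊢
  exact h

end CZStrong

/-! ### Schur kernels, duality and the full range of p -/

section CZDual

set_option linter.unusedSectionVars false

theorem eLpNorm_rpow_eq {Z F : Type*} [MeasurableSpace Z] [NormedAddCommGroup F] {μ : Measure Z}
    {p : ℝ} (hp : 0 < p) (f : Z → F) :
    eLpNorm f (ENNReal.ofReal p) μ ^ p = ∫⁻ z, ‖f z‖ₑ ^ p ∂μ := by
  rw [eLpNorm_eq_lintegral_rpow_enorm_toReal (by simpa using hp) (by simp),
    ENNReal.toReal_ofReal hp.le, ← ENNReal.rpow_mul, one_div, inv_mul_cancel₀ hp.ne',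
    ENNReal.rpow_one]

theorem eLpNorm_le_mul_iff {Z F F' : Type*} [MeasurableSpace Z] [NormedAddCommGroup F]
    [NormedAddCommGroup F'] {μ : Measure Z} {p : ℝ} (hp : 0 < p) {f : Z → F} {f' : Z → F'}
    {C : ℝ≥0∞} :
    eLpNorm f (ENNReal.ofReal p) μ ≤ C * eLpNorm f' (ENNReal.ofReal p) μ ↔
      ∫⁻ z, ‖f z‖ₑ ^ p ∂μ ≤ C ^ p * ∫⁻ z, ‖f' z‖ₑ ^ p ∂μ := by
  rw [← eLpNorm_rpow_eq hp, ← eLpNorm_rpow_eq hp, ← ENNReal.mul_rpow_of_nonneg _ _ hp.le,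
    ENNReal.rpow_le_rpow_iff hp]

theorem memLp_ofReal_iff {Z F : Type*} [MeasurableSpace Z] [NormedAddCommGroup F]
    {μ : Measure Z} {p : ℝ} (hp : 0 < p) {f : Z → F} (hf : AEStronglyMeasurable f μ) :
    MemLp f (ENNReal.ofReal p) μ ↔ ∫⁻ z, ‖f z‖ₑ ^ p ∂μ ≠ ⊤ := by
  rw [← eLpNorm_rpow_eq hp]
  constructor
  · intro h
    exact ENNReal.rpow_ne_top_of_nonneg hp.le h.2.ne
  · intro h
    refine ⟨hf, lt_top_iff_ne_top.2 fun h' => h ?_⟩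
    rw [h', ENNReal.top_rpow_of_pos hp]

variable {Z : Type*} [TopologicalSpace Z] [MeasurableSpace Z] {μ : Measure Z}
variable {H : Type*} [NormedAddCommGroup H] [InnerProductSpace ℂ H]
variable [CompleteSpace H] [BorelSpace Z] [SigmaFinite μ]

/-- The kernel of the adjoint operator. -/
def kernelAdj (k : Z → Z → ℂ) (z w : Z) : ℂ := (starRingEnd ℂ) (k w z)

theorem kernelAdj_kernelAdj (k : Z → Z → ℂ) : kernelAdj (kernelAdj k) = k := by
  ext z w
  simp [kernelAdj]

theorem measurable_kernelAdj {k : Z → Z → ℂ} (hk : Measurable (Function.uncurry k)) :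
    Measurable (Function.uncurry (kernelAdj k)) :=
  (Complex.continuous_conj.measurable).comp (hk.comp measurable_swap)

/-- Measurable kernels satisfying Schur's condition. -/
structure SchurKernel (μ : Measure Z) (M : NNReal) (k : Z → Z → ℂ) : Prop where
  meas : Measurable (Function.uncurry k)
  row : ∀ z, ∫⁻ w, ‖k z w‖ₑ ∂μ ≤ M
  col : ∀ w, ∫⁻ z, ‖k z w‖ₑ ∂μ ≤ M

theorem CZKernel.schur {g : DyadicGrid Z μ} {A M : NNReal} {k : Z → Z → ℂ}
    (hk : CZKernel g A M k) : SchurKernel μ M k := ⟨hk.meas, hk.row, hk.col⟩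

theorem SchurKernel.adj {M : NNReal} {k : Z → Z → ℂ}
    (hk : SchurKernel μ M k) : SchurKernel μ M (kernelAdj k) := by
  refine ⟨measurable_kernelAdj hk.meas, fun z => ?_, fun z => ?_⟩
  · simpa [kernelAdj] using hk.col z
  · simpa [kernelAdj] using hk.row z

namespace SchurKernel

variable {M : NNReal} {k : Z → Z → ℂ} (hk : SchurKernel μ M k) {p : ℝ} (hp : 1 < p)
include hk hp

theorem lintegral_abs_le {f : Z → H} (hf : AEStronglyMeasurable f μ) :
    ∫⁻ z, (∫⁻ w, ‖k z w‖ₑ * ‖f w‖ₑ ∂μ) ^ p ∂μ ≤ M ^ p * ∫⁻ z, ‖f z‖ₑ ^ p ∂μ := by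
  have h := lintegral_rpow_lintegral_mul_le (μ := μ) (ν := μ) (a := fun z w => ‖k z w‖ₑ)
    hk.meas.enorm (Eventually.of_forall hk.row) (Eventually.of_forall hk.col) hp hf.enorm
  refine h.trans (le_of_eq ?_)
  congr 1
  rcases eq_or_ne (M : ℝ≥0∞) 0 with h0 | h0
  · rw [h0]
    simp [ENNReal.zero_rpow_of_pos (show 0 < p by linarith)]
  · nth_rewrite 2 [← ENNReal.rpow_one (M : ℝ≥0∞)]
    rw [← ENNReal.rpow_add _ _ h0 (by simp)]
    congr 1; ring

theorem ae_integrable {f : Z → H} (hf : MemLp f (ENNReal.ofReal p) μ) :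
    ∀ᵐ z ∂μ, Integrable (fun w => k z w • f w) μ := by
  have hp0 : 0 < p := by linarith
  have h1 : ∫⁻ z, (∫⁻ w, ‖k z w‖ₑ * ‖f w‖ₑ ∂μ) ^ p ∂μ ≠ ⊤ := by
    refine ne_top_of_le_ne_top ?_ (hk.lintegral_abs_le hp hf.1)
    exact ENNReal.mul_ne_top (by simp [hp0.le])
      ((memLp_ofReal_iff hp0 hf.1).1 hf)
  have hm : AEMeasurable (fun z => (∫⁻ w, ‖k z w‖ₑ * ‖f w‖ₑ ∂μ) ^ p) μ := by
    apply AEMeasurable.pow_const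
    exact AEMeasurable.lintegral_prod_right'
      (f := fun q : Z × Z => ‖k q.1 q.2‖ₑ * ‖f q.2‖ₑ)
      (hk.meas.enorm.aemeasurable.mul hf.1.comp_snd.enorm)
  filter_upwards [ae_lt_top' hm h1] with z hz
  refine ⟨hk.meas.of_uncurry_left.aestronglyMeasurable.smul hf.1, ?_⟩
  rw [HasFiniteIntegral]
  simp only [enorm_smul]
  by_contra h
  rw [not_lt, top_le_iff] at h
  rw [h, ENNReal.top_rpow_of_pos hp0] at hz
  exact lt_irrefl _ hz

theorem eLpNorm_le {f : Z → H} (hf : AEStronglyMeasurable f μ) :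
    eLpNorm (kernelOp μ k f) (ENNReal.ofReal p) μ ≤ M * eLpNorm f (ENNReal.ofReal p) μ := by
  have hp0 : 0 < p := by linarith
  rw [eLpNorm_le_mul_iff hp0]
  refine le_trans ?_ (hk.lintegral_abs_le hp hf)
  gcongr with z
  exact enorm_kernelOp_le k f z

theorem memLp {f : Z → H} (hf : MemLp f (ENNReal.ofReal p) μ) :
    MemLp (kernelOp μ k f) (ENNReal.ofReal p) μ :=
  ⟨aestronglyMeasurable_kernelOp hk.meas hf.1, (hk.eLpNorm_le hp hf.1).trans_lt
    (ENNReal.mul_lt_top (by simp) hf.2)⟩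

theorem ae_sub {f f' : Z → H} (hf : MemLp f (ENNReal.ofReal p) μ)
    (hf' : MemLp f' (ENNReal.ofReal p) μ) :
    kernelOp μ k (f - f') =ᵐ[μ] kernelOp μ k f - kernelOp μ k f' := by
  filter_upwards [hk.ae_integrable hp hf, hk.ae_integrable hp hf'] with z h1 h2
  simp only [kernelOp, Pi.sub_apply, smul_sub]
  exact integral_sub h1 h2

/-- A bound on continuous functions with compact support extends to `L^p`. -/
theorem eLpNorm_le_of_continuous [NormalSpace Z] [R1Space Z] [WeaklyLocallyCompactSpace Z] [μ.Regular] {C : ℝ≥0∞}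
    (hC : C ≠ ⊤)
    (h : ∀ f : Z → H, Continuous f → HasCompactSupport f →
      eLpNorm (kernelOp μ k f) (ENNReal.ofReal p) μ ≤ C * eLpNorm f (ENNReal.ofReal p) μ)
    {f : Z → H} (hf : MemLp f (ENNReal.ofReal p) μ) :
    eLpNorm (kernelOp μ k f) (ENNReal.ofReal p) μ ≤ C * eLpNorm f (ENNReal.ofReal p) μ := by
  have hp1 : 1 ≤ ENNReal.ofReal p := by simpa using hp.le
  -- The Schur constant M multiplies only the approximation error, so it disappears in the limit ε →
  -- 0.
  have key : ∀ ε : ℝ≥0∞, ε ≠ 0 → eLpNorm (kernelOp μ k f) (ENNReal.ofReal p) μ ≤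
      C * eLpNorm f (ENNReal.ofReal p) μ + (M + C) * ε := by
    intro ε hε
    obtain ⟨h', hc, hle, hcont, hmem⟩ := hf.exists_hasCompactSupport_eLpNorm_sub_le (by simp) hε
    have e1 := hk.ae_sub hp hf hmem
    have e2 : kernelOp μ k f =ᵐ[μ] kernelOp μ k (f - h') + kernelOp μ k h' := by
      filter_upwards [e1] with z hz
      simp only [Pi.add_apply]
      rw [hz, Pi.sub_apply, sub_add_cancel]
    have e3 : eLpNorm h' (ENNReal.ofReal p) μ ≤ eLpNorm f (ENNReal.ofReal p) μ + ε := by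
      have : h' = f - (f - h') := by simp
      rw [this]
      exact (eLpNorm_sub_le hf.1 (hf.sub hmem).1 hp1).trans (by gcongr)
    calc eLpNorm (kernelOp μ k f) (ENNReal.ofReal p) μ
        = eLpNorm (kernelOp μ k (f - h') + kernelOp μ k h') (ENNReal.ofReal p) μ :=
          eLpNorm_congr_ae e2
      _ ≤ eLpNorm (kernelOp μ k (f - h')) (ENNReal.ofReal p) μ +
          eLpNorm (kernelOp μ k h') (ENNReal.ofReal p) μ :=
          eLpNorm_add_le (aestronglyMeasurable_kernelOp hk.meas (hf.sub hmem).1)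
            (aestronglyMeasurable_kernelOp hk.meas hmem.1) hp1
      _ ≤ M * ε + C * (eLpNorm f (ENNReal.ofReal p) μ + ε) := by
          gcongr
          · exact (hk.eLpNorm_le hp (hf.sub hmem).1).trans (by gcongr)
          · exact (h h' hcont hc).trans (by gcongr)
      _ = _ := by ring
  have hlim : Tendsto (fun ε : ℝ≥0∞ => C * eLpNorm f (ENNReal.ofReal p) μ + (M + C) * ε)
      (𝓝[≠] 0) (𝓝 (C * eLpNorm f (ENNReal.ofReal p) μ + (M + C) * 0)) := by
    refine (tendsto_const_nhds.add (ENNReal.Tendsto.const_mul tendsto_id ?_)).mono_left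
      nhdsWithin_le_nhds
    exact Or.inr (by simp [hC])
  rw [mul_zero, add_zero] at hlim
  have : (𝓝[≠] (0 : ℝ≥0∞)).NeBot := by infer_instance
  exact ge_of_tendsto hlim (eventually_nhdsWithin_of_forall fun ε hε => key ε hε)

/-- The bound on `L^q` for the adjoint kernel gives the bound on `L^p`. -/
theorem eLpNorm_le_of_adj {q : ℝ} (hpq : p.HolderConjugate q) {C : ℝ≥0∞}
    (h : ∀ f : Z → H, MemLp f (ENNReal.ofReal q) μ →
      eLpNorm (kernelOp μ (kernelAdj k) f) (ENNReal.ofReal q) μ ≤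
        C * eLpNorm f (ENNReal.ofReal q) μ)
    {f : Z → H} (hf : MemLp f (ENNReal.ofReal p) μ) :
    eLpNorm (kernelOp μ k f) (ENNReal.ofReal p) μ ≤ C * eLpNorm f (ENNReal.ofReal p) μ := by
  have hp0 : 0 < p := by linarith
  have hq0 : 0 < q := hpq.symm.pos
  have hq1 : 1 < q := hpq.symm.lt
  set u := kernelOp μ k f with hu
  have hup : MemLp u (ENNReal.ofReal p) μ := hk.memLp hp hf
  -- The extremal function of the duality between L^p and L^q: ⟨g, u⟩ = ‖u‖^p and ‖g‖^q = ‖u‖^p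
  -- pointwise.
  set g : Z → H := fun z => ((‖u z‖ ^ (p - 2) : ℝ) : ℂ) • u z with hg
  have hgm : AEStronglyMeasurable g μ := by
    apply AEStronglyMeasurable.smul _ hup.1
    exact (Complex.continuous_ofReal.measurable.comp_aemeasurable
      (hup.1.norm.aemeasurable.pow_const _)).aestronglyMeasurable
  have hpq' : (p - 1) * q = p := hpq.sub_one_mul_conj
  have hgn : ∀ z, ‖g z‖ = ‖u z‖ ^ (p - 1) := by
    intro z
    rcases eq_or_ne (u z) 0 with h0 | h0
    · simp [hg, h0, Real.zero_rpow (show p - 1 ≠ 0 by linarith)]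
    · have h0' : 0 < ‖u z‖ := norm_pos_iff.2 h0
      simp only [hg]
      rw [norm_smul, Complex.norm_real, Real.norm_of_nonneg (by positivity),
        ← Real.rpow_add_one h0'.ne']
      congr 1; ring
  have hgq : ∀ z, ‖g z‖ₑ ^ q = ‖u z‖ₑ ^ p := by
    intro z
    rw [← ofReal_norm, ← ofReal_norm, hgn, ENNReal.ofReal_rpow_of_nonneg (by positivity) hq0.le,
      ENNReal.ofReal_rpow_of_nonneg (by positivity) hp0.le, ← Real.rpow_mul (norm_nonneg _), hpq']
  set I := ∫⁻ z, ‖u z‖ₑ ^ p ∂μ with hI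
  -- Finiteness is known a priori from Schur's test. It permits the division of I ≤ C·I^{1/q}·‖f‖ by
  -- I^{1/q} at the end.
  have hItop : I ≠ ⊤ := (memLp_ofReal_iff hp0 hup.1).1 hup
  have hgI : ∫⁻ z, ‖g z‖ₑ ^ q ∂μ = I := by simp only [hgq, hI]
  have hgmem : MemLp g (ENNReal.ofReal q) μ := by
    rw [memLp_ofReal_iff hq0 hgm, hgI]
    exact hItop
  have hkm' : AEStronglyMeasurable (fun x : Z × Z => k x.1 x.2) (μ.prod μ) :=
    hk.meas.aestronglyMeasurable
  -- Fubini is justified by Hölder: g in L^q against the operator with the absolute kernel, which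
  -- Schur's test bounds on L^p.
  have hprod : Integrable (fun x : Z × Z => inner ℂ (g x.1) (k x.1 x.2 • f x.2)) (μ.prod μ) := by
    have hm : AEStronglyMeasurable (fun x : Z × Z => inner ℂ (g x.1) (k x.1 x.2 • f x.2))
      (μ.prod μ) := hgm.comp_fst.inner (hkm'.smul hf.1.comp_snd)
    refine ⟨hm, ?_⟩
    have hm2 : AEMeasurable (fun x : Z × Z => ‖k x.1 x.2‖ₑ * ‖f x.2‖ₑ) (μ.prod μ) :=
      hk.meas.enorm.aemeasurable.mul hf.1.comp_snd.enorm
    calc ∫⁻ x, ‖inner ℂ (g x.1) (k x.1 x.2 • f x.2)‖ₑ ∂(μ.prod μ)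
        ≤ ∫⁻ x, ‖g x.1‖ₑ * (‖k x.1 x.2‖ₑ * ‖f x.2‖ₑ) ∂(μ.prod μ) := by
          apply lintegral_mono
          intro x
          dsimp only
          rw [← enorm_smul]
          simp only [← ofReal_norm]
          rw [← ENNReal.ofReal_mul (norm_nonneg _)]
          exact ENNReal.ofReal_le_ofReal (norm_inner_le_norm _ _)
      _ = ∫⁻ z, ∫⁻ w, ‖g z‖ₑ * (‖k z w‖ₑ * ‖f w‖ₑ) ∂μ ∂μ :=
          lintegral_prod _ (hgm.comp_fst.enorm.mul hm2)
      _ = ∫⁻ z, ‖g z‖ₑ * ∫⁻ w, ‖k z w‖ₑ * ‖f w‖ₑ ∂μ ∂μ := by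
          congr with z
          exact lintegral_const_mul' _ _ (by simp)
      _ ≤ (∫⁻ z, ‖g z‖ₑ ^ q ∂μ) ^ (1 / q) *
          (∫⁻ z, (∫⁻ w, ‖k z w‖ₑ * ‖f w‖ₑ ∂μ) ^ p ∂μ) ^ (1 / p) :=
          ENNReal.lintegral_mul_le_Lp_mul_Lq μ hpq.symm hgm.enorm hm2.lintegral_prod_right'
      _ < ⊤ := by
          apply ENNReal.mul_lt_top
          · rw [hgI]
            exact ENNReal.rpow_lt_top_of_nonneg (by positivity) hItop
          · refine ENNReal.rpow_lt_top_of_nonneg (by positivity) ?_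
            refine ne_top_of_le_ne_top ?_ (hk.lintegral_abs_le hp hf.1)
            exact ENNReal.mul_ne_top (by simp [hp0.le]) ((memLp_ofReal_iff hp0 hf.1).1 hf)
  have hinner : ∀ z, inner ℂ (g z) (u z) = ((‖u z‖ ^ p : ℝ) : ℂ) := by
    intro z
    rcases eq_or_ne (u z) 0 with h0 | h0
    · simp [h0, Real.zero_rpow hp0.ne']
    · have h0' : 0 < ‖u z‖ := norm_pos_iff.2 h0
      simp only [hg]
      rw [inner_smul_left, Complex.conj_ofReal, inner_self_eq_norm_sq_to_K]
      have : ‖u z‖ ^ p = ‖u z‖ ^ (p - 2) * ‖u z‖ ^ 2 := by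
        rw [← Real.rpow_add_natCast h0'.ne']; congr 1; push_cast; ring
      rw [this]
      push_cast
      rfl
  have h1 : ∫ z, ((‖u z‖ ^ p : ℝ) : ℂ) ∂μ =
      ∫ z, ∫ w, inner ℂ (g z) (k z w • f w) ∂μ ∂μ := by
    apply integral_congr_ae
    filter_upwards [hk.ae_integrable hp hf] with z hz
    rw [integral_inner hz, ← hinner z, hu]
    rfl
  have h2 : ∫ z, ∫ w, inner ℂ (g z) (k z w • f w) ∂μ ∂μ =
      ∫ w, inner ℂ (kernelOp μ (kernelAdj k) g w) (f w) ∂μ := by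
    rw [integral_integral_swap hprod]
    apply integral_congr_ae
    filter_upwards [hk.adj.ae_integrable hq1 hgmem] with w hw
    have e : ∀ z, inner ℂ (g z) (k z w • f w) =
        (starRingEnd ℂ) (inner ℂ (f w) (kernelAdj k w z • g z)) := by
      intro z
      rw [inner_conj_symm, inner_smul_right, kernelAdj,
        inner_smul_left (g z) (f w) ((starRingEnd ℂ) (k z w)), Complex.conj_conj]
    simp only [e]
    rw [integral_conj, integral_inner hw, inner_conj_symm]
    rfl
  have h3 : I ≤ (C * I ^ (1 / q)) * eLpNorm f (ENNReal.ofReal p) μ := by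
    have hint : Integrable (fun z => ‖u z‖ ^ p) μ := by
      have := hup.integrable_norm_rpow (by simpa using hp0) (by simp)
      rwa [ENNReal.toReal_ofReal hp0.le] at this
    have eI : I = ‖∫ z, ((‖u z‖ ^ p : ℝ) : ℂ) ∂μ‖ₑ := by
      rw [integral_complex_ofReal, ← ofReal_norm, Complex.norm_real,
        Real.norm_of_nonneg (integral_nonneg fun z => by positivity),
        ofReal_integral_eq_lintegral_ofReal hint (Eventually.of_forall fun z => by positivity), hI]
      congr with z
      rw [← ofReal_norm, ENNReal.ofReal_rpow_of_nonneg (norm_nonneg _) hp0.le]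
    have hTm := hk.adj.memLp hq1 hgmem
    calc I = ‖∫ w, inner ℂ (kernelOp μ (kernelAdj k) g w) (f w) ∂μ‖ₑ := by rw [eI, h1, h2]
      _ ≤ ∫⁻ w, ‖inner ℂ (kernelOp μ (kernelAdj k) g w) (f w)‖ₑ ∂μ :=
          enorm_integral_le_lintegral_enorm _
      _ ≤ ∫⁻ w, ‖kernelOp μ (kernelAdj k) g w‖ₑ * ‖f w‖ₑ ∂μ := by
          apply lintegral_mono
          intro w
          simp only [← ofReal_norm]
          rw [← ENNReal.ofReal_mul (norm_nonneg _)]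
          exact ENNReal.ofReal_le_ofReal (norm_inner_le_norm _ _)
      _ ≤ (∫⁻ w, ‖kernelOp μ (kernelAdj k) g w‖ₑ ^ q ∂μ) ^ (1 / q) *
          (∫⁻ w, ‖f w‖ₑ ^ p ∂μ) ^ (1 / p) :=
          ENNReal.lintegral_mul_le_Lp_mul_Lq μ hpq.symm hTm.1.enorm hf.1.enorm
      _ = eLpNorm (kernelOp μ (kernelAdj k) g) (ENNReal.ofReal q) μ *
          eLpNorm f (ENNReal.ofReal p) μ := by
          rw [← eLpNorm_rpow_eq hq0, ← eLpNorm_rpow_eq hp0, ← ENNReal.rpow_mul,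
            ← ENNReal.rpow_mul, mul_one_div_cancel hq0.ne', mul_one_div_cancel hp0.ne',
            ENNReal.rpow_one, ENNReal.rpow_one]
      _ ≤ (C * eLpNorm g (ENNReal.ofReal q) μ) * eLpNorm f (ENNReal.ofReal p) μ := by
          gcongr
          exact h g hgmem
      _ = _ := by
          rw [← hgI, ← eLpNorm_rpow_eq hq0, ← ENNReal.rpow_mul, mul_one_div_cancel hq0.ne',
            ENNReal.rpow_one]
  have hIe : eLpNorm u (ENNReal.ofReal p) μ = I ^ (1 / p) := by
    rw [hI, ← eLpNorm_rpow_eq hp0, ← ENNReal.rpow_mul, mul_one_div_cancel hp0.ne',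
            ENNReal.rpow_one]
  rw [hIe]
  rcases eq_or_ne I 0 with h0 | h0
  · rw [h0, ENNReal.zero_rpow_of_pos (by positivity)]
    exact zero_le
  · have h4 : I ^ (1 / p) * I ^ (1 / q) = I := by
      rw [← ENNReal.rpow_add _ _ h0 hItop, one_div, one_div, hpq.inv_add_inv_eq_one,
        ENNReal.rpow_one]
    have h5 : I ^ (1 / q) ≠ 0 := by simp [h0, hItop]
    have h6 : I ^ (1 / q) ≠ ⊤ := ENNReal.rpow_ne_top_of_nonneg (by positivity) hItop
    rw [← ENNReal.mul_le_mul_iff_left h5 h6, h4]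
    exact h3.trans (le_of_eq (by ring))

end SchurKernel

/-- The constant of the `L^p` estimate. -/
def czNorm (A D : NNReal) (p : ℝ) : ℝ≥0∞ :=
  A + czConst A D p ^ (1 / p) + czConst A D p.conjExponent ^ (1 / p.conjExponent)

theorem czNorm_ne_top (A D : NNReal) {p : ℝ} (hp : 1 < p) : czNorm A D p ≠ ⊤ := by
  have hpq : p.HolderConjugate (p.conjExponent) := Real.HolderConjugate.conjExponent hp
  have h1 : czConst A D p ^ (1 / p) ≠ ⊤ :=
    ENNReal.rpow_ne_top_of_nonneg (by have := hpq.pos; positivity) (czConst_ne_top A D p)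
  have h2 : czConst A D p.conjExponent ^ (1 / p.conjExponent) ≠ ⊤ :=
    ENNReal.rpow_ne_top_of_nonneg (by have := hpq.symm.pos; positivity) (czConst_ne_top A D _)
  exact ENNReal.add_ne_top.2 ⟨ENNReal.add_ne_top.2 ⟨by simp, h1⟩, h2⟩

theorem eLpNorm_two_le_iff {F F' : Type*} [NormedAddCommGroup F] [NormedAddCommGroup F']
    {C : ℝ≥0∞} {f : Z → F} {f' : Z → F'} :
    eLpNorm f 2 μ ≤ C * eLpNorm f' 2 μ ↔
      ∫⁻ z, ‖f z‖ₑ ^ 2 ∂μ ≤ C ^ 2 * ∫⁻ z, ‖f' z‖ₑ ^ 2 ∂μ := by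
  have := eLpNorm_le_mul_iff (μ := μ) (p := 2) (by norm_num) (f := f) (f' := f') (C := C)
  simpa using this

/-- The Calderón–Zygmund theorem: `L^2` bounded operators whose kernel and adjoint kernel satisfy
Hörmander's condition are bounded on `L^p`. -/
theorem eLpNorm_kernelOp_le [NormalSpace Z] [R1Space Z] [WeaklyLocallyCompactSpace Z] [μ.Regular]
    {g : DyadicGrid Z μ} {A M : NNReal} {k : Z → Z → ℂ}
    (hk : CZKernel g A M k) (hk' : CZKernel g A M (kernelAdj k))
    (hL2 : ∀ f : Z → H, MemLp f 2 μ → eLpNorm (kernelOp μ k f) 2 μ ≤ A * eLpNorm f 2 μ)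
    {p : ℝ} (hp : 1 < p) {f : Z → H} (hf : MemLp f (ENNReal.ofReal p) μ) :
    eLpNorm (kernelOp μ k f) (ENNReal.ofReal p) μ ≤
      czNorm A g.D p * eLpNorm f (ENNReal.ofReal p) μ := by
  -- Quantified over the kernel because it serves for k itself when p < 2 and for the adjoint when p
  -- > 2.
  have low : ∀ (k : Z → Z → ℂ), CZKernel g A M k →
      (∀ f : Z → H, MemLp f 2 μ → eLpNorm (kernelOp μ k f) 2 μ ≤ A * eLpNorm f 2 μ) →
      ∀ r : ℝ, 1 < r → r < 2 → ∀ f : Z → H, MemLp f (ENNReal.ofReal r) μ →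
      eLpNorm (kernelOp μ k f) (ENNReal.ofReal r) μ ≤
        czConst A g.D r ^ (1 / r) * eLpNorm f (ENNReal.ofReal r) μ := by
    intro k hk h2 r hr hr2 f hf
    have hr0 : 0 < r := by linarith
    refine hk.schur.eLpNorm_le_of_continuous hr
      (ENNReal.rpow_ne_top_of_nonneg (by positivity) (czConst_ne_top _ _ _)) ?_ hf
    intro f hf hfc
    rw [eLpNorm_le_mul_iff hr0, ← ENNReal.rpow_mul, one_div, inv_mul_cancel₀ hr0.ne',
      ENNReal.rpow_one]
    exact lintegral_kernelOp_rpow_le_of_continuous hk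
      (fun f hf => eLpNorm_two_le_iff.1 (h2 f hf)) hr hr2 hf hfc
  rcases lt_trichotomy p 2 with h | h | h
  · refine (low k hk hL2 p hp h f hf).trans ?_
    gcongr
    rw [czNorm, add_assoc, add_left_comm]
    exact le_self_add
  · subst h
    have hf' : MemLp f 2 μ := by simpa using hf
    have := hL2 f hf'
    simp only [ENNReal.ofReal_ofNat]
    refine this.trans ?_
    gcongr
    rw [czNorm, add_assoc]
    exact le_self_add
  · have hpq : p.HolderConjugate (p.conjExponent) := Real.HolderConjugate.conjExponent hp
    -- The L² bound of the adjoint is the self-dual case p = q = 2, using that the adjoint of the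
    -- adjoint is k.
    have h2' : ∀ f : Z → H, MemLp f 2 μ →
        eLpNorm (kernelOp μ (kernelAdj k) f) 2 μ ≤ A * eLpNorm f 2 μ := by
      intro f hf
      have h22 : (2 : ℝ).HolderConjugate 2 := Real.HolderConjugate.two_two
      have := hk.schur.adj.eLpNorm_le_of_adj (p := 2) (q := 2) (by norm_num) h22 (C := A)
        (H := H) (by simpa [kernelAdj_kernelAdj] using hL2) (f := f) (by simpa using hf)
      simpa using this
    have hq2 : p.conjExponent < 2 := by
      rw [Real.conjExponent, div_lt_iff₀ (by linarith)]
      linarith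
    refine (hk.schur.eLpNorm_le_of_adj hp hpq
      (low _ hk' h2' _ hpq.symm.lt hq2) hf).trans ?_
    gcongr
    rw [czNorm]
    exact le_add_self

end CZDual

/-! ### Functions with bounded derivatives up to a given order -/

section SymBd

variable {V : Type} [NormedAddCommGroup V] [NormedSpace ℝ V]
variable {F : Type} [NormedAddCommGroup F] [NormedSpace ℝ F]

/-- `f` is `C^N` on `U` and all its derivatives of order at most `N` are bounded by `A` there. -/
def SymBd (N : ℕ) (U : Set V) (A : ℝ) (f : V → F) : Prop :=
  ContDiffOn ℝ N f U ∧ ∀ n ≤ N, ∀ ξ ∈ U, ‖iteratedFDerivWithin ℝ n f U ξ‖ ≤ A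

variable {N : ℕ} {U : Set V} {A B : ℝ} {f : V → F}

theorem SymBd.norm_le (h : SymBd N U A f) {ξ : V} (hξ : ξ ∈ U) : ‖f ξ‖ ≤ A := by
  simpa using h.2 0 (Nat.zero_le _) ξ hξ

theorem SymBd.mono (h : SymBd N U A f) (hAB : A ≤ B) : SymBd N U B f :=
  ⟨h.1, fun n hn ξ hξ => (h.2 n hn ξ hξ).trans hAB⟩

theorem SymBd.congr {f' : V → F} (h : SymBd N U A f) (hff : EqOn f' f U) : SymBd N U A f' :=
  ⟨h.1.congr hff, fun n hn ξ hξ => by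
    rw [iteratedFDerivWithin_congr hff hξ]; exact h.2 n hn ξ hξ⟩

theorem symBd_zero_iff : SymBd 0 U A f ↔ ContinuousOn f U ∧ ∀ ξ ∈ U, ‖f ξ‖ ≤ A := by
  constructor
  · exact fun h => ⟨h.1.continuousOn, fun ξ hξ => h.norm_le hξ⟩
  · intro h
    refine ⟨by simpa [contDiffOn_zero] using h.1, fun n hn ξ hξ => ?_⟩
    obtain rfl : n = 0 := by omega
    simpa using h.2 ξ hξ

/-- Allows induction on the order through the first derivative, so that exponentials and parameter
integrals need no formula for higher derivatives of compositions. -/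
theorem symBd_succ_iff (hU : IsOpen U) : SymBd (N + 1) U A f ↔
    DifferentiableOn ℝ f U ∧ (∀ ξ ∈ U, ‖f ξ‖ ≤ A) ∧ SymBd N U A (fderivWithin ℝ f U) := by
  constructor
  · intro h
    have h1 := (contDiffOn_succ_iff_fderivWithin (n := N) hU.uniqueDiffOn).1
      (by simpa using h.1)
    refine ⟨h1.1, fun ξ hξ => h.norm_le hξ, h1.2.2, fun n hn ξ hξ => ?_⟩
    rw [norm_iteratedFDerivWithin_fderivWithin hU.uniqueDiffOn hξ]
    exact h.2 _ (by omega) ξ hξ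
  · rintro ⟨h1, h2, h3⟩
    refine ⟨?_, fun n hn ξ hξ => ?_⟩
    · have := (contDiffOn_succ_iff_fderivWithin (n := N) hU.uniqueDiffOn).2
        ⟨h1, by simp, h3.1⟩
      simpa using this
    · rcases n with _ | n
      · simpa using h2 ξ hξ
      · rw [← norm_iteratedFDerivWithin_fderivWithin hU.uniqueDiffOn hξ]
        exact h3.2 n (by omega) ξ hξ

theorem SymBd.smul [NormedSpace ℂ F] [IsScalarTower ℝ ℂ F] (hU : IsOpen U) (hA : 0 ≤ A)
    (hB : 0 ≤ B) {a : V → ℂ} (ha : SymBd N U A a) (hf : SymBd N U B f) :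
    SymBd N U (2 ^ N * A * B) (fun ξ => a ξ • f ξ) := by
  refine ⟨ha.1.smul hf.1, fun n hn ξ hξ => ?_⟩
  refine (norm_iteratedFDerivWithin_smul_le ha.1 hf.1 hU.uniqueDiffOn hξ
    (by exact_mod_cast hn)).trans ?_
  calc ∑ i ∈ Finset.range (n + 1), (n.choose i : ℝ) * ‖iteratedFDerivWithin ℝ i a U ξ‖ *
        ‖iteratedFDerivWithin ℝ (n - i) f U ξ‖
      ≤ ∑ i ∈ Finset.range (n + 1), (n.choose i : ℝ) * A * B := by
        refine Finset.sum_le_sum fun i hi => ?_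
        have hi' : i ≤ n := Finset.mem_range_succ_iff.1 hi
        gcongr
        · exact ha.2 i (hi'.trans hn) ξ hξ
        · exact hf.2 _ (by omega) ξ hξ
    _ = 2 ^ n * A * B := by
        rw [← Finset.sum_mul, ← Finset.sum_mul]
        congr 2
        exact_mod_cast Nat.sum_range_choose n
    _ ≤ _ := by
        gcongr
        norm_num

theorem fderivWithin_cexp (hU : IsOpen U) {Ψ : V → ℂ} (h : DifferentiableOn ℝ Ψ U) {ξ : V}
    (hξ : ξ ∈ U) : fderivWithin ℝ (fun ξ => Complex.exp (Ψ ξ)) U ξ =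
      Complex.exp (Ψ ξ) • fderivWithin ℝ Ψ U ξ :=
  ((h ξ hξ).hasFDerivWithinAt.cexp).fderivWithin (hU.uniqueDiffOn ξ hξ)

/-- Derivatives of an exponential. -/
theorem SymBd.cexp (hU : IsOpen U) {Ψ : V → ℂ} (hB : 0 ≤ B) (h : SymBd N U B Ψ) {ρ : ℝ}
    (hρ : ∀ ξ ∈ U, ‖Complex.exp (Ψ ξ)‖ ≤ ρ) :
    SymBd N U (2 ^ (N ^ 2) * (1 + B) ^ N * ρ) (fun ξ => Complex.exp (Ψ ξ)) := by
  rcases U.eq_empty_or_nonempty with hemp | ⟨ξ₀, hξ₀⟩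
  · subst hemp
    exact ⟨by simp [ContDiffOn], by simp⟩
  have hρ0 : 0 ≤ ρ := (norm_nonneg _).trans (hρ ξ₀ hξ₀)
  induction N with
  | zero =>
    rw [symBd_zero_iff] at h ⊢
    exact ⟨h.1.cexp, by simpa using hρ⟩
  | succ N ih =>
    rw [symBd_succ_iff hU] at h ⊢
    have h' : SymBd N U B Ψ := by
      have h3 := (symBd_succ_iff hU).2 h
      exact ⟨h3.1.of_le (by simp), fun n hn => h3.2 n (by omega)⟩
    -- The derivative is exp Ψ times the derivative of Ψ. Each induction step costs one Leibniz
    -- factor 2^N and one factor B; the exponent N² collects the former.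
    have h2 := (ih h').smul hU (by positivity) hB h.2.2
    have hB1 : (1 : ℝ) ≤ 1 + B := by linarith
    refine ⟨h.1.cexp, fun ξ hξ => (hρ ξ hξ).trans ?_, ?_⟩
    · have : 1 ≤ (2 : ℝ) ^ ((N + 1) ^ 2) * (1 + B) ^ (N + 1) :=
        one_le_mul_of_one_le_of_one_le (one_le_pow₀ (by norm_num)) (one_le_pow₀ hB1)
      nlinarith
    · refine (h2.congr fun ξ hξ => fderivWithin_cexp hU h.1 hξ).mono ?_
      have e : (2 : ℝ) ^ N * 2 ^ (N ^ 2) ≤ 2 ^ ((N + 1) ^ 2) := by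
        rw [← pow_add]
        exact pow_le_pow_right₀ (by norm_num) (by nlinarith)
      calc (2 : ℝ) ^ N * (2 ^ N ^ 2 * (1 + B) ^ N * ρ) * B
          = (2 ^ N * 2 ^ (N ^ 2)) * (1 + B) ^ N * B * ρ := by ring
        _ ≤ 2 ^ ((N + 1) ^ 2) * (1 + B) ^ N * (1 + B) * ρ := by
            gcongr
            linarith
        _ = _ := by ring

/-- The mean value inequality on the left half plane, which is convex and where the derivative of
exp has norm at most 1. -/
theorem norm_cexp_sub_one_le {z : ℂ} (hz : z.re ≤ 0) : ‖Complex.exp z - 1‖ ≤ ‖z‖ := by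
  have hconv : Convex ℝ {z : ℂ | z.re ≤ 0} := convex_halfSpace_re_le 0
  have := hconv.norm_image_sub_le_of_norm_hasDerivWithin_le (𝕜 := ℂ) (f := Complex.exp)
    (f' := Complex.exp) (C := 1) (x := 0) (y := z)
    (fun w _ => (Complex.hasDerivAt_exp w).hasDerivWithinAt)
    (fun w hw => by rw [Complex.norm_exp]; exact Real.exp_le_one_iff.2 hw) (by simp) hz
  simpa using this

/-- Derivatives of `exp Ψ - 1` are small when those of `Ψ` are. -/
theorem SymBd.cexp_sub_one (hU : IsOpen U) {Ψ : V → ℂ} (hB : 0 ≤ B) (h : SymBd (N + 1) U B Ψ)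
    (hre : ∀ ξ ∈ U, (Ψ ξ).re ≤ 0) :
    SymBd (N + 1) U (2 ^ ((N + 1) ^ 2) * (1 + B) ^ N * B) (fun ξ => Complex.exp (Ψ ξ) - 1) := by
  rw [symBd_succ_iff hU] at h ⊢
  have h' : SymBd N U B Ψ := by
    have h3 := (symBd_succ_iff hU).2 h
    exact ⟨h3.1.of_le (by simp), fun n hn => h3.2 n (by omega)⟩
  have h2 := (h'.cexp hU hB (ρ := 1) fun ξ hξ => by
    rw [Complex.norm_exp]; exact Real.exp_le_one_iff.2 (hre ξ hξ)).smul hU (by positivity) hB h.2.2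
  have hB1 : (1 : ℝ) ≤ 1 + B := by linarith
  refine ⟨h.1.cexp.sub_const 1, fun ξ hξ => ?_, ?_⟩
  · refine (norm_cexp_sub_one_le (hre ξ hξ)).trans ((h.2.1 ξ hξ).trans ?_)
    have : 1 ≤ (2 : ℝ) ^ ((N + 1) ^ 2) * (1 + B) ^ N :=
      one_le_mul_of_one_le_of_one_le (one_le_pow₀ (by norm_num)) (one_le_pow₀ hB1)
    nlinarith
  · refine (h2.congr fun ξ hξ => ?_).mono ?_
    · rw [fderivWithin_sub_const]
      exact fderivWithin_cexp hU h.1 hξ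
    · have e : (2 : ℝ) ^ N * 2 ^ (N ^ 2) ≤ 2 ^ ((N + 1) ^ 2) := by
        rw [← pow_add]
        exact pow_le_pow_right₀ (by norm_num) (by nlinarith)
      calc (2 : ℝ) ^ N * (2 ^ N ^ 2 * (1 + B) ^ N * 1) * B
          = (2 ^ N * 2 ^ (N ^ 2)) * (1 + B) ^ N * B := by ring
        _ ≤ _ := by gcongr

theorem SymBd.add (hU : IsOpen U) {f' : V → F} (h : SymBd N U A f) (h' : SymBd N U B f') :
    SymBd N U (A + B) (fun ξ => f ξ + f' ξ) := by
  refine ⟨h.1.add h'.1, fun n hn ξ hξ => ?_⟩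
  have := iteratedFDerivWithin_add_apply (i := n) ((h.1 ξ hξ).of_le (by exact_mod_cast hn))
    ((h'.1 ξ hξ).of_le (by exact_mod_cast hn)) hU.uniqueDiffOn hξ
  rw [show (fun ξ => f ξ + f' ξ) = f + f' from rfl, this]
  exact (norm_add_le _ _).trans (add_le_add (h.2 n hn ξ hξ) (h'.2 n hn ξ hξ))

/-- Measurability of the derivative of a measurable family. -/
theorem aestronglyMeasurable_fderivWithin {T : Type*} [MeasurableSpace T] {ν : Measure T}
    [FiniteDimensional ℝ V] (hU : IsOpen U) {h : T → V → F}
    (hm : ∀ ξ ∈ U, AEStronglyMeasurable (fun r => h r ξ) ν)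
    (hd : ∀ᵐ r ∂ν, DifferentiableOn ℝ (h r) U) {ξ : V} (hξ : ξ ∈ U) :
    AEStronglyMeasurable (fun r => fderivWithin ℝ (h r) U ξ) ν := by
  have hdir : ∀ v : V, AEStronglyMeasurable (fun r => fderivWithin ℝ (h r) U ξ v) ν := by
    intro v
    have hlim : Tendsto (fun n : ℕ => ξ + (1 / ((n : ℝ) + 1)) • v) atTop (𝓝 ξ) := by
      have := tendsto_one_div_add_atTop_nhds_zero_nat (𝕜 := ℝ)
      simpa using tendsto_const_nhds.add (this.smul_const v)
    -- Directional derivatives are limits of measurable difference quotients; the shift by n₀ keeps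
    -- all the points used inside U.
    obtain ⟨n₀, hn₀⟩ := eventually_atTop.1 (hlim.eventually (hU.mem_nhds hξ))
    refine aestronglyMeasurable_of_tendsto_ae atTop
      (f := fun (n : ℕ) r => (((n + n₀ : ℕ) : ℝ) + 1) •
        (h r (ξ + (1 / (((n + n₀ : ℕ) : ℝ) + 1)) • v) - h r ξ)) ?_ ?_
    · intro n
      exact ((hm _ (hn₀ _ (by simp))).sub (hm ξ hξ)).const_smul _
    · filter_upwards [hd] with r hr
      have h1 : HasFDerivAt (h r) (fderivWithin ℝ (h r) U ξ) ξ :=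
        (hr ξ hξ).hasFDerivWithinAt.hasFDerivAt (hU.mem_nhds hξ)
      have h2 := h1.lim v (c := fun n : ℕ => ((n + n₀ : ℕ) : ℝ) + 1) (l := atTop) ?_
      · refine h2.congr fun n => ?_
        simp
      · have h3 : Tendsto (fun n : ℕ => ((n + n₀ : ℕ) : ℝ) + 1) atTop atTop :=
          (tendsto_natCast_atTop_atTop.comp (tendsto_add_atTop_nat n₀)).atTop_add
            tendsto_const_nhds
        exact tendsto_norm_atTop_atTop.comp h3
  -- In finite dimension the whole derivative is a finite combination of its values on a basis.
  let b := Module.finBasis ℝ V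
  have e : ∀ r, fderivWithin ℝ (h r) U ξ = ∑ i, ((b.coord i).toContinuousLinearMap).smulRight
      (fderivWithin ℝ (h r) U ξ (b i)) := by
    intro r
    ext v
    conv_lhs => rw [← b.sum_repr v, map_sum]
    simp
  rw [show (fun r => fderivWithin ℝ (h r) U ξ) = _ from funext e]
  refine Finset.aestronglyMeasurable_fun_sum _ fun i _ => ?_
  exact ((ContinuousLinearMap.smulRightL ℝ V F
    ((b.coord i).toContinuousLinearMap)).continuous).comp_aestronglyMeasurable (hdir (b i))

end SymBd

/-- Parameter integrals of functions with bounded derivatives. -/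
theorem SymBd.integral {V : Type} [NormedAddCommGroup V] [NormedSpace ℝ V]
    [FiniteDimensional ℝ V] {T : Type*} [MeasurableSpace T] {ν : Measure T} [IsFiniteMeasure ν]
    {U : Set V} (hU : IsOpen U) {A : ℝ} (N : ℕ) :
    -- F stays universally quantified in the induction on N, because the hypothesis is applied to
    -- derivatives, whose values lie in `V →L[ℝ] F`.
    ∀ {F : Type} [NormedAddCommGroup F] [NormedSpace ℝ F] [CompleteSpace F] {h : T → V → F},
    (∀ ξ ∈ U, AEStronglyMeasurable (fun r => h r ξ) ν) → (∀ᵐ r ∂ν, SymBd N U A (h r)) →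
    SymBd N U (ν.real univ * A) (fun ξ => ∫ r, h r ξ ∂ν) := by
  induction N with
  | zero =>
    intro F _ _ _ h hm hs
    rw [symBd_zero_iff]
    refine ⟨?_, fun ξ hξ => ?_⟩
    · refine continuousOn_of_dominated hm (bound := fun _ => A)
        (fun ξ hξ => hs.mono fun r hr => hr.norm_le hξ) (integrable_const _)
        (hs.mono fun r hr => hr.1.continuousOn)
    · have := norm_integral_le_of_norm_le_const (hs.mono fun r hr => hr.norm_le hξ)
      rwa [mul_comm] at this
  | succ N ih =>
    intro F _ _ _ h hm hs
    have hs' := hs.mono fun r hr => (symBd_succ_iff hU).1 hr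
    have hm' : ∀ ξ ∈ U, AEStronglyMeasurable (fun r => fderivWithin ℝ (h r) U ξ) ν :=
      fun ξ hξ => aestronglyMeasurable_fderivWithin hU hm (hs'.mono fun r hr => hr.1) hξ
    have hder : ∀ ξ ∈ U, HasFDerivAt (fun ξ => ∫ r, h r ξ ∂ν)
        (∫ r, fderivWithin ℝ (h r) U ξ ∂ν) ξ := by
      intro ξ hξ
      refine hasFDerivAt_integral_of_dominated_of_fderiv_le (bound := fun _ => A)
        (F' := fun ξ r => fderivWithin ℝ (h r) U ξ) (hU.mem_nhds hξ) ?_ ?_ (hm' ξ hξ) ?_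
        (integrable_const _) ?_
      · exact eventually_of_mem (hU.mem_nhds hξ) hm
      · exact Integrable.of_bound (hm ξ hξ) A (hs.mono fun r hr => hr.norm_le hξ)
      · exact hs'.mono fun r hr ξ hξ => hr.2.2.norm_le hξ
      · exact hs'.mono fun r hr ξ hξ =>
          (hr.1 ξ hξ).hasFDerivWithinAt.hasFDerivAt (hU.mem_nhds hξ)
    rw [symBd_succ_iff hU]
    refine ⟨fun ξ hξ => (hder ξ hξ).differentiableAt.differentiableWithinAt, fun ξ hξ => ?_, ?_⟩
    · have := norm_integral_le_of_norm_le_const (hs.mono fun r hr => hr.norm_le hξ)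
      rwa [mul_comm] at this
    · refine (ih hm' (hs'.mono fun r hr => hr.2.2)).congr fun ξ hξ => ?_
      exact (hder ξ hξ).hasFDerivWithinAt.fderivWithin (hU.uniqueDiffOn ξ hξ)

/-! ### Fourier multipliers with dyadic bounds -/

open scoped FourierTransform

section Multiplier

variable {d : ℕ}

/-- An annulus around the unit sphere. -/
def annulus (d : ℕ) : Set (E d) := {ξ | 1 / 4 < ‖ξ‖ ∧ ‖ξ‖ < 4}

theorem isOpen_annulus : IsOpen (annulus d) :=
  (isOpen_lt continuous_const continuous_norm).inter (isOpen_lt continuous_norm continuous_const)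

/-- A smooth cutoff of the unit ball. -/
def ballCut (d : ℕ) : ContDiffBump (0 : E d) := ⟨1, 2, by norm_num, by norm_num⟩

/-- A smooth function on an annulus whose dyadic dilates sum to one. -/
def dyCut (ξ : E d) : ℝ := ballCut d ξ - ballCut d ((2 : ℝ) • ξ)

theorem contDiff_dyCut {n : ℕ∞} : ContDiff ℝ n (dyCut (d := d)) :=
  (ballCut d).contDiff.sub ((ballCut d).contDiff.comp (contDiff_const_smul 2))

theorem ballCut_eq_one {ξ : E d} (h : ‖ξ‖ ≤ 1) : ballCut d ξ = 1 :=
  (ballCut d).one_of_mem_closedBall (by simpa [ballCut] using h)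

theorem ballCut_eq_zero {ξ : E d} (h : 2 ≤ ‖ξ‖) : ballCut d ξ = 0 :=
  (ballCut d).zero_of_le_dist (by simpa [ballCut] using h)

theorem support_dyCut_subset :
    Function.support (dyCut (d := d)) ⊆ {ξ | 1 / 2 ≤ ‖ξ‖ ∧ ‖ξ‖ ≤ 2} := by
  intro ξ hξ
  by_contra h
  apply hξ
  have h2 : ‖(2 : ℝ) • ξ‖ = 2 * ‖ξ‖ := by rw [norm_smul]; simp
  by_cases h1 : ‖ξ‖ < 1 / 2
  · rw [dyCut, ballCut_eq_one (by linarith), ballCut_eq_one (by rw [h2]; linarith), sub_self]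
  · have h3 : 2 < ‖ξ‖ := by
      by_contra h3
      exact h ⟨not_lt.1 h1, not_lt.1 h3⟩
    rw [dyCut, ballCut_eq_zero h3.le, ballCut_eq_zero (by rw [h2]; linarith), sub_self]

theorem tsupport_dyCut_subset : tsupport (dyCut (d := d)) ⊆ {ξ | 1 / 2 ≤ ‖ξ‖ ∧ ‖ξ‖ ≤ 2} :=
  closure_minimal support_dyCut_subset
    ((isClosed_le continuous_const continuous_norm).inter
      (isClosed_le continuous_norm continuous_const))

theorem tsupport_dyCut_subset_annulus : tsupport (dyCut (d := d)) ⊆ annulus d := by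
  intro ξ hξ
  have := tsupport_dyCut_subset hξ
  exact ⟨by linarith [this.1], by linarith [this.2]⟩

theorem hasCompactSupport_dyCut : HasCompactSupport (dyCut (d := d)) := by
  refine HasCompactSupport.of_support_subset_isCompact (isCompact_closedBall 0 2) ?_
  intro ξ hξ
  simpa using (support_dyCut_subset hξ).2

theorem abs_dyCut_le (ξ : E d) : |dyCut ξ| ≤ 1 := by
  have h1 := (ballCut d).nonneg' ξ
  have h2 := (ballCut d).le_one (x := ξ)
  have h3 := (ballCut d).nonneg' ((2 : ℝ) • ξ)
  have h4 := (ballCut d).le_one (x := (2 : ℝ) • ξ)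
  rw [dyCut, abs_le]
  constructor <;> linarith

theorem exists_symBd_dyCut (N : ℕ) :
    ∃ C : ℝ, 0 ≤ C ∧ SymBd N (annulus d) C (fun ξ => (dyCut ξ : ℂ)) := by
  have hc : ContDiff ℝ N (fun ξ : E d => (dyCut ξ : ℂ)) :=
    Complex.ofRealCLM.contDiff.comp (contDiff_dyCut (n := N))
  have hs : HasCompactSupport (fun ξ : E d => (dyCut ξ : ℂ)) :=
    hasCompactSupport_dyCut.comp_left (g := fun x : ℝ => (x : ℂ)) (by simp)
  have hb : ∀ n : ℕ, n ≤ N → ∃ C : ℝ, ∀ ξ : E d,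
      ‖iteratedFDeriv ℝ n (fun ξ : E d => (dyCut ξ : ℂ)) ξ‖ ≤ C := fun n hn =>
    (hc.continuous_iteratedFDeriv (by exact_mod_cast hn)).bounded_above_of_compact_support
      (hs.iteratedFDeriv n)
  choose! C hC using hb
  refine ⟨∑ n ∈ Finset.range (N + 1), |C n|, Finset.sum_nonneg fun _ _ => abs_nonneg _,
    hc.contDiffOn, fun n hn ξ hξ => ?_⟩
  rw [iteratedFDerivWithin_of_isOpen n isOpen_annulus hξ]
  refine ((hC n hn ξ).trans (le_abs_self _)).trans ?_
  exact Finset.single_le_sum (f := fun n => |C n|) (fun _ _ => abs_nonneg _)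
    (Finset.mem_range.2 (by omega))

/-- The localization of a symbol to an annulus, and the decay of its inverse Fourier transform. -/
theorem exists_norm_fourierInv_dyCut_mul_le (d : ℕ) : ∃ C : ℝ, 0 ≤ C ∧ ∀ (A : ℝ) (f : E d → ℂ),
    0 ≤ A → SymBd (d + 2) (annulus d) A f →
    ∫⁻ ξ, ‖(dyCut ξ : ℂ) * f ξ‖ₑ ≤ ENNReal.ofReal (C * A) ∧
    ∀ x, ‖𝓕⁻ (fun ξ => (dyCut ξ : ℂ) * f ξ) x‖ ≤ C * A * (1 + ‖x‖) ^ (-((d : ℝ) + 2)) := by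
  set N := d + 2 with hN
  obtain ⟨Cχ, hCχ, hχ⟩ := exists_symBd_dyCut (d := d) N
  set v : ℝ := (volume (Metric.closedBall (0 : E d) 2)).toReal with hv
  have hv0 : 0 ≤ v := ENNReal.toReal_nonneg
  have hvtop : volume (Metric.closedBall (0 : E d) 2) ≠ ⊤ :=
    (isCompact_closedBall 0 2).measure_lt_top.ne
  refine ⟨2 ^ N * (2 ^ N * (N + 1) * (2 ^ N * Cχ * v)) * 2 + 2 ^ N * Cχ * v, by positivity, ?_⟩
  intro A f hA hf
  set B : ℝ := 2 ^ N * Cχ * A with hB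
  have hB0 : 0 ≤ B := by positivity
  set F : E d → ℂ := fun ξ => (dyCut ξ : ℂ) * f ξ with hF
  have hFs : SymBd N (annulus d) B F := hχ.smul isOpen_annulus hCχ hA hf
  have hsupp : tsupport F ⊆ tsupport (dyCut (d := d)) := by
    refine closure_mono fun ξ hξ => ?_
    intro h
    exact hξ (by simp [hF, h])
  have hFc : ContDiff ℝ N F := by
    rw [contDiff_iff_contDiffAt]
    intro ξ
    by_cases hξ : ξ ∈ annulus d
    · exact hFs.1.contDiffAt (isOpen_annulus.mem_nhds hξ)
    · have h1 : ξ ∉ tsupport F := fun h => hξ (tsupport_dyCut_subset_annulus (hsupp h))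
      exact contDiffAt_const.congr_of_eventuallyEq (notMem_tsupport_iff_eventuallyEq.1 h1)
  have hbd : ∀ n ≤ N, ∀ ξ, ‖iteratedFDeriv ℝ n F ξ‖ ≤
      (Metric.closedBall (0 : E d) 2).indicator (fun _ => B) ξ := by
    intro n hn ξ
    by_cases hξ : ξ ∈ tsupport (dyCut (d := d))
    · have h1 : ξ ∈ Metric.closedBall (0 : E d) 2 := by
        simpa using (tsupport_dyCut_subset hξ).2
      rw [indicator_of_mem h1, ← iteratedFDerivWithin_of_isOpen n isOpen_annulus
        (tsupport_dyCut_subset_annulus hξ)]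
      exact hFs.2 n hn ξ (tsupport_dyCut_subset_annulus hξ)
    · have h1 : iteratedFDeriv ℝ n F ξ = 0 := by
        by_contra h
        exact hξ (hsupp (support_iteratedFDeriv_subset n h))
      rw [h1, norm_zero]
      exact indicator_nonneg (fun _ _ => hB0) _
  have hint : Integrable ((Metric.closedBall (0 : E d) 2).indicator (fun _ => B)) :=
    (integrable_indicator_iff measurableSet_closedBall).2 (integrableOn_const hvtop)
  have hintv : ∫ ξ, (Metric.closedBall (0 : E d) 2).indicator (fun _ => B) ξ = v * B := by
    rw [integral_indicator measurableSet_closedBall, setIntegral_const]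
    rfl
  have hFint : ∀ n ≤ N, Integrable (iteratedFDeriv ℝ n F) := fun n hn =>
    hint.mono' (hFc.continuous_iteratedFDeriv
      (by exact_mod_cast hn)).aestronglyMeasurable (Eventually.of_forall (hbd n hn))
  have hle : ∀ n ≤ N, ∫ ξ, ‖iteratedFDeriv ℝ n F ξ‖ ≤ v * B := fun n hn => by
    rw [← hintv]
    exact integral_mono (hFint n hn).norm hint (hbd n hn)
  -- Derivatives of F turn into powers of w on the Fourier side; their L¹ norms are bounded since F
  -- is supported in a fixed ball.
  have hpow : ∀ n ≤ N, ∀ w : E d, ‖w‖ ^ n * ‖𝓕 F w‖ ≤ 2 ^ N * (N + 1) * (v * B) := by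
    intro n hn w
    have h1 := Real.pow_mul_norm_iteratedFDeriv_fourier_le (K := 0) (N := (N : ℕ∞)) (f := F)
      (by exact_mod_cast hFc) (fun k n hk hn => by
        obtain rfl : k = 0 := by simpa using hk
        simpa using (hFint n (by exact_mod_cast hn)).norm) (k := 0) (n := n) le_rfl
        (by exact_mod_cast hn) w
    simp only [norm_iteratedFDeriv_zero, pow_zero, one_mul, Nat.cast_zero, mul_zero, zero_add,
      Finset.range_one, Finset.singleton_product, Finset.sum_map, Function.Embedding.coeFn_mk] at h1
    refine h1.trans ?_
    calc (2 : ℝ) ^ n * ∑ q ∈ Finset.range (n + 1), ∫ ξ, ‖iteratedFDeriv ℝ q F ξ‖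
        ≤ 2 ^ n * ∑ q ∈ Finset.range (n + 1), v * B := by
          gcongr with q hq
          exact hle q ((Finset.mem_range_succ_iff.1 hq).trans hn)
      _ = 2 ^ n * (n + 1) * (v * B) := by
          rw [Finset.sum_const, Finset.card_range, nsmul_eq_mul]; push_cast; ring
      _ ≤ _ := by
          gcongr
          norm_num
  constructor
  · have h0 := hle 0 (Nat.zero_le _)
    simp only [norm_iteratedFDeriv_zero] at h0
    have hi0 : Integrable F := by
      refine hint.mono' hFc.continuous.aestronglyMeasurable (Eventually.of_forall fun ξ => ?_)
      simpa using hbd 0 (Nat.zero_le _) ξ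
    rw [← ofReal_integral_norm_eq_lintegral_enorm hi0]
    apply ENNReal.ofReal_le_ofReal
    refine h0.trans ?_
    rw [hB, add_mul]
    have : 0 ≤ 2 ^ N * (2 ^ N * ((N : ℝ) + 1) * (2 ^ N * Cχ * v)) * 2 * A := by positivity
    linarith
  · intro x
    rw [Real.fourierInv_eq_fourier_neg]
    have h0 := hpow 0 (Nat.zero_le _) (-x)
    have h1 := hpow N le_rfl (-x)
    rw [norm_neg] at h0 h1
    have hx1 : 0 < 1 + ‖x‖ := by positivity
    -- The extreme powers 0 and N suffice to produce the full weight.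
    have hx2 : (1 + ‖x‖) ^ N ≤ 2 ^ N * (1 + ‖x‖ ^ N) := by
      rcases le_total ‖x‖ 1 with h | h
      · calc (1 + ‖x‖) ^ N ≤ 2 ^ N := by gcongr; linarith
          _ ≤ _ := le_mul_of_one_le_right (by positivity) (by simp)
      · calc (1 + ‖x‖) ^ N ≤ (2 * ‖x‖) ^ N := by gcongr; linarith
          _ = 2 ^ N * ‖x‖ ^ N := mul_pow _ _ _
          _ ≤ _ := by gcongr; simp
    have hrp : (1 + ‖x‖) ^ (-((d : ℝ) + 2)) = ((1 + ‖x‖) ^ N)⁻¹ := by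
      rw [Real.rpow_neg hx1.le, ← Real.rpow_natCast, hN]
      push_cast; rfl
    rw [hrp, ← div_eq_mul_inv, le_div_iff₀ (by positivity)]
    calc ‖𝓕 F (-x)‖ * (1 + ‖x‖) ^ N ≤ ‖𝓕 F (-x)‖ * (2 ^ N * (1 + ‖x‖ ^ N)) := by gcongr
      _ = 2 ^ N * (‖x‖ ^ 0 * ‖𝓕 F (-x)‖ + ‖x‖ ^ N * ‖𝓕 F (-x)‖) := by ring
      _ ≤ 2 ^ N * (2 ^ N * (N + 1) * (v * B) + 2 ^ N * (N + 1) * (v * B)) := by gcongr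
      _ = 2 ^ N * (2 ^ N * (N + 1) * (2 ^ N * Cχ * v)) * 2 * A := by rw [hB]; ring
      _ ≤ _ := by
        rw [add_mul]
        exact le_add_of_nonneg_right (by positivity)

/-- The weight ‖x‖^η is at most 1 + ‖x‖ and takes one power from the decay of order d+2. What is
left, of order d+1, is still integrable on ℝ^d. -/
theorem exists_lintegral_fourierInv_dyCut_mul_le (d : ℕ) : ∃ C : ℝ, 0 ≤ C ∧
    ∀ (A : ℝ) (f : E d → ℂ), 0 ≤ A → SymBd (d + 2) (annulus d) A f →
    ∫⁻ ξ, ‖(dyCut ξ : ℂ) * f ξ‖ₑ ≤ ENNReal.ofReal (C * A) ∧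
    ∀ η : ℝ, 0 ≤ η → η ≤ 1 →
    ∫⁻ x, ‖𝓕⁻ (fun ξ => (dyCut ξ : ℂ) * f ξ) x‖ₑ * ENNReal.ofReal (‖x‖ ^ η) ≤
      ENNReal.ofReal (C * A) := by
  obtain ⟨C, hC, h⟩ := exists_norm_fourierInv_dyCut_mul_le d
  have hint : Integrable (fun x : E d => (1 + ‖x‖) ^ (-((d : ℝ) + 1))) :=
    integrable_one_add_norm (by simp)
  set W := ∫ x : E d, (1 + ‖x‖) ^ (-((d : ℝ) + 1)) with hW
  have hW0 : 0 ≤ W := integral_nonneg fun x => by positivity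
  refine ⟨C * (1 + W), by positivity, fun A f hA hf => ⟨(h A f hA hf).1.trans ?_, ?_⟩⟩
  · apply ENNReal.ofReal_le_ofReal
    gcongr
    nlinarith
  intro η hη0 hη1
  have hpt : ∀ x : E d, ‖𝓕⁻ (fun ξ => (dyCut ξ : ℂ) * f ξ) x‖ₑ * ENNReal.ofReal (‖x‖ ^ η) ≤
      ENNReal.ofReal (C * A) * ENNReal.ofReal ((1 + ‖x‖) ^ (-((d : ℝ) + 1))) := by
    intro x
    rw [← ofReal_norm, ← ENNReal.ofReal_mul (by positivity), ← ENNReal.ofReal_mul (by positivity)]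
    apply ENNReal.ofReal_le_ofReal
    have hx1 : 0 < 1 + ‖x‖ := by positivity
    have h1 : ‖x‖ ^ η ≤ (1 + ‖x‖) ^ (1 : ℝ) :=
      (Real.rpow_le_rpow (norm_nonneg _) (by simp) hη0).trans
        (Real.rpow_le_rpow_of_exponent_le (by simp) hη1)
    calc _ ≤ (C * A * (1 + ‖x‖) ^ (-((d : ℝ) + 2))) * (1 + ‖x‖) ^ (1 : ℝ) := by
          gcongr
          exact (h A f hA hf).2 x
      _ = C * A * ((1 + ‖x‖) ^ (-((d : ℝ) + 2)) * (1 + ‖x‖) ^ (1 : ℝ)) := by ring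
      _ = _ := by
          rw [← Real.rpow_add hx1]
          congr 2; ring
  calc _ ≤ ∫⁻ x : E d, ENNReal.ofReal (C * A) * ENNReal.ofReal ((1 + ‖x‖) ^ (-((d : ℝ) + 1))) :=
        lintegral_mono hpt
    _ = ENNReal.ofReal (C * A) * ENNReal.ofReal W := by
        rw [lintegral_const_mul' _ _ (by simp), hW, ofReal_integral_eq_lintegral_ofReal hint
          (Eventually.of_forall fun x => by positivity)]
    _ ≤ _ := by
        rw [← ENNReal.ofReal_mul (by positivity)]
        apply ENNReal.ofReal_le_ofReal
        have : 0 ≤ C * A := by positivity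
        nlinarith

theorem lintegral_comp_smul_pos (f : E d → ℝ≥0∞) {R : ℝ} (hR : 0 < R) :
    ∫⁻ x, f (R • x) = ENNReal.ofReal ((R ^ d)⁻¹) * ∫⁻ x, f x := by
  have h := lintegral_map_equiv (μ := volume) f
    ((Homeomorph.smulOfNeZero R hR.ne').toMeasurableEquiv : E d ≃ᵐ E d)
  have h2 := Measure.map_addHaar_smul (volume : Measure (E d)) hR.ne'
  have e : ⇑((Homeomorph.smulOfNeZero R hR.ne').toMeasurableEquiv : E d ≃ᵐ E d) =
    fun x => R • x := rfl
  rw [e] at h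
  rw [← h, show Measure.map (fun x : E d => R • x) volume = _ from h2, lintegral_smul_measure,
    abs_of_pos (by positivity)]
  simp

theorem fourierInv_comp_inv_smul (F : E d → ℂ) {R : ℝ} (hR : 0 < R) (x : E d) :
    𝓕⁻ (fun ξ => F (R⁻¹ • ξ)) x = ((R ^ d : ℝ) : ℂ) * 𝓕⁻ F (R • x) := by
  rw [Real.fourierInv_eq', Real.fourierInv_eq']
  have h := Measure.integral_comp_inv_smul_of_nonneg (volume : Measure (E d))
    (fun ξ => Complex.exp ((2 * Real.pi * ⟪ξ, R • x⟫ : ℝ) * Complex.I) • F ξ) hR.le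
  rw [finrank_euclideanSpace_fin] at h
  rw [← Complex.real_smul, ← h]
  congr with ξ
  rw [inner_smul_left, inner_smul_right]
  simp only [conj_trivial]
  rw [inv_mul_cancel_left₀ hR.ne']

/-- Multipliers with dyadic bounds are integrable, and their kernels have integrable moments. -/
theorem exists_multiplier_bound (hd : 0 < d) : ∃ C : ℝ, 0 ≤ C ∧ ∀ (A : ℤ → ℝ) (m : E d → ℂ),
    AEStronglyMeasurable m volume → (∀ k, 0 ≤ A k) →
    (∀ k : ℤ, SymBd (d + 2) (annulus d) (A k) (fun ξ => m (((2 : ℝ) ^ k) • ξ))) →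
    ∀ S₀ : ℝ, (∀ s : Finset ℤ, ∑ k ∈ s, ((2 : ℝ) ^ k) ^ d * A k ≤ S₀) →
    Integrable m ∧ ∀ η S : ℝ, 0 ≤ η → η ≤ 1 →
      (∀ s : Finset ℤ, ∑ k ∈ s, ((2 : ℝ) ^ k) ^ (-η) * A k ≤ S) →
      ∫⁻ x, ‖𝓕⁻ m x‖ₑ * ENNReal.ofReal (‖x‖ ^ η) ≤ ENNReal.ofReal (C * S) := by
  obtain ⟨C, hC, h⟩ := exists_lintegral_fourierInv_dyCut_mul_le d
  refine ⟨C, hC, fun A m hm hA hs S₀ hS₀ => ?_⟩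
  -- The Littlewood–Paley pieces of m. Each is the dilate by 2^k of a function localized to one
  -- fixed annulus.
  set c : ℤ → E d → ℂ := fun k ξ => (dyCut (((2 : ℝ) ^ k)⁻¹ • ξ) : ℂ) * m ξ with hc
  have hcs : ∀ k ξ, c k ξ = (fun ζ => (dyCut ζ : ℂ) * m (((2 : ℝ) ^ k) • ζ))
      (((2 : ℝ) ^ k)⁻¹ • ξ) := by
    intro k ξ
    simp only [hc]
    rw [smul_inv_smul₀ (by positivity)]
  set P : ℕ → E d → ℂ := fun M ξ => ∑ j ∈ Finset.range (2 * M), c ((j : ℤ) - M) ξ with hP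
  -- The cutoffs telescope to a difference of two ball cutoffs. Hence the partial sums are dominated
  -- by m and eventually equal it at each ξ ≠ 0.
  have htel : ∀ M : ℕ, ∀ ξ, P M ξ =
      ((ballCut d (((2 : ℝ) ^ (1 - (M : ℤ))) • ξ) -
        ballCut d (((2 : ℝ) ^ (1 + (M : ℤ))) • ξ) : ℝ) : ℂ) * m ξ := by
    intro M ξ
    have e : ∀ j : ℕ, dyCut (((2 : ℝ) ^ ((j : ℤ) - M))⁻¹ • ξ) =
        ballCut d (((2 : ℝ) ^ (1 - (((j + 1 : ℕ) : ℤ) - M))) • ξ) -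
        ballCut d (((2 : ℝ) ^ (1 - ((j : ℤ) - M))) • ξ) := by
      intro j
      rw [dyCut, smul_smul, ← zpow_neg, ← zpow_one_add₀ (by norm_num)]
      congr 4 <;> (push_cast; ring_nf)
    simp only [hP, hc]
    rw [← Finset.sum_mul, ← Complex.ofReal_sum]
    congr 2
    rw [Finset.sum_congr rfl fun j _ => e j, Finset.sum_range_sub
      (fun j : ℕ => ballCut d (((2 : ℝ) ^ (1 - ((j : ℤ) - M))) • ξ))]
    congr 4 <;> (push_cast; ring_nf)
  have hPle : ∀ M : ℕ, ∀ ξ, ‖P M ξ‖ ≤ ‖m ξ‖ := by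
    intro M ξ
    rw [htel, norm_mul, Complex.norm_real, Real.norm_eq_abs]
    refine mul_le_of_le_one_left (norm_nonneg _) ?_
    rw [abs_le]
    constructor <;> linarith [(ballCut d).nonneg' (((2 : ℝ) ^ (1 - (M : ℤ))) • ξ),
      (ballCut d).le_one (x := ((2 : ℝ) ^ (1 - (M : ℤ))) • ξ),
      (ballCut d).nonneg' (((2 : ℝ) ^ (1 + (M : ℤ))) • ξ),
      (ballCut d).le_one (x := ((2 : ℝ) ^ (1 + (M : ℤ))) • ξ)]
  have hPlim : ∀ ξ : E d, ξ ≠ 0 → ∀ᶠ M in atTop, P M ξ = m ξ := by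
    intro ξ hξ
    have hξ0 : 0 < ‖ξ‖ := norm_pos_iff.2 hξ
    obtain ⟨M₁, hM₁⟩ := pow_unbounded_of_one_lt (2 * ‖ξ‖) (one_lt_two : (1 : ℝ) < 2)
    obtain ⟨M₂, hM₂⟩ := pow_unbounded_of_one_lt (‖ξ‖⁻¹) (one_lt_two : (1 : ℝ) < 2)
    filter_upwards [eventually_ge_atTop M₁, eventually_ge_atTop M₂] with M h1 h2
    have h1' : 2 * ‖ξ‖ ≤ 2 ^ M := hM₁.le.trans (pow_le_pow_right₀ (by norm_num) h1)
    have h2' : ‖ξ‖⁻¹ ≤ 2 ^ M := hM₂.le.trans (pow_le_pow_right₀ (by norm_num) h2)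
    rw [htel, ballCut_eq_one, ballCut_eq_zero]
    · simp
    · rw [norm_smul, Real.norm_of_nonneg (by positivity), zpow_add₀ (by norm_num), zpow_one,
        zpow_natCast, mul_assoc]
      have := mul_le_mul_of_nonneg_right h2' hξ0.le
      rw [inv_mul_cancel₀ hξ0.ne'] at this
      linarith
    · rw [norm_smul, Real.norm_of_nonneg (by positivity), zpow_sub₀ (by norm_num), zpow_one,
        zpow_natCast, div_mul_eq_mul_div, div_le_one (by positivity)]
      exact h1'
  have hae : ∀ᵐ ξ : E d, Tendsto (fun M => P M ξ) atTop (𝓝 (m ξ)) := by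
    have : Nontrivial (E d) := by
      have : Nonempty (Fin d) := ⟨⟨0, hd⟩⟩
      infer_instance
    filter_upwards [compl_mem_ae_iff.2 (measure_singleton (0 : E d))] with ξ hξ
    exact tendsto_const_nhds.congr' ((hPlim ξ hξ).mono fun M hM => hM.symm)
  have hcm : ∀ k, AEStronglyMeasurable (c k) := fun k => by
    have : Continuous fun ξ : E d => (dyCut (((2 : ℝ) ^ k)⁻¹ • ξ) : ℂ) :=
      Complex.continuous_ofReal.comp
        ((contDiff_dyCut (n := 0)).continuous.comp (continuous_const_smul _))
    exact this.aestronglyMeasurable.mul hm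
  have hPm : ∀ M, AEStronglyMeasurable (P M) := fun M =>
    Finset.aestronglyMeasurable_fun_sum _ fun j _ => hcm _
  have hsum : ∀ (M : ℕ) (u : ℤ → ℝ), ∑ j ∈ Finset.range (2 * M), u ((j : ℤ) - M) =
      ∑ k ∈ (Finset.range (2 * M)).image (fun j : ℕ => (j : ℤ) - M), u k := by
    intro M u
    rw [Finset.sum_image]
    intro a _ b _ hab
    simp only at hab
    omega
  have hliminf : ∀ (u : ℕ → ℝ≥0∞) (b : ℝ≥0∞), (∀ n, u n ≤ b) → liminf u atTop ≤ b := by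
    intro u b hub
    exact (liminf_le_liminf (Eventually.of_forall hub)).trans (by simp)
  have hint : Integrable m := by
    refine ⟨hm, lt_of_le_of_lt (b := ENNReal.ofReal (C * S₀)) ?_ (by simp)⟩
    have hck : ∀ k, ∫⁻ ξ, ‖c k ξ‖ₑ ≤ ENNReal.ofReal (C * (((2 : ℝ) ^ k) ^ d * A k)) := by
      intro k
      have h2 : (0 : ℝ) < 2 ^ k := by positivity
      simp only [hcs k]
      rw [lintegral_comp_smul_pos (fun ζ => ‖(dyCut ζ : ℂ) * m (((2 : ℝ) ^ k) • ζ)‖ₑ)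
        (inv_pos.2 h2), inv_pow, inv_inv]
      calc _ ≤ ENNReal.ofReal (((2 : ℝ) ^ k) ^ d) * ENNReal.ofReal (C * A k) := by
            gcongr
            exact (h (A k) _ (hA k) (hs k)).1
        _ = _ := by
            rw [← ENNReal.ofReal_mul (by positivity)]
            congr 1; ring
    -- Fatou's lemma passes a bound uniform in M to the limit; the moments below are treated in the
    -- same way.
    calc ∫⁻ ξ, ‖m ξ‖ₑ = ∫⁻ ξ, liminf (fun M => ‖P M ξ‖ₑ) atTop := by
          apply lintegral_congr_ae
          filter_upwards [hae] with ξ hξ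
          exact (hξ.enorm.liminf_eq).symm
      _ ≤ liminf (fun M => ∫⁻ ξ, ‖P M ξ‖ₑ) atTop := lintegral_liminf_le' fun M => (hPm M).enorm
      _ ≤ ENNReal.ofReal (C * S₀) := by
          refine hliminf _ _ fun M => ?_
          calc ∫⁻ ξ, ‖P M ξ‖ₑ ≤ ∫⁻ ξ, ∑ j ∈ Finset.range (2 * M), ‖c ((j : ℤ) - M) ξ‖ₑ :=
                lintegral_mono fun ξ => enorm_sum_le _ _
            _ = ∑ j ∈ Finset.range (2 * M), ∫⁻ ξ, ‖c ((j : ℤ) - M) ξ‖ₑ :=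
                lintegral_finsetSum' _ fun j _ => (hcm _).enorm
            _ ≤ ∑ j ∈ Finset.range (2 * M),
                  ENNReal.ofReal (C * (((2 : ℝ) ^ ((j : ℤ) - M)) ^ d * A ((j : ℤ) - M))) :=
                Finset.sum_le_sum fun j _ => hck _
            _ = ENNReal.ofReal (∑ j ∈ Finset.range (2 * M),
                  C * (((2 : ℝ) ^ ((j : ℤ) - M)) ^ d * A ((j : ℤ) - M))) := by
                rw [ENNReal.ofReal_sum_of_nonneg]
                intro j _
                have := hA ((j : ℤ) - M)
                positivity
            _ ≤ _ := by
                apply ENNReal.ofReal_le_ofReal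
                rw [← Finset.mul_sum, hsum M fun k => ((2 : ℝ) ^ k) ^ d * A k]
                gcongr
                exact hS₀ _
  refine ⟨hint, fun η S hη0 hη1 hS => ?_⟩
  have hcint : ∀ k, Integrable (c k) := fun k =>
    hint.norm.mono' (hcm k) (Eventually.of_forall fun ξ => by
      simp only [hc]
      rw [norm_mul, Complex.norm_real, Real.norm_eq_abs]
      exact mul_le_of_le_one_left (norm_nonneg _) (abs_dyCut_le _))
  have hchar : ∀ x ξ : E d, ‖Complex.exp (((2 * Real.pi * ⟪ξ, x⟫ : ℝ) : ℂ) * Complex.I)‖ = 1 :=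
    fun x ξ => Complex.norm_exp_ofReal_mul_I _
  have hcharc : ∀ x : E d, Continuous fun ξ : E d =>
      Complex.exp (((2 * Real.pi * ⟪ξ, x⟫ : ℝ) : ℂ) * Complex.I) := fun x => by fun_prop
  have hFP : ∀ M x, 𝓕⁻ (P M) x = ∑ j ∈ Finset.range (2 * M), 𝓕⁻ (c ((j : ℤ) - M)) x := by
    intro M x
    simp only [Real.fourierInv_eq']
    rw [← integral_finsetSum]
    · simp only [hP, Finset.smul_sum]
    · intro j _
      exact (hcint _).bdd_smul 1 (hcharc x).aestronglyMeasurable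
        (Eventually.of_forall fun ξ => (hchar x ξ).le)
  have hFlim : ∀ x, Tendsto (fun M => 𝓕⁻ (P M) x) atTop (𝓝 (𝓕⁻ m x)) := by
    intro x
    simp only [Real.fourierInv_eq']
    refine tendsto_integral_of_dominated_convergence (fun ξ => ‖m ξ‖)
      (fun M => (hcharc x).aestronglyMeasurable.smul (hPm M)) hint.norm ?_ ?_
    · intro M
      refine Eventually.of_forall fun ξ => ?_
      rw [norm_smul, hchar, one_mul]
      exact hPle M ξ
    · filter_upwards [hae] with ξ hξ
      exact hξ.const_smul _
  have hFcm : ∀ k, Continuous (𝓕⁻ (c k)) := fun k => by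
    have h1 : Continuous (𝓕 (c k)) :=
      VectorFourier.fourierIntegral_continuous Real.continuous_fourierChar
        (L := innerₗ (E d)) continuous_inner (hcint k)
    have h2 : 𝓕⁻ (c k) = fun x => 𝓕 (c k) (-x) := by
      ext x; exact Real.fourierInv_eq_fourier_neg _ _
    rw [h2]
    exact h1.comp continuous_neg
  have hwm : Measurable fun x : E d => ENNReal.ofReal (‖x‖ ^ η) :=
    (measurable_norm.pow_const _).ennreal_ofReal
  have hck : ∀ k, ∫⁻ x, ‖𝓕⁻ (c k) x‖ₑ * ENNReal.ofReal (‖x‖ ^ η) ≤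
      ENNReal.ofReal (C * (((2 : ℝ) ^ k) ^ (-η) * A k)) := by
    intro k
    have h2 : (0 : ℝ) < 2 ^ k := by positivity
    set R : ℝ := 2 ^ k with hR
    set F : E d → ℂ := fun ζ => (dyCut ζ : ℂ) * m (R • ζ) with hF
    -- Dilation by R preserves the L¹ norm of the kernel of the piece and turns the moment of order
    -- η into R^{-η} times that at unit scale.
    have e1 : ∀ x, ‖𝓕⁻ (c k) x‖ₑ * ENNReal.ofReal (‖x‖ ^ η) =
        ENNReal.ofReal (R ^ d * R ^ (-η)) *
          (‖𝓕⁻ F (R • x)‖ₑ * ENNReal.ofReal (‖R • x‖ ^ η)) := by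
      intro x
      rw [show c k = fun ξ => F (R⁻¹ • ξ) from funext (hcs k), fourierInv_comp_inv_smul F h2]
      simp only [← ofReal_norm]
      rw [← ENNReal.ofReal_mul (by positivity), ← ENNReal.ofReal_mul (by positivity),
        ← ENNReal.ofReal_mul (by positivity)]
      congr 1
      rw [norm_mul, Complex.norm_real, Real.norm_of_nonneg (by positivity), norm_smul,
        Real.norm_of_nonneg h2.le, Real.mul_rpow h2.le (norm_nonneg _)]
      have : R ^ (-η) * R ^ η = 1 := by rw [← Real.rpow_add h2]; simp
      linear_combination (-(R ^ d * ‖𝓕⁻ F (R • x)‖ * ‖x‖ ^ η)) * this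
    simp only [e1]
    rw [lintegral_const_mul' _ _ (by simp),
      lintegral_comp_smul_pos (fun y => ‖𝓕⁻ F y‖ₑ * ENNReal.ofReal (‖y‖ ^ η)) h2]
    calc _ ≤ ENNReal.ofReal (R ^ d * R ^ (-η)) *
          (ENNReal.ofReal ((R ^ d)⁻¹) * ENNReal.ofReal (C * A k)) := by
          gcongr
          exact (h (A k) _ (hA k) (hs k)).2 η hη0 hη1
      _ = _ := by
          rw [← ENNReal.ofReal_mul (by positivity), ← ENNReal.ofReal_mul (by positivity)]
          congr 1
          field_simp
  calc ∫⁻ x, ‖𝓕⁻ m x‖ₑ * ENNReal.ofReal (‖x‖ ^ η)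
      = ∫⁻ x, liminf (fun M => ‖𝓕⁻ (P M) x‖ₑ * ENNReal.ofReal (‖x‖ ^ η)) atTop := by
        congr with x
        exact ((ENNReal.Tendsto.mul_const (hFlim x).enorm (Or.inr (by simp))).liminf_eq).symm
    _ ≤ liminf (fun M => ∫⁻ x, ‖𝓕⁻ (P M) x‖ₑ * ENNReal.ofReal (‖x‖ ^ η)) atTop := by
        apply lintegral_liminf_le
        intro M
        refine Measurable.mul ?_ hwm
        rw [show 𝓕⁻ (P M) = _ from funext (hFP M)]
        exact (continuous_finsetSum _ fun j _ => hFcm _).enorm.measurable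
    _ ≤ ENNReal.ofReal (C * S) := by
        refine hliminf _ _ fun M => ?_
        calc ∫⁻ x, ‖𝓕⁻ (P M) x‖ₑ * ENNReal.ofReal (‖x‖ ^ η)
            ≤ ∫⁻ x, ∑ j ∈ Finset.range (2 * M),
                ‖𝓕⁻ (c ((j : ℤ) - M)) x‖ₑ * ENNReal.ofReal (‖x‖ ^ η) := by
              apply lintegral_mono
              intro x
              simp only
              rw [hFP, ← Finset.sum_mul]
              gcongr
              exact enorm_sum_le _ _
          _ = ∑ j ∈ Finset.range (2 * M),
                ∫⁻ x, ‖𝓕⁻ (c ((j : ℤ) - M)) x‖ₑ * ENNReal.ofReal (‖x‖ ^ η) :=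
              lintegral_finsetSum _ fun j _ => (hFcm _).enorm.measurable.mul hwm
          _ ≤ ∑ j ∈ Finset.range (2 * M),
                ENNReal.ofReal (C * (((2 : ℝ) ^ ((j : ℤ) - M)) ^ (-η) * A ((j : ℤ) - M))) :=
              Finset.sum_le_sum fun j _ => hck _
          _ = ENNReal.ofReal (∑ j ∈ Finset.range (2 * M),
                C * (((2 : ℝ) ^ ((j : ℤ) - M)) ^ (-η) * A ((j : ℤ) - M))) := by
              rw [ENNReal.ofReal_sum_of_nonneg]
              intro j _
              have := hA ((j : ℤ) - M)
              positivity
          _ ≤ _ := by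
              apply ENNReal.ofReal_le_ofReal
              rw [← Finset.mul_sum, hsum M fun k => ((2 : ℝ) ^ k) ^ (-η) * A k]
              gcongr
              exact hS _

end Multiplier

/-! ### Symbols on dyadic annuli -/

section Symbols

variable {d : ℕ}

/-- A multilinear form on Euclidean space is controlled by its values on the standard basis. -/
theorem norm_multilinear_le_of_basis {n : ℕ} (M : ContinuousMultilinearMap ℝ (fun _ : Fin n => E d) ℂ)
    {b : ℝ} (hb : 0 ≤ b)
    (h : ∀ i : Fin n → Fin d, ‖M (fun j => EuclideanSpace.single (i j) (1 : ℝ))‖ ≤ b) :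
    ‖M‖ ≤ (d : ℝ) ^ n * b := by
  refine M.opNorm_le_bound (by positivity) fun v => ?_
  have hv : v = fun j => ∑ i : Fin d, v j i • EuclideanSpace.single i (1 : ℝ) := by
    ext j i
    simp [Pi.single_apply]
  conv_lhs => rw [hv]
  rw [M.map_sum]
  calc ‖∑ r : Fin n → Fin d, M fun j => v j (r j) • EuclideanSpace.single (r j) (1 : ℝ)‖
      ≤ ∑ r : Fin n → Fin d, ‖M fun j => v j (r j) • EuclideanSpace.single (r j) (1 : ℝ)‖ :=
        norm_sum_le _ _
    _ ≤ ∑ r : Fin n → Fin d, b * ∏ j, ‖v j‖ := by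
        refine Finset.sum_le_sum fun r _ => ?_
        rw [M.map_smul_univ, norm_smul, mul_comm, norm_prod]
        gcongr with j
        · exact h r
        · exact PiLp.norm_apply_le (v j) (r j)
    _ = _ := by
        rw [Finset.sum_const, Finset.card_univ, Fintype.card_fun, Fintype.card_fin,
          Fintype.card_fin, nsmul_eq_mul]
        push_cast; ring

/-- The derivative bounds are only assumed off the coordinate hyperplanes; density and continuity
extend them to every ξ ≠ 0. -/
theorem offHyperplanes_dense : Dense (offHyperplanes d) := by
  have h : Dense (⋂ i : Fin d, {ξ : E d | ξ i ≠ 0}) := by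
    refine dense_iInter_of_isOpen (fun i => ?_) fun i => ?_
    · exact isOpen_ne_fun (by fun_prop) continuous_const
    · intro ξ
      rw [mem_closure_iff_seq_limit]
      by_cases hξ : ξ i = 0
      · refine ⟨fun n : ℕ => ξ + (1 / ((n : ℝ) + 1)) • EuclideanSpace.single i 1, fun n => ?_, ?_⟩
        · have : (0 : ℝ) < 1 / ((n : ℝ) + 1) := by positivity
          simp [hξ]
          positivity
        · have := tendsto_one_div_add_atTop_nhds_zero_nat (𝕜 := ℝ)
          simpa using tendsto_const_nhds.add (this.smul_const (EuclideanSpace.single i (1 : ℝ)))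
      · exact ⟨fun _ => ξ, fun _ => hξ, tendsto_const_nhds⟩
  convert h using 1
  ext ξ
  simp [offHyperplanes]

/-- The constant lost in passing from partial derivatives to Fréchet derivatives on annuli. -/
def symConst (d : ℕ) (γ : ℝ) : ℝ := (d : ℝ) ^ (d + 2) * 4 ^ (γ + (d + 2))

/-- Rescaled symbols on a fixed annulus. -/
theorem symBd_of_partialsBounded (hd : 0 < d) {N : ℕ} (hN : d + 2 ≤ N) {γ μ : ℝ} (hγ : 0 < γ)
    (hμ : 0 ≤ μ)
    {m : E d → ℂ} (hm : ContDiffOn ℝ N m {0}ᶜ)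
    (hb : PartialsBounded N γ μ (offHyperplanes d) m) {R : ℝ} (hR : 0 < R) :
    SymBd (d + 2) (annulus d) (symConst d γ * μ * R ^ γ) (fun ξ => m (R • ξ)) := by
  have hopen : IsOpen ({0}ᶜ : Set (E d)) := isOpen_compl_singleton
  have hd1 : (1 : ℝ) ≤ d := by exact_mod_cast hd
  have hall : ∀ n ≤ N, ∀ i : Fin n → Fin d, ∀ ξ : E d, ξ ≠ 0 →
      ‖iteratedFDeriv ℝ n m ξ (fun j => EuclideanSpace.single (i j) (1 : ℝ))‖
        ≤ μ * ‖ξ‖ ^ (γ - (n : ℝ)) := by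
    intro n hn i ξ hξ
    have hcont : ContinuousOn (iteratedFDeriv ℝ n m) ({0}ᶜ : Set (E d)) :=
      (hm.continuousOn_iteratedFDerivWithin (by exact_mod_cast hn) hopen.uniqueDiffOn).congr
        fun ζ hζ => (iteratedFDerivWithin_of_isOpen n hopen hζ).symm
    have hc1 : ContinuousAt (fun ξ => ‖iteratedFDeriv ℝ n m ξ
        (fun j => EuclideanSpace.single (i j) (1 : ℝ))‖) ξ := by
      have := hcont.continuousAt (hopen.mem_nhds hξ)
      exact ((ContinuousMultilinearMap.apply ℝ (fun _ : Fin n => E d) ℂ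
        (fun j => EuclideanSpace.single (i j) (1 : ℝ))).continuous.continuousAt.comp this).norm
    have hc2 : ContinuousAt (fun ξ : E d => μ * ‖ξ‖ ^ (γ - (n : ℝ))) ξ :=
      continuousAt_const.mul (continuousAt_id.norm.rpow_const (Or.inl (norm_ne_zero_iff.2 hξ)))
    have hcl : ξ ∈ closure (offHyperplanes d) := offHyperplanes_dense ξ
    have := mem_closure_iff_nhdsWithin_neBot.1 hcl
    exact le_of_tendsto_of_tendsto (hc1.mono_left nhdsWithin_le_nhds)
      (hc2.mono_left nhdsWithin_le_nhds)
      (eventually_nhdsWithin_of_forall fun ζ hζ => hb n hn i ζ hζ)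
  have hR' : ∀ ξ ∈ annulus d, R • ξ ≠ 0 := fun ξ hξ => by
    refine smul_ne_zero hR.ne' ?_
    rintro rfl
    have := hξ.1
    simp at this
    linarith
  have hcomp : ContDiffOn ℝ (d + 2 : ℕ) (fun ξ => m (R • ξ)) (annulus d) :=
    (hm.of_le (by exact_mod_cast hN)).comp (contDiff_const_smul R).contDiffOn hR'
  refine ⟨hcomp, fun n hn ξ hξ => ?_⟩
  let e : E d ≃L[ℝ] E d := ContinuousLinearEquiv.smulLeft (Units.mk0 R hR.ne')
  have he : ∀ ξ, e ξ = R • ξ := fun ξ => rfl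
  have hnorm : ‖(e : E d →L[ℝ] E d)‖ ≤ R := by
    refine ContinuousLinearMap.opNorm_le_bound _ hR.le fun v => ?_
    rw [ContinuousLinearEquiv.coe_coe, he, norm_smul, Real.norm_of_nonneg hR.le]
  have hpre : (e ⁻¹' ({0}ᶜ : Set (E d))) = {0}ᶜ := by
    ext ξ
    simp
  have hξ0 : ξ ∈ ({0}ᶜ : Set (E d)) := by
    rintro rfl
    exact hR' 0 hξ (smul_zero _)
  have h1 := e.iteratedFDerivWithin_comp_right m hopen.uniqueDiffOn (x := ξ) (hR' ξ hξ) n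
  rw [hpre, iteratedFDerivWithin_of_isOpen n hopen hξ0,
    iteratedFDerivWithin_of_isOpen (f := m) n hopen (show e ξ ∈ _ from hR' ξ hξ)] at h1
  rw [iteratedFDerivWithin_of_isOpen n isOpen_annulus hξ]
  change ‖iteratedFDeriv ℝ n (m ∘ e) ξ‖ ≤ _
  rw [h1]
  have hξpos : 0 < ‖ξ‖ := norm_pos_iff.2 hξ0
  have h2 := norm_multilinear_le_of_basis (iteratedFDeriv ℝ n m (R • ξ))
    (b := μ * ‖R • ξ‖ ^ (γ - (n : ℝ))) (by positivity)
    fun i => hall n (hn.trans hN) i _ (hR' ξ hξ)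
  calc _ ≤ ‖iteratedFDeriv ℝ n m (R • ξ)‖ * ∏ _j : Fin n, ‖(e : E d →L[ℝ] E d)‖ :=
        ContinuousMultilinearMap.norm_compContinuousLinearMap_le _ _
    _ ≤ ((d : ℝ) ^ n * (μ * ‖R • ξ‖ ^ (γ - (n : ℝ)))) * ∏ _j : Fin n, R := by gcongr
    _ = (d : ℝ) ^ n * ‖ξ‖ ^ (γ - (n : ℝ)) * μ * R ^ γ := by
        rw [Finset.prod_const, Finset.card_univ, Fintype.card_fin, norm_smul,
          Real.norm_of_nonneg hR.le, Real.mul_rpow hR.le (norm_nonneg _), Real.rpow_sub hR,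
          Real.rpow_natCast]
        field_simp
    _ ≤ (d : ℝ) ^ (d + 2) * 4 ^ (γ + (d + 2)) * μ * R ^ γ := by
        gcongr
        -- Both signs of γ - n occur: the outer radius 4 of the annulus serves for the positive one,
        -- the inner radius 1/4 for the negative one.
        · have hn' : (n : ℝ) ≤ d + 2 := by exact_mod_cast hn
          rcases le_total 0 (γ - n) with h | h
          · calc ‖ξ‖ ^ (γ - (n : ℝ)) ≤ 4 ^ (γ - (n : ℝ)) :=
                  Real.rpow_le_rpow hξpos.le hξ.2.le h
              _ ≤ _ := Real.rpow_le_rpow_of_exponent_le (by norm_num) (by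
                  have : (0 : ℝ) ≤ n := Nat.cast_nonneg n
                  linarith)
          · calc ‖ξ‖ ^ (γ - (n : ℝ)) ≤ (1 / 4) ^ (γ - (n : ℝ)) :=
                  Real.rpow_le_rpow_of_nonpos (by norm_num) hξ.1.le h
              _ = 4 ^ ((n : ℝ) - γ) := by
                  rw [one_div, Real.inv_rpow (by norm_num), ← Real.rpow_neg (by norm_num), neg_sub]
              _ ≤ _ := Real.rpow_le_rpow_of_exponent_le (by norm_num) (by linarith)
    _ = _ := by rw [symConst]

/-- The properties of a time independent symbol that the kernel estimates use. -/
structure SpaceSym (γ μ : ℝ) (φ : E d → ℂ) : Prop where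
  meas : Measurable φ
  bd : ∀ R : ℝ, 0 < R → SymBd (d + 2) (annulus d) (μ * R ^ γ) (fun ξ => φ (R • ξ))

/-- The properties of a time dependent symbol that the kernel estimates use. -/
structure TimeSym (γ κ μ : ℝ) (ψ : ℝ → E d → ℂ) : Prop where
  meas : Measurable (Function.uncurry ψ)
  ae : ∀ᵐ r : ℝ, (∀ R : ℝ, 0 < R → SymBd (d + 2) (annulus d) (μ * R ^ γ) (fun ξ => ψ r (R • ξ))) ∧
    ∀ ξ, ξ ≠ 0 → (ψ r ξ).re ≤ -(κ * ‖ξ‖ ^ γ)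

theorem measurable_of_continuousOn_compl {F : Type*} [TopologicalSpace F]
    [MeasurableSpace F] [BorelSpace F] {f : E d → F} (hf : ContinuousOn f {0}ᶜ) : Measurable f := by
  classical
  have h : Measurable (({0}ᶜ : Set (E d)).piecewise f (fun _ => f 0)) :=
    hf.measurable_piecewise continuousOn_const (measurableSet_singleton (0 : E d)).compl
  convert h using 1
  ext ξ
  by_cases hξ : ξ = 0
  · simp [hξ]
  · simp [hξ]

theorem SpaceSym.of_cond (hd : 0 < d) {N : ℕ} (hN : d + 2 ≤ N) {γ μ : ℝ} (hγ : 0 < γ) (hμ : 0 ≤ μ)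
    {φ : E d → ℝ} (h : CondS2 N γ μ (fun _ ξ => ((φ ξ : ℝ) : ℂ))) :
    SpaceSym γ (symConst d γ * μ) (fun ξ => (φ ξ : ℂ)) := by
  -- The condition is stated for almost every time but does not involve the time, so a single
  -- admissible time suffices.
  obtain ⟨_, h1, h2⟩ := h.exists
  exact ⟨measurable_of_continuousOn_compl h1.continuousOn,
    fun R hR => symBd_of_partialsBounded hd hN hγ hμ h1 h2 hR⟩

theorem TimeSym.of_symbolS (hd : 0 < d) {N : ℕ} (hN : d + 2 ≤ N) {γ κ μ : ℝ} (hγ : 0 < γ)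
    (hμ : 0 ≤ μ) {ψ : ℝ → E d → ℂ} (h : SymbolS N γ κ μ ψ) :
    TimeSym γ κ (symConst d γ * μ) ψ := by
  refine ⟨h.measurable, ?_⟩
  filter_upwards [h.s1, h.s2] with r h1 h2
  refine ⟨fun R hR => symBd_of_partialsBounded hd hN hγ hμ h2.1 h2.2 hR, fun ξ hξ => ?_⟩
  -- An inequality valid almost everywhere holds on a dense set, and continuity away from the origin
  -- extends it to every ξ ≠ 0.
  have hdense : Dense {ξ : E d | (ψ r ξ).re ≤ -(κ * ‖ξ‖ ^ γ)} := Measure.dense_of_ae h1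
  have hc : ContinuousAt (ψ r) ξ := h2.1.continuousOn.continuousAt (isOpen_compl_singleton.mem_nhds hξ)
  have hc1 : ContinuousAt (fun ξ => (ψ r ξ).re) ξ := Complex.continuous_re.continuousAt.comp hc
  have hc2 : ContinuousAt (fun ξ : E d => -(κ * ‖ξ‖ ^ γ)) ξ :=
    (continuousAt_const.mul (continuousAt_id.norm.rpow_const (Or.inr hγ.le))).neg
  have := mem_closure_iff_nhdsWithin_neBot.1 (hdense ξ)
  have hev : ∀ᶠ ζ in 𝓝[{ξ : E d | (ψ r ξ).re ≤ -(κ * ‖ξ‖ ^ γ)}] ξ,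
      (ψ r ζ).re ≤ -(κ * ‖ζ‖ ^ γ) := eventually_nhdsWithin_of_forall fun ζ hζ => hζ
  exact le_of_tendsto_of_tendsto (hc1.mono_left nhdsWithin_le_nhds)
      (hc2.mono_left nhdsWithin_le_nhds) hev

end Symbols

/-! ### Dyadic sums -/

theorem exp_neg_le_factorial_div {y : ℝ} (hy : 0 < y) (M : ℕ) :
    Real.exp (-y) ≤ M.factorial / y ^ M := by
  have h := Real.pow_div_factorial_le_exp y hy.le M
  have hM : (0 : ℝ) < M.factorial := by exact_mod_cast M.factorial_pos
  rw [div_le_iff₀ hM] at h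
  rw [Real.exp_neg, inv_eq_one_div, div_le_div_iff₀ (Real.exp_pos y) (by positivity)]
  linarith

/-- As k → ∞ the exponential beats any power: M with γM ≥ a + 1 leaves a geometric tail. As k → -∞
the factor 2^{ka} is itself geometric, which is why a > 0 is required. -/
theorem summable_dyadic {γ c a : ℝ} (hγ : 0 < γ) (hc : 0 < c) (ha : 0 < a) :
    Summable fun k : ℤ => ((2 : ℝ) ^ k) ^ a * Real.exp (-(c * ((2 : ℝ) ^ k) ^ γ)) := by
  obtain ⟨M, hM⟩ := exists_nat_ge ((a + 1) / γ)
  have hM' : a + 1 ≤ γ * M := by rw [div_le_iff₀ hγ] at hM; linarith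
  refine Summable.of_nat_of_neg_add_one ?_ ?_
  · have hg : Summable fun n : ℕ => (M.factorial / c ^ M : ℝ) * (1 / 2) ^ n :=
      (summable_geometric_of_lt_one (by norm_num) (by norm_num)).mul_left _
    refine Summable.of_nonneg_of_le (fun n => by positivity) (fun n => ?_) hg
    rw [zpow_natCast]
    set x : ℝ := 2 ^ n with hx
    have hx1 : 1 ≤ x := one_le_pow₀ (by norm_num)
    have hx0 : 0 < x := by positivity
    calc x ^ a * Real.exp (-(c * x ^ γ)) ≤ x ^ a * (M.factorial / (c * x ^ γ) ^ M) := by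
          gcongr
          exact exp_neg_le_factorial_div (by positivity) M
      _ = (M.factorial / c ^ M) * x ^ (a - γ * M) := by
          rw [mul_pow, ← Real.rpow_natCast (x ^ γ), ← Real.rpow_mul hx0.le, Real.rpow_sub hx0]
          field_simp
      _ ≤ (M.factorial / c ^ M) * x ^ (-1 : ℝ) := by
          gcongr
          linarith
      _ = _ := by rw [Real.rpow_neg_one, hx, ← inv_pow]; norm_num
  · have hlt : (2 : ℝ) ^ (-a) < 1 := Real.rpow_lt_one_of_one_lt_of_neg (by norm_num) (by linarith)
    have hg : Summable fun n : ℕ => (2 : ℝ) ^ (-a) * ((2 : ℝ) ^ (-a)) ^ n :=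
      (summable_geometric_of_lt_one (by positivity) hlt).mul_left _
    refine Summable.of_nonneg_of_le (fun n => by positivity) (fun n => ?_) hg
    have h1 : Real.exp (-(c * ((2 : ℝ) ^ (-((n : ℤ) + 1))) ^ γ)) ≤ 1 := by
      rw [Real.exp_le_one_iff, neg_nonpos]; positivity
    refine (mul_le_of_le_one_right (by positivity) h1).trans (le_of_eq ?_)
    rw [← pow_succ', ← Real.rpow_intCast, ← Real.rpow_mul (by norm_num), ← Real.rpow_natCast,
      ← Real.rpow_mul (by norm_num)]
    congr 1; push_cast; ring

/-- Scaling reduces to τ = 1. Since τ^{1/γ} need not be a power of two, it is rounded down to 2^j,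
the index is shifted by j, and the rounding costs the factor 2^a. -/
theorem exists_dyadic_sum_le {γ c a : ℝ} (hγ : 0 < γ) (hc : 0 < c) (ha : 0 < a) :
    ∃ C : ℝ, 0 ≤ C ∧ ∀ τ : ℝ, 0 < τ → ∀ s : Finset ℤ,
      ∑ k ∈ s, ((2 : ℝ) ^ k) ^ a * Real.exp (-(c * τ * ((2 : ℝ) ^ k) ^ γ)) ≤ C * τ ^ (-(a / γ)) := by
  set T : ℤ → ℝ := fun k => ((2 : ℝ) ^ k) ^ a * Real.exp (-(c * ((2 : ℝ) ^ k) ^ γ)) with hT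
  have hT0 : ∀ k, 0 ≤ T k := fun k => by positivity
  have hsum : Summable T := summable_dyadic hγ hc ha
  refine ⟨2 ^ a * ∑' k, T k, mul_nonneg (by positivity) (tsum_nonneg hT0), fun τ hτ s => ?_⟩
  set y : ℝ := τ ^ (1 / γ) with hy
  have hy0 : 0 < y := by positivity
  have hyγ : y ^ γ = τ := by
    rw [hy, ← Real.rpow_mul hτ.le, one_div, inv_mul_cancel₀ hγ.ne', Real.rpow_one]
  obtain ⟨j, hj1, hj2⟩ := exists_mem_Ico_zpow hy0 (one_lt_two : (1 : ℝ) < 2)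
  have hj3 : y ≤ 2 * 2 ^ j := by
    rw [zpow_add_one₀ (by norm_num)] at hj2; linarith
  have hterm : ∀ k : ℤ, ((2 : ℝ) ^ k) ^ a * Real.exp (-(c * τ * ((2 : ℝ) ^ k) ^ γ)) ≤
      2 ^ a * τ ^ (-(a / γ)) * T (k + j) := by
    intro k
    simp only [hT]
    rw [zpow_add₀ (by norm_num)]
    set u : ℝ := 2 ^ k with hu
    set w : ℝ := 2 ^ j with hw
    have hu0 : 0 < u := by positivity
    have hw0 : 0 < w := by positivity
    have h1 : u ^ a ≤ 2 ^ a * τ ^ (-(a / γ)) * (u * w) ^ a := by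
      have e : τ ^ (-(a / γ)) = y ^ (-a) := by
        rw [hy, ← Real.rpow_mul hτ.le]; congr 1; field_simp
      rw [e, Real.mul_rpow hu0.le hw0.le, Real.rpow_neg hy0.le]
      have h2 : y ^ a ≤ 2 ^ a * w ^ a := by
        rw [← Real.mul_rpow (by norm_num) hw0.le]
        exact Real.rpow_le_rpow hy0.le hj3 ha.le
      have h3 : 0 < y ^ a := by positivity
      have h4 : 0 < u ^ a := by positivity
      rw [mul_comm (2 ^ a) _, mul_assoc, inv_mul_eq_div, le_div_iff₀ h3]
      nlinarith
    have h2 : Real.exp (-(c * τ * u ^ γ)) ≤ Real.exp (-(c * (u * w) ^ γ)) := by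
      apply Real.exp_le_exp.2
      have h5 : w ^ γ ≤ τ := by
        rw [← hyγ]; exact Real.rpow_le_rpow hw0.le hj1 hγ.le
      rw [Real.mul_rpow hu0.le hw0.le]
      have h6 : 0 ≤ c * u ^ γ := by positivity
      nlinarith
    calc _ ≤ (2 ^ a * τ ^ (-(a / γ)) * (u * w) ^ a) * Real.exp (-(c * (u * w) ^ γ)) := by gcongr
      _ = _ := by ring
  calc _ ≤ ∑ k ∈ s, 2 ^ a * τ ^ (-(a / γ)) * T (k + j) := Finset.sum_le_sum fun k _ => hterm k
    _ = 2 ^ a * τ ^ (-(a / γ)) * ∑ k ∈ s.map (addRightEmbedding j), T k := by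
        rw [← Finset.mul_sum, Finset.sum_map]; rfl
    _ ≤ 2 ^ a * τ ^ (-(a / γ)) * ∑' k, T k := by
        gcongr
        exact hsum.sum_le_tsum _ fun k _ => hT0 k
    _ = _ := by ring

/-- Polynomial factors are absorbed by half of the exponential decay. -/
theorem exists_absorb {γ c K : ℝ} (hγ : 0 < γ) (hc : 0 < c) (hK : 0 ≤ K) (M : ℕ) :
    ∃ C : ℝ, 0 ≤ C ∧ ∀ x : ℝ, 0 ≤ x →
      (1 + K * (x + x ^ (1 / γ))) ^ M * Real.exp (-(2 * c * x)) ≤ C * Real.exp (-(c * x)) := by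
  -- An integer exponent above 1/γ bounds the whole prefactor by a natural power of 1 + x, which one
  -- term of the exponential series controls.
  obtain ⟨L, hL⟩ := exists_nat_ge (1 / γ)
  set n := (L + 1) * M with hn
  refine ⟨(1 + 2 * K) ^ M * (n.factorial / c ^ n * Real.exp c), by positivity, fun x hx => ?_⟩
  have h1x : 1 ≤ 1 + x := by linarith
  have h1 : x ≤ (1 + x) ^ (L + 1) := by
    calc x ≤ 1 + x := by linarith
      _ ≤ _ := le_self_pow₀ h1x (by omega)
  have h2 : x ^ (1 / γ) ≤ (1 + x) ^ (L + 1) := by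
    calc x ^ (1 / γ) ≤ (1 + x) ^ (1 / γ) := Real.rpow_le_rpow hx (by linarith) (by positivity)
      _ ≤ (1 + x) ^ ((L : ℝ) + 1) := Real.rpow_le_rpow_of_exponent_le h1x (by linarith)
      _ = _ := by rw [← Real.rpow_natCast]; push_cast; rfl
  have h3 : 1 ≤ (1 + x) ^ (L + 1) := one_le_pow₀ h1x
  have h4 : 1 + K * (x + x ^ (1 / γ)) ≤ (1 + 2 * K) * (1 + x) ^ (L + 1) := by
    have := mul_le_mul_of_nonneg_left h1 hK
    have := mul_le_mul_of_nonneg_left h2 hK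
    nlinarith
  have h5 : (1 + x) ^ n ≤ n.factorial / c ^ n * Real.exp c * Real.exp (c * x) := by
    have h := Real.pow_div_factorial_le_exp (c * (1 + x)) (by positivity) n
    have hM : (0 : ℝ) < n.factorial := by exact_mod_cast n.factorial_pos
    rw [div_le_iff₀ hM, mul_pow, mul_add, Real.exp_add, mul_one] at h
    rw [div_mul_eq_mul_div, div_mul_eq_mul_div, le_div_iff₀ (by positivity)]
    linarith
  have hxx : 0 ≤ x ^ (1 / γ) := by positivity
  calc (1 + K * (x + x ^ (1 / γ))) ^ M * Real.exp (-(2 * c * x))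
      ≤ ((1 + 2 * K) * (1 + x) ^ (L + 1)) ^ M * Real.exp (-(2 * c * x)) := by gcongr
    _ = (1 + 2 * K) ^ M * (1 + x) ^ n * Real.exp (-(2 * c * x)) := by
        rw [mul_pow, ← pow_mul]
    _ ≤ (1 + 2 * K) ^ M * (n.factorial / c ^ n * Real.exp c * Real.exp (c * x)) *
          Real.exp (-(2 * c * x)) := by gcongr
    _ = (1 + 2 * K) ^ M * (n.factorial / c ^ n * Real.exp c) *
          (Real.exp (c * x) * Real.exp (-(2 * c * x))) := by ring
    _ = _ := by rw [← Real.exp_add]; congr 2; ring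

/-! ### Multipliers of exponential type -/

section ExpMultipliers

variable {d : ℕ}

/-- Exponents comparable to `-τ |ξ|^γ`. -/
structure ExpSym (γ κ μ τ : ℝ) (b : E d → ℂ) : Prop where
  meas : Measurable b
  bd : ∀ R : ℝ, 0 < R → SymBd (d + 2) (annulus d) (μ * τ * R ^ γ) (fun ξ => b (R • ξ))
  re_le : ∀ ξ, ξ ≠ 0 → (b ξ).re ≤ -(κ * τ * ‖ξ‖ ^ γ)

/-- Small exponents with nonpositive real part. -/
structure DiffSym (γ σ h : ℝ) (δ : E d → ℂ) : Prop where
  meas : Measurable δ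
  bd : ∀ R : ℝ, 0 < R → SymBd (d + 2) (annulus d) (σ * R ^ γ + h * R) (fun ξ => δ (R • ξ))
  re_le : ∀ ξ, ξ ≠ 0 → (δ ξ).re ≤ 0

theorem smul_ne_zero_of_mem_annulus {R : ℝ} (hR : 0 < R) {ξ : E d} (hξ : ξ ∈ annulus d) :
    R • ξ ≠ 0 := by
  refine smul_ne_zero hR.ne' ?_
  rintro rfl
  have := hξ.1
  simp at this
  linarith

/-- The rate of decay of `exp b` on annuli. -/
def decayRate (γ κ : ℝ) : ℝ := κ * (1 / 4) ^ γ / 2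

theorem decayRate_pos {γ κ : ℝ} (hκ : 0 < κ) : 0 < decayRate γ κ := by
  unfold decayRate; positivity

theorem ExpSym.norm_exp_le {γ κ μ τ : ℝ} {b : E d → ℂ} (hb : ExpSym γ κ μ τ b) (hγ : 0 < γ)
    (hκ : 0 < κ) (hτ : 0 ≤ τ) {R : ℝ} (hR : 0 < R) {ξ : E d} (hξ : ξ ∈ annulus d) :
    ‖Complex.exp (b (R • ξ))‖ ≤ Real.exp (-(2 * decayRate γ κ * (τ * R ^ γ))) := by
  rw [Complex.norm_exp, Real.exp_le_exp]
  refine (hb.re_le _ (smul_ne_zero_of_mem_annulus hR hξ)).trans ?_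
  rw [norm_smul, Real.norm_of_nonneg hR.le, Real.mul_rpow hR.le (norm_nonneg _)]
  have h1 : (1 / 4 : ℝ) ^ γ ≤ ‖ξ‖ ^ γ := Real.rpow_le_rpow (by norm_num) hξ.1.le hγ.le
  have h2 : 0 ≤ κ * τ * R ^ γ := by positivity
  unfold decayRate
  nlinarith

/-- Derivatives of exp b on the annulus of scale R cost powers of x = τR^γ, and those of exp δ cost
powers of D = σR^γ + hR. The assumptions on σ and h say that D ≤ B(x + x^{1/γ}), so half of the
exponential decay absorbs both polynomials. One factor D is kept; it is the gain from the smallness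
of δ. -/
theorem exists_symBd_exp_mul (d : ℕ) {γ κ μ B : ℝ} (hγ : 0 < γ) (hκ : 0 < κ) (hμ : 0 ≤ μ)
    (hB : 0 ≤ B) : ∃ C : ℝ, 0 ≤ C ∧ ∀ (τ : ℝ) (b : E d → ℂ), 0 < τ → ExpSym γ κ μ τ b →
    (∀ R, 0 < R → SymBd (d + 2) (annulus d) (C * Real.exp (-(decayRate γ κ * τ * R ^ γ)))
      (fun ξ => Complex.exp (b (R • ξ)))) ∧
    ∀ (σ h : ℝ) (δ : E d → ℂ), 0 ≤ σ → 0 ≤ h → σ ≤ B * τ → h ≤ B * τ ^ (1 / γ) →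
      DiffSym γ σ h δ → ∀ R, 0 < R → SymBd (d + 2) (annulus d)
      (C * (σ * R ^ γ + h * R) * Real.exp (-(decayRate γ κ * τ * R ^ γ)))
      (fun ξ => Complex.exp (b (R • ξ)) * (Complex.exp (δ (R • ξ)) - 1)) := by
  set N := d + 2 with hN
  obtain ⟨C₁, hC₁, h₁⟩ := exists_absorb (K := μ + B) hγ (decayRate_pos (γ := γ) hκ)
    (by positivity) (N + N)
  set C := 2 ^ N * 2 ^ (N ^ 2) * 2 ^ (N ^ 2) * C₁ with hC
  have h2N : (1 : ℝ) ≤ 2 ^ N * 2 ^ (N ^ 2) :=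
    one_le_mul_of_one_le_of_one_le (one_le_pow₀ (by norm_num)) (one_le_pow₀ (by norm_num))
  refine ⟨C, by positivity, fun τ b hτ hb => ?_⟩
  have hexp : ∀ R, 0 < R → SymBd N (annulus d) (2 ^ (N ^ 2) * (1 + μ * τ * R ^ γ) ^ N *
      Real.exp (-(2 * decayRate γ κ * (τ * R ^ γ)))) (fun ξ => Complex.exp (b (R • ξ))) :=
    fun R hR => (hb.bd R hR).cexp isOpen_annulus (by positivity)
      fun ξ hξ => hb.norm_exp_le hγ hκ hτ.le hR hξ
  have habs : ∀ R, 0 < R → (1 + μ * τ * R ^ γ) ^ N * (1 + B * (τ * R ^ γ +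
      (τ * R ^ γ) ^ (1 / γ))) ^ N * Real.exp (-(2 * decayRate γ κ * (τ * R ^ γ))) ≤
      C₁ * Real.exp (-(decayRate γ κ * τ * R ^ γ)) := by
    intro R hR
    set x := τ * R ^ γ with hx
    have hx0 : 0 ≤ x := by positivity
    have hx1 : 0 ≤ x ^ (1 / γ) := by positivity
    have hm := mul_nonneg hμ hx0
    have hb' := mul_nonneg hB hx0
    have hm1 := mul_nonneg hμ hx1
    have hb1 := mul_nonneg hB hx1
    have := h₁ x hx0
    rw [pow_add] at this
    have e1 : 1 + μ * τ * R ^ γ ≤ 1 + (μ + B) * (x + x ^ (1 / γ)) := by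
      rw [mul_assoc, ← hx]; nlinarith
    have e2 : 1 + B * (x + x ^ (1 / γ)) ≤ 1 + (μ + B) * (x + x ^ (1 / γ)) := by nlinarith
    calc _ ≤ (1 + (μ + B) * (x + x ^ (1 / γ))) ^ N * (1 + (μ + B) * (x + x ^ (1 / γ))) ^ N *
          Real.exp (-(2 * decayRate γ κ * x)) :=
          mul_le_mul_of_nonneg_right (mul_le_mul (pow_le_pow_left₀ (by positivity) e1 N)
            (pow_le_pow_left₀ (by positivity) e2 N) (by positivity) (by positivity))
            (Real.exp_nonneg _)
      _ ≤ C₁ * Real.exp (-(decayRate γ κ * x)) := this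
      _ = _ := by rw [mul_assoc]
  have hone : ∀ R, 0 < R → (1 : ℝ) ≤ (1 + B * (τ * R ^ γ + (τ * R ^ γ) ^ (1 / γ))) ^ N :=
    fun R hR => one_le_pow₀ (by
      have : 0 ≤ B * (τ * R ^ γ + (τ * R ^ γ) ^ (1 / γ)) := by positivity
      linarith)
  constructor
  · intro R hR
    refine (hexp R hR).mono ?_
    calc _ ≤ 2 ^ (N ^ 2) * ((1 + μ * τ * R ^ γ) ^ N * (1 + B * (τ * R ^ γ +
          (τ * R ^ γ) ^ (1 / γ))) ^ N * Real.exp (-(2 * decayRate γ κ * (τ * R ^ γ)))) := by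
          rw [mul_assoc]
          gcongr
          exact le_mul_of_one_le_right (by positivity) (hone R hR)
      _ ≤ 2 ^ (N ^ 2) * (C₁ * Real.exp (-(decayRate γ κ * τ * R ^ γ))) := by
          exact mul_le_mul_of_nonneg_left (habs R hR) (by positivity)
      _ ≤ (2 ^ N * 2 ^ (N ^ 2)) * (2 ^ (N ^ 2) *
          (C₁ * Real.exp (-(decayRate γ κ * τ * R ^ γ)))) :=
          le_mul_of_one_le_left (by positivity) h2N
      _ = _ := by rw [hC]; ring
  · intro σ h δ hσ hh hστ hhτ hδ R hR
    set D := σ * R ^ γ + h * R with hD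
    have hD0 : 0 ≤ D := by positivity
    have hDle : D ≤ B * (τ * R ^ γ + (τ * R ^ γ) ^ (1 / γ)) := by
      have e : (τ * R ^ γ) ^ (1 / γ) = τ ^ (1 / γ) * R := by
        rw [Real.mul_rpow hτ.le (by positivity), ← Real.rpow_mul hR.le, mul_one_div_cancel hγ.ne',
          Real.rpow_one]
      rw [e, hD]
      have h1 := mul_le_mul_of_nonneg_right hστ (show 0 ≤ R ^ γ by positivity)
      have h2 := mul_le_mul_of_nonneg_right hhτ hR.le
      nlinarith
    have h2 := (hδ.bd R hR).cexp_sub_one isOpen_annulus hD0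
      (fun ξ hξ => hδ.re_le _ (smul_ne_zero_of_mem_annulus hR hξ))
    have h3 := (hexp R hR).smul isOpen_annulus (by positivity) (by positivity) h2
    refine h3.mono ?_
    have hpow : (1 + D) ^ (d + 1) ≤ (1 + B * (τ * R ^ γ + (τ * R ^ γ) ^ (1 / γ))) ^ N := by
      calc (1 + D) ^ (d + 1) ≤ (1 + D) ^ N := pow_le_pow_right₀ (by linarith) (by omega)
        _ ≤ _ := by gcongr
    calc (2 : ℝ) ^ N * (2 ^ (N ^ 2) * (1 + μ * τ * R ^ γ) ^ N *
          Real.exp (-(2 * decayRate γ κ * (τ * R ^ γ)))) *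
          (2 ^ ((d + 1 + 1) ^ 2) * (1 + D) ^ (d + 1) * D)
        = 2 ^ N * 2 ^ (N ^ 2) * 2 ^ (N ^ 2) * D * ((1 + μ * τ * R ^ γ) ^ N * (1 + D) ^ (d + 1) *
          Real.exp (-(2 * decayRate γ κ * (τ * R ^ γ)))) := by
          rw [show d + 1 + 1 = N from rfl]; ring
      _ ≤ 2 ^ N * 2 ^ (N ^ 2) * 2 ^ (N ^ 2) * D * ((1 + μ * τ * R ^ γ) ^ N *
          (1 + B * (τ * R ^ γ + (τ * R ^ γ) ^ (1 / γ))) ^ N *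
          Real.exp (-(2 * decayRate γ κ * (τ * R ^ γ)))) := by gcongr
      _ ≤ 2 ^ N * 2 ^ (N ^ 2) * 2 ^ (N ^ 2) * D *
          (C₁ * Real.exp (-(decayRate γ κ * τ * R ^ γ))) := by
          exact mul_le_mul_of_nonneg_left (habs R hR) (by positivity)
      _ = _ := by rw [hC]; ring

end ExpMultipliers

open scoped FourierTransform

/-! ### Moments and increments of kernels with exponentially decaying multipliers -/

section KernelBounds

variable {d : ℕ}

theorem integrable_fourierChar_smul {m : E d → ℂ} (hm : Integrable m) (x : E d) :
    Integrable fun v => Real.fourierChar ⟪v, x⟫ • m v := by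
  refine hm.mono ?_ (ae_of_all _ fun v => by rw [Circle.norm_smul])
  have h1 : Continuous fun v : E d => ((Real.fourierChar ⟪v, x⟫ : Circle) : ℂ) :=
    continuous_subtype_val.comp (Real.continuous_fourierChar.comp
      (continuous_id.inner continuous_const))
  exact h1.aestronglyMeasurable.smul hm.aestronglyMeasurable

theorem fourierInv_sub_apply {m m' : E d → ℂ} (hm : Integrable m) (hm' : Integrable m') (x : E d) :
    𝓕⁻ (fun ξ => m ξ - m' ξ) x = 𝓕⁻ m x - 𝓕⁻ m' x := by
  rw [Real.fourierInv_eq, Real.fourierInv_eq, Real.fourierInv_eq, ← integral_sub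
    (integrable_fourierChar_smul hm x) (integrable_fourierChar_smul hm' x)]
  simp only [smul_sub]

/-- Moments of kernels whose multipliers decay exponentially on dyadic annuli. -/
theorem exists_lintegral_fourierInv_le (hd : 0 < d) {γ c η α β : ℝ} (hγ : 0 < γ) (hc : 0 < c)
    (hη0 : 0 ≤ η) (hη1 : η ≤ 1) (hα : η < α) (hβ : η < β) :
    ∃ C : ℝ, 0 ≤ C ∧ ∀ (τ P Q : ℝ) (m : E d → ℂ), 0 < τ → 0 ≤ P → 0 ≤ Q →
      AEStronglyMeasurable m volume →
      (∀ R : ℝ, 0 < R → SymBd (d + 2) (annulus d)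
        ((P * R ^ α + Q * R ^ β) * Real.exp (-(c * τ * R ^ γ))) (fun ξ => m (R • ξ))) →
      Integrable m ∧ ∫⁻ x, ‖𝓕⁻ m x‖ₑ * ENNReal.ofReal (‖x‖ ^ η) ≤
        ENNReal.ofReal (C * (P * τ ^ (-((α - η) / γ)) + Q * τ ^ (-((β - η) / γ)))) := by
  obtain ⟨C₀, hC₀, hmul⟩ := exists_multiplier_bound (d := d) hd
  obtain ⟨C₁, hC₁, h₁⟩ := exists_dyadic_sum_le (a := α - η) hγ hc (by linarith)
  obtain ⟨C₂, hC₂, h₂⟩ := exists_dyadic_sum_le (a := β - η) hγ hc (by linarith)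
  -- C₃ and C₄ serve only to show that m is integrable; they do not enter the final constant.
  obtain ⟨C₃, hC₃, h₃⟩ := exists_dyadic_sum_le (a := α + d) hγ hc (by have := hη0.trans_lt hα; positivity)
  obtain ⟨C₄, hC₄, h₄⟩ := exists_dyadic_sum_le (a := β + d) hγ hc (by have := hη0.trans_lt hβ; positivity)
  refine ⟨C₀ * (C₁ + C₂), by positivity, fun τ P Q m hτ hP hQ hm hbd => ?_⟩
  set A : ℤ → ℝ := fun k => (P * ((2 : ℝ) ^ k) ^ α + Q * ((2 : ℝ) ^ k) ^ β) *
    Real.exp (-(c * τ * ((2 : ℝ) ^ k) ^ γ)) with hA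
  have h := hmul A m hm (fun k => by positivity) (fun k => hbd _ (by positivity))
    (P * (C₃ * τ ^ (-((α + d) / γ))) + Q * (C₄ * τ ^ (-((β + d) / γ)))) (fun s => by
      calc ∑ k ∈ s, ((2 : ℝ) ^ k) ^ d * A k = P * ∑ k ∈ s, ((2 : ℝ) ^ k) ^ (α + d) *
            Real.exp (-(c * τ * ((2 : ℝ) ^ k) ^ γ)) + Q * ∑ k ∈ s, ((2 : ℝ) ^ k) ^ (β + d) *
            Real.exp (-(c * τ * ((2 : ℝ) ^ k) ^ γ)) := by
            rw [Finset.mul_sum, Finset.mul_sum, ← Finset.sum_add_distrib]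
            refine Finset.sum_congr rfl fun k _ => ?_
            simp only [hA]
            rw [Real.rpow_add (by positivity), Real.rpow_add (by positivity), Real.rpow_natCast]
            ring
        _ ≤ _ := add_le_add (mul_le_mul_of_nonneg_left (h₃ τ hτ s) hP)
            (mul_le_mul_of_nonneg_left (h₄ τ hτ s) hQ))
  refine ⟨h.1, (h.2 η (P * (C₁ * τ ^ (-((α - η) / γ))) + Q * (C₂ * τ ^ (-((β - η) / γ)))) hη0 hη1
    fun s => ?_).trans (ENNReal.ofReal_le_ofReal ?_)⟩
  · calc ∑ k ∈ s, ((2 : ℝ) ^ k) ^ (-η) * A k = P * ∑ k ∈ s, ((2 : ℝ) ^ k) ^ (α - η) *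
            Real.exp (-(c * τ * ((2 : ℝ) ^ k) ^ γ)) + Q * ∑ k ∈ s, ((2 : ℝ) ^ k) ^ (β - η) *
            Real.exp (-(c * τ * ((2 : ℝ) ^ k) ^ γ)) := by
          rw [Finset.mul_sum, Finset.mul_sum, ← Finset.sum_add_distrib]
          refine Finset.sum_congr rfl fun k _ => ?_
          simp only [hA]
          rw [sub_eq_add_neg, sub_eq_add_neg, Real.rpow_add (by positivity),
            Real.rpow_add (by positivity)]
          ring
      _ ≤ _ := add_le_add (mul_le_mul_of_nonneg_left (h₁ τ hτ s) hP)
          (mul_le_mul_of_nonneg_left (h₂ τ hτ s) hQ)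
  · have e1 : 0 ≤ P * τ ^ (-((α - η) / γ)) := by positivity
    have e2 : 0 ≤ Q * τ ^ (-((β - η) / γ)) := by positivity
    rw [mul_assoc]
    refine mul_le_mul_of_nonneg_left ?_ hC₀
    nlinarith

theorem ExpSym.measurable_exp {γ κ μ τ : ℝ} {b : E d → ℂ} (hb : ExpSym γ κ μ τ b) :
    Measurable fun ξ => Complex.exp (b ξ) := Complex.measurable_exp.comp hb.meas

/-- Moments of the kernel with multiplier `φ exp b`. -/
theorem exists_kernel_moment_le (hd : 0 < d) {γ κ μ η : ℝ} (hγ : 0 < γ) (hκ : 0 < κ) (hμ : 0 ≤ μ)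
    (hη0 : 0 ≤ η) (hη1 : η ≤ 1) (hηγ : η < γ) :
    ∃ C : ℝ, 0 ≤ C ∧ ∀ (τ : ℝ) (φ b : E d → ℂ), 0 < τ → SpaceSym γ μ φ → ExpSym γ κ μ τ b →
      Integrable (fun ξ => φ ξ * Complex.exp (b ξ)) ∧
      ∫⁻ x, ‖𝓕⁻ (fun ξ => φ ξ * Complex.exp (b ξ)) x‖ₑ * ENNReal.ofReal (‖x‖ ^ η) ≤
        ENNReal.ofReal (C * τ ^ (-1 + η / γ)) := by
  obtain ⟨C₁, hC₁, h₁⟩ := exists_symBd_exp_mul d (B := 0) hγ hκ hμ le_rfl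
  obtain ⟨C₂, hC₂, h₂⟩ := exists_lintegral_fourierInv_le (d := d) hd hγ (decayRate_pos (γ := γ) hκ)
    hη0 hη1 hηγ hηγ
  refine ⟨C₂ * (2 ^ (d + 2) * μ * C₁), by positivity, fun τ φ b hτ hφ hb => ?_⟩
  obtain ⟨hi, hle⟩ := h₂ τ (2 ^ (d + 2) * μ * C₁) 0 (fun ξ => φ ξ * Complex.exp (b ξ)) hτ
    (by positivity) le_rfl (hφ.meas.mul hb.measurable_exp).aestronglyMeasurable fun R hR => by
      refine ((hφ.bd R hR).smul isOpen_annulus (by positivity) (by positivity)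
        ((h₁ τ b hτ hb).1 R hR)).mono (le_of_eq ?_)
      ring
  refine ⟨hi, hle.trans_eq ?_⟩
  congr 1
  rw [zero_mul, add_zero, ← mul_assoc]
  congr 2
  field_simp
  ring

/-- The kernel with multiplier `φ exp b (exp δ - 1)` for a small exponent `δ`. -/
theorem exists_kernel_diff_le (hd : 0 < d) {γ κ μ B : ℝ} (hγ : 0 < γ) (hκ : 0 < κ) (hμ : 0 ≤ μ)
    (hB : 0 ≤ B) :
    ∃ C : ℝ, 0 ≤ C ∧ ∀ (τ σ h : ℝ) (φ b δ : E d → ℂ), 0 < τ → 0 ≤ σ → 0 ≤ h → σ ≤ B * τ →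
      h ≤ B * τ ^ (1 / γ) → SpaceSym γ μ φ → ExpSym γ κ μ τ b → DiffSym γ σ h δ →
      ∫⁻ x, ‖𝓕⁻ (fun ξ => φ ξ * Complex.exp (b ξ + δ ξ)) x -
        𝓕⁻ (fun ξ => φ ξ * Complex.exp (b ξ)) x‖ₑ ≤
        ENNReal.ofReal (C * (σ * τ ^ (-2 : ℝ) + h * τ ^ (-1 - 1 / γ))) := by
  obtain ⟨C₁, hC₁, h₁⟩ := exists_symBd_exp_mul d hγ hκ hμ hB
  -- The factor φ contributes R^γ and δ contributes σR^γ + hR, whence the exponents γ + γ and γ + 1.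
  obtain ⟨C₂, hC₂, h₂⟩ := exists_lintegral_fourierInv_le (d := d) (α := γ + γ) (β := γ + 1) hd hγ
    (decayRate_pos (γ := γ) hκ) le_rfl zero_le_one (by positivity) (by positivity)
  obtain ⟨C₃, hC₃, h₃⟩ := exists_kernel_moment_le (d := d) hd hγ hκ hμ le_rfl zero_le_one hγ
  refine ⟨C₂ * (2 ^ (d + 2) * μ * C₁), by positivity,
    fun τ σ h φ b δ hτ hσ hh hσB hhB hφ hb hδ => ?_⟩
  obtain ⟨hi, hle⟩ := h₂ τ (2 ^ (d + 2) * μ * C₁ * σ) (2 ^ (d + 2) * μ * C₁ * h)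
    (fun ξ => φ ξ * (Complex.exp (b ξ) * (Complex.exp (δ ξ) - 1))) hτ (by positivity)
    (by positivity) (hφ.meas.mul (hb.measurable_exp.mul
      ((Complex.measurable_exp.comp hδ.meas).sub_const 1))).aestronglyMeasurable fun R hR => by
      refine ((hφ.bd R hR).smul isOpen_annulus (by positivity) (by positivity)
        ((h₁ τ b hτ hb).2 σ h δ hσ hh hσB hhB hδ R hR)).mono (le_of_eq ?_)
      rw [Real.rpow_add hR, Real.rpow_add hR, Real.rpow_one]
      ring
  have hi2 := (h₃ τ φ b hτ hφ hb).1
  have hi3 : Integrable fun ξ => φ ξ * Complex.exp (b ξ + δ ξ) := by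
    refine (hi.add hi2).congr (ae_of_all _ fun ξ => ?_)
    simp only [Pi.add_apply, Complex.exp_add]
    ring
  have key : ∀ x, 𝓕⁻ (fun ξ => φ ξ * Complex.exp (b ξ + δ ξ)) x -
      𝓕⁻ (fun ξ => φ ξ * Complex.exp (b ξ)) x =
      𝓕⁻ (fun ξ => φ ξ * (Complex.exp (b ξ) * (Complex.exp (δ ξ) - 1))) x := by
    intro x
    rw [← fourierInv_sub_apply hi3 hi2]
    refine congrArg (fun f : E d → ℂ => 𝓕⁻ f x) (funext fun ξ => ?_)
    rw [Complex.exp_add]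
    ring
  simp only [key]
  simp only [Real.rpow_zero, ENNReal.ofReal_one, mul_one, sub_zero] at hle
  refine hle.trans_eq ?_
  congr 1
  have e1 : -((γ + γ) / γ) = (-2 : ℝ) := by field_simp; ring
  have e2 : -((γ + 1) / γ) = -1 - 1 / γ := by field_simp; ring
  rw [e1, e2]
  ring

end KernelBounds

open scoped FourierTransform

/-! ### Further operations on functions with bounded derivatives -/

section SymBdMore

variable {V F : Type} [NormedAddCommGroup V] [NormedSpace ℝ V] [NormedAddCommGroup F]
  [NormedSpace ℝ F] {N : ℕ} {U : Set V} {A B : ℝ} {f : V → F}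

theorem SymBd.neg (hU : IsOpen U) (h : SymBd N U A f) : SymBd N U A (fun ξ => -f ξ) := by
  refine ⟨h.1.neg, fun n hn ξ hξ => ?_⟩
  rw [show (fun ξ => -f ξ) = -f from rfl, iteratedFDerivWithin_neg_apply hU.uniqueDiffOn hξ,
    norm_neg]
  exact h.2 n hn ξ hξ

theorem SymBd.const (c : F) (hc : ‖c‖ ≤ A) : SymBd N U A (fun _ : V => c) := by
  refine ⟨contDiffOn_const, fun n _ ξ _ => ?_⟩
  rcases n with _ | n
  · simpa using hc
  · rw [iteratedFDerivWithin_succ_const]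
    simpa using (norm_nonneg c).trans hc

theorem SymBd.clm (hU : IsOpen U) (L : V →L[ℝ] F) {r : ℝ} (hr : ∀ ξ ∈ U, ‖ξ‖ ≤ r) (hr1 : 1 ≤ r) :
    SymBd N U (‖L‖ * r) (fun ξ => L ξ) := by
  have h0 : ∀ ξ ∈ U, ‖L ξ‖ ≤ ‖L‖ * r := fun ξ hξ => (L.le_opNorm ξ).trans (by gcongr; exact hr ξ hξ)
  rcases N with _ | N
  · exact symBd_zero_iff.2 ⟨L.continuous.continuousOn, h0⟩
  · refine (symBd_succ_iff hU).2 ⟨L.differentiable.differentiableOn, h0, ?_⟩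
    refine (SymBd.const (A := ‖L‖ * r) L ?_).congr fun ξ hξ => ?_
    · exact le_mul_of_one_le_right (norm_nonneg _) hr1
    · exact L.fderivWithin (hU.uniqueDiffOn ξ hξ)

theorem exists_symBd_of_contDiff [FiniteDimensional ℝ V] (hU : IsOpen U)
    (hb : Bornology.IsBounded U) (hf : ContDiff ℝ N f) : ∃ A, 0 ≤ A ∧ SymBd N U A f := by
  have hK : IsCompact (closure U) := hb.isCompact_closure
  have h : ∀ n : ℕ, ∃ A, 0 ≤ A ∧ (n ≤ N → ∀ ξ ∈ U, ‖iteratedFDeriv ℝ n f ξ‖ ≤ A) := by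
    intro n
    by_cases hn : n ≤ N
    · obtain ⟨A, hA⟩ := hK.exists_bound_of_continuousOn
        (hf.continuous_iteratedFDeriv (m := n) (by exact_mod_cast hn)).continuousOn
      exact ⟨max A 0, le_max_right _ _, fun _ ξ hξ => (hA ξ (subset_closure hξ)).trans
        (le_max_left _ _)⟩
    · exact ⟨0, le_rfl, fun h => absurd h hn⟩
  choose A hA0 hA using h
  refine ⟨∑ n ∈ Finset.range (N + 1), A n, Finset.sum_nonneg fun n _ => hA0 n,
    hf.contDiffOn, fun n hn ξ hξ => ?_⟩
  rw [iteratedFDerivWithin_of_isOpen n hU hξ]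
  exact (hA n hn ξ hξ).trans (Finset.single_le_sum (f := A) (fun i _ => hA0 i)
    (Finset.mem_range.2 (by omega)))

end SymBdMore

/-! ### Integrability of the fundamental solution and Fourier inversion -/

section FundamentalSolution

variable {d : ℕ}

theorem isBounded_annulus : Bornology.IsBounded (annulus d) :=
  (Metric.isBounded_ball (x := (0 : E d)) (r := 4)).subset fun ξ hξ => by
    simpa using hξ.2

/-- The Gaussian is the reference multiplier: it has the same value 1 at the origin as exp b has in
the limit, and its inverse transform is explicitly integrable. -/
theorem exists_expSym_gaussian (d : ℕ) :
    ∃ A, 0 ≤ A ∧ ExpSym 2 1 A 1 (fun ξ : E d => -((‖ξ‖ ^ 2 : ℝ) : ℂ)) := by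
  have hc : ContDiff ℝ (d + 2 : ℕ) (fun ξ : E d => -((‖ξ‖ ^ 2 : ℝ) : ℂ)) :=
    (Complex.ofRealCLM.contDiff.comp (contDiff_norm_sq ℝ)).neg
  obtain ⟨A, hA, h⟩ := exists_symBd_of_contDiff isOpen_annulus isBounded_annulus hc
  refine ⟨2 ^ (d + 2) * A, by positivity, hc.continuous.measurable, fun R hR => ?_,
    fun ξ _ => by rw [Complex.neg_re, Complex.ofReal_re]; simp⟩
  have h1 := (SymBd.const (V := E d) (N := d + 2) (U := annulus d) (A := R ^ 2) ((R ^ 2 : ℝ) : ℂ)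
    (by rw [Complex.norm_real, Real.norm_of_nonneg (by positivity)])).smul isOpen_annulus
    (by positivity) hA h
  refine (h1.mono (le_of_eq ?_)).congr fun ξ _ => ?_
  · rw [Real.rpow_two]; ring
  · simp only [norm_smul, Real.norm_of_nonneg hR.le, smul_eq_mul]
    push_cast
    ring

/-- `exp b` minus its limit at the origin, on small annuli, and `exp b` on large annuli. -/
theorem ExpSym.exists_symBd_sub {γ κ μ τ : ℝ} {b : E d → ℂ} (hb : ExpSym γ κ μ τ b) (hγ : 0 < γ)
    (hκ : 0 < κ) (hμ : 0 ≤ μ) (hτ : 0 < τ) :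
    ∃ C c : ℝ, 0 ≤ C ∧ 0 < c ∧ ∀ R : ℝ, 0 < R → SymBd (d + 2) (annulus d)
      (C * (R ^ γ * Real.exp (-(c * R ^ γ))))
      (fun ξ => Complex.exp (b (R • ξ)) - if R ≤ 1 then 1 else 0) := by
  obtain ⟨C₁, hC₁, h₁⟩ := exists_symBd_exp_mul d (B := 0) hγ hκ hμ le_rfl
  set c := decayRate γ κ * τ with hc
  have hc0 : 0 < c := mul_pos (decayRate_pos hκ) hτ
  set C₂ := 2 ^ ((d + 1 + 1) ^ 2) * (1 + μ * τ) ^ (d + 1) * (μ * τ) * Real.exp c with hC₂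
  refine ⟨C₁ + C₂, c, by positivity, hc0, fun R hR => ?_⟩
  -- The subtracted constant depends on R alone, so it cancels when two such symbols are subtracted.
  -- For R ≤ 1 the subtraction gains R^γ; the factor exp c only makes up for the exponential in the
  -- common form of the bound. For R > 1 the factor R^γ is at least 1.
  split_ifs with h
  · have hR1 : R ^ γ ≤ 1 := Real.rpow_le_one hR.le h hγ.le
    have hR0 : 0 ≤ R ^ γ := by positivity
    have hμτ : μ * τ * R ^ γ ≤ μ * τ := mul_le_of_le_one_right (by positivity) hR1
    refine ((hb.bd R hR).cexp_sub_one isOpen_annulus (by positivity) fun ξ hξ =>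
      (hb.re_le _ (smul_ne_zero_of_mem_annulus hR hξ)).trans
        (neg_nonpos.2 (by positivity))).mono ?_
    have h1 : 1 ≤ Real.exp c * Real.exp (-(c * R ^ γ)) := by
      rw [← Real.exp_add, Real.one_le_exp_iff]
      nlinarith
    calc _ ≤ (2 : ℝ) ^ ((d + 1 + 1) ^ 2) * (1 + μ * τ) ^ (d + 1) * (μ * τ * R ^ γ) := by gcongr
      _ ≤ (2 : ℝ) ^ ((d + 1 + 1) ^ 2) * (1 + μ * τ) ^ (d + 1) * (μ * τ * R ^ γ) *
          (Real.exp c * Real.exp (-(c * R ^ γ))) := le_mul_of_one_le_right (by positivity) h1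
      _ = C₂ * (R ^ γ * Real.exp (-(c * R ^ γ))) := by rw [hC₂]; ring
      _ ≤ _ := mul_le_mul_of_nonneg_right (by linarith) (by positivity)
  · have hR1 : 1 ≤ R ^ γ := Real.one_le_rpow (not_le.1 h).le hγ.le
    simp only [sub_zero]
    refine ((h₁ τ b hτ hb).1 R hR).mono ?_
    have h2 : 0 ≤ C₂ := by positivity
    calc C₁ * Real.exp (-(decayRate γ κ * τ * R ^ γ)) ≤
          C₁ * (R ^ γ * Real.exp (-(c * R ^ γ))) := by
          refine mul_le_mul_of_nonneg_left ?_ hC₁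
          exact le_mul_of_one_le_left (Real.exp_nonneg _) hR1
      _ ≤ _ := mul_le_mul_of_nonneg_right (by linarith) (by positivity)

theorem integrable_of_lintegral_enorm_le {α F : Type*} [MeasurableSpace α] {ν : Measure α}
    [NormedAddCommGroup F] {f : α → F} (hf : AEStronglyMeasurable f ν) {C : ℝ}
    (h : ∫⁻ x, ‖f x‖ₑ ∂ν ≤ ENNReal.ofReal C) : Integrable f ν :=
  ⟨hf, h.trans_lt ENNReal.ofReal_lt_top⟩

theorem continuous_fourierInv {m : E d → ℂ} (hm : Integrable m) : Continuous (𝓕⁻ m) := by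
  have h := VectorFourier.fourierIntegral_continuous Real.continuous_fourierChar
    (L := -innerₗ (E d)) (by
      have h0 : Continuous fun p : E d × E d => -⟪p.1, p.2⟫ :=
        (continuous_fst.inner continuous_snd).neg
      exact h0) hm
  exact h

/-- The fundamental solution is integrable. -/
theorem ExpSym.integrable_fourierInv_exp (hd : 0 < d) {γ κ μ τ : ℝ} {b : E d → ℂ}
    (hb : ExpSym γ κ μ τ b) (hγ : 0 < γ) (hκ : 0 < κ) (hμ : 0 ≤ μ) (hτ : 0 < τ) :
    Integrable (fun ξ => Complex.exp (b ξ)) ∧ Integrable (𝓕⁻ fun ξ => Complex.exp (b ξ)) := by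
  obtain ⟨A, hA, hg⟩ := exists_expSym_gaussian d
  obtain ⟨C₁, c₁, hC₁, hc₁, h₁⟩ := hb.exists_symBd_sub hγ hκ hμ hτ
  obtain ⟨C₂, c₂, hC₂, hc₂, h₂⟩ := hg.exists_symBd_sub two_pos one_pos hA one_pos
  obtain ⟨C, hC, hmul⟩ := exists_multiplier_bound (d := d) hd
  -- At η = 0 the dyadic bounds for exp b do not sum at low frequency, where exp b tends to 1. The
  -- difference with the Gaussian is small there and falls under `exists_multiplier_bound`.
  set g : E d → ℂ := fun ξ => Complex.exp (-((‖ξ‖ ^ 2 : ℝ) : ℂ)) with hg'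
  have hgi : Integrable g := by
    have := GaussianFourier.integrable_cexp_neg_mul_sq_norm_add (V := E d) (b := 1) (by simp) 0 0
    simpa [hg'] using this
  have hgF : Integrable (𝓕⁻ g) := by
    have h1 : ∀ x, 𝓕⁻ g x = 𝓕 g (-x) := fun x => Real.fourierInv_eq_fourier_neg g x
    have h2 := GaussianFourier.integrable_cexp_neg_mul_sq_norm_add (V := E d)
      (b := ((Real.pi ^ 2 : ℝ) : ℂ)) (by
        rw [Complex.ofReal_re]; positivity) 0 0
    have h3 : 𝓕⁻ g = fun x => (Real.pi / 1 : ℂ) ^ (Module.finrank ℝ (E d) / 2 : ℂ) *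
        Complex.exp (-((Real.pi ^ 2 : ℝ) : ℂ) * ‖x‖ ^ 2 + 0 * ((⟪(0 : E d), x⟫ : ℝ) : ℂ)) := by
      funext x
      rw [h1]
      have h4 := fourier_gaussian_innerProductSpace (V := E d) (b := 1) (by simp) (-x)
      have h5 : g = fun v : E d => Complex.exp (-1 * (‖v‖ : ℂ) ^ 2) := by
        funext v; simp [hg']
      rw [h5, h4, norm_neg]
      simp
    rw [h3]
    exact h2.const_mul _
  have hS : ∀ (γ' c a : ℝ), 0 < γ' → 0 < c → 0 < a → ∀ s : Finset ℤ,
      ∑ k ∈ s, ((2 : ℝ) ^ k) ^ a * Real.exp (-(c * ((2 : ℝ) ^ k) ^ γ')) ≤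
      ∑' k : ℤ, ((2 : ℝ) ^ k) ^ a * Real.exp (-(c * ((2 : ℝ) ^ k) ^ γ')) := fun γ' c a h1 h2 h3 s =>
    (summable_dyadic h1 h2 h3).sum_le_tsum _ fun k _ => by positivity
  set B : ℤ → ℝ := fun k => C₁ * (((2 : ℝ) ^ k) ^ γ * Real.exp (-(c₁ * ((2 : ℝ) ^ k) ^ γ))) +
    C₂ * (((2 : ℝ) ^ k) ^ (2 : ℝ) * Real.exp (-(c₂ * ((2 : ℝ) ^ k) ^ (2 : ℝ)))) with hB
  have h := hmul B (fun ξ => Complex.exp (b ξ) - g ξ)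
    (hb.measurable_exp.sub hg.measurable_exp).aestronglyMeasurable (fun k => by positivity)
    (fun k => ((h₁ _ (by positivity)).add isOpen_annulus
      ((h₂ ((2 : ℝ) ^ k) (by positivity)).neg isOpen_annulus)).congr fun ξ _ => by
        simp only [hg']; abel)
    _ (fun s => by
      calc ∑ k ∈ s, ((2 : ℝ) ^ k) ^ d * B k = C₁ * ∑ k ∈ s, ((2 : ℝ) ^ k) ^ (γ + d) *
            Real.exp (-(c₁ * ((2 : ℝ) ^ k) ^ γ)) + C₂ * ∑ k ∈ s, ((2 : ℝ) ^ k) ^ ((2 : ℝ) + d) *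
            Real.exp (-(c₂ * ((2 : ℝ) ^ k) ^ (2 : ℝ))) := by
            rw [Finset.mul_sum, Finset.mul_sum, ← Finset.sum_add_distrib]
            refine Finset.sum_congr rfl fun k _ => ?_
            simp only [hB]
            rw [Real.rpow_add (by positivity), Real.rpow_add (by positivity), Real.rpow_natCast]
            ring
        _ ≤ _ := add_le_add
            (mul_le_mul_of_nonneg_left (hS γ c₁ (γ + d) hγ hc₁ (by positivity) s) hC₁)
            (mul_le_mul_of_nonneg_left (hS 2 c₂ (2 + d) two_pos hc₂ (by positivity) s) hC₂))
  obtain ⟨hi, hη⟩ := h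
  have hi' : Integrable fun ξ => Complex.exp (b ξ) := by
    refine (hi.add hgi).congr (ae_of_all _ fun ξ => ?_)
    simp
  refine ⟨hi', ?_⟩
  have hle := hη 0 _ le_rfl zero_le_one (fun s => by
      calc ∑ k ∈ s, ((2 : ℝ) ^ k) ^ (-(0 : ℝ)) * B k = C₁ * ∑ k ∈ s, ((2 : ℝ) ^ k) ^ γ *
            Real.exp (-(c₁ * ((2 : ℝ) ^ k) ^ γ)) + C₂ * ∑ k ∈ s, ((2 : ℝ) ^ k) ^ (2 : ℝ) *
            Real.exp (-(c₂ * ((2 : ℝ) ^ k) ^ (2 : ℝ))) := by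
            rw [Finset.mul_sum, Finset.mul_sum, ← Finset.sum_add_distrib]
            refine Finset.sum_congr rfl fun k _ => ?_
            simp only [hB]
            rw [neg_zero, Real.rpow_zero, one_mul]
        _ ≤ _ := add_le_add
            (mul_le_mul_of_nonneg_left (hS γ c₁ γ hγ hc₁ hγ s) hC₁)
            (mul_le_mul_of_nonneg_left (hS 2 c₂ 2 two_pos hc₂ two_pos s) hC₂))
  simp only [Real.rpow_zero, ENNReal.ofReal_one, mul_one] at hle
  have hd' := integrable_of_lintegral_enorm_le (continuous_fourierInv hi).aestronglyMeasurable hle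
  refine (hd'.add hgF).congr (ae_of_all _ fun x => ?_)
  rw [Pi.add_apply, fourierInv_sub_apply hi' hgi, sub_add_cancel]

theorem continuousAt_of_annulus {f : E d → ℂ}
    (h : ∀ R : ℝ, 0 < R → ContinuousOn (fun ξ => f (R • ξ)) (annulus d)) {ξ : E d} (hξ : ξ ≠ 0) :
    ContinuousAt f ξ := by
  have hR : 0 < ‖ξ‖ := norm_pos_iff.2 hξ
  have hmem : ‖ξ‖⁻¹ • ξ ∈ annulus d := by
    have : ‖‖ξ‖⁻¹ • ξ‖ = 1 := by
      rw [norm_smul, norm_inv, norm_norm, inv_mul_cancel₀ hR.ne']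
    constructor <;> rw [this] <;> norm_num
  have h1 := (h ‖ξ‖ hR).continuousAt (isOpen_annulus.mem_nhds hmem)
  have h2 : ContinuousAt (fun ζ : E d => ‖ξ‖⁻¹ • ζ) ξ := (continuous_const_smul _).continuousAt
  have h3 := ContinuousAt.comp (f := fun ζ : E d => ‖ξ‖⁻¹ • ζ) h1 h2
  refine h3.congr (Eventually.of_forall fun ζ => ?_)
  simp only [Function.comp_apply]
  rw [smul_inv_smul₀ hR.ne']

theorem norm_le_of_annulus {f : E d → ℂ} {A : ℝ → ℝ} {N : ℕ}
    (h : ∀ R : ℝ, 0 < R → SymBd N (annulus d) (A R) (fun ξ => f (R • ξ))) {ξ : E d} (hξ : ξ ≠ 0) :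
    ‖f ξ‖ ≤ A ‖ξ‖ := by
  have hR : 0 < ‖ξ‖ := norm_pos_iff.2 hξ
  have hmem : ‖ξ‖⁻¹ • ξ ∈ annulus d := by
    have : ‖‖ξ‖⁻¹ • ξ‖ = 1 := by
      rw [norm_smul, norm_inv, norm_norm, inv_mul_cancel₀ hR.ne']
    constructor <;> rw [this] <;> norm_num
  have := (h ‖ξ‖ hR).norm_le hmem
  rwa [smul_inv_smul₀ hR.ne'] at this

theorem integrable_fourier_iff {f : E d → ℂ} : Integrable (𝓕 f) ↔ Integrable (𝓕⁻ f) := by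
  have h : 𝓕⁻ f = fun x => 𝓕 f (-x) := funext fun x => Real.fourierInv_eq_fourier_neg f x
  rw [h]
  exact ⟨fun hf => hf.comp_neg, fun hf => by simpa using hf.comp_neg⟩

/-- Undoes the Fourier transform in the definition of `pseudoOp`. Inversion is pointwise and needs
continuity, which b has away from the origin only. -/
theorem ExpSym.fourier_fourierInv_exp (hd : 0 < d) {γ κ μ τ : ℝ} {b : E d → ℂ}
    (hb : ExpSym γ κ μ τ b) (hγ : 0 < γ) (hκ : 0 < κ) (hμ : 0 ≤ μ) (hτ : 0 < τ) {ξ : E d}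
    (hξ : ξ ≠ 0) : 𝓕 (𝓕⁻ fun ξ => Complex.exp (b ξ)) ξ = Complex.exp (b ξ) := by
  obtain ⟨h1, h2⟩ := hb.integrable_fourierInv_exp hd hγ hκ hμ hτ
  exact h1.fourier_fourierInv_eq (integrable_fourier_iff.2 h2)
    (continuousAt_of_annulus (fun R hR => (hb.bd R hR).1.continuousOn) hξ).cexp

/-- The kernel with multiplier `φ exp b` has mean zero. -/
theorem integral_fourierInv_mul_exp (hd : 0 < d) {γ κ μ τ : ℝ} {φ b : E d → ℂ}
    (hφ : SpaceSym γ μ φ) (hb : ExpSym γ κ μ τ b) (hγ : 0 < γ) (hκ : 0 < κ) (hμ : 0 ≤ μ)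
    (hτ : 0 < τ) : Integrable (𝓕⁻ fun ξ => φ ξ * Complex.exp (b ξ)) ∧
      (∫ x, (𝓕⁻ fun ξ => φ ξ * Complex.exp (b ξ)) x = 0) ∧
      ∀ ξ, ξ ≠ 0 → 𝓕 (𝓕⁻ fun ξ => φ ξ * Complex.exp (b ξ)) ξ = φ ξ * Complex.exp (b ξ) := by
  obtain ⟨C, hC, h⟩ := exists_kernel_moment_le hd hγ hκ hμ le_rfl zero_le_one hγ
  obtain ⟨hi, hle⟩ := h τ φ b hτ hφ hb
  set m : E d → ℂ := fun ξ => φ ξ * Complex.exp (b ξ) with hm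
  simp only [Real.rpow_zero, ENNReal.ofReal_one, mul_one] at hle
  have hF := integrable_of_lintegral_enorm_le (continuous_fourierInv hi).aestronglyMeasurable hle
  refine ⟨hF, ?_, fun ξ hξ => hi.fourier_fourierInv_eq (integrable_fourier_iff.2 hF)
    ((continuousAt_of_annulus (fun R hR => (hφ.bd R hR).1.continuousOn) hξ).mul
      (continuousAt_of_annulus (fun R hR => (hb.bd R hR).1.continuousOn) hξ).cexp)⟩
  have : Nonempty (Fin d) := ⟨⟨0, hd⟩⟩
  -- The value of m at 0 is arbitrary. Replacing it by 0 makes the multiplier continuous there,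
  -- since it is bounded by μ‖ξ‖^γ, and changes no integral. Inversion at 0 then says that the
  -- kernel has integral m₀(0) = 0.
  set m₀ : E d → ℂ := Function.update m 0 0 with hm₀
  have hae : m =ᵐ[volume] m₀ := by
    have : ∀ᵐ ξ : E d, ξ ≠ 0 := by
      simp [ae_iff]
    filter_upwards [this] with ξ hξ
    rw [hm₀, Function.update_of_ne hξ]
  have hi₀ : Integrable m₀ := hi.congr hae
  have hinv : 𝓕⁻ m₀ = 𝓕⁻ m := by
    funext x
    rw [Real.fourierInv_eq, Real.fourierInv_eq]
    refine integral_congr_ae (hae.symm.mono fun ξ hξ => ?_)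
    simp only [hξ]
  have hcont : ContinuousAt m₀ 0 := by
    rw [ContinuousAt, hm₀, Function.update_self, tendsto_zero_iff_norm_tendsto_zero]
    have h0 : Tendsto (fun ξ : E d => μ * ‖ξ‖ ^ γ) (𝓝 0) (𝓝 0) := by
      have : ContinuousAt (fun ξ : E d => μ * ‖ξ‖ ^ γ) 0 :=
        continuousAt_const.mul (continuousAt_id.norm.rpow_const (Or.inr hγ.le))
      have h2 := this.tendsto
      simpa [Real.zero_rpow hγ.ne'] using h2
    refine squeeze_zero (fun ξ => norm_nonneg _) (fun ξ => ?_) h0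
    by_cases hξ : ξ = 0
    · subst hξ
      simp [Real.zero_rpow hγ.ne']
    · rw [Function.update_of_ne hξ, hm, norm_mul]
      have h1 := norm_le_of_annulus hφ.bd hξ
      have h2 : ‖Complex.exp (b ξ)‖ ≤ 1 := by
        rw [Complex.norm_exp, Real.exp_le_one_iff]
        exact (hb.re_le ξ hξ).trans (neg_nonpos.2 (by positivity))
      calc _ ≤ μ * ‖ξ‖ ^ γ * 1 := by gcongr
        _ = _ := mul_one _
  have h3 := hi₀.fourier_fourierInv_eq (integrable_fourier_iff.2 (by rwa [hinv])) hcont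
  rw [hinv, hm₀, Function.update_self, Real.fourier_eq] at h3
  simpa using h3

end FundamentalSolution

open scoped FourierTransform

/-! ### Time integrals of the symbol as exponents -/

section SymbolIntegrals

variable {d : ℕ}

/-- The exponent `∫_s^t ψ(r, ·) dr`. -/
def expo (ψ : ℝ → E d → ℂ) (t s : ℝ) (ξ : E d) : ℂ := ∫ r in s..t, ψ r ξ

theorem expo_add_adjacent {γ κ μ : ℝ} {ψ : ℝ → E d → ℂ} (hψ : TimeSym γ κ μ ψ) {ξ : E d}
    (hξ : ξ ≠ 0) (s r t : ℝ) : expo ψ t s ξ = expo ψ t r ξ + expo ψ r s ξ := by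
  have hi : ∀ a b : ℝ, IntervalIntegrable (fun r => ψ r ξ) volume a b := by
    intro a b
    refine (intervalIntegrable_const (c := μ * ‖ξ‖ ^ γ)).mono_fun
      (hψ.meas.comp measurable_prodMk_right).aestronglyMeasurable ?_
    refine ae_restrict_of_ae (hψ.ae.mono fun r hr => ?_)
    exact (norm_le_of_annulus hr.1 hξ).trans (le_abs_self _)
  rw [expo, expo, expo, add_comm, intervalIntegral.integral_add_adjacent_intervals (hi _ _) (hi _ _)]

theorem measurable_expo {ψ : ℝ → E d → ℂ} (hψ : Measurable (Function.uncurry ψ)) :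
    Measurable fun p : ℝ × ℝ × E d => expo ψ p.1 p.2.1 p.2.2 := by
  have key : ∀ S : Set ((ℝ × ℝ × E d) × ℝ), MeasurableSet S →
      Measurable fun p : ℝ × ℝ × E d => ∫ r, S.indicator (fun q => ψ q.2 q.1.2.2) (p, r) := by
    intro S hS
    have h1 : Measurable (S.indicator fun q : (ℝ × ℝ × E d) × ℝ => ψ q.2 q.1.2.2) :=
      (hψ.comp (measurable_snd.prodMk measurable_fst.snd.snd)).indicator hS
    exact (h1.stronglyMeasurable.integral_prod_right').measurable
  have hS1 : MeasurableSet {q : (ℝ × ℝ × E d) × ℝ | q.1.2.1 < q.2 ∧ q.2 ≤ q.1.1} :=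
    (measurableSet_lt measurable_fst.snd.fst measurable_snd).inter
      (measurableSet_le measurable_snd measurable_fst.fst)
  have hS2 : MeasurableSet {q : (ℝ × ℝ × E d) × ℝ | q.1.1 < q.2 ∧ q.2 ≤ q.1.2.1} :=
    (measurableSet_lt measurable_fst.fst measurable_snd).inter
      (measurableSet_le measurable_snd measurable_fst.snd.fst)
  convert (key _ hS1).sub (key _ hS2) using 1
  funext p
  rw [expo, intervalIntegral, ← integral_indicator measurableSet_Ioc,
    ← integral_indicator measurableSet_Ioc]
  rfl

theorem TimeSym.symBd_expo {γ κ μ : ℝ} {ψ : ℝ → E d → ℂ} (hψ : TimeSym γ κ μ ψ) {s t : ℝ}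
    (hst : s ≤ t) {R : ℝ} (hR : 0 < R) :
    SymBd (d + 2) (annulus d) (μ * (t - s) * R ^ γ) (fun ξ => expo ψ t s (R • ξ)) := by
  have h := SymBd.integral (T := ℝ) (ν := volume.restrict (Ioc s t)) isOpen_annulus (d + 2)
    (A := μ * R ^ γ) (h := fun r ξ => ψ r (R • ξ))
    (fun ξ _ => (hψ.meas.comp measurable_prodMk_right).aestronglyMeasurable)
    (ae_restrict_of_ae (hψ.ae.mono fun r hr => hr.1 R hR))
  refine (h.mono (le_of_eq ?_)).congr fun ξ _ => ?_
  · rw [measureReal_restrict_apply_univ, Real.volume_real_Ioc_of_le hst]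
    ring
  · rw [expo, intervalIntegral.integral_of_le hst]

theorem TimeSym.re_expo_le {γ κ μ : ℝ} {ψ : ℝ → E d → ℂ} (hψ : TimeSym γ κ μ ψ) {s t : ℝ}
    (hst : s ≤ t) {ξ : E d} (hξ : ξ ≠ 0) : (expo ψ t s ξ).re ≤ -(κ * (t - s) * ‖ξ‖ ^ γ) := by
  rw [expo, intervalIntegral.integral_of_le hst]
  have hi : Integrable (fun r => ψ r ξ) (volume.restrict (Ioc s t)) :=
    (integrable_const (μ * ‖ξ‖ ^ γ)).mono' (hψ.meas.comp measurable_prodMk_right).aestronglyMeasurable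
      (ae_restrict_of_ae (hψ.ae.mono fun r hr => norm_le_of_annulus hr.1 hξ))
  have h1 : (∫ r in Ioc s t, ψ r ξ).re = ∫ r in Ioc s t, (ψ r ξ).re :=
    (Complex.reCLM.integral_comp_comm hi).symm
  rw [h1]
  calc ∫ r in Ioc s t, (ψ r ξ).re ≤ ∫ r in Ioc s t, -(κ * ‖ξ‖ ^ γ) :=
        integral_mono_ae hi.re (integrable_const _)
          (ae_restrict_of_ae (hψ.ae.mono fun r hr => hr.2 ξ hξ))
    _ = _ := by
        rw [setIntegral_const, Real.volume_real_Ioc_of_le hst, smul_eq_mul]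
        ring

theorem TimeSym.expSym {γ κ μ : ℝ} {ψ : ℝ → E d → ℂ} (hψ : TimeSym γ κ μ ψ) {s t : ℝ}
    (hst : s ≤ t) : ExpSym γ κ μ (t - s) (expo ψ t s) :=
  ⟨(measurable_expo hψ.meas).comp (measurable_const.prodMk (measurable_const.prodMk measurable_id)),
    fun _ hR => hψ.symBd_expo hst hR, fun _ hξ => hψ.re_expo_le hst hξ⟩

/-- The exponent of a translation added to a short time integral is a small exponent. -/
theorem TimeSym.diffSym {γ κ μ : ℝ} {ψ : ℝ → E d → ℂ} (hψ : TimeSym γ κ μ ψ) (hκ : 0 ≤ κ)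
    {s t : ℝ} (hst : s ≤ t) (v : E d) :
    DiffSym γ (μ * (t - s)) (8 * Real.pi * ‖v‖)
      (fun ξ => expo ψ t s ξ + ((2 * Real.pi * ⟪ξ, v⟫ : ℝ) : ℂ) * Complex.I) := by
  have hts : 0 ≤ t - s := by linarith
  refine ⟨(hψ.expSym hst).meas.add ((Complex.measurable_ofReal.comp
    ((measurable_id.inner measurable_const).const_mul _)).mul_const _), fun R hR => ?_,
    fun ξ hξ => ?_⟩
  · refine (hψ.symBd_expo hst hR).add isOpen_annulus ?_
    -- The translation is linear in ξ with norm 2πR‖v‖; the outer radius 4 of the annulus turns this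
    -- into 8π‖v‖R.
    set L : E d →L[ℝ] ℂ := (innerSL ℝ v).smulRight (((2 * Real.pi * R : ℝ) : ℂ) * Complex.I) with hL
    have hLn : ‖L‖ ≤ ‖v‖ * (2 * Real.pi * R) := by
      rw [hL, ContinuousLinearMap.norm_smulRight_apply, innerSL_apply_norm, norm_mul,
        Complex.norm_I, mul_one, Complex.norm_real, Real.norm_of_nonneg (by positivity)]
    refine ((SymBd.clm (r := 4) isOpen_annulus L (fun ξ hξ => hξ.2.le) (by norm_num)).mono
      ?_).congr fun ξ _ => ?_
    · calc ‖L‖ * 4 ≤ ‖v‖ * (2 * Real.pi * R) * 4 := by gcongr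
        _ = _ := by ring
    · simp only [hL, ContinuousLinearMap.smulRight_apply, innerSL_apply_apply, inner_smul_left,
        real_inner_comm v ξ, Complex.real_smul, conj_trivial]
      push_cast
      ring
  · have h1 := hψ.re_expo_le hst hξ
    have h2 : 0 ≤ κ * (t - s) * ‖ξ‖ ^ γ := by positivity
    rw [Complex.add_re, Complex.re_ofReal_mul, Complex.I_re, mul_zero, add_zero]
    linarith

theorem SpaceSym.comp_smul {γ μ : ℝ} {φ : E d → ℂ} (hφ : SpaceSym γ μ φ) {c : ℝ} (hc : 0 < c) :
    SpaceSym γ (c ^ γ * μ) (fun ξ => φ (c • ξ)) := by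
  refine ⟨hφ.meas.comp (measurable_const_smul c), fun R hR => ?_⟩
  refine ((hφ.bd (c * R) (by positivity)).mono (le_of_eq ?_)).congr fun ξ _ => ?_
  · rw [Real.mul_rpow hc.le hR.le]; ring
  · simp only [mul_smul]

theorem TimeSym.comp_smul {γ κ μ : ℝ} {ψ : ℝ → E d → ℂ} (hψ : TimeSym γ κ μ ψ) {c : ℝ}
    (hc : 0 < c) : TimeSym γ (c ^ γ * κ) (c ^ γ * μ) (fun r ξ => ψ r (c • ξ)) := by
  refine ⟨hψ.meas.comp (measurable_fst.prodMk (measurable_snd.const_smul c)), ?_⟩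
  filter_upwards [hψ.ae] with r hr
  refine ⟨fun R hR => ?_, fun ξ hξ => ?_⟩
  · refine ((hr.1 (c * R) (by positivity)).mono (le_of_eq ?_)).congr fun ξ _ => ?_
    · rw [Real.mul_rpow hc.le hR.le]; ring
    · simp only [mul_smul]
  · refine (hr.2 (c • ξ) (smul_ne_zero hc.ne' hξ)).trans (le_of_eq ?_)
    rw [norm_smul, Real.norm_of_nonneg hc.le, Real.mul_rpow hc.le (norm_nonneg _)]
    ring

end SymbolIntegrals

/-! ### Uniform bounds of the potential kernel -/

section Kernel

variable {d : ℕ}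

/-- The kernel with multiplier `φ exp (∫_s^t ψ)` in the normalisation of `𝓕⁻`. -/
def mulKernel (φ : E d → ℂ) (ψ : ℝ → E d → ℂ) (t s : ℝ) : E d → ℂ :=
  𝓕⁻ fun ξ => φ ξ * Complex.exp (expo ψ t s ξ)

theorem measurable_mulKernel {φ : E d → ℂ} {ψ : ℝ → E d → ℂ} (hφ : Measurable φ)
    (hψ : Measurable (Function.uncurry ψ)) :
    Measurable fun p : ℝ × ℝ × E d => mulKernel φ ψ p.1 p.2.1 p.2.2 := by
  have h1 : Measurable fun q : (ℝ × ℝ × E d) × E d =>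
      Complex.exp (((2 * Real.pi * ⟪q.2, q.1.2.2⟫ : ℝ) : ℂ) * Complex.I) •
        (φ q.2 * Complex.exp (expo ψ q.1.1 q.1.2.1 q.2)) := by
    simp only [smul_eq_mul]
    refine Measurable.mul ?_ ?_
    · exact Complex.measurable_exp.comp ((Complex.measurable_ofReal.comp
        ((measurable_snd.inner measurable_fst.snd.snd).const_mul _)).mul_const _)
    · exact (hφ.comp measurable_snd).mul (Complex.measurable_exp.comp
        ((measurable_expo hψ).comp (measurable_fst.fst.prodMk
          (measurable_fst.snd.fst.prodMk measurable_snd))))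
  convert (h1.stronglyMeasurable.integral_prod_right' (ν := volume)).measurable using 1
  funext p
  rw [mulKernel, Real.fourierInv_eq']

/-- A translation of the kernel adds a purely imaginary linear term to the exponent. It therefore
fits into `DiffSym` together with a time increment. -/
theorem fourierInv_add (m : E d → ℂ) (x v : E d) :
    𝓕⁻ m (x + v) =
      𝓕⁻ (fun ξ => m ξ * Complex.exp (((2 * Real.pi * ⟪ξ, v⟫ : ℝ) : ℂ) * Complex.I)) x := by
  rw [Real.fourierInv_eq', Real.fourierInv_eq']
  refine integral_congr_ae (ae_of_all _ fun ξ => ?_)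
  simp only [inner_add_right, smul_eq_mul]
  push_cast
  rw [mul_add, add_mul, Complex.exp_add]
  ring

theorem fourierInv_congr_ae {m m' : E d → ℂ} (h : m =ᵐ[volume] m') : 𝓕⁻ m = 𝓕⁻ m' := by
  funext x
  rw [Real.fourierInv_eq, Real.fourierInv_eq]
  exact integral_congr_ae (h.mono fun ξ hξ => by simp only [hξ])

theorem ae_ne_zero (hd : 0 < d) : ∀ᵐ ξ : E d, ξ ≠ 0 := by
  have : Nonempty (Fin d) := ⟨⟨0, hd⟩⟩
  simp [ae_iff]

/-- Bounds of the kernels `mulKernel φ ψ t s`, uniform over the symbols. -/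
structure KernelBounds (γ κ η M B : ℝ) (k : ℝ → ℝ → E d → ℂ) : Prop where
  meas : Measurable fun p : ℝ × ℝ × E d => k p.1 p.2.1 p.2.2
  lint : ∀ s t, s < t → ∫⁻ x, ‖k t s x‖ₑ ≤ ENNReal.ofReal (M * (t - s)⁻¹)
  moment : ∀ s t, s < t → ∫⁻ x, ‖k t s x‖ₑ * ENNReal.ofReal (‖x‖ ^ η) ≤
    ENNReal.ofReal (M * (t - s) ^ (-1 + η / γ))
  -- The increments in time and space are taken together and are at most B times the parabolic scale
  -- of the time difference, so the perturbed exponent is still dominated by the decay.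
  sub_start : ∀ s s' t v, s ≤ s' → s' < t → s' - s ≤ B * (t - s') → ‖v‖ ≤ B * (t - s') ^ (1 / γ) →
    ∫⁻ x, ‖k t s (x + v) - k t s' x‖ₑ ≤
      ENNReal.ofReal (M * ((s' - s) * (t - s') ^ (-2 : ℝ) + ‖v‖ * (t - s') ^ (-1 - 1 / γ)))
  sub_stop : ∀ s t t' v, s < t → t ≤ t' → t' - t ≤ B * (t - s) → ‖v‖ ≤ B * (t - s) ^ (1 / γ) →
    ∫⁻ x, ‖k t' s (x + v) - k t s x‖ₑ ≤
      ENNReal.ofReal (M * ((t' - t) * (t - s) ^ (-2 : ℝ) + ‖v‖ * (t - s) ^ (-1 - 1 / γ)))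
  integral_eq : ∀ s t, s < t → ∫ x, k t s x = 0
  fourier_le : ∀ s t ξ, s < t → ξ ≠ 0 →
    ‖𝓕 (k t s) ξ‖ ≤ M * ‖ξ‖ ^ γ * Real.exp (-(κ * (t - s) * ‖ξ‖ ^ γ))

/-- Moving the start or the end of the time interval adds the integral of ψ over a short interval,
and a translation adds an imaginary linear exponent. Both increments are thus one comparison of exp
a with exp (a + δ), isolated in `hshift`. M is chosen before the symbols. -/
theorem exists_kernelBounds (hd : 0 < d) {γ κ μ η B : ℝ} (hγ : 0 < γ) (hκ : 0 < κ) (hμ : 0 ≤ μ)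
    (hη0 : 0 ≤ η) (hη1 : η ≤ 1) (hηγ : η < γ) (hB : 0 ≤ B) :
    ∃ M : ℝ, 0 ≤ M ∧ ∀ (φ : E d → ℂ) (ψ : ℝ → E d → ℂ), SpaceSym γ μ φ → TimeSym γ κ μ ψ →
      KernelBounds γ κ η M B (mulKernel φ ψ) := by
  obtain ⟨C₁, hC₁, h₁⟩ := exists_kernel_moment_le hd hγ hκ hμ le_rfl zero_le_one hγ
  obtain ⟨C₂, hC₂, h₂⟩ := exists_kernel_moment_le hd hγ hκ hμ hη0 hη1 hηγ
  -- The small exponent has σ = μ(s' - s) and h = 8π‖v‖, so B must be enlarged by a factor that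
  -- covers both μ and 8π.
  obtain ⟨C₃, hC₃, h₃⟩ := exists_kernel_diff_le (B := B * (μ + 8 * Real.pi)) hd hγ hκ hμ
    (by positivity)
  have hshift : ∀ (φ : E d → ℂ) (ψ : ℝ → E d → ℂ), SpaceSym γ μ φ → TimeSym γ κ μ ψ →
      ∀ (τ : ℝ) (a a' : E d → ℂ) (s s' : ℝ) (v : E d), 0 < τ → ExpSym γ κ μ τ a → s ≤ s' →
      s' - s ≤ B * τ → ‖v‖ ≤ B * τ ^ (1 / γ) → (∀ ξ, ξ ≠ 0 → a' ξ = a ξ + expo ψ s' s ξ) →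
      ∫⁻ x, ‖𝓕⁻ (fun ξ => φ ξ * Complex.exp (a' ξ)) (x + v) -
        𝓕⁻ (fun ξ => φ ξ * Complex.exp (a ξ)) x‖ₑ ≤
      ENNReal.ofReal (C₃ * (μ + 8 * Real.pi) *
        ((s' - s) * τ ^ (-2 : ℝ) + ‖v‖ * τ ^ (-1 - 1 / γ))) := by
    intro φ ψ hφ hψ τ a a' s s' v hτ ha hss hsB hvB haa
    have hπ := Real.pi_pos
    have hs0 : 0 ≤ s' - s := by linarith
    have h := h₃ τ (μ * (s' - s)) (8 * Real.pi * ‖v‖) φ a _ hτ (by positivity) (by positivity)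
      (by
        calc μ * (s' - s) ≤ (μ + 8 * Real.pi) * (B * τ) := by gcongr; linarith
          _ = _ := by ring)
      (by
        calc 8 * Real.pi * ‖v‖ ≤ (μ + 8 * Real.pi) * (B * τ ^ (1 / γ)) := by gcongr; linarith
          _ = _ := by ring) hφ ha (hψ.diffSym hκ.le hss v)
    refine le_trans (le_of_eq ?_) (h.trans (ENNReal.ofReal_le_ofReal ?_))
    · refine lintegral_congr fun x => ?_
      rw [fourierInv_add, fourierInv_congr_ae (m' := fun ξ => φ ξ * Complex.exp (a ξ +
        (expo ψ s' s ξ + ((2 * Real.pi * ⟪ξ, v⟫ : ℝ) : ℂ) * Complex.I)))]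
      filter_upwards [ae_ne_zero hd] with ξ hξ
      rw [haa ξ hξ, ← add_assoc, Complex.exp_add _ (_ * Complex.I), mul_assoc]
    · rw [mul_assoc C₃]
      refine mul_le_mul_of_nonneg_left ?_ hC₃
      have e1 : 0 ≤ (s' - s) * τ ^ (-2 : ℝ) := by positivity
      have e2 : 0 ≤ ‖v‖ * τ ^ (-1 - 1 / γ) := by positivity
      nlinarith [mul_nonneg hμ e2, mul_nonneg hπ.le e1]
  set M := C₁ + C₂ + C₃ * (μ + 8 * Real.pi) + μ with hM
  have hπ := Real.pi_pos
  have hM3 : 0 ≤ C₃ * (μ + 8 * Real.pi) := by positivity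
  refine ⟨M, by positivity, fun φ ψ hφ hψ => ⟨measurable_mulKernel hφ.meas hψ.meas, ?_, ?_, ?_, ?_,
    fun s t hst => (integral_fourierInv_mul_exp hd hφ (hψ.expSym hst.le) hγ hκ hμ
      (by linarith)).2.1, fun s t ξ hst hξ => ?_⟩⟩
  · intro s t hst
    have hτ : 0 < t - s := by linarith
    have h := (h₁ (t - s) φ _ hτ hφ (hψ.expSym hst.le)).2
    simp only [Real.rpow_zero, ENNReal.ofReal_one, mul_one, zero_div, add_zero,
      Real.rpow_neg_one] at h
    refine h.trans (ENNReal.ofReal_le_ofReal ?_)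
    gcongr
    linarith
  · intro s t hst
    have hτ : 0 < t - s := by linarith
    refine (h₂ (t - s) φ _ hτ hφ (hψ.expSym hst.le)).2.trans (ENNReal.ofReal_le_ofReal ?_)
    gcongr
    linarith
  · intro s s' t v hss hst hsB hvB
    have hτ : 0 < t - s' := by linarith
    have hs0 : 0 ≤ s' - s := by linarith
    refine (hshift φ ψ hφ hψ (t - s') (expo ψ t s') (expo ψ t s) s s' v hτ (hψ.expSym hst.le) hss
      hsB hvB fun ξ hξ => expo_add_adjacent hψ hξ _ _ _).trans (ENNReal.ofReal_le_ofReal ?_)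
    gcongr
    linarith
  · intro s t t' v hst htt htB hvB
    have hτ : 0 < t - s := by linarith
    have hs0 : 0 ≤ t' - t := by linarith
    refine (hshift φ ψ hφ hψ (t - s) (expo ψ t s) (expo ψ t' s) t t' v hτ (hψ.expSym hst.le) htt
      htB hvB fun ξ hξ => by rw [expo_add_adjacent hψ hξ _ t _, add_comm]).trans
        (ENNReal.ofReal_le_ofReal ?_)
    gcongr
    linarith
  · rw [mulKernel, (integral_fourierInv_mul_exp hd hφ (hψ.expSym hst.le) hγ hκ hμ
      (by linarith)).2.2 ξ hξ, norm_mul]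
    have h1 : ‖φ ξ‖ ≤ M * ‖ξ‖ ^ γ := (norm_le_of_annulus hφ.bd hξ).trans (by gcongr; linarith)
    have h2 : ‖Complex.exp (expo ψ t s ξ)‖ ≤ Real.exp (-(κ * (t - s) * ‖ξ‖ ^ γ)) := by
      rw [Complex.norm_exp]
      exact Real.exp_le_exp.2 (hψ.re_expo_le hst.le hξ)
    gcongr

/-- The substitution ξ = 2πζ passes between the convention exp(i x·ξ) and that of `𝓕⁻`; the symbols
are rescaled accordingly. -/
theorem fourierTInv_eq (F : E d → ℂ) (x : E d) :
    fourierTInv F x = (((2 * Real.pi) ^ ((d : ℝ) / 2) : ℝ) : ℂ) *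
      𝓕⁻ (fun ζ => F ((2 * Real.pi) • ζ)) x := by
  have hπ : (0 : ℝ) < 2 * Real.pi := by positivity
  have h := Measure.integral_comp_smul_of_nonneg (volume : Measure (E d))
    (fun ξ => Complex.exp (Complex.I * ((⟪x, ξ⟫ : ℝ) : ℂ)) * F ξ) (2 * Real.pi) (hR := hπ.le)
  rw [finrank_euclideanSpace_fin] at h
  have h2 : 𝓕⁻ (fun ζ => F ((2 * Real.pi) • ζ)) x = ∫ ξ : E d, Complex.exp (Complex.I *
      ((⟪x, (2 * Real.pi) • ξ⟫ : ℝ) : ℂ)) * F ((2 * Real.pi) • ξ) := by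
    rw [Real.fourierInv_eq']
    refine integral_congr_ae (ae_of_all _ fun ξ => ?_)
    simp only [inner_smul_right, real_inner_comm x ξ, smul_eq_mul]
    rw [mul_comm Complex.I]
  rw [h2, h, fourierTInv, Complex.real_smul, ← mul_assoc, ← Complex.ofReal_mul]
  congr 2
  rw [← Real.rpow_natCast, ← Real.rpow_neg hπ.le, ← Real.rpow_add hπ]
  congr 1
  ring

theorem fourierT_eq (f : E d → ℂ) (ξ : E d) :
    fourierT f ((2 * Real.pi) • ξ) = (((2 * Real.pi) ^ (-(d : ℝ) / 2) : ℝ) : ℂ) * 𝓕 f ξ := by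
  rw [fourierT, Real.fourier_eq']
  congr 1
  refine integral_congr_ae (ae_of_all _ fun x => ?_)
  simp only [inner_smul_right, smul_eq_mul]
  congr 2
  push_cast
  ring

/-- The kernel of the potential operator in terms of the rescaled symbols. -/
theorem potKernel_eq (hd : 0 < d) {γ κ μ : ℝ} (hγ : 0 < γ) (hκ : 0 < κ) (hμ : 0 ≤ μ)
    (φ : E d → ℝ) {ψ : ℝ → E d → ℂ} (hψ : TimeSym γ κ μ ψ) {s t : ℝ} (hst : s < t) :
    potKernel φ ψ t s = mulKernel (fun ξ => (φ ((2 * Real.pi) • ξ) : ℂ))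
      (fun r ξ => ψ r ((2 * Real.pi) • ξ)) t s := by
  have hπ : (0 : ℝ) < 2 * Real.pi := by positivity
  have hψ' := hψ.comp_smul hπ
  -- The normalizing powers of 2π cancel twice: once in the fundamental solution and once between
  -- the transform and its inverse.
  have hc : (((2 * Real.pi) ^ (-(d : ℝ) / 2) : ℝ) : ℂ) *
      (((2 * Real.pi) ^ ((d : ℝ) / 2) : ℝ) : ℂ) = 1 := by
    rw [← Complex.ofReal_mul, ← Real.rpow_add hπ]
    rw [show -(d : ℝ) / 2 + d / 2 = 0 by ring, Real.rpow_zero, Complex.ofReal_one]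
  have hfund : fundSol ψ t s = 𝓕⁻ fun ζ => Complex.exp
      (expo (fun r ξ => ψ r ((2 * Real.pi) • ξ)) t s ζ) := by
    funext x
    rw [fundSol, fourierTInv_eq, ← mul_assoc, hc, one_mul]
    rfl
  funext x
  rw [potKernel, pseudoOp, fourierTInv_eq, mulKernel]
  have hae : (fun ζ : E d => (φ ((2 * Real.pi) • ζ) : ℂ) * fourierT (fundSol ψ t s)
      ((2 * Real.pi) • ζ)) =ᵐ[volume] fun ζ => (((2 * Real.pi) ^ (-(d : ℝ) / 2) : ℝ) : ℂ) *
      ((φ ((2 * Real.pi) • ζ) : ℂ) * Complex.exp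
        (expo (fun r ξ => ψ r ((2 * Real.pi) • ξ)) t s ζ)) := by
    filter_upwards [ae_ne_zero hd] with ζ hζ
    rw [fourierT_eq, hfund, (hψ'.expSym hst.le).fourier_fourierInv_exp hd hγ (by positivity)
      (by positivity) (by linarith) hζ]
    ring
  rw [fourierInv_congr_ae hae, Real.fourierInv_eq, Real.fourierInv_eq, ← integral_const_mul]
  refine integral_congr_ae (ae_of_all _ fun ζ => ?_)
  simp only [Circle.smul_def, smul_eq_mul]
  linear_combination (((Real.fourierChar ⟪ζ, x⟫ : Circle) : ℂ) * ((φ ((2 * Real.pi) • ζ) : ℂ) *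
    Complex.exp (expo (fun r ξ => ψ r ((2 * Real.pi) • ξ)) t s ζ))) * hc

end Kernel

open scoped FourierTransform

/-! ### Plancherel for vector valued integrable functions -/

section Plancherel

variable {d : ℕ} {H : Type*} [NormedAddCommGroup H] [InnerProductSpace ℂ H]

theorem continuous_fourier {f : E d → H} (hf : Integrable f) : Continuous (𝓕 f) := by
  have h := VectorFourier.fourierIntegral_continuous Real.continuous_fourierChar
    (L := innerₗ (E d)) (by exact continuous_fst.inner continuous_snd) hf
  exact h

theorem integral_smul_fourier [CompleteSpace H] (g : E d → ℂ) (f : E d → H) (hg : Integrable g)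
    (hf : Integrable f) : ∫ ξ, 𝓕 g ξ • f ξ = ∫ x, g x • 𝓕 f x := by
  have h := VectorFourier.integral_fourierIntegral_smul_eq_flip (L := innerₗ (E d))
    Real.continuous_fourierChar (by exact continuous_fst.inner continuous_snd) hg hf
  rw [flip_innerₗ] at h
  exact h

/-- Plancherel's theorem for integrable functions in `L^2`. -/
theorem lintegral_enorm_fourier_sq [CompleteSpace H] {f : E d → H} (h1 : Integrable f)
    (h2 : MemLp f 2) : ∫⁻ ξ, ‖𝓕 f ξ‖ₑ ^ 2 = ∫⁻ x, ‖f x‖ₑ ^ 2 := by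
  set F : Lp H 2 (volume : Measure (E d)) := h2.toLp f with hF
  set G : Lp H 2 (volume : Measure (E d)) := 𝓕 F with hG
  -- The Fourier integral of f and the L² transform of its class agree as distributions, hence
  -- almost everywhere; the isometry on L² then applies.
  have hae : ∀ᵐ x : E d, 𝓕 f x = G x := by
    refine ae_eq_of_integral_contDiff_smul_eq (continuous_fourier h1).locallyIntegrable
      ((Lp.memLp G).locallyIntegrable (by norm_num)) fun g hg hgs => ?_
    set g' : SchwartzMap (E d) ℂ := HasCompactSupport.toSchwartzMap (f := fun x => (g x : ℂ))
      (hgs.comp_left (g := fun x : ℝ => (x : ℂ)) (by simp))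
      (Complex.ofRealCLM.contDiff.comp hg) with hg'
    have hg'x : ∀ x, g' x = (g x : ℂ) := fun x => rfl
    have h3 := congrArg (fun T => T g') (Lp.fourier_toTemperedDistribution_eq F)
    simp only [TemperedDistribution.fourier_apply, Lp.toTemperedDistribution_apply] at h3
    have h4 := integral_smul_fourier (fun x => g' x) f g'.integrable h1
    have h5 : ∫ x, (𝓕 g') x • F x = ∫ x, 𝓕 (fun x => g' x) x • f x := by
      refine integral_congr_ae ?_
      filter_upwards [h2.coeFn_toLp] with x hx
      rw [hx, SchwartzMap.fourier_coe]
    rw [h5, h4] at h3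
    simpa [hg'x] using h3
  have e1 : ∫⁻ ξ, ‖𝓕 f ξ‖ₑ ^ 2 = ∫⁻ ξ, ‖G ξ‖ₑ ^ 2 :=
    lintegral_congr_ae (hae.mono fun x hx => by simp only [hx])
  have e2 : ∫⁻ x, ‖f x‖ₑ ^ 2 = ∫⁻ ξ, ‖F ξ‖ₑ ^ 2 :=
    lintegral_congr_ae (h2.coeFn_toLp.mono fun x hx => by simp only [← hx, hF])
  have e3 : eLpNorm G 2 = eLpNorm F 2 := by
    have h6 : ‖G‖ = ‖F‖ := Lp.norm_fourier_eq F
    rw [Lp.norm_def, Lp.norm_def, ENNReal.toReal_eq_toReal_iff' (Lp.eLpNorm_ne_top _)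
      (Lp.eLpNorm_ne_top _)] at h6
    exact h6
  have e4 := eLpNorm_rpow_eq (μ := (volume : Measure (E d))) (p := 2) two_pos G
  have e5 := eLpNorm_rpow_eq (μ := (volume : Measure (E d))) (p := 2) two_pos F
  simp only [ENNReal.ofReal_ofNat, ENNReal.rpow_two] at e4 e5
  rw [e1, e2, ← e4, ← e5, e3]

end Plancherel

/-! ### Truncation of the time difference -/

section TruncatedKernel

variable {d : ℕ}

theorem lintegral_ite_sub_left (g : ℝ → ℝ≥0∞) (t : ℝ) :
    ∫⁻ s, (if s < t then g (t - s) else 0) = ∫⁻ τ in Ioi 0, g τ := by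
  rw [← lintegral_indicator measurableSet_Ioi, ← lintegral_sub_left_eq_self _ t]
  refine lintegral_congr fun s => ?_
  simp [indicator]

theorem lintegral_ite_sub_right (g : ℝ → ℝ≥0∞) (s : ℝ) :
    ∫⁻ t, (if s < t then g (t - s) else 0) = ∫⁻ τ in Ioi 0, g τ := by
  rw [← lintegral_indicator measurableSet_Ioi,
    ← lintegral_sub_right_eq_self ((Ioi (0 : ℝ)).indicator g) s]
  refine lintegral_congr fun s => ?_
  simp [indicator]

/-- Truncations of the time difference. -/
structure TimeCutoff (χ : ℝ → ℝ) : Prop where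
  meas : Measurable χ
  nonneg : ∀ τ, 0 < τ → 0 ≤ χ τ
  le_one : ∀ τ, 0 < τ → χ τ ≤ 1
  -- Lipschitz relative to τ with a fixed constant: the increments of the cutoff then obey the same
  -- bound as those of the kernel, uniformly in the cutoff.
  lipschitz : ∀ τ τ', 0 < τ → τ ≤ τ' → |χ τ' - χ τ| ≤ 2 * ((τ' - τ) / τ)
  lintegral_ne_top : ∫⁻ τ in Ioi 0, ENNReal.ofReal (χ τ * τ⁻¹) ≠ ⊤

/-- The kernel of the truncated potential operator. -/
def truncKernel (k : ℝ → ℝ → E d → ℂ) (χ : ℝ → ℝ) (z w : ℝ × E d) : ℂ :=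
  if w.1 < z.1 then (χ (z.1 - w.1) : ℂ) * k z.1 w.1 (z.2 - w.2) else 0

variable {γ κ η M B : ℝ} {k : ℝ → ℝ → E d → ℂ} {χ : ℝ → ℝ}

theorem measurable_truncKernel
    (hk : Measurable fun p : ℝ × ℝ × E d => k p.1 p.2.1 p.2.2) (hχ : Measurable χ) :
    Measurable (Function.uncurry (truncKernel k χ)) := by
  refine Measurable.ite (measurableSet_lt measurable_snd.fst measurable_fst.fst) ?_ measurable_const
  refine Measurable.mul (Complex.measurable_ofReal.comp (hχ.comp
    (measurable_fst.fst.sub measurable_snd.fst))) ?_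
  exact hk.comp (measurable_fst.fst.prodMk (measurable_snd.fst.prodMk
    (measurable_fst.snd.sub measurable_snd.snd)))

theorem KernelBounds.lintegral_truncKernel_left_le (hk : KernelBounds γ κ η M B k)
    (hχ : TimeCutoff χ) (t : ℝ) (w : ℝ × E d) :
    ∫⁻ x, ‖truncKernel k χ (t, x) w‖ₑ ≤
      if w.1 < t then ENNReal.ofReal (M * (χ (t - w.1) * (t - w.1)⁻¹)) else 0 := by
  simp only [truncKernel]
  split_ifs with h
  · have hτ : 0 < t - w.1 := by linarith
    simp only [enorm_mul]
    rw [lintegral_const_mul' _ _ (by simp), lintegral_sub_right_eq_self (fun x => ‖k t w.1 x‖ₑ) w.2]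
    calc _ ≤ ENNReal.ofReal (χ (t - w.1)) * ENNReal.ofReal (M * (t - w.1)⁻¹) := by
          gcongr
          · rw [← ofReal_norm, Complex.norm_real, Real.norm_of_nonneg (hχ.nonneg _ hτ)]
          · exact hk.lint _ _ h
      _ = _ := by rw [← ENNReal.ofReal_mul (hχ.nonneg _ hτ)]; congr 1; ring
  · simp

theorem KernelBounds.lintegral_truncKernel_right_le (hk : KernelBounds γ κ η M B k)
    (hχ : TimeCutoff χ) (s : ℝ) (z : ℝ × E d) :
    ∫⁻ y, ‖truncKernel k χ z (s, y)‖ₑ ≤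
      if s < z.1 then ENNReal.ofReal (M * (χ (z.1 - s) * (z.1 - s)⁻¹)) else 0 := by
  simp only [truncKernel]
  split_ifs with h
  · have hτ : 0 < z.1 - s := by linarith
    simp only [enorm_mul]
    rw [lintegral_const_mul' _ _ (by simp), lintegral_sub_left_eq_self (fun x => ‖k z.1 s x‖ₑ) z.2]
    calc _ ≤ ENNReal.ofReal (χ (z.1 - s)) * ENNReal.ofReal (M * (z.1 - s)⁻¹) := by
          gcongr
          · rw [← ofReal_norm, Complex.norm_real, Real.norm_of_nonneg (hχ.nonneg _ hτ)]
          · exact hk.lint _ _ h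
      _ = _ := by rw [← ENNReal.ofReal_mul (hχ.nonneg _ hτ)]; congr 1; ring
  · simp

/-- Rows and columns reduce to M times the integral of χ(τ)/τ. The constant S depends on the
truncation and enters none of the uniform bounds. -/
theorem KernelBounds.schurKernel (hM : 0 ≤ M) (hk : KernelBounds γ κ η M B k)
    (hχ : TimeCutoff χ) : ∃ S : NNReal, SchurKernel volume S (truncKernel k χ) := by
  have hfin : ∫⁻ τ in Ioi (0 : ℝ), ENNReal.ofReal (M * (χ τ * τ⁻¹)) ≠ ⊤ := by
    simp only [ENNReal.ofReal_mul hM]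
    rw [lintegral_const_mul' _ _ (by simp)]
    exact ENNReal.mul_ne_top (by simp) hχ.lintegral_ne_top
  have hm := measurable_truncKernel hk.meas hχ.meas
  refine ⟨(∫⁻ τ in Ioi (0 : ℝ), ENNReal.ofReal (M * (χ τ * τ⁻¹))).toNNReal, hm,
    fun z => ?_, fun w => ?_⟩
  · have hz : Measurable fun w => ‖truncKernel k χ z w‖ₑ := (hm.comp measurable_prodMk_left).enorm
    rw [ENNReal.coe_toNNReal hfin, Measure.volume_eq_prod, lintegral_prod _ hz.aemeasurable,
      ← lintegral_ite_sub_left (fun τ => ENNReal.ofReal (M * (χ τ * τ⁻¹))) z.1]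
    exact lintegral_mono fun s => hk.lintegral_truncKernel_right_le hχ s z
  · have hw : Measurable fun z => ‖truncKernel k χ z w‖ₑ := (hm.comp measurable_prodMk_right).enorm
    rw [ENNReal.coe_toNNReal hfin, Measure.volume_eq_prod, lintegral_prod _ hw.aemeasurable,
      ← lintegral_ite_sub_right (fun τ => ENNReal.ofReal (M * (χ τ * τ⁻¹))) w.1]
    exact lintegral_mono fun t => hk.lintegral_truncKernel_left_le hχ t w

end TruncatedKernel

open scoped FourierTransform

/-! ### The L² estimate -/

section LTwo

variable {d : ℕ} {H : Type*} [NormedAddCommGroup H] [InnerProductSpace ℂ H]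
variable {γ κ η M B : ℝ} {k : ℝ → ℝ → E d → ℂ} {χ : ℝ → ℝ}

/-- The result does not depend on lam = ‖ξ‖^γ, and this is why the L² bound is uniform over
frequencies. -/
theorem lintegral_exp_decay {lam M : ℝ} (hl : 0 < lam) (hκ : 0 < κ) (hM : 0 ≤ M) :
    ∫⁻ τ in Ioi (0 : ℝ), ENNReal.ofReal (M * lam * Real.exp (-(κ * τ * lam))) =
      ENNReal.ofReal (M / κ) := by
  have hneg : -(κ * lam) < 0 := neg_lt_zero.2 (by positivity)
  have hi : IntegrableOn (fun τ => M * lam * Real.exp (-(κ * lam) * τ)) (Ioi 0) :=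
    (integrableOn_exp_mul_Ioi hneg 0).const_mul _
  have e : ∀ τ : ℝ, M * lam * Real.exp (-(κ * τ * lam)) = M * lam * Real.exp (-(κ * lam) * τ) :=
    fun τ => by congr 2; ring
  simp only [e]
  rw [← ofReal_integral_eq_lintegral_ofReal hi (ae_of_all _ fun τ => by positivity),
    integral_const_mul, integral_exp_mul_Ioi hneg]
  congr 1
  rw [mul_zero, Real.exp_zero]
  field_simp

theorem lintegral_volume_prod {f : ℝ × E d → ℝ≥0∞} (hf : AEMeasurable f volume) :
    ∫⁻ z, f z = ∫⁻ t, ∫⁻ x, f (t, x) := by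
  rw [Measure.volume_eq_prod] at hf ⊢
  exact lintegral_prod _ hf

/-- The Fourier transform of a slice of the truncated potential. -/
theorem KernelBounds.enorm_fourier_slice_le [CompleteSpace H]
    (hk : KernelBounds γ κ η M B k) (hχ : TimeCutoff χ) {f : ℝ × E d → H} {t : ℝ}
    (hint : Integrable (fun q : E d × (ℝ × E d) => truncKernel k χ (t, q.1) q.2 • f q.2)
      (volume.prod volume)) {ξ : E d} (hξ : ξ ≠ 0) :
    ‖𝓕 (fun x => kernelOp volume (truncKernel k χ) f (t, x)) ξ‖ₑ ≤
      ∫⁻ s, (if s < t then ENNReal.ofReal (M * ‖ξ‖ ^ γ * Real.exp (-(κ * (t - s) * ‖ξ‖ ^ γ)))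
        else 0) * ‖𝓕 (fun y => f (s, y)) ξ‖ₑ := by
  set e : E d → ℂ := fun x => ((Real.fourierChar (-⟪x, ξ⟫) : Circle) : ℂ) with he
  have hem : Continuous e := continuous_subtype_val.comp (Real.continuous_fourierChar.comp
    (continuous_id.inner continuous_const).neg)
  have hen : ∀ x, ‖e x‖ = 1 := fun x => Circle.norm_coe _
  have hint' : Integrable (fun q : E d × (ℝ × E d) => e q.1 • (truncKernel k χ (t, q.1) q.2 •
      f q.2)) (volume.prod volume) := by
    refine hint.mono ((hem.comp continuous_fst).aestronglyMeasurable.smul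
      hint.aestronglyMeasurable) (ae_of_all _ fun q => ?_)
    rw [norm_smul, hen, one_mul]
  set G : ℝ × E d → H := fun w => (∫ x, e x * truncKernel k χ (t, x) w) • f w with hG
  have h1 : 𝓕 (fun x => kernelOp volume (truncKernel k χ) f (t, x)) ξ = ∫ w, G w := by
    rw [Real.fourier_eq]
    calc ∫ x, Real.fourierChar (-⟪x, ξ⟫) • kernelOp volume (truncKernel k χ) f (t, x)
        = ∫ x, ∫ w, e x • (truncKernel k χ (t, x) w • f w) := by
          refine integral_congr_ae (ae_of_all _ fun x => ?_)
          simp only [kernelOp]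
          rw [integral_smul]
          rfl
      _ = ∫ w, ∫ x, e x • (truncKernel k χ (t, x) w • f w) := integral_integral_swap hint'
      _ = ∫ w, G w := by
          refine integral_congr_ae (ae_of_all _ fun w => ?_)
          simp only [hG, smul_smul]
          exact integral_smul_const _ _
  have hGi : Integrable G (volume.prod volume) := by
    have h2 := hint'.integral_prod_right
    refine h2.congr (ae_of_all _ fun w => ?_)
    simp only [hG, smul_smul]
    exact integral_smul_const _ _
  -- Integrating in x first turns the spatial convolution into the transform of the kernel times a
  -- character in y.
  have hGs : ∀ s y, G (s, y) = if s < t then ((χ (t - s) : ℂ) * 𝓕 (k t s) ξ) •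
      (Real.fourierChar (-⟪y, ξ⟫) • f (s, y)) else 0 := by
    intro s y
    simp only [hG, truncKernel]
    split_ifs with hst
    · have h3 : ∫ x, e x * ((χ (t - s) : ℂ) * k t s (x - y)) =
          ((χ (t - s) : ℂ) * 𝓕 (k t s) ξ) * e y := by
        rw [← integral_add_right_eq_self _ y, Real.fourier_eq, ← integral_const_mul,
          ← integral_mul_const]
        refine integral_congr_ae (ae_of_all _ fun x => ?_)
        simp only [he, inner_add_left, neg_add, AddChar.map_add_eq_mul, Circle.coe_mul,
          add_sub_cancel_right, Circle.smul_def, smul_eq_mul]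
        ring
      rw [h3, mul_smul]
      rfl
    · simp
  rw [h1, Measure.volume_eq_prod, integral_prod _ hGi]
  refine (enorm_integral_le_lintegral_enorm _).trans (lintegral_mono fun s => ?_)
  simp only [hGs]
  split_ifs with hst
  · have hτ : 0 < t - s := by linarith
    rw [integral_smul, ← Real.fourier_eq, enorm_smul]
    gcongr
    rw [← ofReal_norm]
    refine ENNReal.ofReal_le_ofReal ?_
    rw [norm_mul, Complex.norm_real, Real.norm_of_nonneg (hχ.nonneg _ hτ)]
    calc χ (t - s) * ‖𝓕 (k t s) ξ‖ ≤ 1 * (M * ‖ξ‖ ^ γ * Real.exp (-(κ * (t - s) * ‖ξ‖ ^ γ))) := by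
          gcongr
          · exact hχ.le_one _ hτ
          · exact hk.fourier_le s t ξ hst hξ
      _ = _ := one_mul _
  · simp

omit [InnerProductSpace ℂ H] in
theorem exists_lintegral_slice_le {f : ℝ × E d → H} (hf : Continuous f)
    (hfs : HasCompactSupport f) : ∃ C : ℝ, 0 ≤ C ∧ (∀ w, ‖f w‖ₑ ≤ ENNReal.ofReal C) ∧
      (∀ s, ∫⁻ y, ‖f (s, y)‖ₑ ≤ ENNReal.ofReal C) ∧ ∀ s, HasCompactSupport fun y => f (s, y) := by
  obtain ⟨C, hC⟩ := hf.bounded_above_of_compact_support hfs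
  have hC0 : 0 ≤ C := (norm_nonneg _).trans (hC 0)
  set S : Set (E d) := Prod.snd '' tsupport f with hS
  have hSc : IsCompact S := hfs.isCompact.image continuous_snd
  have hsupp : ∀ s y, y ∉ S → f (s, y) = 0 := fun s y hy =>
    image_eq_zero_of_notMem_tsupport fun h => hy ⟨(s, y), h, rfl⟩
  have hfin : volume S ≠ ⊤ := hSc.measure_ne_top
  have hle : ∀ w, ‖f w‖ₑ ≤ ENNReal.ofReal C := fun w => by
    rw [← ofReal_norm]; exact ENNReal.ofReal_le_ofReal (hC w)
  refine ⟨C + C * (volume S).toReal, by positivity, fun w => (hle w).trans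
    (ENNReal.ofReal_le_ofReal (by have : 0 ≤ C * (volume S).toReal := by positivity
                                  linarith)), fun s => ?_,
    fun s => HasCompactSupport.intro hSc fun y hy => hsupp s y hy⟩
  calc ∫⁻ y, ‖f (s, y)‖ₑ ≤ ∫⁻ y, S.indicator (fun _ => ENNReal.ofReal C) y := by
        refine lintegral_mono fun y => ?_
        by_cases hy : y ∈ S
        · rw [indicator_of_mem hy]; exact hle _
        · simp [hsupp s y hy]
    _ = ENNReal.ofReal C * volume S := by
        rw [lintegral_indicator hSc.measurableSet, setLIntegral_const]
    _ = ENNReal.ofReal (C * (volume S).toReal) := by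
        rw [ENNReal.ofReal_mul hC0, ENNReal.ofReal_toReal hfin]
    _ ≤ _ := ENNReal.ofReal_le_ofReal (by linarith)

theorem KernelBounds.integrable_truncKernel_smul (hM : 0 ≤ M) (hk : KernelBounds γ κ η M B k)
    (hχ : TimeCutoff χ) {f : ℝ × E d → H} (hf : Continuous f) (hfs : HasCompactSupport f) (t : ℝ) :
    Integrable (fun q : E d × (ℝ × E d) => truncKernel k χ (t, q.1) q.2 • f q.2)
      (volume.prod volume) := by
  obtain ⟨C, hC0, hCf, hCs, hcs⟩ := exists_lintegral_slice_le hf hfs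
  have hfm : AEStronglyMeasurable f volume := hf.aestronglyMeasurable
  have hfi : ∀ s, Integrable fun y => f (s, y) := fun s =>
    (hf.comp (Continuous.prodMk_right s)).integrable_of_hasCompactSupport (hcs s)
  have hfin : ∫⁻ τ in Ioi (0 : ℝ), ENNReal.ofReal (M * (χ τ * τ⁻¹)) ≠ ⊤ := by
    simp only [ENNReal.ofReal_mul hM]
    rw [lintegral_const_mul' _ _ (by simp)]
    exact ENNReal.mul_ne_top (by simp) hχ.lintegral_ne_top
  have hm : Measurable fun q : E d × (ℝ × E d) => truncKernel k χ (t, q.1) q.2 :=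
    (measurable_truncKernel hk.meas hχ.meas).comp ((measurable_const.prodMk measurable_fst).prodMk measurable_snd)
  have hms : AEStronglyMeasurable (fun q : E d × (ℝ × E d) => truncKernel k χ (t, q.1) q.2 •
      f q.2) (volume.prod volume) := hm.aestronglyMeasurable.smul hfm.comp_snd
  refine ⟨hms, ?_⟩
  rw [hasFiniteIntegral_iff_enorm, lintegral_prod_symm _ hms.enorm]
  set g : ℝ → ℝ≥0∞ := fun s => if s < t then
    ENNReal.ofReal (M * (χ (t - s) * (t - s)⁻¹)) else 0 with hg
  have hgm : Measurable g := by
    refine Measurable.ite (measurableSet_lt measurable_id measurable_const) ?_ measurable_const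
    exact ENNReal.measurable_ofReal.comp (((hχ.meas.comp (measurable_const.sub measurable_id)).mul
      (measurable_const.sub measurable_id).inv).const_mul _)
  calc ∫⁻ w, ∫⁻ x, ‖truncKernel k χ (t, x) w • f w‖ₑ ≤ ∫⁻ w, g w.1 * ‖f w‖ₑ := by
        refine lintegral_mono fun w => ?_
        simp only [enorm_smul]
        rw [lintegral_mul_const' _ _ (by simp)]
        gcongr
        exact hk.lintegral_truncKernel_left_le hχ t w
    _ = ∫⁻ s, ∫⁻ y, g s * ‖f (s, y)‖ₑ :=
        lintegral_volume_prod ((hgm.comp measurable_fst).aemeasurable.mul hfm.enorm)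
    _ ≤ ∫⁻ s, g s * ENNReal.ofReal C := by
        refine lintegral_mono fun s => ?_
        rw [lintegral_const_mul'' _ (hfi s).1.enorm]
        gcongr
        exact hCs s
    _ = (∫⁻ s, g s) * ENNReal.ofReal C := lintegral_mul_const' _ _ (by simp)
    _ < ⊤ := by
        rw [hg, lintegral_ite_sub_left (fun τ => ENNReal.ofReal (M * (χ τ * τ⁻¹))) t]
        exact ENNReal.mul_lt_top hfin.lt_top (by simp)

/-- Each slice is bounded, by the rows of the Schur kernel, and integrable, hence square integrable.
Plancherel needs both integrability and L². -/
theorem KernelBounds.memLp_slice (hM : 0 ≤ M) (hk : KernelBounds γ κ η M B k)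
    (hχ : TimeCutoff χ) {f : ℝ × E d → H} (hf : Continuous f) (hfs : HasCompactSupport f) (t : ℝ) :
    MemLp (fun x => kernelOp volume (truncKernel k χ) f (t, x)) 2 := by
  obtain ⟨S, hS⟩ := hk.schurKernel hM hχ
  obtain ⟨C, hC0, hCf, -⟩ := exists_lintegral_slice_le hf hfs
  have hslice : Integrable (fun x => kernelOp volume (truncKernel k χ) f (t, x)) :=
    (hk.integrable_truncKernel_smul hM hχ hf hfs t).integral_prod_left
  have hbdd : ∀ z, ‖kernelOp volume (truncKernel k χ) f z‖ₑ ≤ S * ENNReal.ofReal C := by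
    intro z
    calc _ ≤ ∫⁻ w, ‖truncKernel k χ z w‖ₑ * ‖f w‖ₑ := enorm_kernelOp_le _ _ _
      _ ≤ ∫⁻ w, ‖truncKernel k χ z w‖ₑ * ENNReal.ofReal C := by gcongr; exact hCf _
      _ ≤ _ := by
          rw [lintegral_mul_const' _ _ (by simp)]
          gcongr
          exact hS.row z
  have h2 := memLp_ofReal_iff (p := 2) two_pos hslice.1
  simp only [ENNReal.ofReal_ofNat, ENNReal.rpow_two] at h2
  rw [h2]
  refine ne_top_of_le_ne_top (b := S * ENNReal.ofReal C *
    ∫⁻ x, ‖kernelOp volume (truncKernel k χ) f (t, x)‖ₑ) ?_ ?_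
  · exact ENNReal.mul_ne_top (ENNReal.mul_ne_top (by simp) (by simp)) hslice.2.ne
  · rw [← lintegral_const_mul'' _ hslice.1.enorm]
    refine lintegral_mono fun x => ?_
    rw [sq]
    gcongr
    exact hbdd _

theorem measurable_enorm_fourier_slice {f : ℝ × E d → H} (hf : Continuous f) :
    Measurable fun q : E d × ℝ => ‖𝓕 (fun y => f (q.2, y)) q.1‖ₑ := by
  have hcont : Continuous fun q : (E d × ℝ) × E d =>
      Real.fourierChar (-⟪q.2, q.1.1⟫) • f (q.1.2, q.2) := by
    have h1 : Continuous fun q : (E d × ℝ) × E d => Real.fourierChar (-⟪q.2, q.1.1⟫) :=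
      Real.continuous_fourierChar.comp (continuous_snd.inner continuous_fst.fst).neg
    exact h1.smul (hf.comp (continuous_fst.snd.prodMk continuous_snd))
  exact (hcont.stronglyMeasurable.integral_prod_right' (ν := volume)).enorm

/-- The dominating kernel of the slices on the Fourier side. -/
def decayKernel (d : ℕ) (γ κ M : ℝ) (ξ : E d) (t s : ℝ) : ℝ≥0∞ :=
  if s < t then ENNReal.ofReal (M * ‖ξ‖ ^ γ * Real.exp (-(κ * (t - s) * ‖ξ‖ ^ γ))) else 0

theorem measurable_decayKernel :
    Measurable fun q : E d × ℝ × ℝ => decayKernel d γ κ M q.1 q.2.1 q.2.2 := by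
  have h : Measurable fun q : E d × ℝ × ℝ =>
      ENNReal.ofReal (M * ‖q.1‖ ^ γ * Real.exp (-(κ * (q.2.1 - q.2.2) * ‖q.1‖ ^ γ))) := by
    fun_prop
  exact h.ite (measurableSet_lt measurable_snd.snd measurable_snd.fst) measurable_const

theorem lintegral_decayKernel (hκ : 0 < κ) (hM : 0 ≤ M) {ξ : E d} (hξ : ξ ≠ 0) :
    (∀ t, ∫⁻ s, decayKernel d γ κ M ξ t s = ENNReal.ofReal (M / κ)) ∧
      ∀ s, ∫⁻ t, decayKernel d γ κ M ξ t s = ENNReal.ofReal (M / κ) := by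
  have hl : 0 < ‖ξ‖ ^ γ := Real.rpow_pos_of_pos (norm_pos_iff.2 hξ) _
  exact ⟨fun t => (lintegral_ite_sub_left _ t).trans (lintegral_exp_decay hl hκ hM),
    fun s => (lintegral_ite_sub_right _ s).trans (lintegral_exp_decay hl hκ hM)⟩

/-- Schur's test on the frequency side, one frequency at a time. -/
theorem lintegral_sq_lintegral_le_of_ae {α : Type*} [MeasurableSpace α] {ν : Measure α} [SFinite ν]
    {a : α → ℝ → ℝ → ℝ≥0∞} {u : α → ℝ → ℝ≥0∞} {A : ℝ≥0∞} (hA : A ≠ ⊤)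
    (ha : Measurable fun q : α × ℝ × ℝ => a q.1 q.2.1 q.2.2)
    (hu : Measurable fun q : α × ℝ => u q.1 q.2)
    (hrow : ∀ᵐ ξ ∂ν, (∀ t, ∫⁻ s, a ξ t s = A) ∧ ∀ s, ∫⁻ t, a ξ t s = A) :
    ∫⁻ t, ∫⁻ ξ, (∫⁻ s, a ξ t s * u ξ s) ^ 2 ∂ν ≤ A ^ 2 * ∫⁻ s, ∫⁻ ξ, u ξ s ^ 2 ∂ν := by
  have h1 : Measurable fun p : (ℝ × α) × ℝ => a p.1.2 p.1.1 p.2 :=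
    ha.comp (measurable_fst.snd.prodMk (measurable_fst.fst.prodMk measurable_snd))
  have h2 : Measurable fun p : (ℝ × α) × ℝ => u p.1.2 p.2 :=
    hu.comp (measurable_fst.snd.prodMk measurable_snd)
  have hI : Measurable fun p : ℝ × α => (∫⁻ s, a p.2 p.1 s * u p.2 s) ^ 2 :=
    (h1.mul h2).lintegral_prod_right'.pow_const 2
  have step : ∀ᵐ ξ ∂ν, ∫⁻ t, (∫⁻ s, a ξ t s * u ξ s) ^ 2 ≤ A ^ 2 * ∫⁻ s, u ξ s ^ 2 := by
    filter_upwards [hrow] with ξ hξ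
    have h3 := lintegral_rpow_lintegral_mul_le (μ := (volume : Measure ℝ))
      (ν := (volume : Measure ℝ)) (a := a ξ) (A := A) (B := A) (u := u ξ) (p := 2)
      (ha.comp (measurable_const.prodMk measurable_id)) (ae_of_all _ fun t => (hξ.1 t).le)
      (ae_of_all _ fun s => (hξ.2 s).le) one_lt_two
      (hu.comp (measurable_const.prodMk measurable_id)).aemeasurable
    have e1 : (2 : ℝ) - 1 = 1 := by norm_num
    simp only [ENNReal.rpow_two, e1, ENNReal.rpow_one] at h3
    rwa [sq]
  rw [lintegral_lintegral_swap hI.aemeasurable]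
  refine (lintegral_mono_ae step).trans (le_of_eq ?_)
  rw [lintegral_const_mul' _ _ (ENNReal.pow_ne_top hA),
    lintegral_lintegral_swap (hu.pow_const 2).aemeasurable]

/-- Plancherel in space at each fixed time, Schur's test in time at each fixed frequency with a
kernel of mass M/κ, and Plancherel back. -/
theorem KernelBounds.eLpNorm_two_kernelOp_le_of_continuous [CompleteSpace H] (hd : 0 < d)
    (hκ : 0 < κ)
    (hM : 0 ≤ M) (hk : KernelBounds γ κ η M B k) (hχ : TimeCutoff χ) {f : ℝ × E d → H}
    (hf : Continuous f) (hfs : HasCompactSupport f) :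
    eLpNorm (kernelOp volume (truncKernel k χ) f) 2 volume ≤
      ENNReal.ofReal (M / κ) * eLpNorm f 2 volume := by
  obtain ⟨S, hS⟩ := hk.schurKernel hM hχ
  obtain ⟨C, hC0, hCf, hCs, hcs⟩ := exists_lintegral_slice_le hf hfs
  have hfm : AEStronglyMeasurable f volume := hf.aestronglyMeasurable
  have hfi : ∀ s, Integrable fun y => f (s, y) := fun s =>
    (hf.comp (Continuous.prodMk_right s)).integrable_of_hasCompactSupport (hcs s)
  have hf2 : ∀ s, MemLp (fun y => f (s, y)) 2 := fun s =>
    (hf.comp (Continuous.prodMk_right s)).memLp_of_hasCompactSupport (hcs s)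
  have hint := fun t => hk.integrable_truncKernel_smul hM hχ hf hfs t
  have hslice : ∀ t, Integrable (fun x => kernelOp volume (truncKernel k χ) f (t, x)) :=
    fun t => (hint t).integral_prod_left
  have hslice2 := fun t => hk.memLp_slice hM hχ hf hfs t
  rw [eLpNorm_two_le_iff]
  calc ∫⁻ z, ‖kernelOp volume (truncKernel k χ) f z‖ₑ ^ 2
      = ∫⁻ t, ∫⁻ x, ‖kernelOp volume (truncKernel k χ) f (t, x)‖ₑ ^ 2 :=
        lintegral_volume_prod ((aestronglyMeasurable_kernelOp hS.meas hfm).enorm.pow_const 2)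
    _ = ∫⁻ t, ∫⁻ ξ, ‖𝓕 (fun x => kernelOp volume (truncKernel k χ) f (t, x)) ξ‖ₑ ^ 2 :=
        lintegral_congr fun t => (lintegral_enorm_fourier_sq (hslice t) (hslice2 t)).symm
    _ ≤ ∫⁻ t, ∫⁻ ξ, (∫⁻ s, decayKernel d γ κ M ξ t s * ‖𝓕 (fun y => f (s, y)) ξ‖ₑ) ^ 2 := by
        refine lintegral_mono fun t => lintegral_mono_ae ?_
        filter_upwards [ae_ne_zero hd] with ξ hξ
        exact pow_le_pow_left' (hk.enorm_fourier_slice_le hχ (hint t) hξ) 2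
    _ ≤ ENNReal.ofReal (M / κ) ^ 2 * ∫⁻ s, ∫⁻ ξ, ‖𝓕 (fun y => f (s, y)) ξ‖ₑ ^ 2 :=
        lintegral_sq_lintegral_le_of_ae ENNReal.ofReal_ne_top measurable_decayKernel
          (measurable_enorm_fourier_slice hf)
          ((ae_ne_zero hd).mono fun ξ hξ => lintegral_decayKernel hκ hM hξ)
    _ = ENNReal.ofReal (M / κ) ^ 2 * ∫⁻ s, ∫⁻ y, ‖f (s, y)‖ₑ ^ 2 := by
        congr 1
        exact lintegral_congr fun s => lintegral_enorm_fourier_sq (hfi s) (hf2 s)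
    _ = _ := by
        rw [lintegral_volume_prod (hfm.enorm.pow_const 2)]

theorem KernelBounds.eLpNorm_two_kernelOp_le [CompleteSpace H] (hd : 0 < d) (hκ : 0 < κ)
    (hM : 0 ≤ M) (hk : KernelBounds γ κ η M B k) (hχ : TimeCutoff χ) {f : ℝ × E d → H}
    (hf : MemLp f 2 volume) :
    eLpNorm (kernelOp volume (truncKernel k χ) f) 2 volume ≤
      ENNReal.ofReal (M / κ) * eLpNorm f 2 volume := by
  obtain ⟨S, hS⟩ := hk.schurKernel hM hχ
  have h := hS.eLpNorm_le_of_continuous (H := H) (p := 2) one_lt_two (C := ENNReal.ofReal (M / κ))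
    ENNReal.ofReal_ne_top
  simp only [ENNReal.ofReal_ofNat] at h
  exact h (fun f hf hfs => hk.eLpNorm_two_kernelOp_le_of_continuous hd hκ hM hχ hf hfs) hf

end LTwo

open scoped FourierTransform

/-! ### Hörmander's condition on parabolic boxes -/

section Hormander

variable {d : ℕ} {γ κ η M B : ℝ} {k : ℝ → ℝ → E d → ℂ} {χ : ℝ → ℝ}

theorem lintegral_Ioi_rpow_of_lt {c a : ℝ} (hc : 0 < c) (ha : a < -1) :
    ∫⁻ τ in Ioi c, ENNReal.ofReal (τ ^ a) = ENNReal.ofReal (-c ^ (a + 1) / (a + 1)) := by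
  rw [← ofReal_integral_eq_lintegral_ofReal (integrableOn_Ioi_rpow_of_lt ha hc)
    ((ae_restrict_iff' measurableSet_Ioi).2 (ae_of_all _ fun τ hτ =>
      Real.rpow_nonneg (hc.trans hτ).le _)), integral_Ioi_rpow_of_lt ha hc]

theorem lintegral_Ioc_rpow {c a : ℝ} (hc : 0 < c) (ha : -1 < a) :
    ∫⁻ τ in Ioc 0 c, ENNReal.ofReal (τ ^ a) = ENNReal.ofReal (c ^ (a + 1) / (a + 1)) := by
  have hi : IntegrableOn (fun τ : ℝ => τ ^ a) (Ioc 0 c) :=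
    (intervalIntegrable_iff_integrableOn_Ioc_of_le hc.le).1 (intervalIntegral.intervalIntegrable_rpow' ha)
  rw [← ofReal_integral_eq_lintegral_ofReal hi
    ((ae_restrict_iff' measurableSet_Ioc).2 (ae_of_all _ fun τ hτ =>
      Real.rpow_nonneg hτ.1.le _)), ← intervalIntegral.integral_of_le hc.le, integral_rpow (Or.inl ha),
      Real.zero_rpow (by linarith), sub_zero]

/-- A product rule: the increment of k, plus the increment of the cutoff times k. The factor 3 is 1
from the kernel and 2 from the Lipschitz constant of the cutoff. -/
theorem KernelBounds.lintegral_truncKernel_sub_le (hM : 0 ≤ M) (hk : KernelBounds γ κ η M B k)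
    (hχ : TimeCutoff χ) {t s₀ s₁ : ℝ} {y₀ y₁ : E d} (hs : s₀ ≤ s₁) (ht : s₁ < t)
    (hsB : s₁ - s₀ ≤ B * (t - s₁)) (hyB : ‖y₁ - y₀‖ ≤ B * (t - s₁) ^ (1 / γ)) :
    ∫⁻ x, ‖truncKernel k χ (t, x) (s₀, y₀) - truncKernel k χ (t, x) (s₁, y₁)‖ₑ ≤
      ENNReal.ofReal (M * (3 * ((s₁ - s₀) * (t - s₁) ^ (-2 : ℝ)) +
        ‖y₁ - y₀‖ * (t - s₁) ^ (-1 - 1 / γ))) := by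
  have hτ : 0 < t - s₁ := by linarith
  have hτ0 : 0 < t - s₀ := by linarith
  have hs0 : 0 ≤ s₁ - s₀ := by linarith
  have hpt : ∀ x, ‖truncKernel k χ (t, x) (s₀, y₀) - truncKernel k χ (t, x) (s₁, y₁)‖ₑ ≤
      ‖k t s₀ (x - y₀) - k t s₁ (x - y₁)‖ₑ +
        ENNReal.ofReal (2 * ((s₁ - s₀) / (t - s₁))) * ‖k t s₁ (x - y₁)‖ₑ := by
    intro x
    simp only [truncKernel, if_pos ht, if_pos (hs.trans_lt ht)]
    have e : (χ (t - s₀) : ℂ) * k t s₀ (x - y₀) - (χ (t - s₁) : ℂ) * k t s₁ (x - y₁) =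
        (χ (t - s₀) : ℂ) * (k t s₀ (x - y₀) - k t s₁ (x - y₁)) +
        ((χ (t - s₀) - χ (t - s₁) : ℝ) : ℂ) * k t s₁ (x - y₁) := by
      push_cast; ring
    rw [e]
    refine (enorm_add_le _ _).trans (add_le_add ?_ ?_)
    · rw [enorm_mul, ← ofReal_norm (χ _ : ℂ), Complex.norm_real,
        Real.norm_of_nonneg (hχ.nonneg _ hτ0)]
      calc _ ≤ 1 * ‖k t s₀ (x - y₀) - k t s₁ (x - y₁)‖ₑ := by
            gcongr
            exact ENNReal.ofReal_le_one.2 (hχ.le_one _ hτ0)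
        _ = _ := one_mul _
    · rw [enorm_mul, ← ofReal_norm ((_ : ℝ) : ℂ), Complex.norm_real]
      gcongr
      have := hχ.lipschitz (t - s₁) (t - s₀) hτ (by linarith)
      rw [show t - s₀ - (t - s₁) = s₁ - s₀ by ring] at this
      exact this
  have hm : Measurable fun x => ‖k t s₁ (x - y₁)‖ₑ :=
    (hk.meas.comp (measurable_const.prodMk (measurable_const.prodMk
      (measurable_id.sub_const y₁)))).enorm
  have h1 : ∫⁻ x, ‖k t s₀ (x - y₀) - k t s₁ (x - y₁)‖ₑ ≤
      ENNReal.ofReal (M * ((s₁ - s₀) * (t - s₁) ^ (-2 : ℝ) +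
        ‖y₁ - y₀‖ * (t - s₁) ^ (-1 - 1 / γ))) := by
    refine le_trans (le_of_eq ?_) (hk.sub_start s₀ s₁ t (y₁ - y₀) hs ht hsB hyB)
    rw [← lintegral_add_right_eq_self _ y₁]
    refine lintegral_congr fun x => ?_
    rw [add_sub_cancel_right, add_sub_assoc]
  have h2 : ∫⁻ x, ‖k t s₁ (x - y₁)‖ₑ ≤ ENNReal.ofReal (M * (t - s₁)⁻¹) := by
    rw [lintegral_sub_right_eq_self (fun x => ‖k t s₁ x‖ₑ) y₁]
    exact hk.lint _ _ ht
  calc _ ≤ ∫⁻ x, (‖k t s₀ (x - y₀) - k t s₁ (x - y₁)‖ₑ +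
        ENNReal.ofReal (2 * ((s₁ - s₀) / (t - s₁))) * ‖k t s₁ (x - y₁)‖ₑ) := lintegral_mono hpt
    _ = (∫⁻ x, ‖k t s₀ (x - y₀) - k t s₁ (x - y₁)‖ₑ) +
        ENNReal.ofReal (2 * ((s₁ - s₀) / (t - s₁))) * ∫⁻ x, ‖k t s₁ (x - y₁)‖ₑ := by
        rw [lintegral_add_right _ (hm.const_mul _), lintegral_const_mul _ hm]
    _ ≤ _ := by
        refine (add_le_add h1 (mul_le_mul_right h2 _)).trans (le_of_eq ?_)
        rw [← ENNReal.ofReal_mul (by positivity), ← ENNReal.ofReal_add (by positivity)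
          (by positivity)]
        congr 1
        rw [Real.rpow_neg hτ.le, Real.rpow_two]
        field_simp
        ring

/-- The constant in Hörmander's condition. -/
def horConst (γ η M B : ℝ) : ℝ :=
  M * (3 + B * γ) + 2 * (M * (γ / η) * (3 + B) ^ (η / γ))

/-- Parabolic boxes. -/
def parBox (γ B ρ : ℝ) (w : ℝ × E d) : Set (ℝ × E d) :=
  {z | |z.1 - w.1| ≤ (2 + B) * ρ ^ γ ∧ ‖z.2 - w.2‖ ≤ (2 + B) * ρ}

theorem measurableSet_parBox (γ B ρ : ℝ) (w : ℝ × E d) : MeasurableSet (parBox γ B ρ w) :=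
  (measurableSet_le (measurable_fst.sub_const w.1).abs measurable_const).inter
    (measurableSet_le (measurable_snd.sub_const w.2).norm measurable_const)

/-- Near in time but far in space no cancellation is needed. There ‖x - w.2‖ ≥ ρ, so the factor (‖x
- w.2‖/ρ)^η ≥ 1 may be inserted. The moment bound τ^{-1+η/γ} is integrable on (0, (3+B)ρ^γ], and its
integral scales like ρ^η, which cancels ρ^{-η}. -/
theorem KernelBounds.lintegral_truncKernel_far_le (hγ : 0 < γ) (hη : 0 < η) (hM : 0 ≤ M)
    (hB : 0 ≤ B) (hk : KernelBounds γ κ η M B k) (hχ : TimeCutoff χ) {ρ : ℝ} (hρ : 0 < ρ)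
    {w w' : ℝ × E d} (hw1 : |w.1 - w'.1| ≤ ρ ^ γ) (hw2 : ‖w.2 - w'.2‖ ≤ B * ρ) :
    ∫⁻ z in {z : ℝ × E d | |z.1 - w'.1| ≤ (2 + B) * ρ ^ γ ∧ (2 + B) * ρ < ‖z.2 - w'.2‖},
      ‖truncKernel k χ z w‖ₑ ≤ ENNReal.ofReal (M * (γ / η) * (3 + B) ^ (η / γ)) := by
  set S := {z : ℝ × E d | |z.1 - w'.1| ≤ (2 + B) * ρ ^ γ ∧ (2 + B) * ρ < ‖z.2 - w'.2‖} with hS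
  have hSm : MeasurableSet S :=
    (measurableSet_le (measurable_fst.sub_const w'.1).abs measurable_const).inter
      (measurableSet_lt measurable_const (measurable_snd.sub_const w'.2).norm)
  have hm : Measurable fun z => ‖truncKernel k χ z w‖ₑ :=
    ((measurable_truncKernel hk.meas hχ.meas).comp measurable_prodMk_right).enorm
  have hT : 0 < ρ ^ γ := by positivity
  have ha : 0 < η / γ := by positivity
  set c := (3 + B) * ρ ^ γ with hc
  have hc0 : 0 < c := by positivity
  rw [← lintegral_indicator hSm, lintegral_volume_prod (hm.indicator hSm).aemeasurable]
  have hslice : ∀ t, ∫⁻ x, S.indicator (fun z => ‖truncKernel k χ z w‖ₑ) (t, x) ≤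
      if w.1 < t then (Ioc 0 c).indicator
        (fun τ => ENNReal.ofReal (M * ρ ^ (-η)) * ENNReal.ofReal (τ ^ (-1 + η / γ))) (t - w.1)
        else 0 := by
    intro t
    split_ifs with ht
    · have hτ : 0 < t - w.1 := by linarith
      by_cases htc : t - w.1 ≤ c
      · rw [indicator_of_mem (show t - w.1 ∈ Ioc 0 c from ⟨hτ, htc⟩)]
        have hpt : ∀ x, S.indicator (fun z => ‖truncKernel k χ z w‖ₑ) (t, x) ≤
            ENNReal.ofReal (ρ ^ (-η)) * (‖k t w.1 (x - w.2)‖ₑ *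
              ENNReal.ofReal (‖x - w.2‖ ^ η)) := by
          intro x
          by_cases hx : (t, x) ∈ S
          · rw [indicator_of_mem hx]
            simp only [truncKernel, if_pos ht]
            have hx1 : ρ ≤ ‖x - w.2‖ := by
              have h1 : (2 + B) * ρ < ‖x - w'.2‖ := hx.2
              have h2 : ‖x - w'.2‖ ≤ ‖x - w.2‖ + ‖w.2 - w'.2‖ := by
                rw [← sub_add_sub_cancel x w.2 w'.2]; exact norm_add_le _ _
              nlinarith
            have h3 : ‖((χ (t - w.1) : ℝ) : ℂ)‖ₑ ≤ 1 := by
              rw [← ofReal_norm, Complex.norm_real, Real.norm_of_nonneg (hχ.nonneg _ hτ)]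
              exact ENNReal.ofReal_le_one.2 (hχ.le_one _ hτ)
            have h4 : 1 ≤ ENNReal.ofReal (ρ ^ (-η)) * ENNReal.ofReal (‖x - w.2‖ ^ η) := by
              rw [← ENNReal.ofReal_mul (by positivity), ENNReal.one_le_ofReal,
                Real.rpow_neg hρ.le, inv_mul_eq_div, one_le_div (by positivity)]
              exact Real.rpow_le_rpow hρ.le hx1 hη.le
            rw [enorm_mul]
            calc _ ≤ 1 * ‖k t w.1 (x - w.2)‖ₑ := by gcongr
              _ ≤ (ENNReal.ofReal (ρ ^ (-η)) * ENNReal.ofReal (‖x - w.2‖ ^ η)) *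
                  ‖k t w.1 (x - w.2)‖ₑ := by gcongr
              _ = _ := by ring
          · rw [indicator_of_notMem hx]; exact zero_le
        calc _ ≤ ∫⁻ x, ENNReal.ofReal (ρ ^ (-η)) * (‖k t w.1 (x - w.2)‖ₑ *
              ENNReal.ofReal (‖x - w.2‖ ^ η)) := lintegral_mono hpt
          _ = ENNReal.ofReal (ρ ^ (-η)) * ∫⁻ x, ‖k t w.1 x‖ₑ * ENNReal.ofReal (‖x‖ ^ η) := by
              rw [lintegral_const_mul' _ _ (by simp), lintegral_sub_right_eq_self
                (fun x => ‖k t w.1 x‖ₑ * ENNReal.ofReal (‖x‖ ^ η)) w.2]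
          _ ≤ ENNReal.ofReal (ρ ^ (-η)) * ENNReal.ofReal (M * (t - w.1) ^ (-1 + η / γ)) := by
              gcongr
              exact hk.moment _ _ ht
          _ = _ := by
              rw [ENNReal.ofReal_mul hM, ENNReal.ofReal_mul hM]
              ring
      · have hemp : ∀ x, S.indicator (fun z => ‖truncKernel k χ z w‖ₑ) (t, x) = 0 := by
          intro x
          refine indicator_of_notMem (fun hx => htc ?_) _
          have h1 : |t - w'.1| ≤ (2 + B) * ρ ^ γ := hx.1
          have h2 := abs_le.1 h1
          have h3 := abs_le.1 hw1
          rw [hc]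
          linarith
        simp [hemp]
    · have hemp : ∀ x, S.indicator (fun z => ‖truncKernel k χ z w‖ₑ) (t, x) = 0 := by
        intro x
        simp [indicator, truncKernel, ht]
      simp [hemp]
  refine (lintegral_mono hslice).trans (le_of_eq ?_)
  rw [lintegral_ite_sub_right (fun τ => (Ioc 0 c).indicator
    (fun τ => ENNReal.ofReal (M * ρ ^ (-η)) * ENNReal.ofReal (τ ^ (-1 + η / γ))) τ) w.1,
    lintegral_indicator measurableSet_Ioc, Measure.restrict_restrict measurableSet_Ioc,
    inter_eq_left.2 Ioc_subset_Ioi_self, lintegral_const_mul' _ _ (by simp),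
    lintegral_Ioc_rpow hc0 (by linarith), ← ENNReal.ofReal_mul (by positivity)]
  congr 1
  rw [show -1 + η / γ + 1 = η / γ by ring, hc, Real.mul_rpow (by positivity) hT.le,
    ← Real.rpow_mul hρ.le, mul_div_cancel₀ η hγ.ne', Real.rpow_neg hρ.le]
  field_simp

/-- At such times z either precedes both sources, where the kernel vanishes, or follows both by more
than T = ρ^γ. In the second case the increment bounds are integrable at infinity and all powers of ρ
cancel. The reference time s' is left free between s₀ and s₁ because the centre of the box may be
either of the two sources. -/
theorem KernelBounds.lintegral_truncKernel_late_le (hγ : 0 < γ) (hM : 0 ≤ M) (hB : 1 ≤ B)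
    (hk : KernelBounds γ κ η M B k) (hχ : TimeCutoff χ) {ρ : ℝ} (hρ : 0 < ρ) {s₀ s₁ s' : ℝ}
    {y₀ y₁ : E d} (hs : s₀ ≤ s₁) (hs₁ : s₁ - s₀ ≤ ρ ^ γ) (hs' : s₀ ≤ s') (hs'' : s' ≤ s₁)
    (hy : ‖y₁ - y₀‖ ≤ B * ρ) :
    ∫⁻ z in {z : ℝ × E d | (2 + B) * ρ ^ γ < |z.1 - s'|},
      ‖truncKernel k χ z (s₀, y₀) - truncKernel k χ z (s₁, y₁)‖ₑ ≤
        ENNReal.ofReal (M * (3 + B * γ)) := by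
  set S := {z : ℝ × E d | (2 + B) * ρ ^ γ < |z.1 - s'|} with hS
  have hSm : MeasurableSet S := measurableSet_lt measurable_const (measurable_fst.sub_const s').abs
  have hmk := measurable_truncKernel hk.meas hχ.meas
  have hm : Measurable fun z => ‖truncKernel k χ z (s₀, y₀) - truncKernel k χ z (s₁, y₁)‖ₑ :=
    ((hmk.comp measurable_prodMk_right).sub (hmk.comp measurable_prodMk_right)).enorm
  set T := ρ ^ γ with hT
  have hT0 : 0 < T := by positivity
  have hTρ : T ^ (1 / γ) = ρ := by
    rw [hT, ← Real.rpow_mul hρ.le, mul_one_div_cancel hγ.ne', Real.rpow_one]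
  set G : ℝ → ℝ≥0∞ := (Ioi T).indicator fun τ =>
    ENNReal.ofReal (3 * M * T) * ENNReal.ofReal (τ ^ (-2 : ℝ)) +
      ENNReal.ofReal (M * B * ρ) * ENNReal.ofReal (τ ^ (-1 - 1 / γ)) with hG
  rw [← lintegral_indicator hSm, lintegral_volume_prod (hm.indicator hSm).aemeasurable]
  have hslice : ∀ t, ∫⁻ x, S.indicator
      (fun z => ‖truncKernel k χ z (s₀, y₀) - truncKernel k χ z (s₁, y₁)‖ₑ) (t, x) ≤
      if s₁ < t then G (t - s₁) else 0 := by
    intro t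
    by_cases htS : (2 + B) * T < |t - s'|
    · rcases le_total t s' with h | h
      · have h1 : t < s₀ := by
          rw [abs_of_nonpos (by linarith)] at htS
          nlinarith
        have hz : ∀ x, S.indicator
            (fun z => ‖truncKernel k χ z (s₀, y₀) - truncKernel k χ z (s₁, y₁)‖ₑ) (t, x) = 0 := by
          intro x
          simp [indicator, truncKernel, not_lt.2 h1.le, not_lt.2 (h1.le.trans hs)]
        simp [hz]
      · rw [abs_of_nonneg (by linarith)] at htS
        have hτT : T < t - s₁ := by nlinarith
        have ht : s₁ < t := by linarith
        have hτ : 0 < t - s₁ := by linarith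
        rw [if_pos ht, hG, indicator_of_mem (show t - s₁ ∈ Ioi T from hτT)]
        refine (lintegral_mono fun x => indicator_le_self _ _ _).trans
          ((hk.lintegral_truncKernel_sub_le hM hχ hs ht (by nlinarith) ?_).trans ?_)
        · refine hy.trans ?_
          have : ρ ≤ (t - s₁) ^ (1 / γ) := by
            rw [← hTρ]; exact Real.rpow_le_rpow hT0.le hτT.le (by positivity)
          gcongr
        · rw [← ENNReal.ofReal_mul (by positivity), ← ENNReal.ofReal_mul (by positivity),
            ← ENNReal.ofReal_add (by positivity) (by positivity)]
          refine ENNReal.ofReal_le_ofReal ?_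
          calc _ ≤ M * (3 * (T * (t - s₁) ^ (-2 : ℝ)) + B * ρ * (t - s₁) ^ (-1 - 1 / γ)) := by
                gcongr
            _ = _ := by ring
    · have hz : ∀ x, S.indicator
          (fun z => ‖truncKernel k χ z (s₀, y₀) - truncKernel k χ z (s₁, y₁)‖ₑ) (t, x) = 0 :=
        fun x => indicator_of_notMem (show (t, x) ∉ S from htS) _
      simp [hz]
  refine (lintegral_mono hslice).trans (le_of_eq ?_)
  have hm1 : Measurable fun τ : ℝ => ENNReal.ofReal (τ ^ (-2 : ℝ)) :=
    ENNReal.measurable_ofReal.comp (measurable_id.pow_const _)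
  have hg1 : 0 < 1 / γ := by positivity
  rw [lintegral_ite_sub_right G s₁, hG, lintegral_indicator measurableSet_Ioi,
    Measure.restrict_restrict measurableSet_Ioi, inter_eq_left.2 (Ioi_subset_Ioi hT0.le),
    lintegral_add_left (hm1.const_mul _), lintegral_const_mul' _ _ (by simp),
    lintegral_const_mul' _ _ (by simp), lintegral_Ioi_rpow_of_lt hT0 (by norm_num),
    lintegral_Ioi_rpow_of_lt hT0 (by linarith), ← ENNReal.ofReal_mul (by positivity)]
  have e1 : -T ^ ((-2 : ℝ) + 1) / (-2 + 1) = T⁻¹ := by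
    rw [show (-2 : ℝ) + 1 = -1 by norm_num, Real.rpow_neg_one]; ring
  have e2 : -T ^ (-1 - 1 / γ + 1) / (-1 - 1 / γ + 1) = γ * ρ⁻¹ := by
    rw [show -1 - 1 / γ + 1 = -(1 / γ) by ring, Real.rpow_neg hT0.le, hTρ]
    field_simp
  rw [e1, e2, ← ENNReal.ofReal_mul (by positivity), ← ENNReal.ofReal_add (by positivity)
    (by positivity)]
  congr 1
  field_simp

/-- Hörmander's condition for the truncated kernels. -/
theorem KernelBounds.hormander (hγ : 0 < γ) (hη : 0 < η) (hM : 0 ≤ M) (hB : 1 ≤ B)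
    (hk : KernelBounds γ κ η M B k) (hχ : TimeCutoff χ) {ρ : ℝ} (hρ : 0 < ρ)
    {w w' : ℝ × E d} (hw1 : |w.1 - w'.1| ≤ ρ ^ γ) (hw2 : ‖w.2 - w'.2‖ ≤ B * ρ) :
    ∫⁻ z in (parBox γ B ρ w')ᶜ, ‖truncKernel k χ z w - truncKernel k χ z w'‖ₑ ≤
      ENNReal.ofReal (horConst γ η M B) := by
  have hB0 : 0 ≤ B := by linarith
  have hT : 0 < ρ ^ γ := by positivity
  set R₁ := {z : ℝ × E d | (2 + B) * ρ ^ γ < |z.1 - w'.1|} with hR₁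
  set R₂ := {z : ℝ × E d | |z.1 - w'.1| ≤ (2 + B) * ρ ^ γ ∧ (2 + B) * ρ < ‖z.2 - w'.2‖} with hR₂
  have hsub : (parBox γ B ρ w')ᶜ ⊆ R₁ ∪ R₂ := by
    intro z hz
    by_cases h1 : |z.1 - w'.1| ≤ (2 + B) * ρ ^ γ
    · refine Or.inr ⟨h1, not_le.1 fun h2 => hz ⟨h1, h2⟩⟩
    · exact Or.inl (not_le.1 h1)
  have hmk := measurable_truncKernel hk.meas hχ.meas
  have h1 : ∫⁻ z in R₁, ‖truncKernel k χ z w - truncKernel k χ z w'‖ₑ ≤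
      ENNReal.ofReal (M * (3 + B * γ)) := by
    have hab := abs_le.1 hw1
    rcases le_total w.1 w'.1 with h | h
    · exact hk.lintegral_truncKernel_late_le hγ hM hB hχ hρ (s' := w'.1) h (by linarith) h le_rfl
        (by rwa [norm_sub_rev])
    · have := hk.lintegral_truncKernel_late_le hγ hM hB hχ hρ (s' := w'.1) h (by linarith) le_rfl h
        hw2
      refine le_trans (le_of_eq ?_) this
      exact lintegral_congr fun z => enorm_sub_rev _ _
  have h2 : ∫⁻ z in R₂, ‖truncKernel k χ z w - truncKernel k χ z w'‖ₑ ≤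
      ENNReal.ofReal (2 * (M * (γ / η) * (3 + B) ^ (η / γ))) := by
    have hm : Measurable fun z => ‖truncKernel k χ z w‖ₑ := (hmk.comp measurable_prodMk_right).enorm
    calc _ ≤ ∫⁻ z in R₂, (‖truncKernel k χ z w‖ₑ + ‖truncKernel k χ z w'‖ₑ) :=
          lintegral_mono fun z => enorm_sub_le
      _ = (∫⁻ z in R₂, ‖truncKernel k χ z w‖ₑ) + ∫⁻ z in R₂, ‖truncKernel k χ z w'‖ₑ :=
          lintegral_add_left hm _
      _ ≤ _ := add_le_add
          (hk.lintegral_truncKernel_far_le hγ hη hM hB0 hχ hρ hw1 hw2)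
          (hk.lintegral_truncKernel_far_le hγ hη hM hB0 hχ hρ (w := w') (by simpa using hT.le)
            (by simpa using by positivity))
      _ = _ := by
          rw [← ENNReal.ofReal_add (by positivity) (by positivity), ← two_mul]
  calc _ ≤ ∫⁻ z in R₁ ∪ R₂, ‖truncKernel k χ z w - truncKernel k χ z w'‖ₑ :=
        lintegral_mono_set hsub
    _ ≤ _ := lintegral_union_le _ _ _
    _ ≤ _ := add_le_add h1 h2
    _ = _ := by
        rw [← ENNReal.ofReal_add (by positivity) (by positivity), horConst]

theorem lintegral_neg_volume_prod {f : ℝ × E d → ℝ≥0∞} (hf : Measurable f) :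
    ∫⁻ z, f (-z) = ∫⁻ z, f z := by
  have hf' : Measurable fun z : ℝ × E d => f (-z) := hf.comp measurable_neg
  rw [lintegral_volume_prod hf.aemeasurable, lintegral_volume_prod hf'.aemeasurable,
    ← lintegral_neg_eq_self (fun t => ∫⁻ x, f (t, x))]
  exact lintegral_congr fun t => lintegral_neg_eq_self (fun x => f (-t, x))

/-- The kernel with time reversed. -/
def reverseKernel (k : ℝ → ℝ → E d → ℂ) (t s : ℝ) : E d → ℂ := k (-s) (-t)

/-- Time reversal exchanges the increments in the start and in the end time. Since both are among
the bounds, the adjoint kernel satisfies the same Hörmander condition. -/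
theorem KernelBounds.reverse (hk : KernelBounds γ κ η M B k) :
    KernelBounds γ κ η M B (reverseKernel k) := by
  refine ⟨?_, fun s t hst => ?_, fun s t hst => ?_, fun s s' t v hss hst hsB hv => ?_,
    fun s t t' v hst htt htB hv => ?_, fun s t hst => hk.integral_eq _ _ (neg_lt_neg hst),
    fun s t ξ hst hξ => ?_⟩
  · exact hk.meas.comp (measurable_snd.fst.neg.prodMk (measurable_fst.neg.prodMk measurable_snd.snd))
  · have := hk.lint _ _ (neg_lt_neg hst)
    rwa [neg_sub_neg] at this
  · have := hk.moment _ _ (neg_lt_neg hst)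
    rwa [neg_sub_neg] at this
  · have := hk.sub_stop (-t) (-s') (-s) v (neg_lt_neg hst) (neg_le_neg hss) (by
      rw [neg_sub_neg, neg_sub_neg]; exact hsB) (by rw [neg_sub_neg]; exact hv)
    rwa [neg_sub_neg, neg_sub_neg] at this
  · have := hk.sub_start (-t') (-t) (-s) v (neg_le_neg htt) (neg_lt_neg hst) (by
      rw [neg_sub_neg, neg_sub_neg]; exact htB) (by rw [neg_sub_neg]; exact hv)
    rwa [neg_sub_neg, neg_sub_neg] at this
  · have := hk.fourier_le _ _ ξ (neg_lt_neg hst) hξ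
    rwa [neg_sub_neg] at this

theorem truncKernel_reverse (k : ℝ → ℝ → E d → ℂ) (χ : ℝ → ℝ) (z w : ℝ × E d) :
    truncKernel (reverseKernel k) χ z w = truncKernel k χ (-w) (-z) := by
  simp only [truncKernel, reverseKernel, Prod.fst_neg, Prod.snd_neg, neg_lt_neg_iff, neg_sub_neg]

/-- Hörmander's condition for the adjoints of the truncated kernels. -/
theorem KernelBounds.hormander_adj (hγ : 0 < γ) (hη : 0 < η) (hM : 0 ≤ M) (hB : 1 ≤ B)
    (hk : KernelBounds γ κ η M B k) (hχ : TimeCutoff χ) {ρ : ℝ} (hρ : 0 < ρ)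
    {w w' : ℝ × E d} (hw1 : |w.1 - w'.1| ≤ ρ ^ γ) (hw2 : ‖w.2 - w'.2‖ ≤ B * ρ) :
    ∫⁻ z in (parBox γ B ρ w')ᶜ, ‖kernelAdj (truncKernel k χ) z w -
      kernelAdj (truncKernel k χ) z w'‖ₑ ≤ ENNReal.ofReal (horConst γ η M B) := by
  have h := hk.reverse.hormander hγ hη hM hB hχ hρ (w := -w) (w' := -w')
    (by rw [Prod.fst_neg, Prod.fst_neg, neg_sub_neg, abs_sub_comm]; exact hw1)
    (by rw [Prod.snd_neg, Prod.snd_neg, neg_sub_neg, norm_sub_rev]; exact hw2)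
  refine le_trans (le_of_eq ?_) h
  have hm := measurable_kernelAdj (measurable_truncKernel hk.meas hχ.meas)
  have hF : Measurable ((parBox γ B ρ w')ᶜ.indicator fun z => ‖kernelAdj (truncKernel k χ) z w -
      kernelAdj (truncKernel k χ) z w'‖ₑ) :=
    ((hm.comp measurable_prodMk_right).sub (hm.comp measurable_prodMk_right)).enorm.indicator
      (measurableSet_parBox _ _ _ _).compl
  rw [← lintegral_indicator (measurableSet_parBox _ _ _ _).compl,
    ← lintegral_indicator (measurableSet_parBox _ _ _ _).compl,
    ← lintegral_neg_volume_prod hF]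
  refine lintegral_congr fun z => ?_
  have hmem : -z ∈ (parBox γ B ρ w')ᶜ ↔ z ∈ (parBox γ B ρ (-w'))ᶜ := by
    simp only [mem_compl_iff, parBox, mem_ofPred_eq, Prod.fst_neg, Prod.snd_neg]
    rw [show -z.1 - w'.1 = -(z.1 - -w'.1) by ring, abs_neg,
      show -z.2 - w'.2 = -(z.2 - -w'.2) by abel, norm_neg]
  by_cases hz : -z ∈ (parBox γ B ρ w')ᶜ
  · rw [indicator_of_mem hz, indicator_of_mem (hmem.1 hz), truncKernel_reverse, truncKernel_reverse,
      neg_neg, neg_neg]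
    simp only [kernelAdj, ← map_sub]
    rw [← ofReal_norm, ← ofReal_norm]
    congr 1
    exact RCLike.norm_conj _
  · rw [indicator_of_notMem hz, indicator_of_notMem fun h => hz (hmem.2 h)]

end Hormander

/-! ### An explicit family of cutoffs -/

section Cutoff

/-- The truncations of the time difference that exhaust `(0, ∞)`. -/
def timeCutoff (n : ℕ) (τ : ℝ) : ℝ :=
  -- The first factor vanishes like τ at 0, the second decays like 1/τ at infinity; both increase to
  -- 1 with n.
  ((n + 1) * τ / (1 + (n + 1) * τ)) * ((n + 1) / (n + 1 + τ))

/-- Each of the two factors has values in [0, 1] and relative Lipschitz constant 1 whatever n is;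
the product rule adds them up to 2. -/
theorem timeCutoff_lipschitz (n : ℕ) {τ τ' : ℝ} (hτ : 0 < τ) (h : τ ≤ τ') :
    |timeCutoff n τ' - timeCutoff n τ| ≤ 2 * ((τ' - τ) / τ) := by
  have hτ' : 0 < τ' := hτ.trans_le h
  set N : ℝ := n + 1 with hN
  have hN0 : 0 < N := by positivity
  set u : ℝ → ℝ := fun τ => N * τ / (1 + N * τ) with hu
  set v : ℝ → ℝ := fun τ => N / (N + τ) with hv
  have hd : 0 ≤ τ' - τ := by linarith
  have hu1 : ∀ r, 0 < r → 0 ≤ u r ∧ u r ≤ 1 := fun r hr =>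
    ⟨by positivity, by simp only [hu]; rw [div_le_one (by positivity)]; linarith⟩
  have hv1 : ∀ r, 0 < r → 0 ≤ v r ∧ v r ≤ 1 := fun r hr =>
    ⟨by positivity, by simp only [hv]; rw [div_le_one (by positivity)]; linarith⟩
  have hud : |u τ' - u τ| ≤ (τ' - τ) / τ := by
    have e : u τ' - u τ = N * (τ' - τ) / ((1 + N * τ') * (1 + N * τ)) := by
      simp only [hu]; field_simp; ring
    rw [e, abs_of_nonneg (by positivity), div_le_div_iff₀ (by positivity) hτ]
    have h1 : N * τ ≤ (1 + N * τ') * (1 + N * τ) := by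
      have := mul_pos hN0 hτ
      have := mul_pos hN0 hτ'
      nlinarith
    nlinarith
  have hvd : |v τ' - v τ| ≤ (τ' - τ) / τ := by
    have e : v τ' - v τ = -(N * (τ' - τ) / ((N + τ') * (N + τ))) := by
      simp only [hv]; field_simp; ring
    rw [e, abs_neg, abs_of_nonneg (by positivity), div_le_div_iff₀ (by positivity) hτ]
    have h1 : N * τ ≤ (N + τ') * (N + τ) := by nlinarith
    nlinarith
  have e : timeCutoff n τ' - timeCutoff n τ = (u τ' - u τ) * v τ' + u τ * (v τ' - v τ) := by
    simp only [timeCutoff, hu, hv, hN]; ring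
  rw [e]
  calc _ ≤ |u τ' - u τ| * |v τ'| + |u τ| * |v τ' - v τ| := by
        rw [← abs_mul, ← abs_mul]; exact abs_add_le _ _
    _ ≤ (τ' - τ) / τ * 1 + 1 * ((τ' - τ) / τ) := by
        have h1 := hu1 τ hτ
        have h2 := hv1 τ' hτ'
        rw [abs_of_nonneg h1.1, abs_of_nonneg h2.1]
        gcongr
        exacts [h2.2, h1.2]
    _ = _ := by ring

theorem timeCutoff_timeCutoff (n : ℕ) : TimeCutoff (timeCutoff n) := by
  have hN0 : (0 : ℝ) < n + 1 := by positivity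
  refine ⟨by unfold timeCutoff; fun_prop, fun τ hτ => by unfold timeCutoff; positivity,
    fun τ hτ => ?_, fun τ τ' h1 h2 => timeCutoff_lipschitz n h1 h2, ?_⟩
  · unfold timeCutoff
    refine mul_le_one₀ ?_ (by positivity) ?_
    · rw [div_le_one (by positivity)]; linarith
    · rw [div_le_one (by positivity)]; linarith
  · have hle : ∀ τ ∈ Ioi (0 : ℝ), ENNReal.ofReal (timeCutoff n τ * τ⁻¹) ≤
        (Ioc 0 1).indicator (fun _ => ENNReal.ofReal (n + 1)) τ +
        (Ioi 1).indicator (fun τ => ENNReal.ofReal (n + 1) * ENNReal.ofReal (τ ^ (-2 : ℝ))) τ := by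
      intro τ hτ
      have hτ : 0 < τ := hτ
      rcases le_or_gt τ 1 with h | h
      · rw [indicator_of_mem (show τ ∈ Ioc (0 : ℝ) 1 from ⟨hτ, h⟩)]
        refine le_add_right (ENNReal.ofReal_le_ofReal ?_)
        unfold timeCutoff
        rw [div_mul_div_comm, ← div_eq_mul_inv, div_div, div_le_iff₀ (by positivity)]
        have := mul_pos hN0 hτ
        nlinarith [mul_pos this this, mul_pos this hτ, mul_pos hN0 hN0]
      · rw [indicator_of_mem (show τ ∈ Ioi (1 : ℝ) from h)]
        refine le_add_left ?_
        rw [← ENNReal.ofReal_mul hN0.le]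
        refine ENNReal.ofReal_le_ofReal ?_
        unfold timeCutoff
        rw [Real.rpow_neg hτ.le, Real.rpow_two, div_mul_div_comm, ← div_eq_mul_inv, div_div,
          ← div_eq_mul_inv, div_le_div_iff₀ (by positivity) (by positivity)]
        have h3 : (n + 1 : ℝ) * τ * τ ≤ (1 + (n + 1) * τ) * (n + 1 + τ) := by
          have := mul_pos hN0 hτ
          nlinarith [mul_pos this hN0]
        have h4 : 0 ≤ (n + 1 : ℝ) * τ := by positivity
        nlinarith [mul_le_mul_of_nonneg_left h3 h4]
    refine ne_top_of_le_ne_top ?_ (setLIntegral_mono' measurableSet_Ioi hle)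
    have hm : Measurable ((Ioc (0 : ℝ) 1).indicator fun _ => ENNReal.ofReal ((n : ℝ) + 1)) :=
      measurable_const.indicator measurableSet_Ioc
    rw [lintegral_add_left hm]
    refine ENNReal.add_ne_top.2 ⟨?_, ?_⟩
    · refine ne_top_of_le_ne_top ?_ (setLIntegral_le_lintegral _ _)
      rw [lintegral_indicator measurableSet_Ioc, setLIntegral_const]
      exact ENNReal.mul_ne_top (by simp) (by simp)
    · refine ne_top_of_le_ne_top ?_ (setLIntegral_le_lintegral _ _)
      rw [lintegral_indicator measurableSet_Ioi, lintegral_const_mul' _ _ (by simp),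
        lintegral_Ioi_rpow_of_lt one_pos (by norm_num)]
      exact ENNReal.mul_ne_top (by simp) (by simp)

theorem tendsto_timeCutoff {τ : ℝ} (hτ : 0 < τ) :
    Tendsto (fun n => timeCutoff n τ) atTop (𝓝 1) := by
  have hN : Tendsto (fun n : ℕ => (n : ℝ) + 1) atTop atTop :=
    tendsto_atTop_add_const_right _ _ tendsto_natCast_atTop_atTop
  have hinv : Tendsto (fun n : ℕ => ((n : ℝ) + 1)⁻¹) atTop (𝓝 0) := tendsto_inv_atTop_zero.comp hN
  have h1 : Tendsto (fun n : ℕ => (τ / (((n : ℝ) + 1)⁻¹ + τ)) * (1 / (1 + ((n : ℝ) + 1)⁻¹ * τ))) atTop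
      (𝓝 ((τ / (0 + τ)) * (1 / (1 + 0 * τ)))) :=
    (tendsto_const_nhds.div (hinv.add_const _) (by simpa using hτ.ne')).mul
      (tendsto_const_nhds.div ((hinv.mul_const _).const_add _) (by simp))
  have e : (τ / (0 + τ)) * (1 / (1 + 0 * τ)) = 1 := by
    rw [zero_add, div_self hτ.ne']; simp
  rw [e] at h1
  refine h1.congr fun n => ?_
  have hN0 : (0 : ℝ) < n + 1 := by positivity
  unfold timeCutoff
  field_simp

end Cutoff

/-! ### The parabolic dyadic grid -/

section Grid

variable {d : ℕ}

theorem floor_div_two_eq {a b c : ℝ} (h : ⌊a / c⌋ = ⌊b / c⌋) (n : ℕ) :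
    ⌊a / (c * 2 ^ n)⌋ = ⌊b / (c * 2 ^ n)⌋ := by
  have key : ∀ x : ℝ, ⌊x / (c * 2 ^ n)⌋ = ⌊x / c⌋ / (2 ^ n : ℕ) := by
    intro x
    rw [← div_div]
    have := Int.floor_div_natCast (x / c) (2 ^ n)
    push_cast at this ⊢
    exact this
  rw [key, key, h]

theorem floor_div_eq_iff {a c : ℝ} (hc : 0 < c) (m : ℤ) :
    ⌊a / c⌋ = m ↔ a ∈ Ico (m * c) (m * c + c) := by
  rw [Int.floor_eq_iff, mem_Ico, le_div_iff₀ hc, div_lt_iff₀ hc]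
  ring_nf

/-- The side length in time of cubes of scale `k`. -/
def timeSide (γ : ℝ) (k : ℤ) : ℝ := (2 : ℝ) ^ ⌊γ * k⌋

theorem timeSide_pos (γ : ℝ) (k : ℤ) : 0 < timeSide γ k := by unfold timeSide; positivity

theorem timeSide_le (γ : ℝ) (k : ℤ) : timeSide γ k ≤ ((2 : ℝ) ^ k) ^ γ := by
  rw [timeSide, ← Real.rpow_intCast, ← Real.rpow_intCast, ← Real.rpow_mul (by norm_num)]
  refine Real.rpow_le_rpow_of_exponent_le (by norm_num) ?_
  rw [mul_comm]; exact Int.floor_le _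

theorem le_timeSide (γ : ℝ) (k : ℤ) : ((2 : ℝ) ^ k) ^ γ ≤ 2 * timeSide γ k := by
  have h : (2 : ℝ) * timeSide γ k = 2 ^ ((⌊γ * k⌋ : ℝ) + 1) := by
    rw [Real.rpow_add (by norm_num), Real.rpow_intCast, Real.rpow_one, timeSide, mul_comm]
  rw [h, ← Real.rpow_intCast, ← Real.rpow_mul (by norm_num)]
  refine Real.rpow_le_rpow_of_exponent_le (by norm_num) ?_
  rw [mul_comm]; exact (Int.lt_floor_add_one _).le

/-- Rounding γk down to an integer makes consecutive time sides differ by a power of two, which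
nesting requires. The price is a factor of at most 2 against the exact side 2^{kγ}. -/
theorem exists_timeSide_succ (γ : ℝ) (hγ : 0 < γ) (k : ℤ) :
    ∃ n : ℕ, timeSide γ (k + 1) = timeSide γ k * 2 ^ n := by
  have h : ⌊γ * k⌋ ≤ ⌊γ * (k + 1 : ℤ)⌋ := Int.floor_le_floor (by push_cast; nlinarith)
  obtain ⟨n, hn⟩ := Int.le.dest h
  refine ⟨n, ?_⟩
  rw [timeSide, timeSide, ← hn, zpow_add₀ (by norm_num), zpow_natCast]

/-- The index of the parabolic cube of scale `k` around `z`. -/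
def parIdx (d : ℕ) (γ : ℝ) (k : ℤ) (z : ℝ × E d) : ℤ × (Fin d → ℤ) :=
  (⌊z.1 / timeSide γ k⌋, fun i => ⌊z.2 i / (2 : ℝ) ^ k⌋)

theorem parCube_eq (γ : ℝ) (k : ℤ) (z : ℝ × E d) :
    {w | parIdx d γ k w = parIdx d γ k z} =
      Ico (⌊z.1 / timeSide γ k⌋ * timeSide γ k) (⌊z.1 / timeSide γ k⌋ * timeSide γ k + timeSide γ k) ×ˢ
      ((fun y : E d => (y : Fin d → ℝ)) ⁻¹' (univ.pi fun i => Ico (⌊z.2 i / (2 : ℝ) ^ k⌋ * (2 : ℝ) ^ k)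
        (⌊z.2 i / (2 : ℝ) ^ k⌋ * (2 : ℝ) ^ k + (2 : ℝ) ^ k))) := by
  ext w
  simp only [parIdx, mem_ofPred_eq, Prod.mk.injEq, mem_prod, mem_preimage, mem_univ_pi, funext_iff]
  rw [floor_div_eq_iff (timeSide_pos γ k)]
  simp only [floor_div_eq_iff (show (0 : ℝ) < 2 ^ k by positivity)]

theorem measurableSet_parCube (γ : ℝ) (k : ℤ) (z : ℝ × E d) :
    MeasurableSet {w | parIdx d γ k w = parIdx d γ k z} := by
  rw [parCube_eq]
  refine measurableSet_Ico.prod ?_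
  exact (PiLp.volume_preserving_ofLp (Fin d)).measurable
    (MeasurableSet.univ_pi fun i => measurableSet_Ico)

theorem volume_parCube (γ : ℝ) (k : ℤ) (z : ℝ × E d) :
    volume {w | parIdx d γ k w = parIdx d γ k z} =
      ENNReal.ofReal (timeSide γ k * ((2 : ℝ) ^ k) ^ d) := by
  rw [parCube_eq, Measure.volume_eq_prod, Measure.prod_prod, Real.volume_Ico]
  have h := (PiLp.volume_preserving_ofLp (Fin d)).measure_preimage
    (s := univ.pi fun i => Ico (⌊z.2 i / (2 : ℝ) ^ k⌋ * (2 : ℝ) ^ k)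
        (⌊z.2 i / (2 : ℝ) ^ k⌋ * (2 : ℝ) ^ k + (2 : ℝ) ^ k))
    (MeasurableSet.univ_pi fun i => measurableSet_Ico).nullMeasurableSet
  rw [show volume ((fun y : E d => (y : Fin d → ℝ)) ⁻¹' _) = _ from h, volume_pi_pi]
  simp only [Real.volume_Ico, add_sub_cancel_left, Finset.prod_const, Finset.card_univ,
    Fintype.card_fin]
  rw [← ENNReal.ofReal_pow (by positivity), ← ENNReal.ofReal_mul (timeSide_pos γ k).le]

theorem abs_sub_lt_of_floor_eq {a b c : ℝ} (hc : 0 < c) (h : ⌊a / c⌋ = ⌊b / c⌋) : |a - b| < c := by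
  have h1 := (floor_div_eq_iff hc _).1 h
  have h2 := (floor_div_eq_iff (a := b) hc _).1 rfl
  rw [abs_lt]
  constructor <;> linarith [h1.1, h1.2, h2.1, h2.2]

/-- The Euclidean diagonal of a spatial cube is the source of the condition √d ≤ B. -/
theorem dist_of_mem_parCube {γ : ℝ} {k : ℤ} {z w : ℝ × E d}
    (h : parIdx d γ k w = parIdx d γ k z) :
    |w.1 - z.1| ≤ timeSide γ k ∧ ‖w.2 - z.2‖ ≤ Real.sqrt d * (2 : ℝ) ^ k := by
  simp only [parIdx, Prod.mk.injEq, funext_iff] at h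
  refine ⟨(abs_sub_lt_of_floor_eq (timeSide_pos γ k) h.1).le, ?_⟩
  have h2 : (0 : ℝ) < 2 ^ k := by positivity
  rw [EuclideanSpace.norm_eq]
  calc Real.sqrt (∑ i, ‖(w.2 - z.2) i‖ ^ 2) ≤ Real.sqrt (∑ _i : Fin d, ((2 : ℝ) ^ k) ^ 2) := by
        refine Real.sqrt_le_sqrt (Finset.sum_le_sum fun i _ => ?_)
        refine pow_le_pow_left₀ (norm_nonneg _) ?_ 2
        exact (abs_sub_lt_of_floor_eq h2 (h.2 i)).le
    _ = _ := by
        rw [Finset.sum_const, Finset.card_univ, Fintype.card_fin, nsmul_eq_mul,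
          Real.sqrt_mul (by positivity), Real.sqrt_sq h2.le]

/-- The doubling constant of the parabolic grid. -/
def parConst (d : ℕ) (γ B : ℝ) : NNReal :=
  Real.toNNReal (2 * 2 ^ γ * 2 ^ d) + 1 + Real.toNNReal (4 * (2 + B) * (2 + B) ^ d) *
    (volume (Metric.ball (0 : E d) 1)).toNNReal

theorem volume_parBox_le (γ : ℝ) {B : ℝ} (hB : 0 ≤ B) (k : ℤ) (z : ℝ × E d) :
    volume (parBox γ B ((2 : ℝ) ^ k) z) ≤
      ENNReal.ofReal (4 * (2 + B) * (2 + B) ^ d) * volume (Metric.ball (0 : E d) 1) *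
        ENNReal.ofReal (timeSide γ k * ((2 : ℝ) ^ k) ^ d) := by
  have h2 : (0 : ℝ) < 2 ^ k := by positivity
  have hsub : parBox γ B ((2 : ℝ) ^ k) z ⊆
      Icc (z.1 - (2 + B) * (2 * timeSide γ k)) (z.1 + (2 + B) * (2 * timeSide γ k)) ×ˢ
      Metric.closedBall z.2 ((2 + B) * (2 : ℝ) ^ k) := by
    intro w hw
    have h1 := abs_le.1 hw.1
    have h3 := mul_le_mul_of_nonneg_left (le_timeSide γ k) (show 0 ≤ 2 + B by linarith)
    refine ⟨⟨by linarith, by linarith⟩, ?_⟩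
    rw [Metric.mem_closedBall, dist_eq_norm]
    exact hw.2
  have ht := timeSide_pos γ k
  refine (measure_mono hsub).trans (le_of_eq ?_)
  rw [Measure.volume_eq_prod, Measure.prod_prod, Real.volume_Icc,
    Measure.addHaar_closedBall _ _ (by positivity), finrank_euclideanSpace_fin]
  rw [mul_right_comm, ← mul_assoc, ← ENNReal.ofReal_mul (by nlinarith),
    ← ENNReal.ofReal_mul (by positivity)]
  congr 2
  rw [mul_pow]
  ring

/-- The parabolic dyadic grid. -/
def parGrid (d : ℕ) (hd : 0 < d) {γ B : ℝ} (hγ : 0 < γ) (hB : 0 ≤ B) :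
    DyadicGrid (ℝ × E d) volume where
  ι := ℤ × (Fin d → ℤ)
  countable_ι := inferInstance
  idx := parIdx d γ
  measurable_cube := measurableSet_parCube γ
  nested := by
    intro k z w h
    obtain ⟨n, hn⟩ := exists_timeSide_succ γ hγ k
    simp only [parIdx, Prod.mk.injEq, funext_iff] at h ⊢
    refine ⟨?_, fun i => ?_⟩
    · rw [hn]
      exact floor_div_two_eq h.1 n
    · have := floor_div_two_eq (h.2 i) 1
      rwa [pow_one, ← zpow_add_one₀ (by norm_num)] at this
  D := parConst d γ B
  one_le_D := by
    unfold parConst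
    exact le_add_right (le_add_left le_rfl)
  doubling := by
    intro k z
    rw [volume_parCube, volume_parCube]
    have h2 : (0 : ℝ) < 2 ^ k := by positivity
    have h1 : timeSide γ (k + 1) * ((2 : ℝ) ^ (k + 1)) ^ d ≤
        (2 * 2 ^ γ * 2 ^ d) * (timeSide γ k * ((2 : ℝ) ^ k) ^ d) := by
      have h3 := timeSide_le γ (k + 1)
      have h4 := le_timeSide γ k
      rw [zpow_add_one₀ (by norm_num), Real.mul_rpow h2.le (by norm_num)] at h3
      have h5 : timeSide γ (k + 1) ≤ 2 * 2 ^ γ * timeSide γ k := by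
        have : (0 : ℝ) ≤ 2 ^ γ := by positivity
        nlinarith
      rw [zpow_add_one₀ (by norm_num), mul_pow]
      calc _ ≤ (2 * 2 ^ γ * timeSide γ k) * (((2 : ℝ) ^ k) ^ d * 2 ^ d) := by gcongr
        _ = _ := by ring
    refine (ENNReal.ofReal_le_ofReal h1).trans ?_
    rw [ENNReal.ofReal_mul (by positivity)]
    gcongr
    unfold parConst
    rw [add_assoc, ENNReal.coe_add]
    exact le_add_right le_rfl
  pos := by
    intro k z
    rw [volume_parCube, ENNReal.ofReal_pos]
    have := timeSide_pos γ k
    positivity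
  large := by
    intro R hR
    obtain ⟨N, hN⟩ := exists_nat_gt R.toReal
    refine ⟨max 0 N, fun k hk z => ?_⟩
    rw [volume_parCube]
    have hk0 : 0 ≤ k := (le_max_left _ _).trans hk
    obtain ⟨m, rfl⟩ := Int.eq_ofNat_of_zero_le hk0
    have hNm : N ≤ m := by exact_mod_cast (le_max_right _ _).trans hk
    have h1 : (1 : ℝ) ≤ timeSide γ m := by
      unfold timeSide
      exact one_le_zpow₀ (by norm_num) (Int.floor_nonneg.2 (by positivity))
    have h3 : (m : ℝ) < (2 : ℝ) ^ m := by exact_mod_cast Nat.lt_two_pow_self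
    have h2 : (2 : ℝ) ^ m ≤ ((2 : ℝ) ^ m) ^ d :=
      le_self_pow₀ (one_le_pow₀ (by norm_num)) hd.ne'
    rw [ENNReal.lt_ofReal_iff_toReal_lt hR]
    have h4 : (N : ℝ) ≤ m := by exact_mod_cast hNm
    rw [zpow_natCast]
    nlinarith
  finite := by
    intro k z
    rw [volume_parCube]
    exact ENNReal.ofReal_ne_top
  small := by
    intro z U hU
    obtain ⟨ε, hε, hεU⟩ := Metric.mem_nhds_iff.1 hU
    have hlim : Tendsto (fun n : ℕ => ((1 / 2 : ℝ) ^ n) ^ γ) atTop (𝓝 0) := by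
      have h1 : Tendsto (fun n : ℕ => (1 / 2 : ℝ) ^ n) atTop (𝓝 0) :=
        tendsto_pow_atTop_nhds_zero_of_lt_one (by norm_num) (by norm_num)
      have := h1.rpow_const (p := γ) (Or.inr hγ.le)
      rwa [Real.zero_rpow hγ.ne'] at this
    have hlim2 : Tendsto (fun n : ℕ => Real.sqrt d * (1 / 2 : ℝ) ^ n) atTop (𝓝 0) := by
      have := (tendsto_pow_atTop_nhds_zero_of_lt_one (r := (1 / 2 : ℝ)) (by norm_num)
        (by norm_num)).const_mul (Real.sqrt d)
      rwa [mul_zero] at this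
    obtain ⟨n, hn1, hn2⟩ := ((hlim.eventually (gt_mem_nhds hε)).and
      (hlim2.eventually (gt_mem_nhds hε))).exists
    have e : (2 : ℝ) ^ (-(n : ℤ)) = (1 / 2) ^ n := by
      rw [zpow_neg, zpow_natCast, one_div, inv_pow]
    refine ⟨-n, fun w hw => hεU ?_⟩
    have h := dist_of_mem_parCube hw
    rw [Metric.mem_ball, Prod.dist_eq, max_lt_iff]
    constructor
    · rw [Real.dist_eq]
      refine (h.1.trans (timeSide_le _ _)).trans_lt ?_
      rwa [e]
    · rw [dist_eq_norm]
      refine h.2.trans_lt ?_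
      rwa [e]
  star := fun k z => parBox γ B ((2 : ℝ) ^ k) z
  measurable_star := fun k z => measurableSet_parBox _ _ _ _
  star_le := by
    intro k z
    refine (volume_parBox_le γ hB k z).trans ?_
    rw [volume_parCube]
    gcongr
    unfold parConst
    rw [ENNReal.coe_add, ENNReal.coe_mul, ENNReal.coe_toNNReal measure_ball_lt_top.ne]
    exact le_add_left le_rfl

end Grid

/-! ### The L^p bound uniform in the truncation -/

section UniformBound

variable {d : ℕ} {γ κ η M B : ℝ} {k : ℝ → ℝ → E d → ℂ} {χ : ℝ → ℝ}
variable {H : Type*} [NormedAddCommGroup H] [InnerProductSpace ℂ H] [CompleteSpace H]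

/-- The bound of the truncated operators on `L^p`, uniform in the truncation. -/
theorem KernelBounds.eLpNorm_kernelOp_le (hd : 0 < d) (hγ : 0 < γ) (hκ : 0 < κ) (hη : 0 < η)
    (hM : 0 ≤ M) (hB : 1 ≤ B) (hBd : Real.sqrt d ≤ B) (hk : KernelBounds γ κ η M B k)
    (hχ : TimeCutoff χ) {p : ℝ} (hp : 1 < p) {f : ℝ × E d → H}
    (hf : MemLp f (ENNReal.ofReal p) volume) :
    eLpNorm (kernelOp volume (truncKernel k χ) f) (ENNReal.ofReal p) volume ≤
      czNorm (Real.toNNReal (horConst γ η M B + M / κ)) (parConst d γ B) p *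
        eLpNorm f (ENNReal.ofReal p) volume := by
  have hB0 : 0 ≤ B := by linarith
  obtain ⟨S, hS⟩ := hk.schurKernel hM hχ
  have hor0 : 0 ≤ horConst γ η M B := by unfold horConst; positivity
  have hMκ : 0 ≤ M / κ := by positivity
  set A : NNReal := Real.toNNReal (horConst γ η M B + M / κ) with hA
  have hdist : ∀ j (w w' : ℝ × E d), w ∈ (parGrid d hd hγ hB0).cube j w' →
      |w.1 - w'.1| ≤ ((2 : ℝ) ^ j) ^ γ ∧ ‖w.2 - w'.2‖ ≤ B * (2 : ℝ) ^ j := by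
    intro j w w' h
    have h1 := dist_of_mem_parCube (γ := γ) (k := j) h
    exact ⟨h1.1.trans (timeSide_le _ _), h1.2.trans (by gcongr)⟩
  have hA1 : ENNReal.ofReal (horConst γ η M B) ≤ A := ENNReal.ofReal_le_ofReal (by linarith)
  have hA2 : ENNReal.ofReal (M / κ) ≤ A := ENNReal.ofReal_le_ofReal (by linarith)
  have h1 : CZKernel (parGrid d hd hγ hB0) A S (truncKernel k χ) :=
    ⟨hS.meas, hS.row, hS.col, fun j w w' h => (hk.hormander hγ hη hM hB hχ (by positivity)
      (hdist j w w' h).1 (hdist j w w' h).2).trans hA1⟩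
  have h2 : CZKernel (parGrid d hd hγ hB0) A S (kernelAdj (truncKernel k χ)) :=
    ⟨hS.adj.meas, hS.adj.row, hS.adj.col, fun j w w' h => (hk.hormander_adj hγ hη hM hB hχ
      (by positivity) (hdist j w w' h).1 (hdist j w w' h).2).trans hA1⟩
  exact PseudoDiff.eLpNorm_kernelOp_le (g := parGrid d hd hγ hB0) h1 h2
    (fun f hf => (hk.eLpNorm_two_kernelOp_le hd hκ hM hχ hf).trans (by gcongr)) hp hf

end UniformBound

/-! ### Absolute convergence on Hölder continuous functions -/

section SliceConvolution

variable {d : ℕ} {H : Type*} [NormedAddCommGroup H] [InnerProductSpace ℂ H]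

theorem enorm_conv_le (k : E d → ℂ) (f : E d → H) (x : E d) :
    ‖∫ y, k (x - y) • f y‖ₑ ≤ ∫⁻ y, ‖k y‖ₑ * ‖f (x - y)‖ₑ := by
  refine (enorm_integral_le_lintegral_enorm _).trans (le_of_eq ?_)
  rw [← lintegral_sub_left_eq_self (fun y => ‖k y‖ₑ * ‖f (x - y)‖ₑ) x]
  simp [enorm_smul]

theorem integrable_conv {k : E d → ℂ} (hk : Integrable k) {f : E d → H} (hf : Continuous f)
    {C : ℝ} (hb : ∀ y, ‖f y‖ ≤ C) (x : E d) : Integrable fun y => k (x - y) • f y :=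
  (hk.comp_sub_left x).smul_bdd C hf.aestronglyMeasurable (ae_of_all _ hb)

/-- The mean value zero of the kernel allows f x to be subtracted, so the oscillation of f appears
in place of its size. -/
theorem enorm_conv_le_of_integral_eq_zero {k : E d → ℂ} (hk : Integrable k) (h0 : ∫ y, k y = 0)
    {f : E d → H} (hf : Continuous f) {C : ℝ} (hb : ∀ y, ‖f y‖ ≤ C) (x : E d) :
    ‖∫ y, k (x - y) • f y‖ₑ ≤ ∫⁻ y, ‖k y‖ₑ * ‖f (x - y) - f x‖ₑ := by
  have h1 : Integrable fun y => k y • f (x - y) :=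
    hk.smul_bdd C (hf.comp (continuous_const.sub continuous_id)).aestronglyMeasurable
      (ae_of_all _ fun y => hb _)
  have h2 : ∫ y, k y • f x = 0 := by
    -- Without completeness the Bochner integral is 0 by definition.
    by_cases hH : CompleteSpace H
    · rw [integral_smul_const, h0, zero_smul]
    · simp [integral, hH]
  have h3 : ∫ y, k (x - y) • f y = ∫ y, k y • (f (x - y) - f x) := by
    simp only [smul_sub]
    rw [integral_sub h1 (hk.smul_const _), h2, sub_zero,
      ← integral_sub_left_eq_self (fun y => k y • f (x - y)) volume x]
    simp
  rw [h3]
  refine (enorm_integral_le_lintegral_enorm _).trans (le_of_eq ?_)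
  simp [enorm_smul]

/-- Yields a supremum bound and an L¹ bound at once, with the same constant; together they control
every L^p norm of a slice. -/
theorem conv_bounds {k : E d → ℂ} (hk : Measurable k) {u : E d → ℝ≥0∞} {G : E d → E d → ℝ≥0∞}
    (hG : Measurable (Function.uncurry G)) {w : E d → ℝ≥0∞} (hw : Measurable w) {A a : ℝ≥0∞}
    (hu : ∀ x, u x ≤ ∫⁻ y, ‖k y‖ₑ * G x y) (h1 : ∀ x y, G x y ≤ A * w y)
    (h2 : ∀ y, ∫⁻ x, G x y ≤ A * w y) (ha : ∫⁻ y, ‖k y‖ₑ * w y ≤ a) :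
    (∀ x, u x ≤ A * a) ∧ ∫⁻ x, u x ≤ A * a := by
  have h3 : ∫⁻ y, ‖k y‖ₑ * (A * w y) ≤ A * a := by
    simp only [mul_left_comm _ A]
    have hm : Measurable fun y => ‖k y‖ₑ * w y := hk.enorm.mul hw
    rw [lintegral_const_mul _ hm]
    gcongr
  refine ⟨fun x => (hu x).trans (le_trans (lintegral_mono fun y => ?_) h3), ?_⟩
  · exact mul_le_mul_of_nonneg_left (h1 x y) zero_le
  calc ∫⁻ x, u x ≤ ∫⁻ x, ∫⁻ y, ‖k y‖ₑ * G x y := lintegral_mono hu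
    _ = ∫⁻ y, ∫⁻ x, ‖k y‖ₑ * G x y :=
        lintegral_lintegral_swap ((hk.enorm.comp measurable_snd).mul hG).aemeasurable
    _ = ∫⁻ y, ‖k y‖ₑ * ∫⁻ x, G x y := by
        refine lintegral_congr fun y => ?_
        rw [lintegral_const_mul]
        exact hG.comp measurable_prodMk_right
    _ ≤ ∫⁻ y, ‖k y‖ₑ * (A * w y) :=
        lintegral_mono fun y => mul_le_mul_of_nonneg_left (h2 y) zero_le
    _ ≤ _ := h3

/-- Functions supported in the times `|s| ≤ R` whose slices are bounded and Hölder continuous of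
exponent `η`, uniformly and in the mean. -/
structure HolderSlices (η A R : ℝ) (F : ℝ × E d → H) : Prop where
  cont : Continuous F
  sup : ∀ w, ‖F w‖ₑ ≤ ENNReal.ofReal A
  mean : ∀ s, ∫⁻ y, ‖F (s, y)‖ₑ ≤ ENNReal.ofReal A
  sup_sub : ∀ s x y, ‖F (s, x - y) - F (s, x)‖ₑ ≤ ENNReal.ofReal A * ENNReal.ofReal (‖y‖ ^ η)
  mean_sub : ∀ s y, ∫⁻ x, ‖F (s, x - y) - F (s, x)‖ₑ ≤
    ENNReal.ofReal A * ENNReal.ofReal (‖y‖ ^ η)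
  supp : ∀ s, R < |s| → ∀ y, F (s, y) = 0

omit [InnerProductSpace ℂ H] in
-- The Lipschitz bound for ‖y‖ ≤ 1 and boundedness for ‖y‖ ≥ 1 combine to any exponent η in [0, 1].
-- For the mean bounds, an increment is supported in the union of a ball and its translate, whose
-- volume is independent of y.
theorem exists_holderSlices {F : ℝ × E d → H} {L : NNReal} (hF : LipschitzWith L F)
    (hFs : HasCompactSupport F) {η : ℝ} (hη0 : 0 ≤ η) (hη1 : η ≤ 1) :
    ∃ A R : ℝ, 0 ≤ A ∧ 1 ≤ R ∧ HolderSlices η A R F := by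
  obtain ⟨C, hC0, hC1, hC2, -⟩ := exists_lintegral_slice_le hF.continuous hFs
  obtain ⟨R, hR⟩ := hFs.isCompact.isBounded.subset_closedBall (0 : ℝ × E d)
  have hzero : ∀ w : ℝ × E d, R < ‖w‖ → F w = 0 := fun w hw =>
    image_eq_zero_of_notMem_tsupport fun h => by
      have := hR h
      rw [mem_closedBall_zero_iff] at this
      linarith
  have hsub : ∀ s x y, ‖F (s, x - y) - F (s, x)‖ ≤ (2 * C + L) * ‖y‖ ^ η := by
    intro s x y
    have hpos : 0 ≤ ‖y‖ ^ η := by positivity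
    have hL : (0 : ℝ) ≤ L := L.2
    rcases le_total ‖y‖ 1 with h | h
    · have h1 := hF.dist_le_mul (s, x - y) (s, x)
      rw [dist_eq_norm] at h1
      have h2 : dist (s, x - y) (s, x) = ‖y‖ := by
        rw [Prod.dist_eq]; simp
      rw [h2] at h1
      have h3 : ‖y‖ ≤ ‖y‖ ^ η := by
        rcases eq_or_ne y 0 with rfl | hy
        · simpa using hpos
        · calc ‖y‖ = ‖y‖ ^ (1 : ℝ) := (Real.rpow_one _).symm
            _ ≤ ‖y‖ ^ η := Real.rpow_le_rpow_of_exponent_ge (norm_pos_iff.2 hy) h hη1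
      nlinarith [mul_le_mul_of_nonneg_left h3 hL, mul_nonneg hC0 hpos]
    · have hb : ∀ w, ‖F w‖ ≤ C := fun w => by
        have := hC1 w
        rwa [← ofReal_norm, ENNReal.ofReal_le_ofReal_iff hC0] at this
      have h1 : 1 ≤ ‖y‖ ^ η := Real.one_le_rpow h hη0
      have h2 := norm_sub_le (F (s, x - y)) (F (s, x))
      nlinarith [hb (s, x - y), hb (s, x), mul_nonneg hL hpos]
  set V : ℝ≥0∞ := volume (Metric.closedBall (0 : E d) R) with hV
  have hVt : V ≠ ⊤ := measure_closedBall_lt_top.ne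
  have hL : (0 : ℝ) ≤ L := L.2
  set A' : ℝ := 2 * C + L with hA'
  have hA'0 : 0 ≤ A' := by positivity
  have hle : ENNReal.ofReal A' ≤ ENNReal.ofReal (C + A' + 2 * (A' * V.toReal)) :=
    ENNReal.ofReal_le_ofReal (by have : 0 ≤ A' * V.toReal := by positivity
                                 linarith)
  have hle' : ENNReal.ofReal C ≤ ENNReal.ofReal (C + A' + 2 * (A' * V.toReal)) :=
    ENNReal.ofReal_le_ofReal (by have : 0 ≤ A' * V.toReal := by positivity
                                 linarith)
  have hsub' : ∀ s x y, ‖F (s, x - y) - F (s, x)‖ₑ ≤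
      ENNReal.ofReal A' * ENNReal.ofReal (‖y‖ ^ η) := fun s x y => by
    rw [← ofReal_norm, ← ENNReal.ofReal_mul hA'0]
    exact ENNReal.ofReal_le_ofReal (hsub s x y)
  have hnorm : ∀ (s : ℝ) (x : E d), R < ‖x‖ → F (s, x) = 0 := fun s x hx =>
    hzero _ (hx.trans_le (le_max_right _ _))
  refine ⟨C + A' + 2 * (A' * V.toReal), max R 1, by positivity, le_max_right _ _, hF.continuous,
    fun w => (hC1 w).trans hle', fun s => (hC2 s).trans hle',
    fun s x y => (hsub' s x y).trans (mul_le_mul_of_nonneg_right hle zero_le), fun s y => ?_,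
    fun s hs y => hzero _ (((le_max_left _ _).trans_lt hs).trans_le (le_max_left _ _))⟩
  set b : ℝ≥0∞ := ENNReal.ofReal (‖y‖ ^ η) with hb
  set I : E d → ℝ≥0∞ := (Metric.closedBall (0 : E d) R).indicator
    (fun _ => ENNReal.ofReal A' * b) with hI
  have hIm : Measurable I := measurable_const.indicator measurableSet_closedBall
  have hIint : ∫⁻ x, I x = ENNReal.ofReal A' * b * V := by
    rw [hI, lintegral_indicator measurableSet_closedBall, setLIntegral_const]
  calc ∫⁻ x, ‖F (s, x - y) - F (s, x)‖ₑ ≤ ∫⁻ x, (I (x - y) + I x) := by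
        refine lintegral_mono fun x => ?_
        by_cases h1 : x ∈ Metric.closedBall (0 : E d) R
        · exact le_add_left ((hsub' s x y).trans (by rw [hI, indicator_of_mem h1]))
        by_cases h2 : x - y ∈ Metric.closedBall (0 : E d) R
        · exact le_add_right ((hsub' s x y).trans (by rw [hI, indicator_of_mem h2]))
        · rw [mem_closedBall_zero_iff, not_le] at h1 h2
          rw [hnorm s x h1, hnorm s _ h2]
          simp
    _ = 2 * (ENNReal.ofReal A' * b * V) := by
        rw [lintegral_add_right _ hIm, lintegral_sub_right_eq_self I y, hIint, two_mul]
    _ = ENNReal.ofReal (2 * (A' * V.toReal)) * b := by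
        rw [ENNReal.ofReal_mul (by norm_num), ENNReal.ofReal_mul hA'0, ENNReal.ofReal_toReal hVt,
          ENNReal.ofReal_ofNat]
        ring
    _ ≤ _ := by
        refine mul_le_mul_of_nonneg_right (ENNReal.ofReal_le_ofReal ?_) zero_le
        linarith

/-- The convolution in space of the kernel with a slice of `F`. -/
def sliceConv (k : ℝ → ℝ → E d → ℂ) (F : ℝ × E d → H) (t s : ℝ) (x : E d) : H :=
  ∫ y, k t s (x - y) • F (s, y)

theorem stronglyMeasurable_sliceConv {k : ℝ → ℝ → E d → ℂ}
    (hk : Measurable fun p : ℝ × ℝ × E d => k p.1 p.2.1 p.2.2) {F : ℝ × E d → H}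
    (hF : StronglyMeasurable F) :
    StronglyMeasurable fun q : ℝ × ℝ × E d => sliceConv k F q.1 q.2.1 q.2.2 := by
  have h1 : Measurable fun q : (ℝ × ℝ × E d) × E d => k q.1.1 q.1.2.1 (q.1.2.2 - q.2) := by
    have : Measurable fun q : (ℝ × ℝ × E d) × E d => (q.1.1, q.1.2.1, q.1.2.2 - q.2) := by fun_prop
    exact hk.comp this
  have h2 : Measurable fun q : (ℝ × ℝ × E d) × E d => (q.1.2.1, q.2) := by fun_prop
  have h3 : StronglyMeasurable fun q : (ℝ × ℝ × E d) × E d =>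
      k q.1.1 q.1.2.1 (q.1.2.2 - q.2) • F (q.1.2.1, q.2) :=
    h1.stronglyMeasurable.smul (hF.comp_measurable h2)
  exact h3.integral_prod_right'

/-- The rate at which the convolutions of the kernel with Hölder continuous functions are
controlled. -/
def sliceRate (γ η τ : ℝ) : ℝ := if τ ≤ 1 then τ ^ (-1 + η / γ) else τ⁻¹

variable {γ κ η M B A R : ℝ} {k : ℝ → ℝ → E d → ℂ} {F : ℝ × E d → H}

theorem KernelBounds.integrable (hk : KernelBounds γ κ η M B k) {s t : ℝ} (hst : s < t) :
    Integrable (k t s) := by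
  have hm : Measurable (k t s) :=
    hk.meas.comp ((measurable_const (a := t)).prodMk ((measurable_const (a := s)).prodMk measurable_id))
  exact ⟨hm.aestronglyMeasurable, (hk.lint s t hst).trans_lt ENNReal.ofReal_lt_top⟩

omit [InnerProductSpace ℂ H] in
theorem HolderSlices.norm_le (hA : 0 ≤ A) (hF : HolderSlices η A R F) (w : ℝ × E d) : ‖F w‖ ≤ A := by
  have := hF.sup w
  rwa [← ofReal_norm, ENNReal.ofReal_le_ofReal_iff hA] at this

/-- For short time differences the cancellation and the η-moment give an integrable singularity; for
long ones the plain L¹ bound is enough and decays. -/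
theorem KernelBounds.sliceConv_bounds (hA : 0 ≤ A)
    (hk : KernelBounds γ κ η M B k) (hF : HolderSlices η A R F) {s t : ℝ} (hst : s < t) :
    (∀ x, ‖sliceConv k F t s x‖ₑ ≤
      ENNReal.ofReal A * ENNReal.ofReal (M * sliceRate γ η (t - s))) ∧
    ∫⁻ x, ‖sliceConv k F t s x‖ₑ ≤
      ENNReal.ofReal A * ENNReal.ofReal (M * sliceRate γ η (t - s)) := by
  have hm : Measurable (k t s) :=
    hk.meas.comp ((measurable_const (a := t)).prodMk ((measurable_const (a := s)).prodMk measurable_id))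
  have hfc : Continuous fun y => F (s, y) := hF.cont.comp (Continuous.prodMk_right s)
  unfold sliceRate
  split_ifs with h
  · refine conv_bounds hm (G := fun x y => ‖F (s, x - y) - F (s, x)‖ₑ)
      (w := fun y => ENNReal.ofReal (‖y‖ ^ η)) ?_ (by fun_prop)
      (fun x => enorm_conv_le_of_integral_eq_zero (hk.integrable hst) (hk.integral_eq s t hst) hfc
        (fun y => hF.norm_le hA _) x)
      (fun x y => hF.sup_sub s x y) (fun y => hF.mean_sub s y) (hk.moment s t hst)
    have : Continuous fun q : E d × E d => F (s, q.1 - q.2) - F (s, q.1) :=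
      (hfc.comp (continuous_fst.sub continuous_snd)).sub (hfc.comp continuous_fst)
    exact this.enorm.measurable
  · refine conv_bounds hm (G := fun x y => ‖F (s, x - y)‖ₑ) (w := fun _ => 1) ?_ measurable_const
      (fun x => enorm_conv_le _ _ x) (fun x y => by simpa using hF.sup _) (fun y => ?_)
      (by simpa using hk.lint s t hst)
    · exact (hfc.comp (continuous_fst.sub continuous_snd)).enorm.measurable
    · rw [lintegral_sub_right_eq_self (fun x => ‖F (s, x)‖ₑ) y, mul_one]
      exact hF.mean s

/-- The integral in time of the rates over the times of the support. -/
def rateIntegral (γ η M R t : ℝ) : ℝ≥0∞ :=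
  ∫⁻ s, if s < t then (if |s| ≤ R then ENNReal.ofReal (M * sliceRate γ η (t - s)) else 0) else 0

/-- The integral of the norms of the convolutions. -/
def absPotential (k : ℝ → ℝ → E d → ℂ) (F : ℝ × E d → H) (z : ℝ × E d) : ℝ≥0∞ :=
  ∫⁻ s, if s < z.1 then ‖sliceConv k F z.1 s z.2‖ₑ else 0

theorem measurable_absPotential_integrand
    (hk : Measurable fun p : ℝ × ℝ × E d => k p.1 p.2.1 p.2.2) (hF : StronglyMeasurable F) :
    Measurable fun q : (ℝ × E d) × ℝ => if q.2 < q.1.1 then ‖sliceConv k F q.1.1 q.2 q.1.2‖ₑ else 0 := by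
  have h1 : Measurable fun q : (ℝ × E d) × ℝ => (q.1.1, q.2, q.1.2) := by fun_prop
  exact Measurable.ite (measurableSet_lt measurable_snd (measurable_fst.comp measurable_fst))
    ((stronglyMeasurable_sliceConv hk hF).comp_measurable h1).enorm measurable_const

theorem measurable_absPotential (hk : Measurable fun p : ℝ × ℝ × E d => k p.1 p.2.1 p.2.2)
    (hF : StronglyMeasurable F) : Measurable (absPotential k F) :=
  (measurable_absPotential_integrand hk hF).lintegral_prod_right'

theorem HolderSlices.sliceConv_eq_zero (hF : HolderSlices η A R F) {s : ℝ} (hs : R < |s|) (t : ℝ)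
    (x : E d) : sliceConv k F t s x = 0 := by
  simp [sliceConv, hF.supp s hs]

theorem KernelBounds.absPotential_bounds (hA : 0 ≤ A)
    (hk : KernelBounds γ κ η M B k) (hF : HolderSlices η A R F) (t : ℝ) :
    (∀ x, absPotential k F (t, x) ≤ ENNReal.ofReal A * rateIntegral γ η M R t) ∧
    ∫⁻ x, absPotential k F (t, x) ≤ ENNReal.ofReal A * rateIntegral γ η M R t := by
  have hb : ∀ s, (∀ x, (if s < t then ‖sliceConv k F t s x‖ₑ else 0) ≤ ENNReal.ofReal A *
      if s < t then (if |s| ≤ R then ENNReal.ofReal (M * sliceRate γ η (t - s)) else 0) else 0) ∧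
      ∫⁻ x, (if s < t then ‖sliceConv k F t s x‖ₑ else 0) ≤ ENNReal.ofReal A *
      if s < t then (if |s| ≤ R then ENNReal.ofReal (M * sliceRate γ η (t - s)) else 0) else 0 := by
    intro s
    split_ifs with h1 h2
    · exact hk.sliceConv_bounds hA hF h1
    · simp [hF.sliceConv_eq_zero (not_le.1 h2)]
    · simp
  have hc : ENNReal.ofReal A * rateIntegral γ η M R t = ∫⁻ s, ENNReal.ofReal A *
      if s < t then (if |s| ≤ R then ENNReal.ofReal (M * sliceRate γ η (t - s)) else 0) else 0 :=
    (lintegral_const_mul' _ _ ENNReal.ofReal_ne_top).symm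
  rw [hc]
  refine ⟨fun x => lintegral_mono fun s => (hb s).1 x, ?_⟩
  unfold absPotential
  have hm : Measurable fun q : E d × ℝ => if q.2 < t then ‖sliceConv k F t q.2 q.1‖ₑ else 0 :=
    (measurable_absPotential_integrand hk.meas hF.cont.stronglyMeasurable).comp
      (((measurable_const (a := t)).prodMk measurable_fst).prodMk measurable_snd)
  rw [lintegral_lintegral_swap hm.aemeasurable]
  exact lintegral_mono fun s => (hb s).2

theorem rateIntegral_of_le {t : ℝ} (ht : t ≤ -R) : rateIntegral γ η M R t = 0 := by
  unfold rateIntegral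
  rw [lintegral_eq_zero_of_ae_eq_zero]
  refine ae_of_all _ fun s => ?_
  by_cases h1 : s < t
  · have : ¬|s| ≤ R := fun h => by linarith [(abs_le.1 h).1]
    simp [this]
  · simp [h1]

theorem rateIntegral_le (hγ : 0 < γ) (hη : 0 < η) (hM : 0 ≤ M) (hR : 0 ≤ R) (t : ℝ) :
    rateIntegral γ η M R t ≤ ENNReal.ofReal (M * (γ / η) + M * (2 * R)) := by
  have h1 : ∀ s, (if s < t then (if |s| ≤ R then ENNReal.ofReal (M * sliceRate γ η (t - s)) else 0)
      else 0) ≤ (if s < t then (Ioc 0 1).indicator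
        (fun τ => ENNReal.ofReal (M * τ ^ (-1 + η / γ))) (t - s) else 0) +
        (Icc (-R) R).indicator (fun _ => ENNReal.ofReal M) s := by
    intro s
    split_ifs with h1 h2
    · unfold sliceRate
      split_ifs with h3
      · rw [indicator_of_mem (show t - s ∈ Ioc (0 : ℝ) 1 from ⟨by linarith, h3⟩)]
        exact le_add_right le_rfl
      · rw [indicator_of_mem (show s ∈ Icc (-R) R from abs_le.1 h2)]
        refine le_add_left (ENNReal.ofReal_le_ofReal (mul_le_of_le_one_right hM ?_))
        exact inv_le_one_of_one_le₀ (not_le.1 h3).le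
    · exact zero_le
    · exact zero_le
  refine (lintegral_mono h1).trans ?_
  rw [lintegral_add_right _ (measurable_const.indicator measurableSet_Icc),
    lintegral_ite_sub_left (fun τ => (Ioc 0 1).indicator
        (fun τ => ENNReal.ofReal (M * τ ^ (-1 + η / γ))) τ), setLIntegral_indicator measurableSet_Ioc,
    lintegral_indicator measurableSet_Icc, setLIntegral_const, Real.volume_Icc,
    ENNReal.ofReal_add (by positivity) (by positivity)]
  refine add_le_add ?_ ?_
  · rw [inter_eq_left.2 (show Ioc (0 : ℝ) 1 ⊆ Ioi 0 from Ioc_subset_Ioi_self)]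
    simp only [ENNReal.ofReal_mul hM]
    rw [lintegral_const_mul' _ _ ENNReal.ofReal_ne_top, lintegral_Ioc_rpow one_pos
      (by have := div_pos hη hγ; linarith), neg_add_cancel_comm, Real.one_rpow, one_div_div]
  · rw [← ENNReal.ofReal_mul hM]
    exact ENNReal.ofReal_le_ofReal (le_of_eq (by ring))

/-- At t > 2R all source times are at distance at least t/2, so the rate is O(1/t); its p-th power
is integrable at infinity because p > 1. -/
theorem rateIntegral_le_inv (hM : 0 ≤ M) (hR : 1 ≤ R) {t : ℝ} (ht : 2 * R < t) :
    rateIntegral γ η M R t ≤ ENNReal.ofReal (4 * M * R * t⁻¹) := by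
  have ht0 : 0 < t := by linarith
  have h1 : ∀ s, (if s < t then (if |s| ≤ R then ENNReal.ofReal (M * sliceRate γ η (t - s)) else 0)
      else 0) ≤ (Icc (-R) R).indicator (fun _ => ENNReal.ofReal (M * (2 * t⁻¹))) s := by
    intro s
    split_ifs with h1 h2
    · have hs := abs_le.1 h2
      rw [indicator_of_mem (show s ∈ Icc (-R) R from hs)]
      have h4 : t / 2 ≤ t - s := by linarith [hs.2]
      have h5 : (t - s)⁻¹ ≤ 2 * t⁻¹ := by
        calc (t - s)⁻¹ ≤ (t / 2)⁻¹ := inv_anti₀ (by positivity) h4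
          _ = 2 * t⁻¹ := by rw [inv_div]; rfl
      refine ENNReal.ofReal_le_ofReal (mul_le_mul_of_nonneg_left ?_ hM)
      unfold sliceRate
      split_ifs with h3
      · have h6 : t - s = 1 := le_antisymm h3 (by linarith)
        rw [h6, inv_one] at h5
        rwa [h6, Real.one_rpow]
      · exact h5
    · exact zero_le
    · exact zero_le
  refine (lintegral_mono h1).trans ?_
  rw [lintegral_indicator measurableSet_Icc, setLIntegral_const, Real.volume_Icc,
    ← ENNReal.ofReal_mul (by positivity)]
  exact ENNReal.ofReal_le_ofReal (le_of_eq (by ring))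

theorem lintegral_rateIntegral_rpow_ne_top (hγ : 0 < γ) (hη : 0 < η) (hM : 0 ≤ M) (hR : 1 ≤ R)
    {p : ℝ} (hp : 1 < p) : ∫⁻ t, rateIntegral γ η M R t ^ p ≠ ⊤ := by
  have hp0 : 0 < p := by linarith
  set c : ℝ≥0∞ := ENNReal.ofReal (M * (γ / η) + M * (2 * R)) with hc
  have h1 : ∀ t, rateIntegral γ η M R t ^ p ≤ (Ioc (-R) (2 * R)).indicator (fun _ => c ^ p) t +
      (Ioi (2 * R)).indicator
        (fun t => ENNReal.ofReal (4 * M * R) ^ p * ENNReal.ofReal (t ^ (-p))) t := by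
    intro t
    rcases le_or_gt t (-R) with h | h
    · rw [rateIntegral_of_le h, ENNReal.zero_rpow_of_pos hp0]
      exact zero_le
    rcases le_or_gt t (2 * R) with h' | h'
    · rw [indicator_of_mem (show t ∈ Ioc (-R) (2 * R) from ⟨h, h'⟩)]
      exact le_add_right (ENNReal.rpow_le_rpow (rateIntegral_le hγ hη hM (by linarith) t) hp0.le)
    · rw [indicator_of_mem (show t ∈ Ioi (2 * R) from h')]
      have ht0 : 0 < t := by linarith
      refine le_add_left ((ENNReal.rpow_le_rpow (rateIntegral_le_inv hM hR h') hp0.le).trans ?_)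
      rw [ENNReal.ofReal_mul (by positivity), ENNReal.mul_rpow_of_nonneg _ _ hp0.le,
        ENNReal.ofReal_rpow_of_pos (inv_pos.2 ht0), Real.inv_rpow ht0.le, Real.rpow_neg ht0.le]
  refine ne_top_of_le_ne_top ?_ (lintegral_mono h1)
  rw [lintegral_add_left (measurable_const.indicator measurableSet_Ioc),
    lintegral_indicator measurableSet_Ioc, lintegral_indicator measurableSet_Ioi, setLIntegral_const,
    lintegral_const_mul' _ _ (ENNReal.rpow_ne_top_of_nonneg hp0.le ENNReal.ofReal_ne_top),
    lintegral_Ioi_rpow_of_lt (by linarith) (by linarith), Real.volume_Ioc]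
  refine ENNReal.add_ne_top.2 ⟨ENNReal.mul_ne_top ?_ ENNReal.ofReal_ne_top,
    ENNReal.mul_ne_top ?_ ENNReal.ofReal_ne_top⟩
  · exact ENNReal.rpow_ne_top_of_nonneg hp0.le ENNReal.ofReal_ne_top
  · exact ENNReal.rpow_ne_top_of_nonneg hp0.le ENNReal.ofReal_ne_top

theorem KernelBounds.absPotential_ne_top (hγ : 0 < γ) (hη : 0 < η) (hM : 0 ≤ M) (hA : 0 ≤ A)
    (hR : 1 ≤ R) (hk : KernelBounds γ κ η M B k) (hF : HolderSlices η A R F) (z : ℝ × E d) :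
    absPotential k F z ≠ ⊤ := by
  refine ne_top_of_le_ne_top ?_ ((hk.absPotential_bounds hA hF z.1).1 z.2)
  exact ENNReal.mul_ne_top ENNReal.ofReal_ne_top
    (ne_top_of_le_ne_top ENNReal.ofReal_ne_top (rateIntegral_le hγ hη hM (by linarith) z.1))

/-- On a slice, u^p ≤ (sup u)^{p-1} u combines the supremum and L¹ bounds into an L^p bound; what
remains is the p-th power of the rate integral in t. -/
theorem KernelBounds.lintegral_absPotential_rpow_ne_top (hγ : 0 < γ) (hη : 0 < η) (hM : 0 ≤ M)
    (hA : 0 ≤ A) (hR : 1 ≤ R) (hk : KernelBounds γ κ η M B k) (hF : HolderSlices η A R F)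
    {p : ℝ} (hp : 1 < p) : ∫⁻ z, absPotential k F z ^ p ≠ ⊤ := by
  have hp0 : 0 < p := by linarith
  have hm := measurable_absPotential hk.meas hF.cont.stronglyMeasurable
  rw [lintegral_volume_prod (hm.pow_const p).aemeasurable]
  set a : ℝ → ℝ≥0∞ := fun t => ENNReal.ofReal A * rateIntegral γ η M R t with ha
  have h1 : ∀ t, ∫⁻ x, absPotential k F (t, x) ^ p ≤ a t ^ p := by
    intro t
    have hb := hk.absPotential_bounds hA hF t
    calc ∫⁻ x, absPotential k F (t, x) ^ p ≤ ∫⁻ x, a t ^ (p - 1) * absPotential k F (t, x) := by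
          refine lintegral_mono fun x => ?_
          calc absPotential k F (t, x) ^ p
              = absPotential k F (t, x) ^ (p - 1) * absPotential k F (t, x) := by
                conv_rhs => rw [← ENNReal.rpow_one (absPotential k F (t, x)),
                  ← ENNReal.rpow_mul, one_mul, ← ENNReal.rpow_add_of_nonneg _ _ (by linarith) zero_le_one]
                congr 1; ring
            _ ≤ _ := mul_le_mul_of_nonneg_right
                (ENNReal.rpow_le_rpow (hb.1 x) (by linarith)) zero_le
      _ = a t ^ (p - 1) * ∫⁻ x, absPotential k F (t, x) :=
          lintegral_const_mul _ (hm.comp measurable_prodMk_left)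
      _ ≤ a t ^ (p - 1) * a t := mul_le_mul_of_nonneg_left hb.2 zero_le
      _ = a t ^ p := by
          conv_lhs => rw [← ENNReal.rpow_one (a t), ← ENNReal.rpow_mul, one_mul,
            ← ENNReal.rpow_add_of_nonneg _ _ (by linarith) zero_le_one]
          congr 1; ring
  refine ne_top_of_le_ne_top ?_ (lintegral_mono h1)
  simp only [ha, ENNReal.mul_rpow_of_nonneg _ _ hp0.le]
  rw [lintegral_const_mul' _ _ (ENNReal.rpow_ne_top_of_nonneg hp0.le ENNReal.ofReal_ne_top)]
  exact ENNReal.mul_ne_top (ENNReal.rpow_ne_top_of_nonneg hp0.le ENNReal.ofReal_ne_top)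
    (lintegral_rateIntegral_rpow_ne_top hγ hη hM hR hp)

end SliceConvolution

/-! ### Strong limits of uniformly bounded operators -/

section Limits

/-- A three epsilon argument: the uniform bound spreads the Cauchy property from the dense set to
all of X. -/
theorem exists_continuousLinearMap_of_tendsto_dense {X Y : Type*} [NormedAddCommGroup X]
    [NormedSpace ℝ X] [CompleteSpace X] [NormedAddCommGroup Y] [NormedSpace ℝ Y] [CompleteSpace Y]
    {T : ℕ → X →L[ℝ] Y} {C : ℝ} (hC0 : 0 ≤ C) (hC : ∀ n x, ‖T n x‖ ≤ C * ‖x‖) {D : Set X}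
    (hD : Dense D) (h : ∀ x ∈ D, ∃ y, Tendsto (fun n => T n x) atTop (𝓝 y)) :
    ∃ G : X →L[ℝ] Y, (∀ x, Tendsto (fun n => T n x) atTop (𝓝 (G x))) ∧ ∀ x, ‖G x‖ ≤ C * ‖x‖ := by
  have hlim : ∀ x, ∃ y, Tendsto (fun n => T n x) atTop (𝓝 y) := by
    intro x
    refine cauchySeq_tendsto_of_complete (Metric.cauchySeq_iff'.2 fun ε hε => ?_)
    -- C + 1 appears in place of C because C may be zero.
    obtain ⟨x', hx', hxx'⟩ := hD.exists_dist_lt x (show 0 < ε / (3 * (C + 1)) by positivity)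
    obtain ⟨y, hy⟩ := h x' hx'
    obtain ⟨N, hN⟩ := Metric.cauchySeq_iff'.1 hy.cauchySeq (ε / 3) (by positivity)
    refine ⟨N, fun n hn => ?_⟩
    have h1 : ∀ m, dist (T m x) (T m x') < ε / 3 := by
      intro m
      rw [dist_eq_norm, ← map_sub]
      rw [dist_eq_norm, lt_div_iff₀ (by positivity)] at hxx'
      have := hC m (x - x')
      nlinarith [norm_nonneg (x - x')]
    calc dist (T n x) (T N x) ≤ dist (T n x) (T n x') + dist (T n x') (T N x') +
          dist (T N x') (T N x) := dist_triangle4 _ _ _ _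
      _ < ε / 3 + ε / 3 + ε / 3 :=
          add_lt_add (add_lt_add (h1 n) (hN n hn)) (by rw [dist_comm]; exact h1 N)
      _ = ε := by ring
  choose g hg using hlim
  refine ⟨continuousLinearMapOfTendsto T (tendsto_pi_nhds.2 hg), hg, fun x => ?_⟩
  exact le_of_tendsto (hg x).norm (Eventually.of_forall fun n => hC n x)

variable {Z : Type*} [TopologicalSpace Z] [MeasurableSpace Z] [BorelSpace Z] {μ : Measure Z}
  [SigmaFinite μ]
variable {H : Type*} [NormedAddCommGroup H] [InnerProductSpace ℂ H] [CompleteSpace H]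

theorem SchurKernel.exists_continuousLinearMap {S : NNReal} {k : Z → Z → ℂ}
    (hk : SchurKernel μ S k) {p : ℝ} (hp : 1 < p) [Fact (1 ≤ ENNReal.ofReal p)] {C : ℝ}
    (hC0 : 0 ≤ C)
    (hC : ∀ f : Z → H, MemLp f (ENNReal.ofReal p) μ → eLpNorm (kernelOp μ k f) (ENNReal.ofReal p) μ ≤
      ENNReal.ofReal C * eLpNorm f (ENNReal.ofReal p) μ) :
    ∃ T : Lp H (ENNReal.ofReal p) μ →L[ℝ] Lp H (ENNReal.ofReal p) μ,
      (∀ f, T f =ᵐ[μ] kernelOp μ k f) ∧ ∀ f, ‖T f‖ ≤ C * ‖f‖ := by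
  have hmem : ∀ f : Lp H (ENNReal.ofReal p) μ, MemLp (kernelOp μ k f) (ENNReal.ofReal p) μ :=
    fun f => hk.memLp hp (Lp.memLp f)
  let T : Lp H (ENNReal.ofReal p) μ →ₗ[ℝ] Lp H (ENNReal.ofReal p) μ :=
    { toFun := fun f => (hmem f).toLp _
      map_add' := by
        intro f g
        apply Lp.ext
        filter_upwards [(hmem (f + g)).coeFn_toLp, (hmem f).coeFn_toLp, (hmem g).coeFn_toLp,
          Lp.coeFn_add ((hmem f).toLp _) ((hmem g).toLp _), hk.ae_integrable hp (Lp.memLp f),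
          hk.ae_integrable hp (Lp.memLp g)] with z h1 h2 h3 h4 h5 h6
        rw [h1, h4, Pi.add_apply, h2, h3]
        unfold kernelOp
        rw [← integral_add h5 h6]
        refine integral_congr_ae ((Lp.coeFn_add f g).mono fun w hw => ?_)
        simp only [hw, Pi.add_apply, smul_add]
      map_smul' := by
        intro c f
        apply Lp.ext
        filter_upwards [(hmem (c • f)).coeFn_toLp, (hmem f).coeFn_toLp,
          Lp.coeFn_smul c ((hmem f).toLp _)] with z h1 h2 h4
        rw [h1, RingHom.id_apply, h4, Pi.smul_apply, h2]
        unfold kernelOp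
        rw [← integral_smul]
        refine integral_congr_ae ((Lp.coeFn_smul c f).mono fun w hw => ?_)
        simp only [hw, Pi.smul_apply]
        exact smul_comm _ _ _ }
  have hT : ∀ f, ‖T f‖ ≤ C * ‖f‖ := by
    intro f
    have h1 := hC f (Lp.memLp f)
    change ‖(hmem f).toLp _‖ ≤ _
    rw [Lp.norm_toLp, Lp.norm_def]
    refine ENNReal.toReal_le_of_le_ofReal (by positivity) (h1.trans (le_of_eq ?_))
    rw [ENNReal.ofReal_mul hC0, ENNReal.ofReal_toReal (Lp.eLpNorm_ne_top f)]
  exact ⟨T.mkContinuous C hT, fun f => (hmem f).coeFn_toLp, hT⟩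

end Limits

/-! ### Removing the truncation -/

section TimeLimit

variable {d : ℕ} {H : Type*} [NormedAddCommGroup H] [InnerProductSpace ℂ H]
variable {γ κ η M B A R : ℝ} {k : ℝ → ℝ → E d → ℂ} {χ : ℝ → ℝ} {F : ℝ × E d → H}

theorem kernelOp_truncKernel_eq {z : ℝ × E d}
    (hint : Integrable (fun w => truncKernel k χ z w • F w)) :
    kernelOp volume (truncKernel k χ) F z =
      ∫ s in Iio z.1, (χ (z.1 - s) : ℂ) • sliceConv k F z.1 s z.2 := by
  unfold kernelOp
  rw [Measure.volume_eq_prod] at hint ⊢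
  rw [integral_prod _ hint, ← integral_indicator measurableSet_Iio]
  refine integral_congr_ae (ae_of_all _ fun s => ?_)
  by_cases hs : s < z.1
  · rw [indicator_of_mem (show s ∈ Iio z.1 from hs), sliceConv, ← integral_smul]
    simp [truncKernel, hs, mul_smul]
  · rw [indicator_of_notMem (show s ∉ Iio z.1 from hs)]
    simp [truncKernel, hs]

theorem enorm_kernelOp_truncKernel_le (hχ : TimeCutoff χ) {z : ℝ × E d}
    (hint : Integrable (fun w => truncKernel k χ z w • F w)) :
    ‖kernelOp volume (truncKernel k χ) F z‖ₑ ≤ absPotential k F z := by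
  have h1 : absPotential k F z = ∫⁻ s in Iio z.1, ‖sliceConv k F z.1 s z.2‖ₑ := by
    rw [← lintegral_indicator measurableSet_Iio]
    rfl
  rw [kernelOp_truncKernel_eq hint, h1]
  refine (enorm_integral_le_lintegral_enorm _).trans
    (setLIntegral_mono' measurableSet_Iio fun s hs => ?_)
  have hs : 0 < z.1 - s := sub_pos.2 hs
  rw [enorm_smul]
  refine mul_le_of_le_one_left zero_le ?_
  rw [← ofReal_norm, Complex.norm_real, Real.norm_of_nonneg (hχ.nonneg _ hs)]
  exact ENNReal.ofReal_le_one.2 (hχ.le_one _ hs)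

/-- Dominated convergence with the absolutely convergent integral itself as majorant. No regularity
of F is involved, so this identifies the limit for every f in L^p. -/
theorem tendsto_kernelOp_timeCutoff {z : ℝ × E d}
    (hint : ∀ n, Integrable (fun w => truncKernel k (timeCutoff n) z w • F w))
    (hz : IntegrableOn (fun s => sliceConv k F z.1 s z.2) (Iio z.1)) :
    Tendsto (fun n => kernelOp volume (truncKernel k (timeCutoff n)) F z) atTop
      (𝓝 (∫ s in Iio z.1, sliceConv k F z.1 s z.2)) := by
  simp only [fun n => kernelOp_truncKernel_eq (hint n)]
  refine tendsto_integral_of_dominated_convergence (fun s => ‖sliceConv k F z.1 s z.2‖)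
    (fun n => ?_) hz.norm (fun n => ?_) ?_
  · have : Measurable fun s => ((timeCutoff n (z.1 - s) : ℝ) : ℂ) :=
      Complex.measurable_ofReal.comp ((timeCutoff_timeCutoff n).meas.comp (measurable_const_sub _))
    exact this.aestronglyMeasurable.smul hz.aestronglyMeasurable
  · refine (ae_restrict_iff' measurableSet_Iio).2 (ae_of_all _ fun s hs => ?_)
    have hs : 0 < z.1 - s := sub_pos.2 hs
    rw [norm_smul, Complex.norm_real, Real.norm_of_nonneg ((timeCutoff_timeCutoff n).nonneg _ hs)]
    exact mul_le_of_le_one_left (norm_nonneg _) ((timeCutoff_timeCutoff n).le_one _ hs)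
  · refine (ae_restrict_iff' measurableSet_Iio).2 (ae_of_all _ fun s hs => ?_)
    have hs : 0 < z.1 - s := sub_pos.2 hs
    have h1 : Tendsto (fun n => ((timeCutoff n (z.1 - s) : ℝ) : ℂ)) atTop (𝓝 ((1 : ℝ) : ℂ)) :=
      (Complex.continuous_ofReal.tendsto 1).comp (tendsto_timeCutoff hs)
    simpa using h1.smul_const (sliceConv k F z.1 s z.2)

theorem KernelBounds.integrableOn_sliceConv (hγ : 0 < γ) (hη : 0 < η) (hM : 0 ≤ M) (hA : 0 ≤ A)
    (hR : 1 ≤ R) (hk : KernelBounds γ κ η M B k) (hF : HolderSlices η A R F) (z : ℝ × E d) :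
    IntegrableOn (fun s => sliceConv k F z.1 s z.2) (Iio z.1) := by
  have hm : StronglyMeasurable fun s => sliceConv k F z.1 s z.2 :=
    (stronglyMeasurable_sliceConv hk.meas hF.cont.stronglyMeasurable).comp_measurable
      ((measurable_const (a := z.1)).prodMk (measurable_id.prodMk (measurable_const (a := z.2))))
  refine ⟨hm.aestronglyMeasurable, ?_⟩
  have h1 := hk.absPotential_ne_top hγ hη hM hA hR hF z
  have h2 : absPotential k F z = ∫⁻ s in Iio z.1, ‖sliceConv k F z.1 s z.2‖ₑ := by
    rw [← lintegral_indicator measurableSet_Iio]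
    rfl
  rw [h2] at h1
  exact h1.lt_top

variable [CompleteSpace H]

theorem KernelBounds.ae_integrable_truncKernel (hM : 0 ≤ M) (hk : KernelBounds γ κ η M B k)
    {p : ℝ} (hp : 1 < p) (hF : MemLp F (ENNReal.ofReal p) volume) :
    ∀ᵐ z, ∀ n, Integrable (fun w => truncKernel k (timeCutoff n) z w • F w) := by
  refine ae_all_iff.2 fun n => ?_
  obtain ⟨S, hS⟩ := hk.schurKernel hM (timeCutoff_timeCutoff n)
  exact hS.ae_integrable hp hF

/-- On Hölder continuous functions the truncated operators converge in `L^p`. -/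
theorem KernelBounds.exists_tendsto_eLpNorm (hγ : 0 < γ) (hη : 0 < η) (hM : 0 ≤ M) (hA : 0 ≤ A)
    (hR : 1 ≤ R) (hk : KernelBounds γ κ η M B k) (hF : HolderSlices η A R F)
    {p : ℝ} (hp : 1 < p) (hFp : MemLp F (ENNReal.ofReal p) volume) :
    ∃ P : ℝ × E d → H, MemLp P (ENNReal.ofReal p) volume ∧
      Tendsto (fun n => eLpNorm (kernelOp volume (truncKernel k (timeCutoff n)) F - P)
        (ENNReal.ofReal p) volume) atTop (𝓝 0) := by
  have hp0 : 0 < p := by linarith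
  set T : ℕ → ℝ × E d → H := fun n => kernelOp volume (truncKernel k (timeCutoff n)) F with hT
  set P : ℝ × E d → H := fun z => ∫ s in Iio z.1, sliceConv k F z.1 s z.2 with hP
  have hTm : ∀ n, AEStronglyMeasurable (T n) volume := fun n =>
    aestronglyMeasurable_kernelOp (measurable_truncKernel hk.meas (timeCutoff_timeCutoff n).meas)
      hF.cont.aestronglyMeasurable
  have hint := hk.ae_integrable_truncKernel hM hp hFp
  have hlim : ∀ᵐ z, Tendsto (fun n => T n z) atTop (𝓝 (P z)) := by
    filter_upwards [hint] with z hz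
    exact tendsto_kernelOp_timeCutoff hz (hk.integrableOn_sliceConv hγ hη hM hA hR hF z)
  have hle : ∀ᵐ z, ∀ n, ‖T n z‖ₑ ≤ absPotential k F z := by
    filter_upwards [hint] with z hz n
    exact enorm_kernelOp_truncKernel_le (timeCutoff_timeCutoff n) (hz n)
  have hPm : AEStronglyMeasurable P volume := aestronglyMeasurable_of_tendsto_ae _ hTm hlim
  have hPle : ∀ᵐ z, ‖P z‖ₑ ≤ absPotential k F z := by
    filter_upwards [hlim, hle] with z h1 h2
    exact le_of_tendsto h1.enorm (Eventually.of_forall h2)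
  have hfin := hk.lintegral_absPotential_rpow_ne_top hγ hη hM hA hR hF hp
  refine ⟨P, (memLp_ofReal_iff hp0 hPm).2 (ne_top_of_le_ne_top hfin ?_), ?_⟩
  · exact lintegral_mono_ae (hPle.mono fun z hz => ENNReal.rpow_le_rpow hz hp0.le)
  have h1 : Tendsto (fun n => ∫⁻ z, ‖(T n - P) z‖ₑ ^ p) atTop (𝓝 (∫⁻ _ : ℝ × E d, 0)) := by
    refine tendsto_lintegral_of_dominated_convergence'
      (fun z => (2 * absPotential k F z) ^ p)
      (fun n => ((hTm n).sub hPm).enorm.pow_const p) (fun n => ?_) ?_ ?_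
    · filter_upwards [hle, hPle] with z h2 h3
      refine ENNReal.rpow_le_rpow ((enorm_sub_le).trans ?_) hp0.le
      rw [two_mul]
      exact add_le_add (h2 n) h3
    · simp only [ENNReal.mul_rpow_of_nonneg _ _ hp0.le]
      rw [lintegral_const_mul' _ _ (ENNReal.rpow_ne_top_of_nonneg hp0.le (by simp))]
      exact ENNReal.mul_ne_top (ENNReal.rpow_ne_top_of_nonneg hp0.le (by simp)) hfin
    · filter_upwards [hlim] with z hz
      have h2 : Tendsto (fun n => ‖T n z - P z‖ₑ) atTop (𝓝 0) := by
        simpa using (hz.sub_const (P z)).enorm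
      simpa [ENNReal.zero_rpow_of_pos hp0] using h2.ennrpow_const p
  rw [lintegral_zero] at h1
  have h2 := h1.ennrpow_const (1 / p)
  rw [ENNReal.zero_rpow_of_pos (by positivity)] at h2
  refine h2.congr fun n => ?_
  rw [← eLpNorm_rpow_eq hp0, ← ENNReal.rpow_mul, mul_one_div_cancel hp0.ne', ENNReal.rpow_one]

/-- The truncated operators converge to a bounded operator on `L^p` that is given by the
integral wherever that converges. -/
theorem KernelBounds.exists_limit_operator (hd : 0 < d) (hγ : 0 < γ) (hκ : 0 < κ) (hη : 0 < η)
    (hη1 : η ≤ 1) (hM : 0 ≤ M) (hB : 1 ≤ B) (hBd : Real.sqrt d ≤ B) (hk : KernelBounds γ κ η M B k)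
    {p : ℝ} (hp : 1 < p) [Fact (1 ≤ ENNReal.ofReal p)] {K : Type*} [NormedAddCommGroup K]
    [InnerProductSpace ℝ K] [CompleteSpace K] (ι : K →ₗᵢ[ℝ] H) :
    ∃ G : Lp K (ENNReal.ofReal p) (volume : Measure (ℝ × E d)) →L[ℝ]
        Lp H (ENNReal.ofReal p) (volume : Measure (ℝ × E d)),
      (∀ f : Lp K (ENNReal.ofReal p) (volume : Measure (ℝ × E d)), ∀ᵐ z : ℝ × E d,
        IntegrableOn (fun s => sliceConv k (fun w => ι (f w)) z.1 s z.2) (Iio z.1) →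
          G f z = ∫ s in Iio z.1, sliceConv k (fun w => ι (f w)) z.1 s z.2) ∧
      ∀ f : Lp K (ENNReal.ofReal p) (volume : Measure (ℝ × E d)),
        ∫⁻ z, ‖G f z‖ₑ ^ p ≤
          czNorm (Real.toNNReal (horConst γ η M B + M / κ)) (parConst d γ B) p ^ p *
            ∫⁻ z, ‖f z‖ₑ ^ p := by
  have hp0 : 0 < p := by linarith
  set N := czNorm (Real.toNNReal (horConst γ η M B + M / κ)) (parConst d γ B) p with hN
  have hNt : N ≠ ⊤ := czNorm_ne_top _ _ hp
  have hT : ∀ n, ∃ T : Lp H (ENNReal.ofReal p) (volume : Measure (ℝ × E d)) →L[ℝ]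
      Lp H (ENNReal.ofReal p) (volume : Measure (ℝ × E d)),
      (∀ f, T f =ᵐ[volume] kernelOp volume (truncKernel k (timeCutoff n)) f) ∧
        ∀ f, ‖T f‖ ≤ N.toReal * ‖f‖ := by
    intro n
    obtain ⟨S, hS⟩ := hk.schurKernel hM (timeCutoff_timeCutoff n)
    refine hS.exists_continuousLinearMap hp ENNReal.toReal_nonneg fun f hf => ?_
    rw [ENNReal.ofReal_toReal hNt]
    exact hk.eLpNorm_kernelOp_le hd hγ hκ hη hM hB hBd (timeCutoff_timeCutoff n) hp hf
  choose T hT1 hT2 using hT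
  set J : Lp K (ENNReal.ofReal p) (volume : Measure (ℝ × E d)) →L[ℝ]
      Lp H (ENNReal.ofReal p) (volume : Measure (ℝ × E d)) :=
    ι.toContinuousLinearMap.compLpL (ENNReal.ofReal p) volume with hJ
  have hJf : ∀ f, J f =ᵐ[volume] fun w => ι (f w) := fun f =>
    ι.toContinuousLinearMap.coeFn_compLpL f
  have hJn : ∀ f, ‖J f‖ ≤ ‖f‖ := by
    intro f
    rw [Lp.norm_def, Lp.norm_def, eLpNorm_congr_ae (hJf f),
      eLpNorm_congr_norm_ae (ae_of_all _ fun w => ι.norm_map (f w))]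
  have hker : ∀ n f, T n (J f) =ᵐ[volume]
      kernelOp volume (truncKernel k (timeCutoff n)) fun w => ι (f w) := by
    intro n f
    refine (hT1 n (J f)).trans (Eventually.of_forall fun z => ?_)
    exact integral_congr_ae ((hJf f).mono fun w hw => by simp only [hw])
  obtain ⟨G, hG1, hG2⟩ := exists_continuousLinearMap_of_tendsto_dense
    (T := fun n => (T n).comp J) (C := N.toReal) ENNReal.toReal_nonneg
    (fun n f => (hT2 n (J f)).trans (mul_le_mul_of_nonneg_left (hJn f) ENNReal.toReal_nonneg))
    (Lp.dense_hasCompactSupport_contDiff (F := K) (μ := (volume : Measure (ℝ × E d)))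
      (p := ENNReal.ofReal p) ENNReal.ofReal_ne_top) (by
      rintro f ⟨g, hfg, hgs, hg⟩
      obtain ⟨L, hL⟩ := hg.lipschitzWith_of_hasCompactSupport hgs (by simp)
      have hFL : LipschitzWith L fun w => ι (g w) := by
        have h := ι.lipschitz.comp hL
        rw [one_mul] at h
        exact h
      have hFs : HasCompactSupport fun w => ι (g w) := hgs.comp_left ι.map_zero
      obtain ⟨A, R, hA, hR, hF⟩ := exists_holderSlices hFL hFs hη.le hη1
      obtain ⟨P, hP, hlim⟩ := hk.exists_tendsto_eLpNorm hγ hη hM hA hR hF hp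
        (hFL.continuous.memLp_of_hasCompactSupport hFs)
      refine ⟨hP.toLp P, (Lp.tendsto_Lp_iff_tendsto_eLpNorm _ P hP).2 ?_⟩
      refine hlim.congr fun n => eLpNorm_congr_ae ?_
      filter_upwards [hker n f] with z hz
      rw [Pi.sub_apply, Pi.sub_apply]
      refine congrArg (· - P z) ?_
      refine Eq.trans ?_ hz.symm
      exact integral_congr_ae (hfg.mono fun w hw => by simp only [hw]))
  refine ⟨G, fun f => ?_, fun f => ?_⟩
  · have hFp : MemLp (fun w => ι (f w)) (ENNReal.ofReal p) volume :=
      (memLp_congr_ae (hJf f)).1 (Lp.memLp (J f))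
    -- Convergence in L^p gives a subsequence converging almost everywhere. Where the time integral
    -- converges absolutely the whole sequence tends to that integral, so the two limits agree.
    have h1 : TendstoInMeasure volume (fun n => (T n (J f) : ℝ × E d → H)) atTop (G f) :=
      tendstoInMeasure_of_tendsto_Lp (hG1 f)
    obtain ⟨ns, hns, hlim⟩ := h1.exists_seq_tendsto_ae
    filter_upwards [hlim, hk.ae_integrable_truncKernel hM hp hFp,
      ae_all_iff.2 fun n => hker n f] with z h2 h3 h4 hz
    have h5 := (tendsto_kernelOp_timeCutoff h3 hz).comp hns.tendsto_atTop
    refine tendsto_nhds_unique h2 (h5.congr fun i => ?_)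
    exact (h4 (ns i)).symm
  · refine (eLpNorm_le_mul_iff hp0).1 ?_
    have h1 := hG2 f
    rw [Lp.norm_def, Lp.norm_def, ← ENNReal.toReal_mul] at h1
    exact (ENNReal.toReal_le_toReal (Lp.eLpNorm_ne_top _)
      (ENNReal.mul_ne_top hNt (Lp.eLpNorm_ne_top _))).1 h1

end TimeLimit

/-! ### From the rescaled kernel back to the potential -/

section Potential

variable {d : ℕ} {γ κ η μ μ' M B : ℝ} {k : ℝ → ℝ → E d → ℂ}

theorem SpaceSym.mono {φ : E d → ℂ} (hφ : SpaceSym γ μ φ) (h : μ ≤ μ') : SpaceSym γ μ' φ :=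
  ⟨hφ.meas, fun R hR => (hφ.bd R hR).mono (mul_le_mul_of_nonneg_right h (by positivity))⟩

theorem TimeSym.mono {ψ : ℝ → E d → ℂ} (hψ : TimeSym γ κ μ ψ) (h : μ ≤ μ') : TimeSym γ κ μ' ψ :=
  ⟨hψ.meas, hψ.ae.mono fun _ hr => ⟨fun R hR => (hr.1 R hR).mono
    (mul_le_mul_of_nonneg_right h (by positivity)), hr.2⟩⟩

variable {K H : Type*} [NormedAddCommGroup K] [InnerProductSpace ℝ K]
  [NormedAddCommGroup H] [InnerProductSpace ℂ H]
  {φ : E d → ℝ} {ψ : ℝ → E d → ℂ} {ι : K →ₗᵢ[ℝ] H}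

theorem evolOp_eq_sliceConv {s t : ℝ} (h : potKernel φ ψ t s = k t s) (f : ℝ × E d → K) (x : E d) :
    evolOp φ ψ ι t s (fun y => f (s, y)) x = sliceConv k (fun w => ι (f w)) t s x := by
  simp only [evolOp, sliceConv, h]

theorem potential_eq (h : ∀ s t, s < t → potKernel φ ψ t s = k t s) (f : ℝ × E d → K)
    (z : ℝ × E d) :
    potential φ ψ ι f z = ∫ s in Iio z.1, sliceConv k (fun w => ι (f w)) z.1 s z.2 :=
  setIntegral_congr_fun measurableSet_Iio fun s hs => evolOp_eq_sliceConv (h s z.1 hs) f z.2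

theorem PotentialConverges.integrableOn_sliceConv (h : ∀ s t, s < t → potKernel φ ψ t s = k t s)
    {f : ℝ × E d → K} {z : ℝ × E d} (hz : PotentialConverges φ ψ ι f z) :
    IntegrableOn (fun s => sliceConv k (fun w => ι (f w)) z.1 s z.2) (Iio z.1) :=
  hz.2.congr_fun (fun s hs => evolOp_eq_sliceConv (h s z.1 hs) f z.2) measurableSet_Iio

theorem KernelBounds.potentialConverges (hγ : 0 < γ) (hη : 0 < η) (hη1 : η ≤ 1) (hM : 0 ≤ M)
    (hk : KernelBounds γ κ η M B k) (h : ∀ s t, s < t → potKernel φ ψ t s = k t s)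
    {g : ℝ × E d → K} (hg : ContDiff ℝ ∞ g) (hgs : HasCompactSupport g) (z : ℝ × E d) :
    PotentialConverges φ ψ ι g z := by
  obtain ⟨L, hL⟩ := hg.lipschitzWith_of_hasCompactSupport hgs (by simp)
  have hFL : LipschitzWith L fun w => ι (g w) := by
    have h := ι.lipschitz.comp hL
    rw [one_mul] at h
    exact h
  obtain ⟨A, R, hA, hR, hF⟩ := exists_holderSlices hFL (hgs.comp_left ι.map_zero) hη.le hη1
  refine ⟨(ae_restrict_iff' measurableSet_Iio).2 (ae_of_all _ fun s hs => ?_), ?_⟩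
  · rw [h s z.1 hs]
    exact integrable_conv (hk.integrable hs) (hF.cont.comp (Continuous.prodMk_right s))
      (fun y => hF.norm_le hA _) z.2
  · exact (hk.integrableOn_sliceConv hγ hη hM hA hR hF z).congr_fun
      (fun s hs => (evolOp_eq_sliceConv (h s z.1 hs) g z.2).symm) measurableSet_Iio

end Potential


end PseudoDiff

end

/-! ### The main theorem -/

theorem mainTheorem5 (d : ℕ) (hd : 0 < d) (p : ℝ) (hp : 1 < p)
    [Fact (1 ≤ ENNReal.ofReal p)]
    (γ : ℝ) (hγ : 0 < γ) (μφ : ℝ) (hμφ : 0 < μφ)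
    (κψ : ℝ) (hκψ : 0 < κψ) (μψ : ℝ) (hμψ : 0 < μψ) :
    ∃ C : ℝ, 0 < C ∧
      ∀ (φ : PseudoDiff.E d → ℝ) (κφ : ℝ) (Nφ : ℕ) (ψ : ℝ → PseudoDiff.E d → ℂ) (Nψ : ℕ),
        0 < κφ →
        PseudoDiff.SymbolM γ κφ μφ φ →
        PseudoDiff.CondS2 Nφ γ μφ (fun _ ξ => ((φ ξ : ℝ) : ℂ)) →
        PseudoDiff.SymbolS Nψ γ κψ μψ ψ →
        d + 2 + 2 * ⌊γ⌋₊ < Nφ →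
        d + 2 + 2 * ⌊γ⌋₊ < Nψ →
        ∀ (K : Type u) [NormedAddCommGroup K] [InnerProductSpace ℝ K] [CompleteSpace K]
          [TopologicalSpace.SeparableSpace K]
          (H : Type v) [NormedAddCommGroup H] [InnerProductSpace ℂ H] [CompleteSpace H]
          (ι : K →ₗᵢ[ℝ] H),
          -- the potential operator, as an operator on all of `L^p(ℝ^{d+1}; K)`
          ∃ G : Lp K (ENNReal.ofReal p) (volume : Measure (ℝ × PseudoDiff.E d)) →L[ℝ]
              Lp H (ENNReal.ofReal p) (volume : Measure (ℝ × PseudoDiff.E d)),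
            -- the defining integral converges absolutely for every test function
            (∀ g : ℝ × PseudoDiff.E d → K, ContDiff ℝ ∞ g → HasCompactSupport g →
              ∀ z, PseudoDiff.PotentialConverges φ ψ ι g z) ∧
            -- `G f` is the defining integral wherever that converges absolutely
            (∀ f : Lp K (ENNReal.ofReal p) (volume : Measure (ℝ × PseudoDiff.E d)),
              ∀ᵐ z : ℝ × PseudoDiff.E d, PseudoDiff.PotentialConverges φ ψ ι f z →
                G f z = PseudoDiff.potential φ ψ ι f z) ∧
            -- the estimate, for every `f` in `L^p(ℝ^{d+1}; K)`
            (∀ f : Lp K (ENNReal.ofReal p) (volume : Measure (ℝ × PseudoDiff.E d)),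
              ∫⁻ z, ‖G f z‖ₑ ^ p ≤ ENNReal.ofReal C * ∫⁻ z, ‖f z‖ₑ ^ p) := by
  -- The moment exponent η = min(γ, 1)/2 must be positive, at most 1 (the decay of the pieces) and
  -- below γ (the low frequencies).
  have hη : 0 < min γ 1 / 2 := by positivity
  have hη1 : min γ 1 / 2 ≤ 1 := by linarith [min_le_right γ 1]
  have hηγ : min γ 1 / 2 < γ := by linarith [min_le_left γ 1]
  have hc : (0 : ℝ) < 2 * Real.pi := by positivity
  -- The powers (2π)^γ come from rescaling the symbols to the convention of `𝓕`; the maximum of the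
  -- two upper constants serves both symbols.
  have hκ : 0 < (2 * Real.pi) ^ γ * κψ := by positivity
  have hs : 0 ≤ PseudoDiff.symConst d γ := by unfold PseudoDiff.symConst; positivity
  have hμ : 0 ≤ (2 * Real.pi) ^ γ * (PseudoDiff.symConst d γ * max μφ μψ) := by positivity
  -- B must be at least 1 for Hörmander's condition and at least √d to cover the diameter of the
  -- cubes.
  have hB : (1 : ℝ) ≤ max 1 √d := le_max_left _ _
  obtain ⟨M, hM, hker⟩ := PseudoDiff.exists_kernelBounds (B := max 1 √d) hd hγ hκ hμ hη.le hη1 hηγ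
    (by linarith)
  have hCt := ENNReal.rpow_ne_top_of_nonneg (by linarith : 0 ≤ p) (PseudoDiff.czNorm_ne_top
    (Real.toNNReal (PseudoDiff.horConst γ (min γ 1 / 2) M (max 1 √d) +
      M / ((2 * Real.pi) ^ γ * κψ))) (PseudoDiff.parConst d γ (max 1 √d)) hp)
  set C := PseudoDiff.czNorm (Real.toNNReal (PseudoDiff.horConst γ (min γ 1 / 2) M (max 1 √d) +
    M / ((2 * Real.pi) ^ γ * κψ))) (PseudoDiff.parConst d γ (max 1 √d)) p ^ p
  -- Adding 1 makes the constant positive even if C vanishes.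
  refine ⟨C.toReal + 1, by positivity, ?_⟩
  intro φ κφ Nφ ψ Nψ _ _ hφ hψ hNφ hNψ K _ _ _ _ H _ _ _ ι
  have hφ' := (PseudoDiff.SpaceSym.of_cond hd (by omega) hγ hμφ.le hφ).mono
    (mul_le_mul_of_nonneg_left (le_max_left μφ μψ) hs)
  have hψ' := (PseudoDiff.TimeSym.of_symbolS hd (by omega) hγ hμψ.le hψ).mono
    (mul_le_mul_of_nonneg_left (le_max_right μφ μψ) hs)
  have hk := hker _ _ (hφ'.comp_smul hc) (hψ'.comp_smul hc)
  have hpot := fun (s t : ℝ) (hst : s < t) => PseudoDiff.potKernel_eq hd hγ hκψ (by positivity) φ hψ' hst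
  obtain ⟨G, hG1, hG2⟩ := hk.exists_limit_operator hd hγ hκ hη hη1 hM hB (le_max_right _ _) hp ι
  refine ⟨G, fun g hg hgs z => hk.potentialConverges hγ hη hη1 hM hpot hg hgs z, fun f => ?_,
    fun f => (hG2 f).trans (mul_le_mul_of_nonneg_right ?_ zero_le)⟩
  · filter_upwards [hG1 f] with z hz hzc
    rw [hz (hzc.integrableOn_sliceConv hpot), PseudoDiff.potential_eq hpot]
  · rw [ENNReal.le_ofReal_iff_toReal_le hCt (by positivity)]
    exact le_add_of_nonneg_right zero_le_one
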